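/- Notation. For a real function $f$ on $\mathbb R$, $a\in\mathbb R$ and an integer $m\ge 0$, write $f\in H^m_a$ if $e^{ax}f\in H^m(\mathbb R)$, with norm $$\|f\|_{H^m_a}=\Big(\frac1{2\pi}\int_{\mathbb R}(1+k^2)^m\,\big|\widehat{e^{ax}f}(k)\big|^2\,dk\Big)^{1/2},\qquad \hat g(k)=\int_{\mathbb R} e^{-ikx}g(x)\,dx .$$ Let $D=-i\,d/dx$, so that $\sigma(D)$ is the Fourier multiplier with symbol $\sigma(k)$; the symbol $\tanh k/k$ has the value $1$ at $k=0$. For $\varepsilon>0$ set $\gamma=1-\varepsilon^2$. The fixed-point equation for the Riemann strain $\omega:\mathbb R\to\mathbb R$ is $$\omega=\Big(1-\gamma\,\frac{\tanh D}{D}\Big)^{-1}\left(\frac{\tfrac32\omega^2+\omega^3-\tfrac12\,(i\tanh D\,\omega)^2\,(1-2\gamma\,\underline\eta)}{(1+\omega)^2}\right),\qquad \underline\eta=\frac{\tanh D}{D}\,\omega. \tag{1}$$ Theorem. Let $\alpha\in(0,\sqrt3)$, let $m\ge2$ be an integer, let $\nu\in(0,1)$, and let $\Theta(x)=\operatorname{sech}^2(\sqrt3\,x/2)$.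 Then there is $\varepsilon_0>0$ such that for every $\varepsilon\in(0,\varepsilon_0)$ equation (1) has a unique even solution $\omega=\omega_\varepsilon$ in $H^1_{\alpha\varepsilon}$ of the form $$\omega_\varepsilon(x)=\varepsilon^2\,\theta_\varepsilon(\varepsilon x)\qquad\text{with}\qquad \|\theta_\varepsilon-\Theta\|_{H^m_\alpha}<\varepsilon^\nu .$$ Moreover, the solution depends smoothly on $\varepsilon$: the map $\varepsilon\mapsto\theta_\varepsilon$ is $C^\infty$ from $(0,\varepsilon_0)$ into $H^m_\alpha$, and for every $\varepsilon_1\in(0,\varepsilon_0)$, $\omega_\varepsilon$ belongs to $H^m_{a}$ with the fixed weight $a=\alpha\varepsilon_1$ for all $\varepsilon$ near $\varepsilon_1$, and $\varepsilon\mapsto\omega_\varepsilon\in H^m_{a}$ is $C^\infty$ at $\varepsilon_1$. -/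

import Mathlib

open MeasureTheory Filter Topology Set
open scoped FourierTransform ContDiff

noncomputable section

namespace SolitaryWave

/-- The Fourier multiplier `σ(D)`, `D = -i d/dx`, in the classical form
`(σ(D) f)(x) = (1/2π) ∫ e^{ikx} σ(k) (∫ e^{-iks} f(s) ds) dk`
(Mathlib's frequency variable is `ξ = k / 2π`).
For even `f` with `e^{ax} f ∈ H^1`, `a > 0`, one has `f ∈ L^1` and `f̂ ∈ L^1`, so that for bounded
continuous `σ` both integrals converge absolutely and `σ(D) f` is a continuous function. -/
def fourierMultiplier (σ : ℝ → ℂ) (f : ℝ → ℂ) : ℝ → ℂ :=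
  𝓕⁻ (fun ξ : ℝ => σ (2 * Real.pi * ξ) * 𝓕 f ξ)

/-- The function `tanh k / k`, with its continuous value `1` at `k = 0`. -/
def tanhc (k : ℝ) : ℝ := if k = 0 then 1 else Real.tanh k / k

/-- The operator `i tanh D`. -/
def hilbertStrip (f : ℝ → ℂ) : ℝ → ℂ :=
  fourierMultiplier (fun k => Complex.I * (Real.tanh k : ℂ)) f

/-- The operator `tanh D / D`. -/
def tanhDivD (f : ℝ → ℂ) : ℝ → ℂ :=
  fourierMultiplier (fun k => (tanhc k : ℂ)) f

/-- The operator `(1 - γ tanh D / D)⁻¹`. -/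
def dispersionInv (γ : ℝ) (f : ℝ → ℂ) : ℝ → ℂ :=
  fourierMultiplier (fun k => (((1 - γ * tanhc k)⁻¹ : ℝ) : ℂ)) f

/-- The nonlinearity
`(3/2 w² + w³ - 1/2 (i tanh D w)² (1 - 2 γ η)) / (1 + w)²`, where `η = (tanh D / D) w`. -/
def strainNonlinearity (γ : ℝ) (w : ℝ → ℂ) : ℝ → ℂ := fun x =>
  (3 / 2 * w x ^ 2 + w x ^ 3
      - 1 / 2 * hilbertStrip w x ^ 2 * (1 - 2 * (γ : ℂ) * tanhDivD w x))
    / (1 + w x) ^ 2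

/-- The fixed-point equation for the (real) Riemann strain `w`, with parameter `γ`. It is required
at every point, so that it also selects the continuous representative of `w`. -/
def IsRiemannStrain (γ : ℝ) (w : ℝ → ℝ) : Prop :=
  ∀ x : ℝ, (w x : ℂ) = dispersionInv γ (strainNonlinearity γ (fun y => (w y : ℂ))) x

/-- `f ∈ L²_a`, that is, `e^{ax} f ∈ L²(ℝ)`. -/
def MemWeightedL2 (a : ℝ) (f : ℝ → ℝ) : Prop :=
  MemLp (fun x : ℝ => ((Real.exp (a * x) * f x : ℝ) : ℂ)) 2 (volume : Measure ℝ)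

/-- For `f ∈ L²_a`, the function `k ↦ ⟨k⟩^m g^(k)` at `k = 2πξ`, where `g = e^{ax} f`,
`⟨k⟩ = (1 + k²)^{1/2}` and `g^` is the Fourier transform of `g` in the sense of `L²`. -/
def besselFourier (m : ℕ) (a : ℝ) (f : ℝ → ℝ) (h : MemWeightedL2 a f) : ℝ → ℂ := fun ξ =>
  ((Real.sqrt (1 + (2 * Real.pi * ξ) ^ 2) ^ m : ℝ) : ℂ) *
    (𝓕 (MemLp.toLp (fun x : ℝ => ((Real.exp (a * x) * f x : ℝ) : ℂ)) h) : Lp ℂ 2 (volume : Measure ℝ)) ξ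

/-- `f ∈ H^m_a`, that is, `e^{ax} f ∈ H^m(ℝ)`. -/
def MemWeightedSobolev (m : ℕ) (a : ℝ) (f : ℝ → ℝ) : Prop :=
  ∃ h : MemWeightedL2 a f, MemLp (besselFourier m a f h) 2 (volume : Measure ℝ)

open Classical in
/-- The isometric embedding `f ↦ ⟨k⟩^m (e^{ax} f)^(k)` (with `k = 2πξ`) of `H^m_a` into `L²(ℝ)`;
it is given the value `0` off `H^m_a`. A map into `H^m_a` is smooth if and only if its composition
with this linear isometry is smooth. -/
def sobolevEmbed (m : ℕ) (a : ℝ) (f : ℝ → ℝ) : Lp ℂ 2 (volume : Measure ℝ) :=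
  if h : MemWeightedSobolev m a f then MemLp.toLp (besselFourier m a f h.choose) h.choose_spec else 0

/-- The norm of `H^m_a`:
`‖f‖ = ((1/2π) ∫ (1 + k²)^m |(e^{ax} f)^(k)|² dk)^{1/2}` for `f ∈ H^m_a`. -/
def weightedSobolevNorm (m : ℕ) (a : ℝ) (f : ℝ → ℝ) : ℝ := ‖sobolevEmbed m a f‖

/-- The profile `Θ(x) = sech²(√3 x / 2)`. -/
def kdvProfile (x : ℝ) : ℝ := (1 / Real.cosh (Real.sqrt 3 * x / 2)) ^ 2

/-- The scaling `θ ↦ w`, `w(x) = ε² θ(ε x)`. -/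
def kdvScale (ε : ℝ) (θ : ℝ → ℝ) : ℝ → ℝ := fun x => ε ^ 2 * θ (ε * x)

/-- `w` is an even solution, in `H^1_a` with `a = α ε`, of the Riemann strain equation with
`γ = 1 - ε²`, and has the form `w(x) = ε² θ(ε x)` with `‖θ - Θ‖_{H^m_α} < ε^ν`. -/
structure IsSolitaryStrain (α : ℝ) (m : ℕ) (ν ε : ℝ) (w : ℝ → ℝ) : Prop where
  even : Function.Even w
  mem : MemWeightedSobolev 1 (α * ε) w
  eqn : IsRiemannStrain (1 - ε ^ 2) w
  near : ∃ θ : ℝ → ℝ, w = kdvScale ε θ ∧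
    MemWeightedSobolev m α (fun x => θ x - kdvProfile x) ∧
    weightedSobolevNorm m α (fun x => θ x - kdvProfile x) < ε ^ ν

end SolitaryWave

end

open SolitaryWave

noncomputable section

namespace SolitaryWave

/-! The substitution ω(x) = ε²θ(εx) turns (1) into a fixed-point problem θ = B_ε N_ε(θ), where B_ε =
ε²(1 - (1-ε²) tanh(εD)/(εD))⁻¹. Since tanh k / k = 1 - k²/3 + O(k⁴), the symbol of B_ε tends to
3/(3+k²). The convergence is uniform in k at rate ε², because the denominator stays above a multiple
of ε²⟨k⟩²/(1+ε²⟨k⟩²) (`one_sub_mul_tauR_ge`, `norm_resolvent_sub_kdvSym_le`). The nonlinearity tends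
to (3/2)θ², apart from the term with i tanh(εD)θ; this operator is bounded but not small, yet it is
O(ε) on functions with one more derivative, in particular at Θ. The limit θ = (1+D²/3)⁻¹((3/2)θ²) is
the stationary KdV equation, solved by Θ.

The linearization 1 - 3(1+D²/3)⁻¹(Θ ·) is invertible on even functions: the ODE f'' = (3-9Θ)f is
solved by the odd decaying function Θ' and by an even growing function, so nothing even and bounded
lies in the kernel (`opL_injective`), and variation of parameters gives an explicit inverse
(`exists_green`, `opL_surjective`). A contraction built on this inverse
(`IsKdVPerturbation.exists_fixed`) gives a solution at distance O(ε²) from Θ, which is better than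
ε^ν, together with uniqueness in a ball of fixed radius and nondegeneracy.

The work takes place in the spaces `EvenFun M β` of pairs (f, e^{βx}f) with f real and even and both
components in H^M. Keeping both components makes the space an algebra, since e^{βx}fg = (e^{βx}f)g.
A multiplier σ(D) acts on the second component through the values of σ on the line Im = β; for tanh
this is read off from the expansion tanh k / k = Σ 2/(k²+λ_n²), which reduces everything to
resolvents. The restriction α² < 3 keeps the line away from the zeros ±i√3 of 3+k².

For smoothness, the dilation d in tanh(dD) is made complex: a uniformly bounded family of symbols
that is holomorphic in d gives a family of operators that is holomorphic in operator norm
(`hasDerivAt_symMul_family`). The implicit function theorem then yields solutions Ξ(d,γ) with d and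
γ independent. The curve (ε, 1-ε²) gives θ_ε. The curve (ε₁, 1-ε²), with the scale frozen, gives ω_ε
in the fixed weight αε₁; a dilation changes the weight, so the two descriptions are matched by
uniqueness in the unweighted space `EvenFun 1 0`.

Uniqueness in the theorem is also reduced to that space: an even function with a one-sided
exponential weight decays on both sides, hence is integrable and lies in H¹
(`exists_evenFun_of_memWeightedSobolev`). -/

/-! ### The Fourier transform on `L¹ ∩ L²` -/

/-- The space `L²(ℝ; ℂ)`. -/
abbrev L2 := Lp ℂ 2 (volume : Measure ℝ)

/-- Both transforms satisfy ∫ g F̂ = ∫ ĝ F for smooth compactly supported g: the L² one through its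
action on tempered distributions, the classical one by Fubini. Such test functions separate locally
integrable functions. -/
lemma fourier_toLp_ae {F : ℝ → ℂ} (h1 : Integrable F) (h2 : MemLp F 2) :
    ((𝓕 (h2.toLp F) : L2) : ℝ → ℂ) =ᵐ[volume] 𝓕 F := by
  have hc : Continuous (𝓕 F) :=
    VectorFourier.fourierIntegral_continuous Real.continuous_fourierChar
      (innerSL ℝ).continuous₂ h1
  refine ae_eq_of_integral_contDiff_smul_eq
    ((Lp.memLp _).locallyIntegrable (by norm_num)) hc.locallyIntegrable ?_
  intro g hg hgs
  have hg' : ContDiff ℝ ∞ (fun x => (g x : ℂ)) := Complex.ofRealCLM.contDiff.comp hg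
  have hgs' : HasCompactSupport (fun x => (g x : ℂ)) := hgs.comp_left (g := Complex.ofReal) (by simp)
  let G : SchwartzMap ℝ ℂ := hgs'.toSchwartzMap hg'
  have hG : ∀ x, G x = g x := fun x => rfl
  have key := congrArg (fun T => T G) (Lp.fourier_toTemperedDistribution_eq (h2.toLp F))
  simp only [TemperedDistribution.fourier_apply, Lp.toTemperedDistribution_apply] at key
  have e1 : ∫ x, g x • (𝓕 (h2.toLp F) : L2) x = ∫ x, G x • (𝓕 (h2.toLp F) : L2) x := by
    simp [hG]
  have e2 : ∫ x, g x • 𝓕 F x = ∫ x, G x • 𝓕 F x := by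
    simp [hG]
  rw [e1, e2, ← key]
  have e3 : ∫ x, (𝓕 G) x • (h2.toLp F) x = ∫ x, (𝓕 G) x • F x := by
    refine integral_congr_ae ?_
    filter_upwards [h2.coeFn_toLp] with x hx
    rw [hx]
  rw [e3]
  have := VectorFourier.integral_fourierIntegral_smul_eq_flip (L := innerₗ ℝ)
      (μ := volume) (ν := volume) Real.continuous_fourierChar continuous_inner (f := G) G.integrable h1
  simpa [SchwartzMap.fourier_coe] using! this

lemma continuous_fourier {F : ℝ → ℂ} (h1 : Integrable F) : Continuous (𝓕 F) :=
  VectorFourier.fourierIntegral_continuous Real.continuous_fourierChar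
    (innerSL ℝ).continuous₂ h1

lemma continuous_fourierInv {F : ℝ → ℂ} (h1 : Integrable F) : Continuous (𝓕⁻ F) := by
  have : 𝓕⁻ F = fun x => 𝓕 F (-x) := by
    ext x; exact Real.fourierInv_eq_fourier_neg F x
  rw [this]
  exact (continuous_fourier h1).comp continuous_neg

lemma fourierInv_toLp_ae {F : ℝ → ℂ} (h1 : Integrable F) (h2 : MemLp F 2) :
    ((𝓕⁻ (h2.toLp F) : L2) : ℝ → ℂ) =ᵐ[volume] 𝓕⁻ F := by
  refine ae_eq_of_integral_contDiff_smul_eq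
    ((Lp.memLp _).locallyIntegrable (by norm_num)) (continuous_fourierInv h1).locallyIntegrable ?_
  intro g hg hgs
  have hg' : ContDiff ℝ ∞ (fun x => (g x : ℂ)) := Complex.ofRealCLM.contDiff.comp hg
  have hgs' : HasCompactSupport (fun x => (g x : ℂ)) := hgs.comp_left (g := Complex.ofReal) (by simp)
  let G : SchwartzMap ℝ ℂ := hgs'.toSchwartzMap hg'
  have hG : ∀ x, G x = g x := fun x => rfl
  have key := congrArg (fun T => T G) (Lp.fourierInv_toTemperedDistribution_eq (h2.toLp F))
  simp only [TemperedDistribution.fourierInv_apply, Lp.toTemperedDistribution_apply] at key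
  have e1 : ∫ x, g x • (𝓕⁻ (h2.toLp F) : L2) x = ∫ x, G x • (𝓕⁻ (h2.toLp F) : L2) x := by
    simp [hG]
  have e2 : ∫ x, g x • 𝓕⁻ F x = ∫ x, G x • 𝓕⁻ F x := by
    simp [hG]
  rw [e1, e2, ← key]
  have e3 : ∫ x, (𝓕⁻ G) x • (h2.toLp F) x = ∫ x, (𝓕⁻ G) x • F x := by
    refine integral_congr_ae ?_
    filter_upwards [h2.coeFn_toLp] with x hx
    rw [hx]
  rw [e3]
  -- The inverse transform is the forward transform for the negated pairing, so the same exchange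
  -- identity applies.
  have := VectorFourier.integral_fourierIntegral_smul_eq_flip (L := -innerₗ ℝ)
      (μ := volume) (ν := volume) Real.continuous_fourierChar
      (continuous_inner.neg) (f := G) G.integrable h1
  have hf : (-innerₗ ℝ : ℝ →ₗ[ℝ] ℝ →ₗ[ℝ] ℝ).flip = -innerₗ ℝ := by
    ext; simp
  rw [hf] at this
  rw [SchwartzMap.fourierInv_coe]
  exact this

lemma memLp_fourierInv {F : ℝ → ℂ} (h1 : Integrable F) (h2 : MemLp F 2) : MemLp (𝓕⁻ F) 2 :=
  (memLp_congr_ae (fourierInv_toLp_ae h1 h2)).1 (Lp.memLp _)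

lemma fourier_toLp_of_ae_eq_fourierInv {F h : ℝ → ℂ} (h1 : Integrable F) (h2 : MemLp F 2)
    (hh : MemLp h 2) (he : h =ᵐ[volume] 𝓕⁻ F) : 𝓕 (hh.toLp h) = h2.toLp F := by
  have : hh.toLp h = 𝓕⁻ (h2.toLp F) :=
    Lp.ext (hh.coeFn_toLp.trans (he.trans (fourierInv_toLp_ae h1 h2).symm))
  rw [this, FourierTransform.fourier_fourierInv_eq]

lemma fourier_fourierInv_ae {F : ℝ → ℂ} (h1 : Integrable F) (h2 : MemLp F 2)
    (h3 : Integrable (𝓕⁻ F)) : 𝓕 (𝓕⁻ F) =ᵐ[volume] F := by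
  have h4 := memLp_fourierInv h1 h2
  have e := fourier_toLp_of_ae_eq_fourierInv h1 h2 h4 ae_eq_rfl
  have e5 := fourier_toLp_ae h3 h4
  rw [e] at e5
  exact e5.symm.trans h2.coeFn_toLp

/-- The L² transform is injective. This is the device that carries pointwise identities between
functions, such as parity or reality, over to their amplitudes. -/
lemma ae_eq_of_fourierInv_ae_eq {F G : ℝ → ℂ} (hF1 : Integrable F) (hF2 : MemLp F 2)
    (hG1 : Integrable G) (hG2 : MemLp G 2) (h : 𝓕⁻ F =ᵐ[volume] 𝓕⁻ G) : F =ᵐ[volume] G := by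
  have h4 := memLp_fourierInv hF1 hF2
  have e1 := fourier_toLp_of_ae_eq_fourierInv hF1 hF2 h4 ae_eq_rfl
  have e2 := fourier_toLp_of_ae_eq_fourierInv hG1 hG2 h4 h
  rw [e1] at e2
  exact (MemLp.toLp_eq_toLp_iff hF2 hG2).1 e2

lemma fourierInv_ae_of_fourier_toLp {F h : ℝ → ℂ} (h1 : Integrable F) (h2 : MemLp F 2)
    (hh : MemLp h 2) (he : 𝓕 (hh.toLp h) = h2.toLp F) : h =ᵐ[volume] 𝓕⁻ F := by
  have : hh.toLp h = 𝓕⁻ (h2.toLp F) := by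
    rw [← he, FourierTransform.fourierInv_fourier_eq]
  refine hh.coeFn_toLp.symm.trans ?_
  rw [this]
  exact fourierInv_toLp_ae h1 h2

/-! ### Bessel weights and the evaluation map -/

/-- The weight `⟨k⟩` at `k = 2πξ`. -/
def jap (ξ : ℝ) : ℝ := Real.sqrt (1 + (2 * Real.pi * ξ) ^ 2)

lemma jap_sq (ξ : ℝ) : jap ξ ^ 2 = 1 + (2 * Real.pi * ξ) ^ 2 :=
  Real.sq_sqrt (by positivity)

lemma one_le_jap (ξ : ℝ) : 1 ≤ jap ξ := by
  rw [jap, Real.one_le_sqrt]; nlinarith [sq_nonneg (2 * Real.pi * ξ)]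

lemma jap_pos (ξ : ℝ) : 0 < jap ξ := zero_lt_one.trans_le (one_le_jap ξ)

lemma jap_neg (ξ : ℝ) : jap (-ξ) = jap ξ := by simp [jap]

@[fun_prop] lemma continuous_jap : Continuous jap := by unfold jap; fun_prop

/-- The weight `⟨k⟩^(-M)` at `k = 2πξ`. -/
def japInv (M : ℕ) (ξ : ℝ) : ℂ := (((jap ξ ^ M)⁻¹ : ℝ) : ℂ)

@[fun_prop] lemma continuous_japInv (M : ℕ) : Continuous (japInv M) := by
  unfold japInv
  exact Complex.continuous_ofReal.comp ((continuous_jap.pow M).inv₀ fun ξ => (pow_pos (jap_pos ξ) M).ne')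

lemma norm_japInv (M : ℕ) (ξ : ℝ) : ‖japInv M ξ‖ = (jap ξ ^ M)⁻¹ := by
  rw [japInv, Complex.norm_real, Real.norm_of_nonneg (inv_nonneg.2 (pow_pos (jap_pos ξ) M).le)]

lemma norm_japInv_le_one (M : ℕ) (ξ : ℝ) : ‖japInv M ξ‖ ≤ 1 := by
  rw [norm_japInv]; exact inv_le_one_of_one_le₀ (one_le_pow₀ (one_le_jap ξ))

lemma jap_sq_inv_le (ξ : ℝ) : (jap ξ ^ 2)⁻¹ ≤ (1 + ξ ^ 2)⁻¹ := by
  rw [jap_sq]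
  have := Real.pi_gt_three
  refine inv_anti₀ (by positivity) ?_
  nlinarith [sq_nonneg ξ, mul_nonneg (sq_nonneg ξ) (by nlinarith : (0:ℝ) ≤ (2 * Real.pi) ^ 2 - 1)]

lemma integrable_jap_sq_inv : Integrable (fun ξ => (jap ξ ^ 2)⁻¹) := by
  refine integrable_inv_one_add_sq.mono' ?_ (Eventually.of_forall fun ξ => ?_)
  · exact ((continuous_jap.pow 2).inv₀ fun ξ => (pow_pos (jap_pos ξ) 2).ne').aestronglyMeasurable
  · rw [Real.norm_of_nonneg (inv_nonneg.2 (pow_pos (jap_pos ξ) 2).le)]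
    exact jap_sq_inv_le ξ

/-- The condition M ≥ 1 is the Sobolev embedding threshold in dimension one: it makes the amplitudes
integrable, so that elements of H^M have continuous bounded representatives. -/
lemma memLp_japInv (M : ℕ) [NeZero M] : MemLp (japInv M) 2 := by
  rw [memLp_two_iff_integrable_sq_norm (continuous_japInv M).aestronglyMeasurable]
  refine integrable_jap_sq_inv.mono' (by fun_prop) (Eventually.of_forall fun ξ => ?_)
  rw [norm_japInv, Real.norm_of_nonneg (by positivity), inv_pow, ← pow_mul]
  exact inv_anti₀ (pow_pos (jap_pos ξ) 2)
    (pow_le_pow_right₀ (one_le_jap ξ) (by have := NeZero.one_le (n := M); omega))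

/-- The amplitude `⟨k⟩^(-M) Φ`. -/
def ampl (M : ℕ) (Φ : ℝ → ℂ) (ξ : ℝ) : ℂ := japInv M ξ * Φ ξ

lemma memLp_ampl (M : ℕ) (Φ : L2) : MemLp (ampl M Φ) 2 := by
  refine (Lp.memLp Φ).of_le
    ((continuous_japInv M).aestronglyMeasurable.mul (Lp.aestronglyMeasurable Φ))
    (Eventually.of_forall fun ξ => ?_)
  rw [ampl, norm_mul]
  exact mul_le_of_le_one_left (norm_nonneg _) (norm_japInv_le_one M ξ)

lemma integrable_ampl (M : ℕ) [NeZero M] (Φ : L2) : Integrable (ampl M Φ) :=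
  (memLp_japInv M).integrable_mul (Lp.memLp Φ)

/-- The map `Φ ↦ f`, where `f` has Fourier transform `⟨k⟩^(-M) Φ`. -/
def evL (M : ℕ) [NeZero M] : L2 →L[ℂ] BoundedContinuousFunction ℝ ℂ :=
  Real.Lp.fourierTransformInvCLM ℝ ℂ ∘L
    ((ContinuousLinearMap.mul ℂ ℂ).holderL volume 2 2 1 ((memLp_japInv M).toLp _))

lemma evL_apply (M : ℕ) [NeZero M] (Φ : L2) (x : ℝ) : evL M Φ x = 𝓕⁻ (ampl M Φ) x := by
  have : evL M Φ x = Real.Lp.fourierTransformInv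
      ((ContinuousLinearMap.mul ℂ ℂ).holderL volume 2 2 1 ((memLp_japInv M).toLp _) Φ) x := rfl
  rw [this, Real.Lp.fourierTransformInv_apply]
  refine Real.fourierInv_congr_ae ?_ x
  filter_upwards [ContinuousLinearMap.coeFn_holder (r := 1) (ContinuousLinearMap.mul ℂ ℂ)
    ((memLp_japInv M).toLp _) Φ, (memLp_japInv M).coeFn_toLp] with ξ h1 h2
  erw [h1]
  simp only [ContinuousLinearMap.mul_apply']
  rw [h2, ampl]

lemma norm_evL_apply_le (M : ℕ) [NeZero M] (Φ : L2) (x : ℝ) : ‖evL M Φ x‖ ≤ ‖evL M‖ * ‖Φ‖ :=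
  ((evL M Φ).norm_coe_le_norm x).trans ((evL M).le_opNorm Φ)

lemma ampl_eq_iff {M : ℕ} {Φ Ψ : ℝ → ℂ} {ξ : ℝ} : ampl M Φ ξ = ampl M Ψ ξ ↔ Φ ξ = Ψ ξ := by
  have : japInv M ξ ≠ 0 := by
    rw [← norm_ne_zero_iff, norm_japInv]; exact (inv_pos.2 (pow_pos (jap_pos ξ) M)).ne'
  simp [ampl, this]

/-- Identities in H^M can therefore be checked pointwise in x; bilinearity and commutativity of the
product are obtained this way. -/
lemma evL_injective (M : ℕ) [NeZero M] : Function.Injective (evL M) := by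
  intro Φ Ψ h
  refine Lp.ext ?_
  have := ae_eq_of_fourierInv_ae_eq (integrable_ampl M Φ) (memLp_ampl M Φ) (integrable_ampl M Ψ)
    (memLp_ampl M Ψ) (Eventually.of_forall fun x => by rw [← evL_apply, ← evL_apply, h])
  filter_upwards [this] with ξ hξ using ampl_eq_iff.1 hξ

/-- The element of `L²` with amplitude `F`. -/
lemma exists_of_weighted {M : ℕ} [NeZero M] {F : ℝ → ℂ}
    (h : MemLp (fun ξ => ((jap ξ ^ M : ℝ) : ℂ) * F ξ) 2) :
    ampl M (h.toLp _) =ᵐ[volume] F ∧ ∀ x, evL M (h.toLp _) x = 𝓕⁻ F x := by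
  have : ampl M (h.toLp _) =ᵐ[volume] F := by
    filter_upwards [h.coeFn_toLp] with ξ hξ
    rw [ampl, hξ, japInv, ← mul_assoc, ← Complex.ofReal_mul,
      inv_mul_cancel₀ (pow_pos (jap_pos ξ) M).ne']
    simp
  exact ⟨this, fun x => by rw [evL_apply]; exact Real.fourierInv_congr_ae this x⟩

/-! ### Products -/

lemma sq_lintegral_mul_le {f g : ℝ → ENNReal} (hf : AEMeasurable f) (hg : AEMeasurable g) :
    (∫⁻ x, f x * g x) ^ 2 ≤ (∫⁻ x, f x ^ 2) * ∫⁻ x, g x ^ 2 := by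
  have h := ENNReal.lintegral_mul_le_Lp_mul_Lq volume Real.HolderConjugate.two_two hf hg
  have h2 := pow_le_pow_left' h 2
  refine h2.trans (le_of_eq ?_)
  rw [mul_pow, ← ENNReal.rpow_natCast, ← ENNReal.rpow_natCast (_ ^ _), ← ENNReal.rpow_mul,
    ← ENNReal.rpow_mul]
  norm_num

lemma jap_add_le (ξ η : ℝ) : jap (ξ + η) ≤ jap ξ + jap η := by
  rw [jap]
  refine Real.sqrt_le_iff.2 ⟨by linarith [jap_pos ξ, jap_pos η], ?_⟩
  have h1 := jap_sq ξ
  have h2 := jap_sq η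
  have h3 : (2 * Real.pi * ξ) * (2 * Real.pi * η) ≤ jap ξ * jap η := by
    refine (abs_le_of_sq_le_sq' ?_ (mul_pos (jap_pos ξ) (jap_pos η)).le).2
    rw [mul_pow _ _ 2, mul_pow (jap ξ), h1, h2]
    nlinarith [sq_nonneg (2 * Real.pi * ξ), sq_nonneg (2 * Real.pi * η)]
  nlinarith

/-- The larger of ⟨η⟩ and ⟨ξ-η⟩ is at least ⟨ξ⟩/2, so one of the two inverse weights absorbs ⟨ξ⟩^M
and the other survives. -/
lemma jap_pow_mul_le (M : ℕ) (ξ η : ℝ) :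
    jap ξ ^ M * ((jap η ^ M)⁻¹ * (jap (ξ - η) ^ M)⁻¹)
      ≤ 2 ^ M * ((jap η ^ M)⁻¹ + (jap (ξ - η) ^ M)⁻¹) := by
  have ha := pow_pos (jap_pos η) M
  have hb := pow_pos (jap_pos (ξ - η)) M
  have h : jap ξ ^ M ≤ 2 ^ M * (jap η ^ M + jap (ξ - η) ^ M) := by
    have h1 : jap ξ ≤ 2 * max (jap η) (jap (ξ - η)) := by
      have := jap_add_le η (ξ - η)
      rw [add_sub_cancel] at this
      linarith [le_max_left (jap η) (jap (ξ - η)), le_max_right (jap η) (jap (ξ - η))]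
    have h2 := pow_le_pow_left₀ (jap_pos ξ).le h1 M
    rw [mul_pow] at h2
    refine h2.trans (mul_le_mul_of_nonneg_left ?_ (by positivity))
    rcases max_choice (jap η) (jap (ξ - η)) with h | h <;> rw [h] <;> linarith
  have h3 : jap ξ ^ M * ((jap η ^ M)⁻¹ * (jap (ξ - η) ^ M)⁻¹)
      ≤ 2 ^ M * (jap η ^ M + jap (ξ - η) ^ M) * ((jap η ^ M)⁻¹ * (jap (ξ - η) ^ M)⁻¹) :=
    mul_le_mul_of_nonneg_right h (by positivity)
  refine h3.trans (le_of_eq ?_)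
  field_simp
  ring

lemma enorm_jap_pow_mul_le (M : ℕ) (ξ η : ℝ) :
    ‖((jap ξ ^ M : ℝ) : ℂ)‖ₑ * (‖japInv M η‖ₑ * ‖japInv M (ξ - η)‖ₑ)
      ≤ 2 ^ M * (‖japInv M η‖ₑ + ‖japInv M (ξ - η)‖ₑ) := by
  simp only [← ofReal_norm, norm_japInv]
  rw [Complex.norm_real, Real.norm_of_nonneg (pow_pos (jap_pos ξ) M).le]
  have ha := inv_pos.2 (pow_pos (jap_pos η) M)
  have hb := inv_pos.2 (pow_pos (jap_pos (ξ - η)) M)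
  rw [← ENNReal.ofReal_mul ha.le, ← ENNReal.ofReal_mul (pow_pos (jap_pos ξ) M).le,
    ← ENNReal.ofReal_add ha.le hb.le]
  have : (2 : ENNReal) ^ M = ENNReal.ofReal (2 ^ M) := by
    rw [ENNReal.ofReal_pow (by norm_num)]; norm_num
  rw [this, ← ENNReal.ofReal_mul (by positivity)]
  exact ENNReal.ofReal_le_ofReal (jap_pow_mul_le M ξ η)

/-- The constant in the product estimate. -/
def mulConst (M : ℕ) : ENNReal := 4 ^ (M + 1) * ∫⁻ η, ‖japInv M η‖ₑ ^ 2

lemma enorm_sq_eLpNorm (F : ℝ → ℂ) : eLpNorm F 2 volume ^ 2 = ∫⁻ x, ‖F x‖ₑ ^ 2 := by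
  have := eLpNorm_nnreal_pow_eq_lintegral (μ := volume) (f := F) (p := 2) (by norm_num)
  have h2 : ((2 : NNReal) : ℝ) = ((2 : ℕ) : ℝ) := by norm_num
  rw [h2] at this
  simpa only [ENNReal.rpow_natCast, ENNReal.coe_ofNat] using this

lemma mulConst_lt_top (M : ℕ) [NeZero M] : mulConst M < ⊤ := by
  refine ENNReal.mul_lt_top (ENNReal.pow_lt_top (by norm_num)) ?_
  rw [← enorm_sq_eLpNorm]
  exact ENNReal.pow_lt_top (memLp_japInv M).2

/-- The factor 4^(M+1) is (2^M)², times 2 from (a+b)² ≤ 2(a²+b²), times 2 for two integrals that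
agree by translation invariance. -/
lemma lintegral_mulKernel_le (M : ℕ) (ξ : ℝ) :
    ∫⁻ η, (2 ^ M * (‖japInv M η‖ₑ + ‖japInv M (ξ - η)‖ₑ)) ^ 2 ≤ mulConst M := by
  have hm : Measurable fun η => ‖japInv M η‖ₑ ^ 2 :=
    ((continuous_japInv M).measurable.enorm).pow_const 2
  have h1 : ∀ η, (2 ^ M * (‖japInv M η‖ₑ + ‖japInv M (ξ - η)‖ₑ)) ^ 2
      ≤ 4 ^ M * (2 * (‖japInv M η‖ₑ ^ 2 + ‖japInv M (ξ - η)‖ₑ ^ 2)) := by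
    intro η
    rw [mul_pow, ← pow_mul, mul_comm M 2, pow_mul]
    norm_num only
    gcongr
    have h := ENNReal.rpow_add_le_mul_rpow_add_rpow ‖japInv M η‖ₑ ‖japInv M (ξ - η)‖ₑ
      (p := 2) (by norm_num)
    norm_num at h
    simpa using h
  refine (lintegral_mono h1).trans ?_
  have hm2 : Measurable fun η => ‖japInv M (ξ - η)‖ₑ ^ 2 :=
    hm.comp (measurable_const.sub measurable_id)
  rw [lintegral_const_mul _ (by fun_prop), lintegral_const_mul _ (by fun_prop),
    lintegral_add_left hm, lintegral_sub_left_eq_self (fun η => ‖japInv M η‖ₑ ^ 2) ξ, mulConst]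
  refine le_of_eq ?_
  rw [pow_succ]; ring

lemma lintegral_conv_sq (Φ Ψ : ℝ → ℂ) (hΦ : Measurable Φ) (hΨ : Measurable Ψ) :
    ∫⁻ ξ, ∫⁻ η, (‖Φ η‖ₑ * ‖Ψ (ξ - η)‖ₑ) ^ 2 = (∫⁻ x, ‖Φ x‖ₑ ^ 2) * ∫⁻ x, ‖Ψ x‖ₑ ^ 2 := by
  rw [lintegral_lintegral_swap]
  · simp_rw [mul_pow]
    have : ∀ η, ∫⁻ ξ, ‖Φ η‖ₑ ^ 2 * ‖Ψ (ξ - η)‖ₑ ^ 2 = ‖Φ η‖ₑ ^ 2 * ∫⁻ x, ‖Ψ x‖ₑ ^ 2 := by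
      intro η
      rw [lintegral_const_mul _ (by fun_prop), lintegral_sub_right_eq_self (fun x => ‖Ψ x‖ₑ ^ 2) η]
    simp_rw [this]
    rw [lintegral_mul_const _ (by fun_prop)]
  · exact Measurable.aemeasurable (by unfold Function.uncurry; fun_prop)

/-- Convolution of amplitudes. -/
def convAmpl (M : ℕ) (Φ Ψ : ℝ → ℂ) : ℝ → ℂ :=
  convolution (ampl M Φ) (ampl M Ψ) (ContinuousLinearMap.mul ℂ ℂ) volume

/-- Cauchy–Schwarz in η with the weights in one factor and Φ, Ψ in the other. The weight factor is
bounded uniformly in ξ, so integrating the rest by Tonelli shows that H^M is an algebra. -/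
lemma enorm_convAmpl_le (M : ℕ) (Φ Ψ : ℝ → ℂ) (hΦ : Measurable Φ) (hΨ : Measurable Ψ) (ξ : ℝ) :
    ‖((jap ξ ^ M : ℝ) : ℂ) * convAmpl M Φ Ψ ξ‖ₑ ^ 2
      ≤ mulConst M * ∫⁻ η, (‖Φ η‖ₑ * ‖Ψ (ξ - η)‖ₑ) ^ 2 := by
  have h1 : ‖((jap ξ ^ M : ℝ) : ℂ) * convAmpl M Φ Ψ ξ‖ₑ
      ≤ ∫⁻ η, (2 ^ M * (‖japInv M η‖ₑ + ‖japInv M (ξ - η)‖ₑ)) * (‖Φ η‖ₑ * ‖Ψ (ξ - η)‖ₑ) := by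
    rw [convAmpl, convolution_def, enorm_mul]
    refine (mul_le_mul_right (enorm_integral_le_lintegral_enorm _) _).trans ?_
    rw [← lintegral_const_mul' _ _ enorm_ne_top]
    refine lintegral_mono fun η => ?_
    simp only [ContinuousLinearMap.mul_apply', ampl, enorm_mul]
    calc _ = ‖((jap ξ ^ M : ℝ) : ℂ)‖ₑ * (‖japInv M η‖ₑ * ‖japInv M (ξ - η)‖ₑ)
          * (‖Φ η‖ₑ * ‖Ψ (ξ - η)‖ₑ) := by ring
      _ ≤ _ := mul_le_mul_left (enorm_jap_pow_mul_le M ξ η) _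
  refine (pow_le_pow_left' h1 2).trans ?_
  refine (sq_lintegral_mul_le ?_ ?_).trans (mul_le_mul_left (lintegral_mulKernel_le M ξ) _)
  · have := (continuous_japInv M).measurable
    exact Measurable.aemeasurable (by fun_prop)
  · exact Measurable.aemeasurable (by fun_prop)

lemma integrable_convAmpl (M : ℕ) [NeZero M] (Φ Ψ : L2) : Integrable (convAmpl M Φ Ψ) :=
  (integrable_ampl M Φ).integrable_convolution _ (integrable_ampl M Ψ)

lemma eLpNorm_convAmpl_le (M : ℕ) (Φ Ψ : L2) :
    eLpNorm (fun ξ => ((jap ξ ^ M : ℝ) : ℂ) * convAmpl M Φ Ψ ξ) 2 volume ^ 2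
      ≤ mulConst M * (eLpNorm Φ 2 volume ^ 2 * eLpNorm Ψ 2 volume ^ 2) := by
  have hΦ := (Lp.stronglyMeasurable Φ).measurable
  have hΨ := (Lp.stronglyMeasurable Ψ).measurable
  rw [enorm_sq_eLpNorm, enorm_sq_eLpNorm, enorm_sq_eLpNorm, ← lintegral_conv_sq Φ Ψ hΦ hΨ,
    ← lintegral_const_mul]
  · exact lintegral_mono fun ξ => enorm_convAmpl_le M Φ Ψ hΦ hΨ ξ
  · refine Measurable.lintegral_prod_right' (f := fun p : ℝ × ℝ => (‖Φ p.2‖ₑ * ‖Ψ (p.1 - p.2)‖ₑ) ^ 2) ?_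
    fun_prop

lemma memLp_convAmpl (M : ℕ) [NeZero M] (Φ Ψ : L2) :
    MemLp (fun ξ => ((jap ξ ^ M : ℝ) : ℂ) * convAmpl M Φ Ψ ξ) 2 := by
  refine ⟨?_, ?_⟩
  · have : Continuous fun ξ => ((jap ξ ^ M : ℝ) : ℂ) :=
      Complex.continuous_ofReal.comp (continuous_jap.pow M)
    exact this.aestronglyMeasurable.mul (integrable_convAmpl M Φ Ψ).1
  · have h := (eLpNorm_convAmpl_le M Φ Ψ).trans_lt (ENNReal.mul_lt_top (mulConst_lt_top M)
      (ENNReal.mul_lt_top (ENNReal.pow_lt_top (Lp.memLp Φ).2) (ENNReal.pow_lt_top (Lp.memLp Ψ).2)))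
    by_contra hc
    rw [not_lt_top_iff] at hc
    rw [hc] at h
    simp at h

lemma fourierInv_convAmpl (M : ℕ) [NeZero M] (Φ Ψ : L2) (x : ℝ) :
    𝓕⁻ (convAmpl M Φ Ψ) x = evL M Φ x * evL M Ψ x := by
  simp only [evL_apply, Real.fourierInv_eq_fourier_neg]
  exact Real.fourier_mul_convolution_eq (integrable_ampl M Φ) (integrable_ampl M Ψ) _

lemma exists_mul (M : ℕ) [NeZero M] (Φ Ψ : L2) : ∃ Υ : L2,
    (∀ x, evL M Υ x = evL M Φ x * evL M Ψ x) ∧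
      ‖Υ‖ ≤ Real.sqrt (mulConst M).toReal * ‖Φ‖ * ‖Ψ‖ := by
  refine ⟨(memLp_convAmpl M Φ Ψ).toLp _, fun x => ?_, ?_⟩
  · rw [(exists_of_weighted (memLp_convAmpl M Φ Ψ)).2, fourierInv_convAmpl]
  · rw [Lp.norm_toLp, Lp.norm_def, Lp.norm_def]
    refine Real.le_sqrt_of_sq_le ?_ |>.trans_eq (?_ : Real.sqrt ((mulConst M).toReal *
      ((eLpNorm Φ 2 volume).toReal ^ 2 * (eLpNorm Ψ 2 volume).toReal ^ 2)) = _)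
    · rw [← ENNReal.toReal_pow, ← ENNReal.toReal_pow, ← ENNReal.toReal_pow, ← ENNReal.toReal_mul,
        ← ENNReal.toReal_mul]
      exact ENNReal.toReal_mono (ENNReal.mul_lt_top (mulConst_lt_top M)
        (ENNReal.mul_lt_top (ENNReal.pow_lt_top (Lp.memLp Φ).2)
          (ENNReal.pow_lt_top (Lp.memLp Ψ).2))).ne (eLpNorm_convAmpl_le M Φ Ψ)
    · rw [Real.sqrt_mul ENNReal.toReal_nonneg, ← mul_pow, Real.sqrt_sq (by positivity), mul_assoc]

/-- The product of two functions on the Fourier side. -/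
def mulVal (M : ℕ) [NeZero M] (Φ Ψ : L2) : L2 := (exists_mul M Φ Ψ).choose

lemma evL_mulVal (M : ℕ) [NeZero M] (Φ Ψ : L2) (x : ℝ) :
    evL M (mulVal M Φ Ψ) x = evL M Φ x * evL M Ψ x :=
  (exists_mul M Φ Ψ).choose_spec.1 x

/-- The product of functions on the Fourier side, as a bounded bilinear map. -/
def mulL (M : ℕ) [NeZero M] : L2 →L[ℂ] L2 →L[ℂ] L2 :=
  LinearMap.mkContinuous₂
    (LinearMap.mk₂ ℂ (mulVal M)
      (fun a b c => evL_injective M <| by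
        ext x
        simp only [map_add, BoundedContinuousFunction.coe_add, Pi.add_apply, evL_mulVal, add_mul])
      (fun r a b => evL_injective M <| by
        ext x
        simp only [map_smul, BoundedContinuousFunction.coe_smul, smul_eq_mul, evL_mulVal, mul_assoc])
      (fun a b c => evL_injective M <| by
        ext x
        simp only [map_add, BoundedContinuousFunction.coe_add, Pi.add_apply, evL_mulVal, mul_add])
      (fun r a b => evL_injective M <| by
        ext x
        simp only [map_smul, BoundedContinuousFunction.coe_smul, smul_eq_mul, evL_mulVal]
        ring))
    (Real.sqrt (mulConst M).toReal) fun Φ Ψ => (exists_mul M Φ Ψ).choose_spec.2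

@[simp] lemma evL_mulL (M : ℕ) [NeZero M] (Φ Ψ : L2) (x : ℝ) :
    evL M (mulL M Φ Ψ) x = evL M Φ x * evL M Ψ x :=
  evL_mulVal M Φ Ψ x

/-! ### Fourier multipliers on `L²` -/

/-- Multiplication by a bounded symbol on the Fourier side. -/
def symMul (σ : ℝ → ℂ) : L2 →L[ℂ] L2 :=
  open Classical in
  if h : MemLp σ ⊤ volume then (ContinuousLinearMap.mul ℂ ℂ).holderL volume ⊤ 2 2 (h.toLp σ) else 0

/-- Bounded measurable symbols. -/
structure IsSymbol (σ : ℝ → ℂ) (C : ℝ) : Prop where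
  meas : AEStronglyMeasurable σ volume
  bound : ∀ ξ, ‖σ ξ‖ ≤ C

lemma IsSymbol.memLp {σ : ℝ → ℂ} {C : ℝ} (h : IsSymbol σ C) : MemLp σ ⊤ volume :=
  memLp_top_of_bound h.meas C (Eventually.of_forall h.bound)

lemma IsSymbol.nonneg {σ : ℝ → ℂ} {C : ℝ} (h : IsSymbol σ C) : 0 ≤ C :=
  (norm_nonneg _).trans (h.bound 0)

lemma IsSymbol.mul {σ τ : ℝ → ℂ} {C D : ℝ} (h : IsSymbol σ C) (h' : IsSymbol τ D) :
    IsSymbol (fun ξ => σ ξ * τ ξ) (C * D) :=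
  ⟨h.meas.mul h'.meas, fun ξ => by
    rw [norm_mul]; exact mul_le_mul (h.bound ξ) (h'.bound ξ) (norm_nonneg _) h.nonneg⟩

lemma IsSymbol.add {σ τ : ℝ → ℂ} {C D : ℝ} (h : IsSymbol σ C) (h' : IsSymbol τ D) :
    IsSymbol (fun ξ => σ ξ + τ ξ) (C + D) :=
  ⟨h.meas.add h'.meas, fun ξ => (norm_add_le _ _).trans (add_le_add (h.bound ξ) (h'.bound ξ))⟩

lemma IsSymbol.sub {σ τ : ℝ → ℂ} {C D : ℝ} (h : IsSymbol σ C) (h' : IsSymbol τ D) :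
    IsSymbol (fun ξ => σ ξ - τ ξ) (C + D) :=
  ⟨h.meas.sub h'.meas, fun ξ => (norm_sub_le _ _).trans (add_le_add (h.bound ξ) (h'.bound ξ))⟩

lemma IsSymbol.const_mul {σ : ℝ → ℂ} {C : ℝ} (h : IsSymbol σ C) (c : ℂ) :
    IsSymbol (fun ξ => c * σ ξ) (‖c‖ * C) :=
  ⟨h.meas.const_mul c, fun ξ => by
    rw [norm_mul]; exact mul_le_mul_of_nonneg_left (h.bound ξ) (norm_nonneg _)⟩

lemma symMul_coe {σ : ℝ → ℂ} {C : ℝ} (h : IsSymbol σ C) (Φ : L2) :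
    symMul σ Φ =ᵐ[volume] fun ξ => σ ξ * Φ ξ := by
  rw [symMul, dif_pos h.memLp]
  filter_upwards [ContinuousLinearMap.coeFn_holder (r := 2) (ContinuousLinearMap.mul ℂ ℂ)
    (h.memLp.toLp _) Φ, h.memLp.coeFn_toLp] with ξ h1 h2
  erw [h1]
  simp only [ContinuousLinearMap.mul_apply']
  rw [h2]

lemma norm_symMul_le {σ : ℝ → ℂ} {C : ℝ} (h : IsSymbol σ C) : ‖symMul σ‖ ≤ C := by
  refine ContinuousLinearMap.opNorm_le_bound _ h.nonneg fun Φ => ?_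
  refine Lp.norm_le_mul_norm_of_ae_le_mul ?_
  filter_upwards [symMul_coe h Φ] with ξ hξ
  rw [hξ, norm_mul]
  exact mul_le_mul_of_nonneg_right (h.bound ξ) (norm_nonneg _)

lemma ampl_symMul {σ : ℝ → ℂ} {C : ℝ} (h : IsSymbol σ C) (M : ℕ) (Φ : L2) :
    ampl M (symMul σ Φ) =ᵐ[volume] fun ξ => σ ξ * ampl M Φ ξ := by
  filter_upwards [symMul_coe h Φ] with ξ hξ
  rw [ampl, hξ, ampl]; ring

lemma evL_symMul {σ : ℝ → ℂ} {C : ℝ} (h : IsSymbol σ C) (M : ℕ) [NeZero M] (Φ : L2) (x : ℝ) :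
    evL M (symMul σ Φ) x = 𝓕⁻ (fun ξ => σ ξ * ampl M Φ ξ) x := by
  rw [evL_apply]
  exact Real.fourierInv_congr_ae (ampl_symMul h M Φ) x

lemma symMul_eq_of_ae {σ : ℝ → ℂ} {C : ℝ} (h : IsSymbol σ C) {Φ Ψ : L2}
    (he : (fun ξ => σ ξ * Φ ξ) =ᵐ[volume] Ψ) : symMul σ Φ = Ψ :=
  Lp.ext ((symMul_coe h Φ).trans he)

lemma symMul_comp {σ τ : ℝ → ℂ} {C D : ℝ} (h : IsSymbol σ C) (h' : IsSymbol τ D) (Φ : L2) :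
    symMul σ (symMul τ Φ) = symMul (fun ξ => σ ξ * τ ξ) Φ := by
  refine symMul_eq_of_ae h ?_
  filter_upwards [symMul_coe h' Φ, symMul_coe (h.mul h') Φ] with ξ h1 h2
  rw [h1, h2]; ring

lemma symMul_sub {σ τ : ℝ → ℂ} {C D : ℝ} (h : IsSymbol σ C) (h' : IsSymbol τ D) :
    symMul (fun ξ => σ ξ - τ ξ) = symMul σ - symMul τ := by
  ext1 Φ
  refine symMul_eq_of_ae (h.sub h') ?_
  filter_upwards [symMul_coe h Φ, symMul_coe h' Φ, Lp.coeFn_sub (symMul σ Φ) (symMul τ Φ)]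
    with ξ h1 h2 h3
  rw [sub_apply, h3, Pi.sub_apply, h1, h2]; ring

lemma symMul_const_mul {σ : ℝ → ℂ} {C : ℝ} (h : IsSymbol σ C) (c : ℂ) :
    symMul (fun ξ => c * σ ξ) = c • symMul σ := by
  ext1 Φ
  refine symMul_eq_of_ae (h.const_mul c) ?_
  filter_upwards [symMul_coe h Φ, Lp.coeFn_smul c (symMul σ Φ)] with ξ h1 h3
  rw [smul_apply, h3, Pi.smul_apply, h1, smul_eq_mul]; ring

/-! ### Holomorphic families of multipliers -/

lemma norm_deriv_le_of_bounded {f : ℂ → ℂ} {z : ℂ} {r C : ℝ} (hr : 0 < r)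
    (hf : DifferentiableOn ℂ f (Metric.ball z r)) (hC : ∀ w ∈ Metric.ball z r, ‖f w‖ ≤ C) {w : ℂ}
    (hw : w ∈ Metric.ball z (r / 2)) : ‖deriv f w‖ ≤ C / (r / 4) := by
  have hsub : Metric.closedBall w (r / 4) ⊆ Metric.ball z r := by
    intro u hu
    rw [Metric.mem_closedBall] at hu
    rw [Metric.mem_ball] at hw ⊢
    linarith [dist_triangle u w z]
  refine Complex.norm_deriv_le_of_forall_mem_sphere_norm_le (by positivity) ?_ fun u hu =>
    hC u (hsub (Metric.sphere_subset_closedBall hu))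
  refine DifferentiableOn.diffContOnCl ?_
  rw [closure_ball _ (by positivity)]
  exact hf.mono hsub

/-- Two Cauchy estimates, with radii r/4 and r/8, bound f'' by (4/r)(8/r)C = 32C/r² near z. Only the
bound C enters, so the Taylor remainder is uniform over a family of functions with a common bound.
-/
lemma norm_sub_sub_deriv_le {f : ℂ → ℂ} {z : ℂ} {r C : ℝ} (hr : 0 < r)
    (hf : DifferentiableOn ℂ f (Metric.ball z r)) (hC : ∀ w ∈ Metric.ball z r, ‖f w‖ ≤ C) {w : ℂ}
    (hw : w ∈ Metric.ball z (r / 4)) :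
    ‖f w - f z - (w - z) * deriv f z‖ ≤ 32 * C / r ^ 2 * ‖w - z‖ ^ 2 := by
  have hf' : DifferentiableOn ℂ (deriv f) (Metric.ball z (r / 2)) :=
    (hf.deriv Metric.isOpen_ball).mono (Metric.ball_subset_ball (by linarith))
  have h2 : ∀ u ∈ Metric.ball z (r / 4), ‖deriv (deriv f) u‖ ≤ 32 * C / r ^ 2 := by
    intro u hu
    have := norm_deriv_le_of_bounded (half_pos hr) hf'
      (fun v hv => norm_deriv_le_of_bounded hr hf hC hv) (by convert hu using 2; ring)
    refine this.trans (le_of_eq ?_)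
    field_simp
    ring
  have hz : z ∈ Metric.ball z (r / 4) := Metric.mem_ball_self (by positivity)
  have h3 : ∀ u ∈ Metric.ball z (r / 4), ‖deriv f u - deriv f z‖ ≤ 32 * C / r ^ 2 * ‖u - z‖ := by
    intro u hu
    refine (convex_ball z (r / 4)).norm_image_sub_le_of_norm_deriv_le (f := deriv f) ?_ h2 hz hu
    intro v hv
    exact hf'.differentiableAt (Metric.isOpen_ball.mem_nhds
      (Metric.ball_subset_ball (by linarith) hv))
  have hs : segment ℝ z w ⊆ Metric.ball z (r / 4) := (convex_ball z (r / 4)).segment_subset hz hw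
  have hd : ∀ u ∈ Metric.ball z (r / 4), DifferentiableAt ℂ f u := fun u hu =>
    hf.differentiableAt (Metric.isOpen_ball.mem_nhds (Metric.ball_subset_ball (by linarith) hu))
  have h4 := (convex_segment z w).norm_image_sub_le_of_norm_deriv_le
    (f := fun u => f u - u * deriv f z) (C := 32 * C / r ^ 2 * ‖w - z‖) (x := z) (y := w)
    (fun u hu => ((hd u (hs hu)).sub (differentiableAt_id.mul_const _)))
    (fun u hu => ?_) (left_mem_segment ℝ z w) (right_mem_segment ℝ z w)
  · have e : f w - w * deriv f z - (f z - z * deriv f z) = f w - f z - (w - z) * deriv f z := by ring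
    rw [e] at h4
    refine h4.trans (le_of_eq ?_)
    ring
  · have hud : HasDerivAt (fun u => f u - u * deriv f z) (deriv f u - 1 * deriv f z) u :=
      (hd u (hs hu)).hasDerivAt.sub ((hasDerivAt_id u).mul_const _)
    rw [hud.deriv, one_mul]
    have hC0 : 0 ≤ C := (norm_nonneg _).trans (hC z (Metric.mem_ball_self hr))
    refine (h3 u (hs hu)).trans (mul_le_mul_of_nonneg_left ?_ (by positivity))
    have := (convex_closedBall z ‖w - z‖).segment_subset (by simp)
      (by simp [dist_eq_norm]) hu
    rwa [Metric.mem_closedBall, dist_eq_norm] at this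

/-- The operator norm is dominated by the sup norm of the symbol, and the Taylor remainder in the
parameter is bounded uniformly in ξ. Pointwise holomorphy with a common bound therefore gives
differentiability in operator norm. -/
lemma hasDerivAt_symMul_family {σ : ℂ → ℝ → ℂ} {z : ℂ} {r C : ℝ} (hr : 0 < r)
    (hσ : ∀ w ∈ Metric.ball z r, IsSymbol (σ w) C)
    (hd : ∀ ξ, DifferentiableOn ℂ (fun w => σ w ξ) (Metric.ball z r)) :
    HasDerivAt (fun w => symMul (σ w)) (symMul fun ξ => deriv (fun w => σ w ξ) z) z := by
  have hz : z ∈ Metric.ball z r := Metric.mem_ball_self hr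
  have hC0 : 0 ≤ C := (hσ z hz).nonneg
  have hC : ∀ ξ, ∀ w ∈ Metric.ball z r, ‖σ w ξ‖ ≤ C := fun ξ w hw => (hσ w hw).bound ξ
  have hD : IsSymbol (fun ξ => deriv (fun w => σ w ξ) z) (C / (r / 4)) := by
    refine ⟨?_, fun ξ => norm_deriv_le_of_bounded hr (hd ξ) (hC ξ)
      (Metric.mem_ball_self (by positivity))⟩
    -- Measurability in ξ of the parameter derivative: it is the limit of difference quotients along
    -- a sequence that stays in the ball.
    have ht : Tendsto (fun n : ℕ => z + ((r / 2 / (n + 1) : ℝ) : ℂ)) atTop (𝓝[≠] z) := by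
      refine tendsto_nhdsWithin_iff.2 ⟨?_, Eventually.of_forall fun n => ?_⟩
      · have : Tendsto (fun n : ℕ => r / 2 / ((n : ℝ) + 1)) atTop (𝓝 0) :=
          tendsto_const_nhds.div_atTop (tendsto_natCast_atTop_atTop.atTop_add tendsto_const_nhds)
        have h2 := (Complex.continuous_ofReal.tendsto 0).comp this
        simpa using h2.const_add z
      · have : (r / 2 / (n + 1) : ℝ) ≠ 0 := by positivity
        simpa using (Complex.ofReal_ne_zero.2 this)
    refine aestronglyMeasurable_of_tendsto_ae (u := atTop)
      (f := fun n : ℕ => fun ξ => slope (fun w => σ w ξ) z (z + ((r / 2 / (n + 1) : ℝ) : ℂ)))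
      (fun n => ?_) (Eventually.of_forall fun ξ => ?_)
    · have hm : z + ((r / 2 / (n + 1) : ℝ) : ℂ) ∈ Metric.ball z r := by
        rw [Metric.mem_ball, dist_eq_norm, add_sub_cancel_left, Complex.norm_real,
          Real.norm_of_nonneg (by positivity)]
        have : r / 2 / ((n : ℝ) + 1) ≤ r / 2 := div_le_self (by positivity) (by linarith [n.cast_nonneg (α := ℝ)])
        linarith
      simp only [slope_def_module]
      exact AEStronglyMeasurable.const_smul ((hσ _ hm).meas.sub (hσ z hz).meas)
        ((z + ((r / 2 / (n + 1) : ℝ) : ℂ) - z)⁻¹)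
    · exact (hasDerivAt_iff_tendsto_slope.1
        ((hd ξ).differentiableAt (Metric.isOpen_ball.mem_nhds hz)).hasDerivAt).comp ht
  have hO : (fun w => symMul (σ w) - symMul (σ z) - (w - z) • symMul fun ξ => deriv (fun w => σ w ξ) z)
      =O[𝓝 z] fun w => (w - z) ^ 2 := by
    refine Asymptotics.IsBigO.of_bound (32 * C / r ^ 2) ?_
    filter_upwards [Metric.isOpen_ball.mem_nhds (Metric.mem_ball_self (show 0 < r / 4 by positivity))]
      with w hw
    have hw' : w ∈ Metric.ball z r := Metric.ball_subset_ball (by linarith) hw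
    rw [← symMul_const_mul hD, ← symMul_sub (hσ w hw') (hσ z hz),
      ← symMul_sub ((hσ w hw').sub (hσ z hz)) (hD.const_mul _)]
    refine norm_symMul_le ⟨(((hσ w hw').sub (hσ z hz)).sub (hD.const_mul _)).meas, fun ξ => ?_⟩
    rw [norm_pow]
    exact norm_sub_sub_deriv_le hr (hd ξ) (hC ξ) hw
  rw [hasDerivAt_iff_isLittleO]
  refine hO.trans_isLittleO ?_
  have := Asymptotics.isLittleO_pow_sub_sub z (m := 2) (by norm_num)
  rw [← Asymptotics.isLittleO_norm_left]
  simpa using this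

lemma contDiffAt_symMul_family {σ : ℂ → ℝ → ℂ} {t : ℝ} {r C : ℝ} (hr : 0 < r)
    (hσ : ∀ w ∈ Metric.ball (t : ℂ) r, IsSymbol (σ w) C)
    (hd : ∀ ξ, DifferentiableOn ℂ (fun w => σ w ξ) (Metric.ball (t : ℂ) r)) :
    ContDiffAt ℝ ∞ (fun s : ℝ => symMul (σ s)) t := by
  have h1 : DifferentiableOn ℂ (fun w => symMul (σ w)) (Metric.ball (t : ℂ) r) := by
    intro w hw
    obtain ⟨ρ, hρ, hsub⟩ := Metric.isOpen_iff.1 Metric.isOpen_ball w hw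
    exact (hasDerivAt_symMul_family hρ (fun u hu => hσ u (hsub hu))
      (fun ξ => (hd ξ).mono hsub)).differentiableAt.differentiableWithinAt
  have h2 : ContDiffAt ℂ ∞ (fun w => symMul (σ w)) (t : ℂ) :=
    (h1.contDiffOn Metric.isOpen_ball).contDiffAt (Metric.isOpen_ball.mem_nhds (Metric.mem_ball_self hr))
  exact (h2.restrict_scalars ℝ).comp t Complex.ofRealCLM.contDiff.contDiffAt

/-- Smoothness of a curve can be tested after a linear isometric embedding. -/
lemma contDiffAt_of_linearIsometry_comp {S V : Type*} [NormedAddCommGroup S] [NormedSpace ℝ S]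
    [CompleteSpace S] [NormedAddCommGroup V] [NormedSpace ℝ V] (J : S →ₗᵢ[ℝ] V) {f : ℝ → S} {t : ℝ}
    (h : ContDiffAt ℝ ∞ (fun s => J (f s)) t) : ContDiffAt ℝ ∞ f t := by
  have hder : ∀ {g : ℝ → S} {s : ℝ}, DifferentiableAt ℝ (fun u => J (g u)) s →
      DifferentiableAt ℝ g s ∧ J (deriv g s) = deriv (fun u => J (g u)) s := by
    intro g s hs
    -- Completeness of the source makes the range closed, so the limit of the difference quotients
    -- of J ∘ g has a preimage.
    have hcl : IsClosed (range J) := J.isometry.isClosedEmbedding.isClosed_range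
    have ht := hasDerivAt_iff_tendsto_slope.1 hs.hasDerivAt
    have hmem : deriv (fun u => J (g u)) s ∈ range J := by
      refine hcl.mem_of_tendsto ht (Eventually.of_forall fun u => ⟨slope g s u, ?_⟩)
      simp [slope_def_module]
    obtain ⟨y, hy⟩ := hmem
    have hg : HasDerivAt g y s := by
      rw [hasDerivAt_iff_tendsto_slope, J.isometry.isEmbedding.tendsto_nhds_iff, hy]
      refine ht.congr fun u => ?_
      simp [slope_def_module]
    exact ⟨hg.differentiableAt, by rw [hg.deriv, hy]⟩
  have key : ∀ n : ℕ, ∀ (g : ℝ → S) (U : Set ℝ), IsOpen U →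
      ContDiffOn ℝ n (fun u => J (g u)) U → ContDiffOn ℝ n g U := by
    intro n
    induction n with
    | zero =>
      intro g U _ hg
      simp only [Nat.cast_zero, contDiffOn_zero] at hg ⊢
      exact (J.isometry.isEmbedding.continuousOn_iff).2 hg
    | succ n ih =>
      intro g U hU hg
      push_cast at hg ⊢
      rw [contDiffOn_succ_iff_deriv_of_isOpen hU] at hg ⊢
      have hd : ∀ s ∈ U, DifferentiableAt ℝ (fun u => J (g u)) s := fun s hs =>
        hg.1.differentiableAt (hU.mem_nhds hs)
      refine ⟨fun s hs => (hder (hd s hs)).1.differentiableWithinAt, by simp, ih _ U hU ?_⟩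
      exact hg.2.2.congr fun s hs => (hder (hd s hs)).2
  refine contDiffAt_infty.2 fun n => ?_
  obtain ⟨u, hu, hcd⟩ := (h.of_le (m := n) (by exact_mod_cast le_top)).contDiffOn le_rfl (by simp)
  obtain ⟨U, hUu, hU, htU⟩ := mem_nhds_iff.1 (by simpa using hu)
  exact (key n f U hU (hcd.mono hUu)).contDiffAt (hU.mem_nhds htU)

/-! ### The partial fraction expansion of `tanh k / k` -/

/-- The poles `(n + 1/2) π` of `tan`. -/
def lam (n : ℕ) : ℝ := (n + 1 / 2) * Real.pi

lemma lam_pos (n : ℕ) : 0 < lam n := mul_pos (by positivity) Real.pi_pos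

/-- The value 12/5 lies just below π²/4. It makes Re w ≥ -2 free of poles, with p + λ_n² ≥ λ_n²/6
for p ≥ -2, since 2 = (5/6)(12/5). -/
lemma lam_sq_ge (n : ℕ) : 12 / 5 ≤ lam n ^ 2 := by
  have h1 : Real.pi / 2 ≤ lam n := by
    rw [lam]; nlinarith [Real.pi_pos, (n.cast_nonneg : (0:ℝ) ≤ n)]
  have := Real.pi_gt_d2
  nlinarith

lemma lam_zero_sq_le (n : ℕ) : lam 0 ^ 2 ≤ lam n ^ 2 := by
  refine pow_le_pow_left₀ (lam_pos 0).le ?_ 2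
  simp only [lam, Nat.cast_zero]
  exact mul_le_mul_of_nonneg_right (by simp) Real.pi_pos.le

lemma lam_zero_sq_le_three : lam 0 ^ 2 ≤ 3 := by
  have := Real.pi_lt_d2
  have := Real.pi_pos
  simp only [lam, Nat.cast_zero]
  nlinarith

lemma hasSum_of_eq {E : Type*} [AddCommMonoid E] [TopologicalSpace E] {f g : ℕ → E} {a b : E}
    (h : HasSum f a) (hf : ∀ n, g n = f n) (hab : b = a) : HasSum g b := by
  rw [hab, funext hf]; exact h

lemma hasSum_odd {f : ℕ → ℝ} {S T : ℝ} (h : HasSum f S) (he : HasSum (fun j => f (2 * j)) T) :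
    HasSum (fun j => f (2 * j + 1)) (S - T) := by
  have hinj : Function.Injective fun j : ℕ => 2 * j + 1 := fun a b h => by simpa using h
  have ho : Summable fun j => f (2 * j + 1) := h.summable.comp_injective hinj
  have := he.even_add_odd ho.hasSum
  have e := this.unique h
  rw [← e, add_sub_cancel_left]
  exact ho.hasSum

lemma hasSum_two_div_lam_sq : HasSum (fun n => 2 / lam n ^ 2) 1 := by
  have h := hasSum_zeta_two
  have he : HasSum (fun j : ℕ => (1 : ℝ) / ((2 * j : ℕ) : ℝ) ^ 2) (1 / 4 * (Real.pi ^ 2 / 6)) := by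
    refine hasSum_of_eq (h.mul_left (1 / 4)) (fun j => ?_) rfl
    push_cast; ring
  refine hasSum_of_eq ((hasSum_odd h he).mul_left (8 / Real.pi ^ 2)) (fun n => ?_) ?_
  · rw [lam]; push_cast
    have := Real.pi_pos.ne'
    have : (n : ℝ) * 2 + 1 ≠ 0 := by positivity
    field_simp
    ring
  · have := Real.pi_pos.ne'
    field_simp; norm_num

/-- This is the coefficient in tanh k / k = 1 - k²/3 + …, obtained from ζ(4) by keeping the odd
integers; it fixes the operator 1 + D²/3 of the limit. -/
lemma hasSum_two_div_lam_four : HasSum (fun n => 2 / lam n ^ 4) (1 / 3) := by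
  have h := hasSum_zeta_four
  have he : HasSum (fun j : ℕ => (1 : ℝ) / ((2 * j : ℕ) : ℝ) ^ 4) (1 / 16 * (Real.pi ^ 4 / 90)) := by
    refine hasSum_of_eq (h.mul_left (1 / 16)) (fun j => ?_) rfl
    push_cast; ring
  refine hasSum_of_eq ((hasSum_odd h he).mul_left (32 / Real.pi ^ 4)) (fun n => ?_) ?_
  · rw [lam]; push_cast
    have := Real.pi_pos.ne'
    have : (n : ℝ) * 2 + 1 ≠ 0 := by positivity
    field_simp
    ring
  · have := Real.pi_pos.ne'
    field_simp; norm_num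

lemma hasSum_coth {k : ℝ} (hk : k ≠ 0) :
    HasSum (fun n : ℕ => 2 * k / (k ^ 2 + (Real.pi * (n + 1)) ^ 2))
      (Real.cosh k / Real.sinh k - 1 / k) := by
  have hpi := Real.pi_pos.ne'
  have hpic : (Real.pi : ℂ) ≠ 0 := Complex.ofReal_ne_zero.2 hpi
  have hkc : (k : ℂ) ≠ 0 := Complex.ofReal_ne_zero.2 hk
  have hx : (Complex.I * k / Real.pi : ℂ) ∈ Complex.integerComplement := by
    rintro ⟨n, hn⟩
    have := congrArg Complex.im hn
    rw [mul_div_assoc, ← Complex.ofReal_div] at this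
    simp at this
    exact div_ne_zero hk hpi this.symm
  have h := (summable_cotTerm hx).hasSum
  have e : ∑' n, cotTerm (Complex.I * k / Real.pi) n = _ := (cot_series_rep' hx).symm
  rw [e] at h
  have h2 := h.mul_left (Complex.I / Real.pi)
  have h3 : HasSum (fun n : ℕ => ((2 * k / (k ^ 2 + (Real.pi * (n + 1)) ^ 2) : ℝ) : ℂ))
      ((Real.cosh k / Real.sinh k - 1 / k : ℝ) : ℂ) := by
    refine hasSum_of_eq h2 (fun n => ?_) ?_
    · rw [cotTerm_identity hx]
      have hne : (k : ℂ) ^ 2 + (Real.pi * (n + 1)) ^ 2 ≠ 0 := by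
        have : (0:ℝ) < k ^ 2 + (Real.pi * (n + 1)) ^ 2 := by positivity
        exact_mod_cast this.ne'
      have e2 : (Complex.I * k / Real.pi + (n + 1)) * (Complex.I * k / Real.pi - (n + 1))
          = - ((k : ℂ) ^ 2 + (Real.pi * (n + 1)) ^ 2) / Real.pi ^ 2 := by
        field_simp
        ring_nf
        simp only [Complex.I_sq]
        ring
      rw [e2]
      push_cast
      field_simp
      simp only [Complex.I_sq]
      ring
    · have e3 : (Real.pi : ℂ) * (Complex.I * k / Real.pi) = k * Complex.I := by
        field_simp
      have hs : Complex.sinh k ≠ 0 := by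
        rw [← Complex.ofReal_sinh]
        exact Complex.ofReal_ne_zero.2 (Real.sinh_ne_zero.2 hk)
      rw [e3, Complex.cot, Complex.cos_mul_I, Complex.sin_mul_I]
      push_cast
      field_simp
  exact_mod_cast h3

lemma hasSum_even {f : ℕ → ℝ} {S T : ℝ} (h : HasSum f S) (ho : HasSum (fun j => f (2 * j + 1)) T) :
    HasSum (fun j => f (2 * j)) (S - T) := by
  have hinj : Function.Injective fun j : ℕ => 2 * j := fun a b h => by simpa using h
  have he : Summable fun j => f (2 * j) := h.summable.comp_injective hinj
  have := he.hasSum.even_add_odd ho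
  have e := this.unique h
  rw [← e, add_sub_cancel_right]
  exact he.hasSum

/-- From tanh k = 2 coth 2k - coth k. In the series of 2 coth 2k the even multiples of π reproduce
coth k, and the odd multiples remain. -/
lemma hasSum_tanh {k : ℝ} (hk : k ≠ 0) :
    HasSum (fun n : ℕ => 2 * k / (k ^ 2 + lam n ^ 2)) (Real.tanh k) := by
  have h1 := hasSum_coth hk
  have h2 : HasSum (fun n : ℕ => 8 * k / (4 * k ^ 2 + (Real.pi * (n + 1)) ^ 2))
      (2 * (Real.cosh (2 * k) / Real.sinh (2 * k) - 1 / (2 * k))) := by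
    refine hasSum_of_eq ((hasSum_coth (mul_ne_zero two_ne_zero hk)).mul_left 2) (fun n => ?_) rfl
    rw [mul_pow 2 k]; ring
  have h3 := hasSum_even h2 (T := Real.cosh k / Real.sinh k - 1 / k) (by
    refine hasSum_of_eq h1 (fun n => ?_) rfl
    have e : 4 * k ^ 2 + (Real.pi * (((2 * n + 1 : ℕ) : ℝ) + 1)) ^ 2
        = 4 * (k ^ 2 + (Real.pi * (n + 1)) ^ 2) := by push_cast; ring
    rw [e, show 8 * k = 4 * (2 * k) by ring, mul_div_mul_left _ _ (by norm_num)])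
  refine hasSum_of_eq h3 (fun n => ?_) ?_
  · have e : 4 * k ^ 2 + (Real.pi * (((2 * n : ℕ) : ℝ) + 1)) ^ 2
        = 4 * (k ^ 2 + lam n ^ 2) := by rw [lam]; push_cast; ring
    rw [e, show 8 * k = 4 * (2 * k) by ring, mul_div_mul_left _ _ (by norm_num)]
  · have hs := Real.sinh_ne_zero.2 hk
    have hc := (Real.cosh_pos k).ne'
    rw [Real.tanh_eq_sinh_div_cosh, Real.cosh_two_mul, Real.sinh_two_mul]
    field_simp
    ring

/-- The meromorphic function `τ(w) = tanh √w / √w`, through its partial fraction expansion. -/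
def tau (w : ℂ) : ℂ := ∑' n, 2 / (w + (lam n : ℂ) ^ 2)

/-- The restriction of `τ` to the real axis. -/
def tauR (p : ℝ) : ℝ := ∑' n, 2 / (p + lam n ^ 2)

lemma sixth_lam_sq_le {p : ℝ} (hp : -2 ≤ p) (n : ℕ) : lam n ^ 2 / 6 ≤ p + lam n ^ 2 := by
  linarith [lam_sq_ge n]

lemma add_lam_sq_pos {p : ℝ} (hp : -2 ≤ p) (n : ℕ) : 0 < p + lam n ^ 2 := by
  linarith [lam_sq_ge n]

lemma two_div_add_le {p : ℝ} (hp : -2 ≤ p) (n : ℕ) :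
    2 / (p + lam n ^ 2) ≤ 6 * (2 / lam n ^ 2) := by
  have := sixth_lam_sq_le hp n
  have h2 := pow_pos (lam_pos n) 2
  calc 2 / (p + lam n ^ 2) ≤ 2 / (lam n ^ 2 / 6) := by gcongr
    _ = _ := by field_simp

lemma summable_tauR {p : ℝ} (hp : -2 ≤ p) : Summable fun n => 2 / (p + lam n ^ 2) :=
  Summable.of_nonneg_of_le (fun n => (div_pos two_pos (add_lam_sq_pos hp n)).le)
    (two_div_add_le hp) (hasSum_two_div_lam_sq.summable.mul_left 6)

lemma tauR_le_six {p : ℝ} (hp : -2 ≤ p) : tauR p ≤ 6 := by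
  have h := (hasSum_two_div_lam_sq.mul_left 6)
  rw [mul_one] at h
  exact hasSum_le (two_div_add_le hp) (summable_tauR hp).hasSum h

lemma tauR_antitone {p q : ℝ} (hp : -2 ≤ p) (hpq : p ≤ q) : tauR q ≤ tauR p := by
  refine (summable_tauR (hp.trans hpq)).tsum_le_tsum (fun n => ?_) (summable_tauR hp)
  have := add_lam_sq_pos hp n
  gcongr

lemma re_add_lam_le (w : ℂ) (n : ℕ) : w.re + lam n ^ 2 ≤ ‖w + (lam n : ℂ) ^ 2‖ := by
  refine le_trans (le_of_eq ?_) (Complex.re_le_norm _)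
  rw [Complex.add_re, ← Complex.ofReal_pow, Complex.ofReal_re]

lemma add_lam_sq_ne_zero {w : ℂ} (hw : -2 ≤ w.re) (n : ℕ) : w + (lam n : ℂ) ^ 2 ≠ 0 :=
  norm_pos_iff.1 ((add_lam_sq_pos hw n).trans_le (re_add_lam_le w n))

lemma norm_tau_term_le {w : ℂ} (hw : -2 ≤ w.re) (n : ℕ) :
    ‖2 / (w + (lam n : ℂ) ^ 2)‖ ≤ 2 / (w.re + lam n ^ 2) := by
  rw [norm_div, Complex.norm_two]
  have := add_lam_sq_pos hw n
  have := re_add_lam_le w n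
  gcongr

lemma summable_tau {w : ℂ} (hw : -2 ≤ w.re) : Summable fun n => 2 / (w + (lam n : ℂ) ^ 2) :=
  Summable.of_norm_bounded (summable_tauR hw) (norm_tau_term_le hw)

lemma norm_tau_le {w : ℂ} (hw : -2 ≤ w.re) : ‖tau w‖ ≤ tauR w.re :=
  tsum_of_norm_bounded (summable_tauR hw).hasSum (norm_tau_term_le hw)

lemma differentiableOn_tau : DifferentiableOn ℂ tau {w | -2 < w.re} := by
  refine Complex.differentiableOn_tsum_of_summable_norm (hasSum_two_div_lam_sq.summable.mul_left 6)
    (fun n => ?_) (isOpen_lt continuous_const Complex.continuous_re) fun n w hw =>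
      (norm_tau_term_le hw.le n).trans (two_div_add_le hw.le n)
  intro w hw
  refine DifferentiableAt.differentiableWithinAt ?_
  exact DifferentiableAt.fun_div (c := fun _ => 2) (d := fun u : ℂ => u + (lam n : ℂ) ^ 2)
    (by fun_prop) (by fun_prop) (add_lam_sq_ne_zero (le_of_lt hw) n)

/-- Termwise, 2/λ_n² - 2/(p+λ_n²) = 2p/(λ_n²(p+λ_n²)), and the factor λ_n²/(p+λ_n²) is traded for
λ_0²/(p+λ_0²). After clearing denominators the gain is a positive multiple of p²(λ_n²-λ_0²), so both
signs of p are covered. -/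
lemma one_sub_tauR_ge {p : ℝ} (hp : -2 ≤ p) : p / 3 / (1 + p / lam 0 ^ 2) ≤ 1 - tauR p := by
  have h1 := hasSum_two_div_lam_sq.sub (summable_tauR hp).hasSum
  have h2 := hasSum_two_div_lam_four.mul_left (p / (1 + p / lam 0 ^ 2))
  have e : p / (1 + p / lam 0 ^ 2) * (1 / 3) = p / 3 / (1 + p / lam 0 ^ 2) := by ring
  rw [e] at h2
  refine hasSum_le (fun n => ?_) h2 h1
  have hl := (lam_pos n).ne'
  have hl0 := (lam_pos 0).ne'
  have hn := pow_pos (lam_pos n) 2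
  have h0 := pow_pos (lam_pos 0) 2
  have hpn := add_lam_sq_pos hp n
  have hp0 := add_lam_sq_pos hp 0
  have e1 : 2 / lam n ^ 2 - 2 / (p + lam n ^ 2) = 2 * p / (lam n ^ 2 * (p + lam n ^ 2)) := by
    field_simp; ring
  have e2 : p / (1 + p / lam 0 ^ 2) * (2 / lam n ^ 4)
      = 2 * p * lam 0 ^ 2 / (lam n ^ 2 * lam n ^ 2 * (p + lam 0 ^ 2)) := by
    have : 1 + p / lam 0 ^ 2 ≠ 0 := by
      rw [one_add_div h0.ne']; exact (div_pos (by linarith) h0).ne'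
    have : lam 0 ^ 2 + p ≠ 0 := by linarith
    field_simp
    ring
  rw [e1, e2, div_le_div_iff₀ (by positivity) (by positivity)]
  have h := lam_zero_sq_le n
  have : 0 ≤ 2 * lam n ^ 2 * p ^ 2 * (lam n ^ 2 - lam 0 ^ 2) := by
    have : 0 ≤ lam n ^ 2 - lam 0 ^ 2 := by linarith
    positivity
  nlinarith [this]

/-- When Re z² ≥ 0, |z²+λ²| dominates both |z|² and λ², hence their mean. The series is then at most
twice that of tanh |z|. -/
lemma norm_mul_tau_sq_le {z : ℂ} (hz : 0 ≤ (z ^ 2).re) : ‖z * tau (z ^ 2)‖ ≤ 2 := by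
  rcases eq_or_ne z 0 with rfl | h0
  · simp
  have hn := norm_pos_iff.2 h0
  have hs := (hasSum_tanh hn.ne').mul_left 2
  have h2 : -2 ≤ (z ^ 2).re := by linarith
  have key : ‖∑' n, z * (2 / (z ^ 2 + (lam n : ℂ) ^ 2))‖ ≤ 2 * Real.tanh ‖z‖ := by
    refine tsum_of_norm_bounded hs fun n => ?_
    rw [norm_mul, norm_div, Complex.norm_two]
    have hl := pow_pos (lam_pos n) 2
    have h3 : (‖z‖ ^ 2 + lam n ^ 2) / 2 ≤ ‖z ^ 2 + (lam n : ℂ) ^ 2‖ := by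
      have h5 : ‖z‖ ^ 2 ≤ ‖z ^ 2 + (lam n : ℂ) ^ 2‖ := by
        rw [← norm_pow, Complex.norm_def, Complex.norm_def]
        refine Real.sqrt_le_sqrt ?_
        rw [Complex.normSq_apply, Complex.normSq_apply, ← Complex.ofReal_pow]
        simp only [Complex.add_re, Complex.ofReal_re, Complex.add_im, Complex.ofReal_im, add_zero]
        nlinarith
      linarith [re_add_lam_le (z ^ 2) n]
    calc ‖z‖ * (2 / ‖z ^ 2 + (lam n : ℂ) ^ 2‖) ≤ ‖z‖ * (2 / ((‖z‖ ^ 2 + lam n ^ 2) / 2)) := by gcongr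
      _ = _ := by field_simp
  rw [tsum_mul_left] at key
  exact key.trans (by linarith [Real.tanh_lt_one ‖z‖])

lemma norm_add_lam_sq_ge {w : ℂ} (hw : -1 ≤ w.re) (n : ℕ) :
    (1 + ‖w‖) / 3 ≤ ‖w + (lam n : ℂ) ^ 2‖ := by
  have h1 := re_add_lam_le w n
  have h2 := Complex.abs_im_le_norm (w + (lam n : ℂ) ^ 2)
  rw [← Complex.ofReal_pow, Complex.add_im, Complex.ofReal_im, add_zero, Complex.ofReal_pow] at h2
  have h3 := Complex.norm_le_abs_re_add_abs_im w
  have h4 := lam_sq_ge n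
  rcases abs_cases w.re with ⟨h, _⟩ | ⟨h, _⟩ <;> linarith

/-- The error is exactly Σ 2w²/(λ_n⁴(w+λ_n²)), and |w+λ_n²| ≥ (1+|w|)/3. The bound is quadratic at 0
but only linear at infinity, which is what makes the long-wave estimate uniform in the frequency. -/
lemma norm_tau_expansion_le {w : ℂ} (hw : -1 ≤ w.re) :
    ‖w / 3 - (1 - tau w)‖ ≤ ‖w‖ ^ 2 / (1 + ‖w‖) := by
  have hw2 : -2 ≤ w.re := by linarith
  have a1 : HasSum (fun n => ((2 / lam n ^ 2 : ℝ) : ℂ)) ((1 : ℝ) : ℂ) :=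
    Complex.hasSum_ofReal.2 hasSum_two_div_lam_sq
  have a2 : HasSum (fun n => ((2 / lam n ^ 4 : ℝ) : ℂ)) ((1 / 3 : ℝ) : ℂ) :=
    Complex.hasSum_ofReal.2 hasSum_two_div_lam_four
  have h := (a2.mul_left w).sub (a1.sub (summable_tau hw2).hasSum)
  have hb := (hasSum_two_div_lam_four.mul_left (3 * (‖w‖ ^ 2 / (1 + ‖w‖))))
  have e : w / 3 - (1 - tau w) = w * ((1 / 3 : ℝ) : ℂ) - (((1 : ℝ) : ℂ) - ∑' n, 2 / (w + (lam n : ℂ) ^ 2)) := by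
    rw [tau]; push_cast; ring
  have e2 : 3 * (‖w‖ ^ 2 / (1 + ‖w‖)) * (1 / 3) = ‖w‖ ^ 2 / (1 + ‖w‖) := by ring
  rw [e2] at hb
  rw [e, ← h.tsum_eq]
  refine tsum_of_norm_bounded hb fun n => ?_
  have hl := lam_pos n
  have hlc : (lam n : ℂ) ≠ 0 := Complex.ofReal_ne_zero.2 hl.ne'
  have hne := add_lam_sq_ne_zero hw2 n
  have e3 : w * ((2 / lam n ^ 4 : ℝ) : ℂ) - (((2 / lam n ^ 2 : ℝ) : ℂ) - 2 / (w + (lam n : ℂ) ^ 2))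
      = 2 * w ^ 2 / ((lam n : ℂ) ^ 4 * (w + (lam n : ℂ) ^ 2)) := by
    push_cast
    field_simp
    ring
  rw [e3, norm_div, norm_mul, norm_mul, norm_pow, norm_pow, Complex.norm_two, Complex.norm_real,
    Real.norm_of_nonneg hl.le]
  have h5 := norm_add_lam_sq_ge hw n
  have h6 : 0 < (1 + ‖w‖) / 3 := by positivity
  calc 2 * ‖w‖ ^ 2 / (lam n ^ 4 * ‖w + (lam n : ℂ) ^ 2‖)
      ≤ 2 * ‖w‖ ^ 2 / (lam n ^ 4 * ((1 + ‖w‖) / 3)) := by gcongr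
    _ = _ := by field_simp

lemma norm_one_sub_tau_le {w : ℂ} (hw : -1 ≤ w.re) : ‖1 - tau w‖ ≤ 2 * ‖w‖ := by
  have h := norm_tau_expansion_le hw
  have h1 : ‖w‖ ^ 2 / (1 + ‖w‖) ≤ ‖w‖ := by
    rw [div_le_iff₀ (by positivity)]; nlinarith [norm_nonneg w]
  have h2 : ‖1 - tau w‖ ≤ ‖w / 3‖ + ‖w / 3 - (1 - tau w)‖ := by
    have := norm_sub_le (w / 3) (w / 3 - (1 - tau w))
    simpa using this
  rw [norm_div] at h2
  norm_num at h2
  linarith [norm_nonneg w]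

lemma tau_sq_real (k : ℝ) : tau ((k : ℂ) ^ 2) = (tanhc k : ℂ) := by
  have e : tau ((k : ℂ) ^ 2) = ((∑' n, 2 / (k ^ 2 + lam n ^ 2) : ℝ) : ℂ) := by
    rw [tau, Complex.ofReal_tsum]; push_cast; rfl
  rw [e]
  congr 1
  rw [tanhc]
  split_ifs with hk
  · simpa [hk] using hasSum_two_div_lam_sq.tsum_eq
  · have h := (hasSum_tanh hk).div_const k
    rw [← h.tsum_eq]
    congr 1
    ext n
    field_simp

/-! ### Symbols on horizontal lines -/

/-- The point `k + i b` with `k = 2πξ`. -/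
def lineVar (b ξ : ℝ) : ℂ := ((2 * Real.pi * ξ : ℝ) : ℂ) + b * Complex.I

@[fun_prop] lemma continuous_lineVar (b : ℝ) : Continuous (lineVar b) := by
  unfold lineVar; fun_prop

lemma lineVar_sq_re (b ξ : ℝ) : (lineVar b ξ ^ 2).re = (2 * Real.pi * ξ) ^ 2 - b ^ 2 := by
  simp [lineVar, sq]

lemma lineVar_sq_im (b ξ : ℝ) : (lineVar b ξ ^ 2).im = 2 * (2 * Real.pi * ξ) * b := by
  simp [lineVar, sq]; ring

lemma norm_lineVar_sq (b ξ : ℝ) : ‖lineVar b ξ‖ ^ 2 = (2 * Real.pi * ξ) ^ 2 + b ^ 2 := by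
  rw [← Complex.normSq_eq_norm_sq, Complex.normSq_apply]
  simp [lineVar]; ring

lemma lineVar_zero (ξ : ℝ) : lineVar 0 ξ = ((2 * Real.pi * ξ : ℝ) : ℂ) := by simp [lineVar]

/-- The symbol of `tanh (dD) / (dD)` on the line `Im = b`. -/
def tSym (d : ℂ) (b ξ : ℝ) : ℂ := tau ((d * lineVar b ξ) ^ 2)

/-- The symbol of `i tanh (dD)` on the line `Im = b`. -/
def hSym (d : ℂ) (b ξ : ℝ) : ℂ := Complex.I * (d * lineVar b ξ * tau ((d * lineVar b ξ) ^ 2))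

/-- Complex dilation parameters for which the symbols are bounded on the line `Im = b`. -/
def admissible (b : ℝ) : Set ℂ := {d | 2 * |(d ^ 2).im| < (d ^ 2).re ∧ ‖d‖ ^ 2 * b ^ 2 < 1 / 2}

lemma isOpen_admissible (b : ℝ) : IsOpen (admissible b) := by
  have h1 : IsOpen {d : ℂ | 2 * |(d ^ 2).im| < (d ^ 2).re} :=
    isOpen_lt (continuous_const.mul (Complex.continuous_im.comp (continuous_pow 2)).abs)
      (Complex.continuous_re.comp (continuous_pow 2))
  have h2 : IsOpen {d : ℂ | ‖d‖ ^ 2 * b ^ 2 < 1 / 2} := isOpen_lt (by fun_prop) (by fun_prop)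
  exact h1.inter h2

lemma ofReal_mem_admissible {t b : ℝ} (ht : 0 < t) (h : t ^ 2 * b ^ 2 < 1 / 2) :
    (t : ℂ) ∈ admissible b := by
  refine ⟨?_, by rwa [Complex.norm_real, Real.norm_of_nonneg ht.le]⟩
  rw [← Complex.ofReal_pow, Complex.ofReal_re, Complex.ofReal_im]
  simp; positivity

lemma mul_lineVar_sq_re (d : ℂ) (b ξ : ℝ) : ((d * lineVar b ξ) ^ 2).re
    = (d ^ 2).re * ((2 * Real.pi * ξ) ^ 2 - b ^ 2) - (d ^ 2).im * (2 * (2 * Real.pi * ξ) * b) := by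
  rw [mul_pow, Complex.mul_re, lineVar_sq_re, lineVar_sq_im]

lemma admissible_re_ge (d : ℂ) (b ξ : ℝ) :
    ((d ^ 2).re - |(d ^ 2).im|) * (2 * Real.pi * ξ) ^ 2 - ((d ^ 2).re + |(d ^ 2).im|) * b ^ 2
      ≤ ((d * lineVar b ξ) ^ 2).re := by
  rw [mul_lineVar_sq_re]
  set k := 2 * Real.pi * ξ
  have h1 : (d ^ 2).im * (2 * k * b) ≤ |(d ^ 2).im| * (k ^ 2 + b ^ 2) := by
    refine (le_abs_self _).trans ?_
    rw [abs_mul]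
    refine mul_le_mul_of_nonneg_left ?_ (abs_nonneg _)
    rw [abs_le]; constructor <;> nlinarith [sq_nonneg (k + b), sq_nonneg (k - b)]
  linarith

/-- The sector condition makes the k² coefficient nonnegative, and ‖d‖²b² < 1/2 bounds the negative
part by 1. The argument of `tau` thus stays away from its poles, also for complex d close to the
positive axis. -/
lemma admissible_re_ge_neg_one {d : ℂ} {b : ℝ} (hd : d ∈ admissible b) (ξ : ℝ) :
    -1 ≤ ((d * lineVar b ξ) ^ 2).re := by
  refine le_trans ?_ (admissible_re_ge d b ξ)
  obtain ⟨h1, h2⟩ := hd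
  have h3 : (d ^ 2).re ≤ ‖d‖ ^ 2 := by rw [← norm_pow]; exact Complex.re_le_norm _
  have h4 : 0 ≤ ((d ^ 2).re - |(d ^ 2).im|) * (2 * Real.pi * ξ) ^ 2 :=
    mul_nonneg (by linarith [abs_nonneg (d ^ 2).im]) (sq_nonneg _)
  have h5 : ((d ^ 2).re + |(d ^ 2).im|) * b ^ 2 ≤ 2 * ‖d‖ ^ 2 * b ^ 2 :=
    mul_le_mul_of_nonneg_right (by linarith [abs_nonneg (d ^ 2).im]) (sq_nonneg _)
  linarith

lemma admissible_re_ge_neg_two {d : ℂ} {b : ℝ} (hd : d ∈ admissible b) (ξ : ℝ) :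
    -2 < ((d * lineVar b ξ) ^ 2).re := by linarith [admissible_re_ge_neg_one hd ξ]

lemma continuous_tSym {d : ℂ} {b : ℝ} (hd : d ∈ admissible b) : Continuous (tSym d b) :=
  differentiableOn_tau.continuousOn.comp_continuous (by fun_prop) (admissible_re_ge_neg_two hd)

lemma continuous_hSym {d : ℂ} {b : ℝ} (hd : d ∈ admissible b) : Continuous (hSym d b) := by
  have := continuous_tSym hd
  unfold tSym at this
  unfold hSym
  fun_prop

lemma isSymbol_tSym {d : ℂ} {b : ℝ} (hd : d ∈ admissible b) : IsSymbol (tSym d b) 6 :=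
  ⟨(continuous_tSym hd).aestronglyMeasurable, fun ξ =>
    (norm_tau_le (admissible_re_ge_neg_two hd ξ).le).trans (tauR_le_six (admissible_re_ge_neg_two hd ξ).le)⟩

/-- If Re (dz)² ≥ 0 the bound is 2. Otherwise the sector condition forces k² < 3b², so dz is bounded
by 2 and `tau` by 6. -/
lemma isSymbol_hSym {d : ℂ} {b : ℝ} (hd : d ∈ admissible b) : IsSymbol (hSym d b) 12 := by
  refine ⟨(continuous_hSym hd).aestronglyMeasurable, fun ξ => ?_⟩
  rw [hSym, norm_mul, Complex.norm_I, one_mul]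
  rcases le_or_gt 0 ((d * lineVar b ξ) ^ 2).re with h | h
  · exact (norm_mul_tau_sq_le h).trans (by norm_num)
  · have h1 := (admissible_re_ge d b ξ).trans_lt h
    have h6 := (isSymbol_tSym hd).bound ξ
    rw [tSym] at h6
    obtain ⟨h2, h3⟩ := hd
    have hR : 0 < (d ^ 2).re := by linarith [abs_nonneg (d ^ 2).im]
    have h4 : (2 * Real.pi * ξ) ^ 2 < 3 * b ^ 2 := by
      by_contra hc
      push Not at hc
      nlinarith [mul_le_mul_of_nonneg_left hc (by linarith : 0 ≤ (d ^ 2).re - |(d ^ 2).im|),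
        mul_nonneg (sq_nonneg b) (by linarith : 0 ≤ (d ^ 2).re - 2 * |(d ^ 2).im|)]
    have h5 : ‖d * lineVar b ξ‖ ^ 2 ≤ 2 := by
      rw [norm_mul, mul_pow, norm_lineVar_sq]
      nlinarith [sq_nonneg ‖d‖]
    have h7 : ‖d * lineVar b ξ‖ ≤ 2 := by nlinarith [norm_nonneg (d * lineVar b ξ)]
    rw [norm_mul]
    exact (mul_le_mul h7 h6 (norm_nonneg _) (by norm_num)).trans (by norm_num)

lemma contDiffAt_symMul_tSym {t b : ℝ} (h : (t : ℂ) ∈ admissible b) :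
    ContDiffAt ℝ ∞ (fun s : ℝ => symMul (tSym s b)) t := by
  obtain ⟨r, hr, hsub⟩ := Metric.isOpen_iff.1 (isOpen_admissible b) _ h
  refine contDiffAt_symMul_family (σ := fun d => tSym d b) hr
    (fun w hw => isSymbol_tSym (hsub hw)) fun ξ => ?_
  exact differentiableOn_tau.comp (by fun_prop) fun w hw => admissible_re_ge_neg_two (hsub hw) ξ

lemma contDiffAt_symMul_hSym {t b : ℝ} (h : (t : ℂ) ∈ admissible b) :
    ContDiffAt ℝ ∞ (fun s : ℝ => symMul (hSym s b)) t := by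
  obtain ⟨r, hr, hsub⟩ := Metric.isOpen_iff.1 (isOpen_admissible b) _ h
  refine contDiffAt_symMul_family (σ := fun d => hSym d b) hr
    (fun w hw => isSymbol_hSym (hsub hw)) fun ξ => ?_
  have : DifferentiableOn ℂ (fun w => tau ((w * lineVar b ξ) ^ 2)) (Metric.ball (t : ℂ) r) :=
    differentiableOn_tau.comp (by fun_prop) fun w hw => admissible_re_ge_neg_two (hsub hw) ξ
  unfold hSym
  fun_prop

lemma norm_lineVar_le {b : ℝ} (hb : b ^ 2 < 3) (ξ : ℝ) : ‖lineVar b ξ‖ ≤ 2 * jap ξ := by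
  have h1 := norm_lineVar_sq b ξ
  have h2 := jap_sq ξ
  refine (abs_le_of_sq_le_sq' (?_ : ‖lineVar b ξ‖ ^ 2 ≤ (2 * jap ξ) ^ 2) (by linarith [jap_pos ξ])).2
  rw [mul_pow, h1, h2]
  nlinarith [sq_nonneg (2 * Real.pi * ξ)]

/-- One derivative buys a factor t. This is the source of the smallness of i tanh(εD)Θ. -/
lemma norm_hSym_le {t b : ℝ} (ht : 0 < t) (h : (t : ℂ) ∈ admissible b) (hb : b ^ 2 < 3) (ξ : ℝ) :
    ‖hSym t b ξ‖ ≤ 12 * t * jap ξ := by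
  have h6 := (isSymbol_tSym h).bound ξ
  rw [tSym] at h6
  rw [hSym, norm_mul, Complex.norm_I, one_mul, norm_mul, norm_mul, Complex.norm_real,
    Real.norm_of_nonneg ht.le]
  have := norm_lineVar_le hb ξ
  have := jap_pos ξ
  calc t * ‖lineVar b ξ‖ * ‖tau ((t * lineVar b ξ) ^ 2)‖ ≤ t * (2 * jap ξ) * 6 := by gcongr
    _ = _ := by ring

/-! ### The resolvent symbol in the long wave limit -/

/-- The symbol of `(1 + D² / 3)⁻¹` on the line `Im = b`. -/
def kdvSym (b ξ : ℝ) : ℂ := 3 / (3 + lineVar b ξ ^ 2)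

/-- The zeros of 3 + z² are ±i√3; this is where the upper limit √3 for the weight enters. -/
lemma three_add_sq_ge {b : ℝ} (hb : b ^ 2 < 3) (ξ : ℝ) :
    (3 - b ^ 2) / 3 * jap ξ ^ 2 ≤ ‖3 + lineVar b ξ ^ 2‖ := by
  refine le_trans ?_ (Complex.re_le_norm _)
  rw [Complex.add_re, lineVar_sq_re, jap_sq]
  simp only [Complex.re_ofNat]
  nlinarith [sq_nonneg b, sq_nonneg (2 * Real.pi * ξ), mul_nonneg (sq_nonneg b) (sq_nonneg (2 * Real.pi * ξ))]

lemma three_add_sq_ne_zero {b : ℝ} (hb : b ^ 2 < 3) (ξ : ℝ) : 3 + lineVar b ξ ^ 2 ≠ 0 :=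
  norm_pos_iff.1 ((mul_pos (by linarith) (pow_pos (jap_pos ξ) 2)).trans_le (three_add_sq_ge hb ξ))

lemma continuous_kdvSym {b : ℝ} (hb : b ^ 2 < 3) : Continuous (kdvSym b) := by
  unfold kdvSym
  exact continuous_const.div (by fun_prop) (three_add_sq_ne_zero hb)

lemma norm_kdvSym_le {b : ℝ} (hb : b ^ 2 < 3) (ξ : ℝ) :
    ‖kdvSym b ξ‖ ≤ 9 / (3 - b ^ 2) * (jap ξ ^ 2)⁻¹ := by
  have hc : 0 < 3 - b ^ 2 := by linarith
  rw [kdvSym, norm_div]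
  have h := three_add_sq_ge hb ξ
  have hJ := pow_pos (jap_pos ξ) 2
  have h3 : ‖(3 : ℂ)‖ = 3 := by simp
  rw [h3]
  calc 3 / ‖3 + lineVar b ξ ^ 2‖ ≤ 3 / ((3 - b ^ 2) / 3 * jap ξ ^ 2) := by gcongr
    _ = _ := by field_simp; norm_num

lemma isSymbol_kdvSym {b : ℝ} (hb : b ^ 2 < 3) : IsSymbol (kdvSym b) (9 / (3 - b ^ 2)) := by
  refine ⟨(continuous_kdvSym hb).aestronglyMeasurable, fun ξ => (norm_kdvSym_le hb ξ).trans ?_⟩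
  have hc : 0 < 3 - b ^ 2 := by linarith
  exact mul_le_of_le_one_right (by positivity) (inv_le_one_of_one_le₀ (one_le_pow₀ (one_le_jap ξ)))

/-- The denominator of the resolvent behaves like ε²⟨k⟩² for k up to 1/ε and like a constant beyond.
The lower bound captures both regimes, with a constant that degenerates only as b² → 3. -/
lemma one_sub_mul_tauR_ge {b ε : ℝ} (hε : 0 < ε) (hb : b ^ 2 < 3) (h : ε ^ 2 ≤ (3 - b ^ 2) / 9)
    (ξ : ℝ) : (3 - b ^ 2) / 3 * (ε ^ 2 * jap ξ ^ 2) / (3 * (1 + ε ^ 2 * jap ξ ^ 2))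
      ≤ 1 - (1 - ε ^ 2) * tauR (ε ^ 2 * ((2 * Real.pi * ξ) ^ 2 - b ^ 2)) := by
  rw [jap_sq]
  set k := 2 * Real.pi * ξ
  set p := ε ^ 2 * (k ^ 2 - b ^ 2) with hp
  have hε2 := pow_pos hε 2
  have hp1 : -(3 * ε ^ 2) ≤ p := by nlinarith [sq_nonneg k]
  have hb2 := sq_nonneg b
  have hε3 : ε ^ 2 ≤ 1 / 3 := by linarith
  have hp2 : -2 ≤ p := by linarith
  have hT := one_sub_tauR_ge hp2
  have hL1 := lam_sq_ge 0
  have hL2 := lam_zero_sq_le_three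
  set L := lam 0 ^ 2
  have hLp : 0 < L + p := by linarith
  have e1 : p / 3 / (1 + p / L) = p * L / (3 * (L + p)) := by
    have : 1 + p / L ≠ 0 := by rw [one_add_div (by linarith)]; exact (div_pos hLp (by linarith)).ne'
    have : L ≠ 0 := by linarith
    field_simp
  rw [e1] at hT
  have h2 : ε ^ 2 + (1 - ε ^ 2) * (p * L / (3 * (L + p))) ≤ 1 - (1 - ε ^ 2) * tauR p := by
    nlinarith
  refine le_trans ?_ h2
  have e2 : ε ^ 2 + (1 - ε ^ 2) * (p * L / (3 * (L + p)))
      = (3 * ε ^ 2 * (L + p) + (1 - ε ^ 2) * (p * L)) / (3 * (L + p)) := by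
    field_simp
  rw [e2]
  -- The main part of the numerator is L(3ε²+p) = Lε²(3-b²+k²). The rest, ε²(3-L)p, is at least -3ε⁴
  -- because p ≥ -3ε² and 0 ≤ 3-L ≤ 1.
  have hN : (3 - b ^ 2) / 3 * (ε ^ 2 * (1 + k ^ 2)) * L
      ≤ 3 * ε ^ 2 * (L + p) + (1 - ε ^ 2) * (p * L) := by
    have a1 : 3 * ε ^ 2 * (L + p) + (1 - ε ^ 2) * (p * L)
        = L * (3 * ε ^ 2 + p) + ε ^ 2 * ((3 - L) * p) := by ring
    have a2 : -(3 * ε ^ 2) ≤ (3 - L) * p := by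
      nlinarith
    have a3 : 3 * ε ^ 2 + p = ε ^ 2 * (3 - b ^ 2 + k ^ 2) := by rw [hp]; ring
    rw [a1, a3]
    have a4 : ε ^ 2 * (-(3 * ε ^ 2)) ≤ ε ^ 2 * ((3 - L) * p) := mul_le_mul_of_nonneg_left a2 hε2.le
    have a5 : (3 - b ^ 2) / 3 * (1 + k ^ 2) * L ≤ L * (3 - b ^ 2 + k ^ 2) - 3 * ε ^ 2 := by
      have : (3 - b ^ 2) / 3 * k ^ 2 ≤ k ^ 2 := by nlinarith [sq_nonneg k]
      nlinarith
    nlinarith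
  rw [div_le_div_iff₀ (by positivity) (by positivity)]
  have hpk : L + p ≤ L * (1 + ε ^ 2 * (1 + k ^ 2)) := by
    nlinarith [mul_nonneg hε2.le (sq_nonneg k), mul_nonneg hε2.le hb2]
  have hc : 0 ≤ (3 - b ^ 2) / 3 * (ε ^ 2 * (1 + k ^ 2)) := by
    have : 0 < 3 - b ^ 2 := by linarith
    positivity
  have hJ : 0 ≤ 1 + ε ^ 2 * (1 + k ^ 2) := by positivity
  have s1 := mul_le_mul_of_nonneg_left hpk hc
  have s2 := mul_le_mul_of_nonneg_right hN hJ
  nlinarith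

lemma mem_admissible_of_small {b ε : ℝ} (hε : 0 < ε) (h : ε ^ 2 ≤ (3 - b ^ 2) / 9) :
    (ε : ℂ) ∈ admissible b := by
  refine ofReal_mem_admissible hε ?_
  nlinarith [sq_nonneg b, sq_nonneg (b ^ 2 - 3 / 2)]

lemma ofReal_mul_lineVar_sq_re (ε b ξ : ℝ) :
    (((ε : ℂ) * lineVar b ξ) ^ 2).re = ε ^ 2 * ((2 * Real.pi * ξ) ^ 2 - b ^ 2) := by
  rw [mul_lineVar_sq_re, ← Complex.ofReal_pow, Complex.ofReal_re, Complex.ofReal_im]; ring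

/-- `(1 - ε²) ‖tanhc‖ < 1` on the line `Im = b`. -/
lemma exists_norm_tSym_le {b ε : ℝ} (hε : 0 < ε) (hb : b ^ 2 < 3) (h : ε ^ 2 ≤ (3 - b ^ 2) / 9) :
    (1 - ε ^ 2) * tauR (-(ε ^ 2 * b ^ 2)) < 1 ∧
      IsSymbol (tSym ε b) (tauR (-(ε ^ 2 * b ^ 2))) := by
  have hadm := mem_admissible_of_small hε h
  refine ⟨?_, (isSymbol_tSym hadm).meas, fun ξ => ?_⟩
  · have h0 := one_sub_mul_tauR_ge hε hb h 0
    have e : ε ^ 2 * ((2 * Real.pi * 0) ^ 2 - b ^ 2) = -(ε ^ 2 * b ^ 2) := by ring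
    rw [e] at h0
    have : 0 < (3 - b ^ 2) / 3 * (ε ^ 2 * jap 0 ^ 2) / (3 * (1 + ε ^ 2 * jap 0 ^ 2)) := by
      have h3 : 0 < 3 - b ^ 2 := by linarith
      have := jap_pos 0
      positivity
    linarith
  · have h1 := admissible_re_ge_neg_two hadm ξ
    refine (norm_tau_le h1.le).trans (tauR_antitone ?_ ?_)
    · nlinarith [sq_nonneg b, sq_nonneg ε]
    · rw [ofReal_mul_lineVar_sq_re]; nlinarith [mul_nonneg (sq_nonneg ε) (sq_nonneg (2 * Real.pi * ξ))]

/-- Since |τ(w)| ≤ τ(Re w), the complex line reduces to the real estimate. -/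
lemma norm_one_sub_tSym_ge {b ε : ℝ} (hε : 0 < ε) (hb : b ^ 2 < 3) (h : ε ^ 2 ≤ (3 - b ^ 2) / 9)
    (ξ : ℝ) : (3 - b ^ 2) / 3 * (ε ^ 2 * jap ξ ^ 2) / (3 * (1 + ε ^ 2 * jap ξ ^ 2))
      ≤ ‖1 - ((1 - ε ^ 2 : ℝ) : ℂ) * tSym ε b ξ‖ := by
  refine (one_sub_mul_tauR_ge hε hb h ξ).trans ?_
  have h1 := admissible_re_ge_neg_two (mem_admissible_of_small hε h) ξ
  have h2 := norm_tau_le h1.le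
  rw [ofReal_mul_lineVar_sq_re] at h2
  have h3 : 0 ≤ 1 - ε ^ 2 := by nlinarith [sq_nonneg b]
  have h4 := norm_sub_norm_le 1 (((1 - ε ^ 2 : ℝ) : ℂ) * tSym ε b ξ)
  rw [norm_one, norm_mul, Complex.norm_real, Real.norm_of_nonneg h3, tSym] at h4
  rw [tSym]
  nlinarith [mul_le_mul_of_nonneg_left h2 h3]

/-- With J = ⟨k⟩², the cross-multiplied numerator is O((ε²J)²/(1+ε²J) + ε²·ε²J) and the product of
the denominators is at least of order ε²J²/(1+ε²J). The quotient is O(ε²) uniformly in k; 189 = 3(27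
+ 18·2). -/
lemma norm_resolvent_sub_kdvSym_le {b ε : ℝ} (hε : 0 < ε) (hb : b ^ 2 < 3)
    (h : ε ^ 2 ≤ (3 - b ^ 2) / 9) (ξ : ℝ) :
    ‖(ε : ℂ) ^ 2 / (1 - ((1 - ε ^ 2 : ℝ) : ℂ) * tSym ε b ξ) - kdvSym b ξ‖
      ≤ 189 / ((3 - b ^ 2) / 3) ^ 2 * ε ^ 2 := by
  have hD := norm_one_sub_tSym_ge hε hb h ξ
  have hK := three_add_sq_ge hb ξ
  have hKne := three_add_sq_ne_zero hb ξ
  have hre := admissible_re_ge_neg_one (mem_admissible_of_small hε h) ξ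
  have hJ := one_le_pow₀ (one_le_jap ξ) (n := 2)
  have hwle : ‖((ε : ℂ) * lineVar b ξ) ^ 2‖ ≤ 3 * (ε ^ 2 * jap ξ ^ 2) := by
    rw [norm_pow, norm_mul, mul_pow, Complex.norm_real, Real.norm_of_nonneg hε.le, norm_lineVar_sq,
      jap_sq]
    nlinarith [mul_nonneg (sq_nonneg ε) (sq_nonneg (2 * Real.pi * ξ)), sq_nonneg ε]
  set c := (3 - b ^ 2) / 3
  have hc : 0 < c := by simp only [c]; linarith
  have hε1 : ε ^ 2 ≤ 1 := by nlinarith [sq_nonneg b]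
  set J := jap ξ ^ 2
  have hε2 := pow_pos hε 2
  have hq : 0 < c * (ε ^ 2 * J) / (3 * (1 + ε ^ 2 * J)) := by positivity
  have hDne : 1 - ((1 - ε ^ 2 : ℝ) : ℂ) * tSym ε b ξ ≠ 0 := norm_pos_iff.1 (hq.trans_le hD)
  rw [kdvSym, div_sub_div _ _ hDne hKne, norm_div, norm_mul]
  have hnum : ‖(ε : ℂ) ^ 2 * (3 + lineVar b ξ ^ 2) - (1 - ((1 - ε ^ 2 : ℝ) : ℂ) * tSym ε b ξ) * 3‖
      ≤ 27 * (ε ^ 2 * J) ^ 2 / (1 + 3 * (ε ^ 2 * J)) + 18 * ε ^ 2 * (ε ^ 2 * J) := by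
    set w := ((ε : ℂ) * lineVar b ξ) ^ 2 with hw
    have e : (ε : ℂ) ^ 2 * (3 + lineVar b ξ ^ 2) - (1 - ((1 - ε ^ 2 : ℝ) : ℂ) * tSym ε b ξ) * 3
        = 3 * (w / 3 - (1 - tau w)) + 3 * ((ε : ℂ) ^ 2 * (1 - tau w)) := by
      rw [tSym, ← hw, hw, mul_pow]; push_cast; ring
    rw [e]
    refine (norm_add_le _ _).trans ?_
    have h3 : ‖(3 : ℂ)‖ = 3 := by simp
    rw [norm_mul, norm_mul, norm_mul, norm_pow, Complex.norm_real, Real.norm_of_nonneg hε.le, h3]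
    have b1 := norm_tau_expansion_le hre
    have b2 := norm_one_sub_tau_le hre
    have b3 : ‖w‖ ^ 2 / (1 + ‖w‖) ≤ (3 * (ε ^ 2 * J)) ^ 2 / (1 + 3 * (ε ^ 2 * J)) := by
      rw [div_le_div_iff₀ (by positivity) (by positivity)]
      have h0 := norm_nonneg w
      have t1 : ‖w‖ ^ 2 ≤ (3 * (ε ^ 2 * J)) ^ 2 := pow_le_pow_left₀ h0 hwle 2
      have t2 : ‖w‖ * (3 * (ε ^ 2 * J)) * ‖w‖ ≤ ‖w‖ * (3 * (ε ^ 2 * J)) * (3 * (ε ^ 2 * J)) :=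
        mul_le_mul_of_nonneg_left hwle (by positivity)
      nlinarith
    have b4 : 3 * ((3 * (ε ^ 2 * J)) ^ 2 / (1 + 3 * (ε ^ 2 * J)))
        = 27 * (ε ^ 2 * J) ^ 2 / (1 + 3 * (ε ^ 2 * J)) := by ring
    have b5 : ε ^ 2 * ‖1 - tau w‖ ≤ ε ^ 2 * (2 * (3 * (ε ^ 2 * J))) := by gcongr; linarith
    linarith
  calc _ ≤ (27 * (ε ^ 2 * J) ^ 2 / (1 + 3 * (ε ^ 2 * J)) + 18 * ε ^ 2 * (ε ^ 2 * J))
        / (c * (ε ^ 2 * J) / (3 * (1 + ε ^ 2 * J)) * (c * J)) := by gcongr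
    _ = 3 / c ^ 2 * ε ^ 2 * (27 * ((1 + ε ^ 2 * J) / (1 + 3 * (ε ^ 2 * J)))
          + 18 * ((1 + ε ^ 2 * J) / J)) := by
        have : J ≠ 0 := by linarith
        field_simp
    _ ≤ 3 / c ^ 2 * ε ^ 2 * (27 * 1 + 18 * 2) := by
        gcongr
        · rw [div_le_one (by positivity)]; nlinarith
        · rw [div_le_iff₀ (by linarith)]; nlinarith
    _ = _ := by ring

/-! ### Shifting multipliers to another line -/

lemma IsSymbol.integrable_mul {σ F : ℝ → ℂ} {C : ℝ} (h : IsSymbol σ C) (hF : Integrable F) :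
    Integrable fun ξ => σ ξ * F ξ :=
  hF.bdd_mul h.meas (Eventually.of_forall h.bound)

lemma fourierInv_real_eq (F : ℝ → ℂ) (x : ℝ) :
    𝓕⁻ F x = ∫ ξ : ℝ, Complex.exp (2 * Real.pi * ξ * x * Complex.I) * F ξ := by
  rw [Real.fourierInv_eq']
  refine integral_congr_ae (Eventually.of_forall fun ξ => ?_)
  simp only [RCLike.inner_apply, conj_trivial, smul_eq_mul]
  congr 2; push_cast; ring

lemma resolvent_den_ne_zero {l : ℝ} (hl : 0 < l) (s k : ℝ) : (l : ℂ) + Complex.I * s * k ≠ 0 := by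
  intro h
  have := congrArg Complex.re h
  simp at this
  exact hl.ne' this

/-- `(λ + i s D)⁻¹ f = ∫_0^∞ e^{-λ u} f(· - s u) du`. -/
lemma fourierInv_resolvent {l : ℝ} (hl : 0 < l) (s : ℝ) {F : ℝ → ℂ} (hF : Integrable F) (x : ℝ) :
    𝓕⁻ (fun ξ => ((l : ℂ) + Complex.I * s * ((2 * Real.pi * ξ : ℝ) : ℂ))⁻¹ * F ξ) x
      = ∫ u in Ioi (0 : ℝ), (Real.exp (-(l * u)) : ℂ) * 𝓕⁻ F (x - s * u) := by
  have h1 : ∀ ξ : ℝ, ((l : ℂ) + Complex.I * s * ((2 * Real.pi * ξ : ℝ) : ℂ))⁻¹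
      = ∫ u in Ioi (0 : ℝ), Complex.exp (-((l : ℂ) + Complex.I * s * ((2 * Real.pi * ξ : ℝ) : ℂ)) * u) := by
    intro ξ
    rw [integral_exp_mul_complex_Ioi (by simp [hl])]
    have := resolvent_den_ne_zero hl s (2 * Real.pi * ξ)
    simp only [Complex.ofReal_zero, mul_zero, Complex.exp_zero]
    field_simp
  have hexp : Integrable (fun u : ℝ => Real.exp (-(l * u))) (volume.restrict (Ioi 0)) := by
    have := exp_neg_integrableOn_Ioi 0 hl
    simpa [IntegrableOn] using this
  rw [fourierInv_real_eq]
  simp_rw [fourierInv_real_eq, h1]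
  have e1 : ∀ ξ : ℝ, Complex.exp (2 * Real.pi * ξ * x * Complex.I) *
      ((∫ u in Ioi (0 : ℝ), Complex.exp (-((l : ℂ) + Complex.I * s * ((2 * Real.pi * ξ : ℝ) : ℂ)) * u)) * F ξ)
      = ∫ u in Ioi (0 : ℝ), (Real.exp (-(l * u)) : ℂ) *
        (Complex.exp (2 * Real.pi * ξ * ((x - s * u : ℝ) : ℂ) * Complex.I) * F ξ) := by
    intro ξ
    rw [← integral_mul_const, ← integral_const_mul]
    refine integral_congr_ae (Eventually.of_forall fun u => ?_)
    simp only
    rw [← mul_assoc, ← mul_assoc, ← Complex.exp_add, Complex.ofReal_exp, ← Complex.exp_add]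
    congr 2
    push_cast; ring
  simp_rw [e1, ← integral_const_mul]
  rw [integral_integral_swap]
  have h2 := hF.mul_prod (ν := volume.restrict (Ioi (0:ℝ)))
    (g := fun u => (Real.exp (-(l * u)) : ℂ)) hexp.ofReal
  refine (h2.bdd_mul (c := 1) (f := fun p : ℝ × ℝ => Complex.exp (2 * Real.pi * p.1 * ((x - s * p.2 : ℝ) : ℂ) * Complex.I)) ?_ ?_).congr ?_
  · exact Continuous.aestronglyMeasurable (by fun_prop)
  · refine Eventually.of_forall fun p => ?_
    rw [show (2 * Real.pi * p.1 * ((x - s * p.2 : ℝ) : ℂ) * Complex.I)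
      = ((2 * Real.pi * p.1 * (x - s * p.2) : ℝ) : ℂ) * Complex.I by push_cast; ring,
      Complex.norm_exp_ofReal_mul_I]
  · refine Eventually.of_forall fun p => ?_
    simp only [Function.uncurry]
    ring

/-- The multiplier with symbol `s₀` on the real line acts on `e^{βx} f` with symbol `s₁`. -/
structure Shifts (β : ℝ) (s₀ s₁ : ℝ → ℂ) : Prop where
  sym₀ : ∃ C, IsSymbol s₀ C
  sym₁ : ∃ C, IsSymbol s₁ C
  shift : ∀ F G : ℝ → ℂ, Integrable F → Integrable G →
    (∀ x, 𝓕⁻ G x = (Real.exp (β * x) : ℂ) * 𝓕⁻ F x) →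
    ∀ x, 𝓕⁻ (fun ξ => s₁ ξ * G ξ) x = (Real.exp (β * x) : ℂ) * 𝓕⁻ (fun ξ => s₀ ξ * F ξ) x

/-- The shifting property passes to products, linear combinations and bounded pointwise limits. It
therefore suffices to know it for resolvents of D, and no contour has to be moved. -/
lemma Shifts.mul {β : ℝ} {s₀ s₁ t₀ t₁ : ℝ → ℂ} (hs : Shifts β s₀ s₁) (ht : Shifts β t₀ t₁) :
    Shifts β (fun ξ => s₀ ξ * t₀ ξ) (fun ξ => s₁ ξ * t₁ ξ) := by
  obtain ⟨C, hC⟩ := hs.sym₀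
  obtain ⟨C', hC'⟩ := hs.sym₁
  obtain ⟨D, hD⟩ := ht.sym₀
  obtain ⟨D', hD'⟩ := ht.sym₁
  refine ⟨⟨_, hC.mul hD⟩, ⟨_, hC'.mul hD'⟩, fun F G hF hG h x => ?_⟩
  simp_rw [mul_assoc]
  exact hs.shift _ _ (hD.integrable_mul hF) (hD'.integrable_mul hG) (ht.shift F G hF hG h) x

lemma fourierInv_add_fun {F G : ℝ → ℂ} (hF : Integrable F) (hG : Integrable G) (x : ℝ) :
    𝓕⁻ (fun ξ => F ξ + G ξ) x = 𝓕⁻ F x + 𝓕⁻ G x := by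
  simp only [Real.fourierInv_eq]
  rw [← integral_add]
  · simp
  · simpa [Real.fourierInv_eq] using (Real.fourierIntegral_convergent_iff (-x)).2 hF
  · simpa [Real.fourierInv_eq] using (Real.fourierIntegral_convergent_iff (-x)).2 hG

lemma fourierInv_const_mul (c : ℂ) (F : ℝ → ℂ) (x : ℝ) :
    𝓕⁻ (fun ξ => c * F ξ) x = c * 𝓕⁻ F x := by
  rw [fourierInv_real_eq, fourierInv_real_eq, ← integral_const_mul]
  refine integral_congr_ae (Eventually.of_forall fun ξ => ?_)
  simp only
  ring

lemma Shifts.add {β : ℝ} {s₀ s₁ t₀ t₁ : ℝ → ℂ} (hs : Shifts β s₀ s₁) (ht : Shifts β t₀ t₁) :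
    Shifts β (fun ξ => s₀ ξ + t₀ ξ) (fun ξ => s₁ ξ + t₁ ξ) := by
  obtain ⟨C, hC⟩ := hs.sym₀
  obtain ⟨C', hC'⟩ := hs.sym₁
  obtain ⟨D, hD⟩ := ht.sym₀
  obtain ⟨D', hD'⟩ := ht.sym₁
  refine ⟨⟨_, hC.add hD⟩, ⟨_, hC'.add hD'⟩, fun F G hF hG h x => ?_⟩
  simp_rw [add_mul]
  rw [fourierInv_add_fun (hC'.integrable_mul hG) (hD'.integrable_mul hG),
    fourierInv_add_fun (hC.integrable_mul hF) (hD.integrable_mul hF), hs.shift F G hF hG h,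
    ht.shift F G hF hG h, mul_add]

lemma Shifts.const_mul {β : ℝ} {s₀ s₁ : ℝ → ℂ} (hs : Shifts β s₀ s₁) (c : ℂ) :
    Shifts β (fun ξ => c * s₀ ξ) (fun ξ => c * s₁ ξ) := by
  obtain ⟨C, hC⟩ := hs.sym₀
  obtain ⟨C', hC'⟩ := hs.sym₁
  refine ⟨⟨_, hC.const_mul c⟩, ⟨_, hC'.const_mul c⟩, fun F G hF hG h x => ?_⟩
  simp_rw [mul_assoc]
  rw [fourierInv_const_mul, fourierInv_const_mul, hs.shift F G hF hG h]
  ring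

lemma Shifts.zero (β : ℝ) : Shifts β (fun _ => 0) (fun _ => 0) := by
  have h0 : IsSymbol (fun _ => 0) 0 := ⟨aestronglyMeasurable_const, by simp⟩
  refine ⟨⟨0, h0⟩, ⟨0, h0⟩, fun F G _ _ _ x => ?_⟩
  simp [fourierInv_real_eq]

lemma Shifts.sum {β : ℝ} {s₀ s₁ : ℕ → ℝ → ℂ} (h : ∀ n, Shifts β (s₀ n) (s₁ n)) (N : ℕ) :
    Shifts β (fun ξ => ∑ n ∈ Finset.range N, s₀ n ξ) (fun ξ => ∑ n ∈ Finset.range N, s₁ n ξ) := by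
  induction N with
  | zero => simpa using Shifts.zero β
  | succ N ih => simpa [Finset.sum_range_succ] using ih.add (h N)

lemma tendsto_fourierInv_mul {s : ℕ → ℝ → ℂ} {t F : ℝ → ℂ} {C : ℝ} (hs : ∀ n, IsSymbol (s n) C)
    (hF : Integrable F) (ht : ∀ ξ, Tendsto (fun n => s n ξ) atTop (𝓝 (t ξ))) (x : ℝ) :
    Tendsto (fun n => 𝓕⁻ (fun ξ => s n ξ * F ξ) x) atTop (𝓝 (𝓕⁻ (fun ξ => t ξ * F ξ) x)) := by
  simp_rw [fourierInv_real_eq]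
  refine tendsto_integral_of_dominated_convergence (fun ξ => C * ‖F ξ‖) (fun n => ?_)
    (hF.norm.const_mul C) (fun n => Eventually.of_forall fun ξ => ?_)
    (Eventually.of_forall fun ξ => ?_)
  · exact (Continuous.aestronglyMeasurable (by fun_prop)).mul ((hs n).meas.mul hF.1)
  · rw [norm_mul, norm_mul, show (2 * Real.pi * ξ * x * Complex.I : ℂ)
      = ((2 * Real.pi * ξ * x : ℝ) : ℂ) * Complex.I by push_cast; ring,
      Complex.norm_exp_ofReal_mul_I, one_mul]
    exact mul_le_mul_of_nonneg_right ((hs n).bound ξ) (norm_nonneg _)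
  · exact ((ht ξ).mul_const _).const_mul _

lemma IsSymbol.of_tendsto {s : ℕ → ℝ → ℂ} {t : ℝ → ℂ} {C : ℝ} (hs : ∀ n, IsSymbol (s n) C)
    (ht : ∀ ξ, Tendsto (fun n => s n ξ) atTop (𝓝 (t ξ))) : IsSymbol t C :=
  ⟨aestronglyMeasurable_of_tendsto_ae atTop (fun n => (hs n).meas) (Eventually.of_forall ht),
    fun ξ => le_of_tendsto (ht ξ).norm (Eventually.of_forall fun n => (hs n).bound ξ)⟩

lemma Shifts.of_tendsto {β : ℝ} {s₀ s₁ : ℕ → ℝ → ℂ} {t₀ t₁ : ℝ → ℂ} {C : ℝ}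
    (h : ∀ n, Shifts β (s₀ n) (s₁ n)) (h₀ : ∀ n, IsSymbol (s₀ n) C) (h₁ : ∀ n, IsSymbol (s₁ n) C)
    (ht₀ : ∀ ξ, Tendsto (fun n => s₀ n ξ) atTop (𝓝 (t₀ ξ)))
    (ht₁ : ∀ ξ, Tendsto (fun n => s₁ n ξ) atTop (𝓝 (t₁ ξ))) : Shifts β t₀ t₁ := by
  refine ⟨⟨C, .of_tendsto h₀ ht₀⟩, ⟨C, .of_tendsto h₁ ht₁⟩, fun F G hF hG hFG x => ?_⟩
  refine tendsto_nhds_unique (tendsto_fourierInv_mul h₁ hG ht₁ x) ?_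
  simp_rw [fun n => (h n).shift F G hF hG hFG x]
  exact (tendsto_fourierInv_mul h₀ hF ht₀ x).const_mul _

/-- The symbol `(λ + i s z)⁻¹` on the line `Im = b`. -/
def resSym (l s b ξ : ℝ) : ℂ := ((l : ℂ) + Complex.I * s * lineVar b ξ)⁻¹

lemma resSym_eq (l s b ξ : ℝ) :
    resSym l s b ξ = (((l - s * b : ℝ) : ℂ) + Complex.I * s * ((2 * Real.pi * ξ : ℝ) : ℂ))⁻¹ := by
  rw [resSym, lineVar]
  congr 1
  push_cast
  linear_combination (s : ℂ) * b * Complex.I_sq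

lemma isSymbol_resSym {l s b : ℝ} (h : 0 < l - s * b) : IsSymbol (resSym l s b) (l - s * b)⁻¹ := by
  have hne := resolvent_den_ne_zero h s
  refine ⟨?_, fun ξ => ?_⟩
  · have : resSym l s b
        = fun ξ => (((l - s * b : ℝ) : ℂ) + Complex.I * s * ((2 * Real.pi * ξ : ℝ) : ℂ))⁻¹ :=
      funext (resSym_eq l s b)
    rw [this]
    refine Continuous.aestronglyMeasurable ?_
    exact Continuous.inv₀ (by fun_prop) fun ξ => hne _
  · rw [resSym_eq, norm_inv]
    refine inv_anti₀ h ?_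
    refine le_trans ?_ (Complex.re_le_norm _)
    simp

/-- The resolvent is a Laplace average of the translates f(x - su), and e^{bx}f(x-su) =
e^{sbu}(e^{b·}f)(x-su). Conjugation by the weight just replaces λ by λ - sb. -/
lemma shifts_resSym {l s b : ℝ} (hl : 0 < l) (h : 0 < l - s * b) :
    Shifts b (resSym l s 0) (resSym l s b) := by
  refine ⟨⟨_, isSymbol_resSym (by simpa using hl)⟩, ⟨_, isSymbol_resSym h⟩, fun F G hF hG hFG x => ?_⟩
  have e0 : ∀ ξ, resSym l s 0 ξ = ((l : ℂ) + Complex.I * s * ((2 * Real.pi * ξ : ℝ) : ℂ))⁻¹ := by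
    intro ξ; rw [resSym_eq]; simp
  simp_rw [resSym_eq l s b, e0]
  rw [fourierInv_resolvent h s hG, fourierInv_resolvent hl s hF, ← integral_const_mul]
  refine integral_congr_ae (Eventually.of_forall fun u => ?_)
  simp only
  rw [hFG, ← mul_assoc, ← mul_assoc, ← Complex.ofReal_mul, ← Complex.ofReal_mul, ← Real.exp_add,
    ← Real.exp_add]
  congr 3
  ring

lemma one_div_sq_add_eq (l : ℝ) (z : ℂ) :
    1 / (z ^ 2 + (l : ℂ) ^ 2)
      = ((l : ℂ) + Complex.I * (1 : ℝ) * z)⁻¹ * ((l : ℂ) + Complex.I * (-1 : ℝ) * z)⁻¹ := by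
  rw [← mul_inv, one_div]
  congr 1
  push_cast
  linear_combination (z ^ 2) * Complex.I_sq

lemma sq_add_sq_ne_zero {l b : ℝ} (h : |b| < l) (ξ : ℝ) : lineVar b ξ ^ 2 + (l : ℂ) ^ 2 ≠ 0 := by
  intro h0
  have := congrArg Complex.re h0
  rw [Complex.add_re, lineVar_sq_re, ← Complex.ofReal_pow, Complex.ofReal_re, Complex.zero_re] at this
  have hb : b ^ 2 < l ^ 2 := by rw [← sq_abs b]; exact pow_lt_pow_left₀ h (abs_nonneg _) two_ne_zero
  nlinarith [sq_nonneg (2 * Real.pi * ξ)]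

lemma shifts_inv_sq {l b : ℝ} (h : |b| < l) :
    Shifts b (fun ξ => 1 / (lineVar 0 ξ ^ 2 + (l : ℂ) ^ 2)) (fun ξ => 1 / (lineVar b ξ ^ 2 + (l : ℂ) ^ 2)) := by
  have hl : 0 < l := (abs_nonneg b).trans_lt h
  have h1 := abs_lt.1 h
  have := (shifts_resSym (s := 1) (b := b) hl (by linarith)).mul
    (shifts_resSym (s := -1) (b := b) hl (by linarith))
  convert this using 2 with ξ ξ
  · exact one_div_sq_add_eq _ _
  · exact one_div_sq_add_eq _ _

lemma shifts_id_div_sq {l b : ℝ} (h : |b| < l) :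
    Shifts b (fun ξ => lineVar 0 ξ / (lineVar 0 ξ ^ 2 + (l : ℂ) ^ 2))
      (fun ξ => lineVar b ξ / (lineVar b ξ ^ 2 + (l : ℂ) ^ 2)) := by
  have hl : 0 < l := (abs_nonneg b).trans_lt h
  have h1 := abs_lt.1 h
  have := ((shifts_resSym (s := 1) (b := b) hl (by linarith)).const_mul (Complex.I / 2)).add
    ((shifts_resSym (s := -1) (b := b) hl (by linarith)).const_mul (-Complex.I / 2))
  have key : ∀ c ξ : ℝ, |c| < l → lineVar c ξ / (lineVar c ξ ^ 2 + (l : ℂ) ^ 2)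
      = Complex.I / 2 * resSym l 1 c ξ + -Complex.I / 2 * resSym l (-1) c ξ := by
    intro c ξ hc
    have h0 := sq_add_sq_ne_zero hc ξ
    set z := lineVar c ξ with hz
    have hm : ((l : ℂ) + Complex.I * (1 : ℝ) * z) * ((l : ℂ) + Complex.I * (-1 : ℝ) * z)
        = z ^ 2 + (l : ℂ) ^ 2 := by
      push_cast; linear_combination (-z ^ 2) * Complex.I_sq
    have ha : ((l : ℂ) + Complex.I * (1 : ℝ) * z) ≠ 0 := left_ne_zero_of_mul (hm ▸ h0)
    have hb : ((l : ℂ) + Complex.I * (-1 : ℝ) * z) ≠ 0 := right_ne_zero_of_mul (hm ▸ h0)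
    rw [resSym, resSym, ← hz, ← hm]
    have hd : Complex.I / 2 * (((l : ℂ) + Complex.I * (-1 : ℝ) * z)
        - ((l : ℂ) + Complex.I * (1 : ℝ) * z)) = z := by
      push_cast; linear_combination (-z) * Complex.I_sq
    rw [div_eq_iff (mul_ne_zero ha hb)]
    nth_rewrite 1 [← hd]
    generalize (l : ℂ) + Complex.I * (-1 : ℝ) * z = B at *
    generalize (l : ℂ) + Complex.I * (1 : ℝ) * z = A at *
    field_simp
    ring
  convert this using 2 with ξ ξ
  · exact key 0 ξ (by simpa using hl)
  · exact key b ξ h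

lemma shifts_kdvSym {b : ℝ} (hb : b ^ 2 < 3) : Shifts b (kdvSym 0) (kdvSym b) := by
  have h : |b| < Real.sqrt 3 := by
    rw [← Real.sqrt_sq_eq_abs]; exact Real.sqrt_lt_sqrt (sq_nonneg _) hb
  have := (shifts_inv_sq h).const_mul 3
  have e : ((Real.sqrt 3 : ℝ) : ℂ) ^ 2 = 3 := by
    rw [← Complex.ofReal_pow, Real.sq_sqrt (by norm_num)]; norm_num
  rw [e] at this
  convert this using 2 with ξ ξ <;> rw [kdvSym, add_comm] <;> ring

lemma lt_lam_div {t b : ℝ} (ht : 0 < t) (h : t ^ 2 * b ^ 2 < 1 / 2) (n : ℕ) : |b| < lam n / t := by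
  rw [lt_div_iff₀ ht]
  have h1 := lam_sq_ge n
  have : (|b| * t) ^ 2 < lam n ^ 2 := by rw [mul_pow, sq_abs]; nlinarith
  exact lt_of_pow_lt_pow_left₀ 2 (lam_pos n).le this

/-- Each term of the partial fraction expansion is a product of two resolvents whose poles ±iλ_n/t
lie outside the strip between the two lines. The partial sums are bounded by 6 on both lines, so the
limit can be taken. -/
lemma shifts_tSym {t b : ℝ} (ht : 0 < t) (h : t ^ 2 * b ^ 2 < 1 / 2) :
    Shifts b (tSym t 0) (tSym t b) := by
  have hadm : ∀ c : ℝ, t ^ 2 * c ^ 2 < 1 / 2 → (t : ℂ) ∈ admissible c := fun c hc =>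
    ofReal_mem_admissible ht hc
  have htc : (t : ℂ) ≠ 0 := Complex.ofReal_ne_zero.2 ht.ne'
  have hterm : ∀ (c ξ : ℝ) (n : ℕ), 2 / ((t * lineVar c ξ) ^ 2 + (lam n : ℂ) ^ 2)
      = (2 / (t : ℂ) ^ 2) * (1 / (lineVar c ξ ^ 2 + ((lam n / t : ℝ) : ℂ) ^ 2)) := by
    intro c ξ n
    push_cast
    rw [div_mul_div_comm, mul_one]
    congr 1
    field_simp
  have hsum : ∀ n, Shifts b (fun ξ => 2 / ((t * lineVar 0 ξ) ^ 2 + (lam n : ℂ) ^ 2))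
      (fun ξ => 2 / ((t * lineVar b ξ) ^ 2 + (lam n : ℂ) ^ 2)) := by
    intro n
    have := (shifts_inv_sq (lt_lam_div ht h n)).const_mul (2 / (t : ℂ) ^ 2)
    simpa only [hterm] using this
  have hpart : ∀ c : ℝ, t ^ 2 * c ^ 2 < 1 / 2 → ∀ N : ℕ,
      IsSymbol (fun ξ => ∑ n ∈ Finset.range N, 2 / ((t * lineVar c ξ) ^ 2 + (lam n : ℂ) ^ 2)) 6 := by
    intro c hc N
    have hre := fun ξ => (admissible_re_ge_neg_two (hadm c hc) ξ).le
    refine ⟨Continuous.aestronglyMeasurable ?_, fun ξ => ?_⟩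
    · refine continuous_finsetSum _ fun n _ => ?_
      exact continuous_const.div (by fun_prop) fun ξ => add_lam_sq_ne_zero (hre ξ) n
    · refine (norm_sum_le _ _).trans ?_
      refine (Finset.sum_le_sum fun n _ => norm_tau_term_le (hre ξ) n).trans ?_
      refine ((summable_tauR (hre ξ)).sum_le_tsum _ fun n _ => ?_).trans (tauR_le_six (hre ξ))
      exact (div_pos two_pos (add_lam_sq_pos (hre ξ) n)).le
  have hlim : ∀ c : ℝ, t ^ 2 * c ^ 2 < 1 / 2 → ∀ ξ : ℝ,
      Tendsto (fun N => ∑ n ∈ Finset.range N, 2 / ((t * lineVar c ξ) ^ 2 + (lam n : ℂ) ^ 2)) atTop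
        (𝓝 (tSym t c ξ)) := fun c hc ξ =>
    (summable_tau (admissible_re_ge_neg_two (hadm c hc) ξ).le).hasSum.tendsto_sum_nat
  exact Shifts.of_tendsto (Shifts.sum hsum) (hpart 0 (by simp)) (hpart b h) (hlim 0 (by simp)) (hlim b h)

/-- The factor z in i tanh(tz) = itz τ((tz)²) is not a bounded symbol by itself. It is regularized
to l²z/(z²+l²), a combination of resolvents, and l → ∞; the products stay bounded because tanh is
bounded on both lines. -/
lemma shifts_hSym {t b : ℝ} (ht : 0 < t) (h : t ^ 2 * b ^ 2 < 1 / 2) :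
    Shifts b (hSym t 0) (hSym t b) := by
  -- The offset guarantees |b| < l and 2b² ≤ l² from the first index on, so the regularizing poles
  -- are outside the strip and the factor l²/(z²+l²) is bounded by 2.
  obtain ⟨N₀, hN₀⟩ := exists_nat_gt (2 * b ^ 2 + |b| + 1)
  have hb0 := abs_nonneg b
  let l : ℕ → ℝ := fun N => N + N₀
  have hl1 : ∀ N, 2 * b ^ 2 + |b| + 1 < l N := fun N => by
    simp only [l]; linarith [(N.cast_nonneg : (0:ℝ) ≤ N)]
  have hlb : ∀ N, |b| < l N := fun N => by nlinarith [hl1 N, sq_nonneg b]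
  have hl2 : ∀ N, 2 * b ^ 2 ≤ l N ^ 2 := fun N => by nlinarith [hl1 N, sq_nonneg b]
  have hlpos : ∀ N, 0 < l N := fun N => hb0.trans_lt (hlb N)
  have hreg : ∀ c : ℝ, c ^ 2 ≤ b ^ 2 → ∀ (N : ℕ) (ξ : ℝ),
      (l N) ^ 2 / 2 ≤ ‖lineVar c ξ ^ 2 + (l N : ℂ) ^ 2‖ := by
    intro c hc N ξ
    refine le_trans ?_ (Complex.re_le_norm _)
    rw [Complex.add_re, lineVar_sq_re, ← Complex.ofReal_pow, Complex.ofReal_re]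
    nlinarith [hl2 N, sq_nonneg (2 * Real.pi * ξ)]
  let s : ℝ → ℕ → ℝ → ℂ := fun c N ξ =>
    (Complex.I * t * (l N : ℂ) ^ 2) * (lineVar c ξ / (lineVar c ξ ^ 2 + (l N : ℂ) ^ 2)) * tSym t c ξ
  have hs : ∀ N, Shifts b (s 0 N) (s b N) := fun N =>
    ((shifts_id_div_sq (hlb N)).const_mul _).mul (shifts_tSym ht h)
  have hse : ∀ c N ξ, s c N ξ = (l N : ℂ) ^ 2 / (lineVar c ξ ^ 2 + (l N : ℂ) ^ 2) * hSym t c ξ := by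
    intro c N ξ
    simp only [s, tSym, hSym]; ring
  have hsb : ∀ c : ℝ, c ^ 2 ≤ b ^ 2 → ∀ N, IsSymbol (s c N) (2 * 12) := by
    intro c hc N
    have hadm : (t : ℂ) ∈ admissible c := ofReal_mem_admissible ht (by nlinarith [sq_nonneg t])
    have hne : ∀ ξ, lineVar c ξ ^ 2 + (l N : ℂ) ^ 2 ≠ 0 := fun ξ =>
      norm_pos_iff.1 (lt_of_lt_of_le (by have := hlpos N; positivity) (hreg c hc N ξ))
    have e : s c N = fun ξ => (l N : ℂ) ^ 2 / (lineVar c ξ ^ 2 + (l N : ℂ) ^ 2) * hSym t c ξ :=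
      funext (hse c N)
    rw [e]
    refine IsSymbol.mul ⟨Continuous.aestronglyMeasurable ?_, fun ξ => ?_⟩ (isSymbol_hSym hadm)
    · exact continuous_const.div (by fun_prop) hne
    · have hp := hlpos N
      rw [norm_div, norm_pow, Complex.norm_real, Real.norm_of_nonneg hp.le,
        div_le_iff₀ (norm_pos_iff.2 (hne ξ))]
      linarith [hreg c hc N ξ]
  have hlim : ∀ c : ℝ, c ^ 2 ≤ b ^ 2 → ∀ ξ : ℝ,
      Tendsto (fun N => s c N ξ) atTop (𝓝 (hSym t c ξ)) := by
    intro c hc ξ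
    simp_rw [hse]
    have hltop : Tendsto (fun N => (l N : ℂ)⁻¹) atTop (𝓝 0) := by
      have : Tendsto l atTop atTop := tendsto_atTop_add_const_right _ _ tendsto_natCast_atTop_atTop
      have h2 := (Complex.continuous_ofReal.tendsto 0).comp this.inv_tendsto_atTop
      simpa [Function.comp_def] using h2
    have h3 : Tendsto (fun N => 1 / (lineVar c ξ ^ 2 * ((l N : ℂ)⁻¹) ^ 2 + 1) * hSym t c ξ) atTop
        (𝓝 (1 / (lineVar c ξ ^ 2 * 0 ^ 2 + 1) * hSym t c ξ)) :=
      ((tendsto_const_nhds.div ((((hltop.pow 2).const_mul _).add_const 1)) (by simp)).mul_const _)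
    simp only [ne_eq, OfNat.ofNat_ne_zero, not_false_eq_true, zero_pow, mul_zero, zero_add, div_one,
      one_mul] at h3
    refine h3.congr fun N => ?_
    have hl : (l N : ℂ) ≠ 0 := Complex.ofReal_ne_zero.2 (hlpos N).ne'
    congr 1
    field_simp
  exact Shifts.of_tendsto hs (hsb 0 (by simpa using sq_nonneg b)) (hsb b le_rfl)
    (hlim 0 (by simpa using sq_nonneg b)) (hlim b le_rfl)

/-! ### Parity and reality on the Fourier side -/

lemma fourierInv_comp_neg (F : ℝ → ℂ) (x : ℝ) : 𝓕⁻ (fun ξ => F (-ξ)) x = 𝓕⁻ F (-x) := by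
  rw [fourierInv_real_eq, fourierInv_real_eq,
    ← integral_neg_eq_self (fun ξ : ℝ => Complex.exp (2 * Real.pi * ξ * ((-x : ℝ) : ℂ) * Complex.I) * F ξ)]
  refine integral_congr_ae (Eventually.of_forall fun ξ => ?_)
  simp only
  congr 2
  push_cast; ring

lemma star_fourierInv (F : ℝ → ℂ) (x : ℝ) :
    starRingEnd ℂ (𝓕⁻ F x) = 𝓕⁻ (fun ξ => starRingEnd ℂ (F (-ξ))) x := by
  rw [fourierInv_comp_neg (fun ξ => starRingEnd ℂ (F ξ)), fourierInv_real_eq, fourierInv_real_eq,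
    ← integral_conj]
  refine integral_congr_ae (Eventually.of_forall fun ξ => ?_)
  simp only [map_mul, ← Complex.exp_conj]
  congr 2
  simp [Complex.conj_ofNat]

section Parity
variable {F : ℝ → ℂ} (h1 : Integrable F) (h2 : MemLp F 2)
include h1 h2

lemma ae_even_of_fourierInv (h : ∀ x, 𝓕⁻ F (-x) = 𝓕⁻ F x) : (fun ξ => F (-ξ)) =ᵐ[volume] F := by
  refine ae_eq_of_fourierInv_ae_eq h1.comp_neg
    (h2.comp_measurePreserving (Measure.measurePreserving_neg volume)) h1 h2
    (Eventually.of_forall fun x => ?_)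
  rw [fourierInv_comp_neg, h]

lemma ae_star_of_fourierInv (h : ∀ x, (𝓕⁻ F x).im = 0) :
    (fun ξ => starRingEnd ℂ (F (-ξ))) =ᵐ[volume] F := by
  refine ae_eq_of_fourierInv_ae_eq ?_ ?_ h1 h2 (Eventually.of_forall fun x => ?_)
  · exact (Complex.conjLIE.integrable_comp_iff).2 h1.comp_neg
  · exact (h2.comp_measurePreserving (Measure.measurePreserving_neg volume)).star
  · rw [← star_fourierInv, Complex.conj_eq_iff_im.2 (h x)]

/-- The constant c allows for both parities: c = 1 for tanh(dD)/(dD) and (1+D²/3)⁻¹, c = -1 for i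
tanh(dD). -/
lemma fourierInv_mul_even {s : ℝ → ℂ} {c : ℂ} (hs : ∀ ξ, s (-ξ) = c * s ξ)
    (h : ∀ x, 𝓕⁻ F (-x) = 𝓕⁻ F x) (x : ℝ) :
    𝓕⁻ (fun ξ => s ξ * F ξ) (-x) = c * 𝓕⁻ (fun ξ => s ξ * F ξ) x := by
  rw [← fourierInv_comp_neg, ← fourierInv_const_mul]
  refine Real.fourierInv_congr_ae ?_ x
  filter_upwards [ae_even_of_fourierInv h1 h2 h] with ξ hξ
  rw [hs, hξ, mul_assoc]

lemma fourierInv_mul_real {s : ℝ → ℂ} (hs : ∀ ξ, starRingEnd ℂ (s (-ξ)) = s ξ)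
    (h : ∀ x, (𝓕⁻ F x).im = 0) (x : ℝ) : (𝓕⁻ (fun ξ => s ξ * F ξ) x).im = 0 := by
  rw [← Complex.conj_eq_iff_im, star_fourierInv]
  refine Real.fourierInv_congr_ae ?_ x
  filter_upwards [ae_star_of_fourierInv h1 h2 h] with ξ hξ
  rw [map_mul, hs, hξ]

end Parity

lemma tauR_ofReal (w : ℝ) : tau w = (tauR w : ℂ) := by
  simp [tau, tauR, Complex.ofReal_tsum]

lemma lineVar_zero_neg (ξ : ℝ) : lineVar 0 (-ξ) = -lineVar 0 ξ := by simp [lineVar]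

lemma tSym_zero (t ξ : ℝ) : tSym t 0 ξ = (tauR ((t * (2 * Real.pi * ξ)) ^ 2) : ℂ) := by
  rw [tSym, ← tauR_ofReal]; simp [lineVar]

lemma tSym_neg (d : ℂ) (ξ : ℝ) : tSym d 0 (-ξ) = tSym d 0 ξ := by
  rw [tSym, tSym, lineVar_zero_neg]; congr 1; ring

lemma tSym_star (t ξ : ℝ) : starRingEnd ℂ (tSym t 0 (-ξ)) = tSym t 0 ξ := by
  rw [tSym_neg, tSym_zero, Complex.conj_ofReal]

lemma hSym_eq (d : ℂ) (b ξ : ℝ) : hSym d b ξ = Complex.I * (d * lineVar b ξ * tSym d b ξ) := rfl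

lemma hSym_neg (d : ℂ) (ξ : ℝ) : hSym d 0 (-ξ) = -1 * hSym d 0 ξ := by
  rw [hSym_eq, hSym_eq, tSym_neg, lineVar_zero_neg]; ring

lemma hSym_star (t ξ : ℝ) : starRingEnd ℂ (hSym t 0 (-ξ)) = hSym t 0 ξ := by
  rw [hSym_eq, hSym_eq, lineVar_zero_neg, map_mul, map_mul, tSym_star, map_mul, map_neg]
  simp [lineVar, Complex.conj_ofNat]

lemma kdvSym_neg (ξ : ℝ) : kdvSym 0 (-ξ) = kdvSym 0 ξ := by
  rw [kdvSym, kdvSym, lineVar_zero_neg]; congr 2; ring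

lemma kdvSym_star (ξ : ℝ) : starRingEnd ℂ (kdvSym 0 (-ξ)) = kdvSym 0 ξ := by
  rw [kdvSym_neg]
  have : kdvSym 0 ξ = ((3 / (3 + (2 * Real.pi * ξ) ^ 2) : ℝ) : ℂ) := by
    rw [kdvSym]; push_cast; simp [lineVar]
  rw [this, Complex.conj_ofReal]

/-! ### Operators on invariant subspaces -/

section Restrict
variable {S V : Type*} [NormedAddCommGroup S] [NormedSpace ℝ S] [NormedAddCommGroup V]
  [NormedSpace ℝ V] (ι : S →ₗᵢ[ℝ] V)

open Classical in
/-- The restriction of an operator to an invariant subspace (`0` if it is not invariant). -/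
def resOp (A : V →L[ℝ] V) : S →L[ℝ] S :=
  if h : ∀ x, ∃ y, ι y = A (ι x) then
    LinearMap.mkContinuous
      { toFun := fun x => (h x).choose
        map_add' := fun x y => ι.injective ((h (x + y)).choose_spec.trans (by
          simp only [map_add, (h x).choose_spec, (h y).choose_spec]))
        map_smul' := fun c x => ι.injective ((h (c • x)).choose_spec.trans (by
          simp only [map_smul, (h x).choose_spec, RingHom.id_apply])) }
      ‖A‖ fun x => by
        rw [← ι.norm_map, ← ι.norm_map x]
        exact (congrArg norm (h x).choose_spec).le.trans (A.le_opNorm _)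
  else 0

open Classical in
/-- The restriction of a bilinear map to an invariant subspace (`0` if it is not invariant). -/
def resBil (A : V →L[ℝ] V →L[ℝ] V) : S →L[ℝ] S →L[ℝ] S :=
  if h : ∀ x y, ∃ z, ι z = A (ι x) (ι y) then
    LinearMap.mkContinuous₂ (LinearMap.mk₂ ℝ (fun x y : S => (h x y).choose)
      (fun x y z => ι.injective ((h (x + y) z).choose_spec.trans (by
        simp only [map_add, (h x z).choose_spec, (h y z).choose_spec, add_apply])))
      (fun c x y => ι.injective ((h (c • x) y).choose_spec.trans (by
        simp only [map_smul, (h x y).choose_spec, smul_apply])))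
      (fun x y z => ι.injective ((h x (y + z)).choose_spec.trans (by
        simp only [map_add, (h x y).choose_spec, (h x z).choose_spec])))
      (fun c x y => ι.injective ((h x (c • y)).choose_spec.trans (by
        simp only [map_smul, (h x y).choose_spec])))) ‖A‖
      fun x y => by
        rw [← ι.norm_map, ← ι.norm_map x, ← ι.norm_map y]
        exact (congrArg norm (h x y).choose_spec).le.trans (A.le_opNorm₂ _ _)
  else 0

variable {ι}

lemma resOp_coe {A : V →L[ℝ] V} (h : ∀ x, ∃ y, ι y = A (ι x)) (x : S) :
    ι (resOp ι A x) = A (ι x) := by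
  rw [resOp, dif_pos h]; exact (h x).choose_spec

lemma resBil_coe {A : V →L[ℝ] V →L[ℝ] V} (h : ∀ x y, ∃ z, ι z = A (ι x) (ι y)) (x y : S) :
    ι (resBil ι A x y) = A (ι x) (ι y) := by
  rw [resBil, dif_pos h]; exact (h x y).choose_spec

variable [CompleteSpace S]

/-- After composition with the isometric inclusion the restriction is A ∘ ι, which is visibly
smooth. Smoothness then descends, because the inclusion induces an isometry of operator spaces. -/
lemma contDiffAt_resOp {A : ℝ → V →L[ℝ] V} {t : ℝ} (hA : ContDiffAt ℝ ∞ A t)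
    (h : ∀ᶠ s in 𝓝 t, ∀ x, ∃ y, ι y = A s (ι x)) : ContDiffAt ℝ ∞ (fun s => resOp ι (A s)) t := by
  refine contDiffAt_of_linearIsometry_comp (ι.postcomp (E := S) (σ₁₂ := RingHom.id ℝ)) ?_
  refine (hA.clm_comp contDiffAt_const (g := A)
    (f := fun _ => ι.toContinuousLinearMap)).congr_of_eventuallyEq ?_
  filter_upwards [h] with s hs
  ext x
  exact resOp_coe hs x

lemma contDiffAt_resBil {A : ℝ → V →L[ℝ] V →L[ℝ] V} {t : ℝ} (hA : ContDiffAt ℝ ∞ A t)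
    (h : ∀ᶠ s in 𝓝 t, ∀ x y, ∃ z, ι z = A s (ι x) (ι y)) :
    ContDiffAt ℝ ∞ (fun s => resBil ι (A s)) t := by
  refine contDiffAt_of_linearIsometry_comp (V := S →L[ℝ] S →L[ℝ] V)
    ((ι.postcomp (E := S) (σ₁₂ := RingHom.id ℝ)).postcomp (E := S) (σ₁₂ := RingHom.id ℝ)) ?_
  have h2 : ContDiffAt ℝ ∞ (fun s => ((ContinuousLinearMap.compL ℝ S V V).flip
      ι.toContinuousLinearMap).comp ((A s).comp ι.toContinuousLinearMap)) t :=
    contDiffAt_const.clm_comp (hA.clm_comp contDiffAt_const)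
  refine h2.congr_of_eventuallyEq ?_
  filter_upwards [h] with s hs
  ext x y
  exact resBil_coe hs x y

end Restrict

/-! ### The spaces of even real functions in weighted Sobolev spaces -/

/-- Pairs of `L²` functions, standing for `(f, e^{βx} f)`. -/
abbrev L2Pair := L2 × L2

/-- The pairs that represent `(f, e^{βx} f)` with `f` real and even, both components in `H^M`. -/
def evenSpace (M : ℕ) [NeZero M] (β : ℝ) : Submodule ℝ L2Pair where
  carrier := {p | (∀ x, evL M p.2 x = (Real.exp (β * x) : ℂ) * evL M p.1 x) ∧
    (∀ x, evL M p.1 (-x) = evL M p.1 x) ∧ ∀ x, (evL M p.1 x).im = 0}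
  add_mem' := by
    rintro p q ⟨h1, h2, h3⟩ ⟨h1', h2', h3'⟩
    refine ⟨fun x => ?_, fun x => ?_, fun x => ?_⟩
    · simp [h1 x, h1' x, mul_add]
    · simp [h2 x, h2' x]
    · simp [h3 x, h3' x]
  zero_mem' := by simp
  smul_mem' := by
    rintro c p ⟨h1, h2, h3⟩
    have e : ∀ Φ : L2, ∀ x, evL M (c • Φ) x = (c : ℂ) * evL M Φ x := fun Φ x => by
      have : (c • Φ : L2) = (c : ℂ) • Φ := Lp.ext (by
        filter_upwards [Lp.coeFn_smul c Φ, Lp.coeFn_smul (c : ℂ) Φ] with ξ h1 h2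
        rw [h1, h2]; simp)
      rw [this, map_smul]; simp
    refine ⟨fun x => ?_, fun x => ?_, fun x => ?_⟩
    · simp only [Prod.smul_snd, Prod.smul_fst, e, h1 x]; ring
    · simp only [Prod.smul_fst, e, h2 x]
    · simp only [Prod.smul_fst, e, Complex.im_ofReal_mul, h3 x, mul_zero]

lemma isClosed_evenSpace (M : ℕ) [NeZero M] (β : ℝ) : IsClosed (evenSpace M β : Set L2Pair) := by
  have hc1 : ∀ x, Continuous fun p : L2Pair => evL M p.1 x := fun x =>
    (continuous_eval_const (F := BoundedContinuousFunction ℝ ℂ) x).comp ((evL M).continuous.comp continuous_fst)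
  have hc2 : ∀ x, Continuous fun p : L2Pair => evL M p.2 x := fun x =>
    (continuous_eval_const (F := BoundedContinuousFunction ℝ ℂ) x).comp ((evL M).continuous.comp continuous_snd)
  have : (evenSpace M β : Set L2Pair)
      = (⋂ x : ℝ, {p : L2Pair | evL M p.2 x = (Real.exp (β * x) : ℂ) * evL M p.1 x}) ∩
        ((⋂ x : ℝ, {p : L2Pair | evL M p.1 (-x) = evL M p.1 x}) ∩
          ⋂ x : ℝ, {p : L2Pair | (evL M p.1 x).im = 0}) := by
    ext p; simp [evenSpace]
  rw [this]
  refine (isClosed_iInter fun x => isClosed_eq (hc2 x) (continuous_const.mul (hc1 x))).inter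
    ((isClosed_iInter fun x => isClosed_eq (hc1 _) (hc1 x)).inter
      (isClosed_iInter fun x => isClosed_eq (Complex.continuous_im.comp (hc1 x)) continuous_const))

/-- The Banach space of real even functions `f` with `f` and `e^{βx} f` in `H^M`. -/
def EvenFun (M : ℕ) [NeZero M] (β : ℝ) : Type := evenSpace M β

namespace EvenFun
variable {M : ℕ} [NeZero M] {β : ℝ}

instance : NormedAddCommGroup (EvenFun M β) := inferInstanceAs (NormedAddCommGroup (evenSpace M β))
instance : NormedSpace ℝ (EvenFun M β) := inferInstanceAs (NormedSpace ℝ (evenSpace M β))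
instance : CompleteSpace (EvenFun M β) := (isClosed_evenSpace M β).completeSpace_coe

/-- The inclusion into pairs of `L²` functions. -/
def incl : EvenFun M β →ₗᵢ[ℝ] L2Pair := (evenSpace M β).subtypeₗᵢ

lemma incl_mem (p : EvenFun M β) : incl p ∈ evenSpace M β := p.2

lemma exists_incl {p : L2Pair} (hp : p ∈ evenSpace M β) : ∃ q : EvenFun M β, incl q = p :=
  ⟨⟨p, hp⟩, rfl⟩

end EvenFun

/-- The action of a pair of symbols. -/
def pairMul (s₀ s₁ : ℝ → ℂ) : L2Pair →L[ℝ] L2Pair :=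
  ContinuousLinearMap.prodMapL ℝ L2 L2 L2 L2 ((symMul s₀).restrictScalars ℝ, (symMul s₁).restrictScalars ℝ)

lemma pairMul_fst (s₀ s₁ : ℝ → ℂ) (p : L2Pair) : (pairMul s₀ s₁ p).1 = symMul s₀ p.1 := rfl
lemma pairMul_snd (s₀ s₁ : ℝ → ℂ) (p : L2Pair) : (pairMul s₀ s₁ p).2 = symMul s₁ p.2 := rfl

lemma norm_pairMul_le {s₀ s₁ : ℝ → ℂ} {C : ℝ} (h₀ : IsSymbol s₀ C) (h₁ : IsSymbol s₁ C) :
    ‖pairMul s₀ s₁‖ ≤ C := by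
  refine ContinuousLinearMap.opNorm_le_bound _ h₀.nonneg fun p => ?_
  rw [Prod.norm_def, pairMul_fst, pairMul_snd]
  refine max_le ?_ ?_
  · exact ((symMul s₀).le_of_opNorm_le (norm_symMul_le h₀) _).trans
      (mul_le_mul_of_nonneg_left (norm_fst_le p) h₀.nonneg)
  · exact ((symMul s₁).le_of_opNorm_le (norm_symMul_le h₁) _).trans
      (mul_le_mul_of_nonneg_left (norm_snd_le p) h₀.nonneg)

lemma contDiffAt_pairMul {s₀ s₁ : ℝ → ℝ → ℂ} {t : ℝ}
    (h₀ : ContDiffAt ℝ ∞ (fun d => symMul (s₀ d)) t) (h₁ : ContDiffAt ℝ ∞ (fun d => symMul (s₁ d)) t) :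
    ContDiffAt ℝ ∞ (fun d => pairMul (s₀ d) (s₁ d)) t := by
  refine (ContinuousLinearMap.prodMapL ℝ L2 L2 L2 L2).contDiff.contDiffAt.comp t ?_
  have hr := (ContinuousLinearMap.restrictScalarsL ℂ L2 L2 ℝ ℝ).contDiff (n := ∞)
  exact (hr.contDiffAt.comp t h₀).prodMk (hr.contDiffAt.comp t h₁)

/-- The product `(f, e^{βx} f) (g, e^{βx} g) = (f g, e^{βx} f g)`. -/
def mulPair (M : ℕ) [NeZero M] : L2Pair →L[ℝ] L2Pair →L[ℝ] L2Pair :=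
  (ContinuousLinearMap.compL ℝ L2Pair L2 L2Pair (.inl ℝ L2 L2)).comp
      (((mulL M).bilinearRestrictScalars ℝ).bilinearComp (.fst ℝ L2 L2) (.fst ℝ L2 L2))
    + (ContinuousLinearMap.compL ℝ L2Pair L2 L2Pair (.inr ℝ L2 L2)).comp
      (((mulL M).bilinearRestrictScalars ℝ).bilinearComp (.snd ℝ L2 L2) (.fst ℝ L2 L2))

lemma mulPair_fst (M : ℕ) [NeZero M] (p q : L2Pair) : (mulPair M p q).1 = mulL M p.1 q.1 := by
  simp [mulPair]
-- Only one factor carries the weight, so the unweighted component of the other is needed to form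
-- the product.
lemma mulPair_snd (M : ℕ) [NeZero M] (p q : L2Pair) : (mulPair M p q).2 = mulL M p.2 q.1 := by
  simp [mulPair]

/-- `(p, q) ↦ (A p) (A q)`. -/
def sqPair (M : ℕ) [NeZero M] (A : L2Pair →L[ℝ] L2Pair) : L2Pair →L[ℝ] L2Pair →L[ℝ] L2Pair :=
  ((ContinuousLinearMap.compL ℝ L2Pair L2Pair L2Pair).flip A).comp ((mulPair M).comp A)

lemma sqPair_apply (M : ℕ) [NeZero M] (A : L2Pair →L[ℝ] L2Pair) (p q : L2Pair) :
    sqPair M A p q = mulPair M (A p) (A q) := rfl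

lemma contDiffAt_sqPair (M : ℕ) [NeZero M] {A : ℝ → L2Pair →L[ℝ] L2Pair} {t : ℝ}
    (hA : ContDiffAt ℝ ∞ A t) : ContDiffAt ℝ ∞ (fun d => sqPair M (A d)) t := by
  refine ContDiffAt.clm_comp ?_ (contDiffAt_const.clm_comp hA)
  exact ContDiffAt.clm_apply (F := L2Pair →L[ℝ] L2Pair)
    (G := (L2Pair →L[ℝ] L2Pair) →L[ℝ] L2Pair →L[ℝ] L2Pair) contDiffAt_const hA

/-! ### Invariance of the even space, and the operators restricted to it -/

section Invariance
variable {M : ℕ} [NeZero M] {β : ℝ}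

lemma pairMul_shift {s₀ s₁ : ℝ → ℂ} (h : Shifts β s₀ s₁) {p : L2Pair} (hp : p ∈ evenSpace M β)
    (x : ℝ) : evL M (pairMul s₀ s₁ p).2 x = (Real.exp (β * x) : ℂ) * evL M (pairMul s₀ s₁ p).1 x := by
  obtain ⟨C, hC⟩ := h.sym₀
  obtain ⟨D, hD⟩ := h.sym₁
  rw [pairMul_fst, pairMul_snd, evL_symMul hC, evL_symMul hD]
  refine h.shift _ _ (integrable_ampl M _) (integrable_ampl M _) (fun y => ?_) x
  rw [← evL_apply, ← evL_apply]
  exact hp.1 y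

lemma pairMul_parity {s₀ s₁ : ℝ → ℂ} {C : ℝ} (h : IsSymbol s₀ C) {c : ℂ}
    (hs : ∀ ξ, s₀ (-ξ) = c * s₀ ξ) {p : L2Pair} (hp : p ∈ evenSpace M β) (x : ℝ) :
    evL M (pairMul s₀ s₁ p).1 (-x) = c * evL M (pairMul s₀ s₁ p).1 x := by
  rw [pairMul_fst, evL_symMul h, evL_symMul h]
  refine fourierInv_mul_even (integrable_ampl M _) (memLp_ampl M _) hs (fun y => ?_) x
  rw [← evL_apply, ← evL_apply]
  exact hp.2.1 y

lemma pairMul_real {s₀ s₁ : ℝ → ℂ} {C : ℝ} (h : IsSymbol s₀ C)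
    (hs : ∀ ξ, starRingEnd ℂ (s₀ (-ξ)) = s₀ ξ) {p : L2Pair} (hp : p ∈ evenSpace M β) (x : ℝ) :
    (evL M (pairMul s₀ s₁ p).1 x).im = 0 := by
  rw [pairMul_fst, evL_symMul h]
  refine fourierInv_mul_real (integrable_ampl M _) (memLp_ampl M _) hs (fun y => ?_) x
  rw [← evL_apply]
  exact hp.2.2 y

lemma pairMul_mem {s₀ s₁ : ℝ → ℂ} (h : Shifts β s₀ s₁) (he : ∀ ξ, s₀ (-ξ) = s₀ ξ)
    (hr : ∀ ξ, starRingEnd ℂ (s₀ (-ξ)) = s₀ ξ) :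
    ∀ p ∈ evenSpace M β, pairMul s₀ s₁ p ∈ evenSpace M β := by
  intro p hp
  obtain ⟨C, hC⟩ := h.sym₀
  refine ⟨pairMul_shift h hp, fun x => ?_, pairMul_real hC hr hp⟩
  simpa using pairMul_parity (s₁ := s₁) (c := 1) hC (by simpa using he) hp x

lemma mulPair_mem : ∀ p ∈ evenSpace M β, ∀ q ∈ evenSpace M β, mulPair M p q ∈ evenSpace M β := by
  intro p hp q hq
  refine ⟨fun x => ?_, fun x => ?_, fun x => ?_⟩
  · rw [mulPair_fst, mulPair_snd, evL_mulL, evL_mulL, hp.1 x, mul_assoc]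
  · rw [mulPair_fst, evL_mulL, evL_mulL, hp.2.1, hq.2.1]
  · rw [mulPair_fst, evL_mulL, Complex.mul_im, hp.2.2, hq.2.2]; simp

/-- An odd symbol takes even functions to odd ones and so does not act on the even space. A product
of two such images is even again, which is why i tanh(dD) is kept only inside a bilinear map. -/
lemma sqPair_mem {s₀ s₁ : ℝ → ℂ} (h : Shifts β s₀ s₁) (ho : ∀ ξ, s₀ (-ξ) = -1 * s₀ ξ)
    (hr : ∀ ξ, starRingEnd ℂ (s₀ (-ξ)) = s₀ ξ) :
    ∀ p ∈ evenSpace M β, ∀ q ∈ evenSpace M β, sqPair M (pairMul s₀ s₁) p q ∈ evenSpace M β := by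
  intro p hp q hq
  obtain ⟨C, hC⟩ := h.sym₀
  rw [sqPair_apply]
  refine ⟨fun x => ?_, fun x => ?_, fun x => ?_⟩
  · rw [mulPair_fst, mulPair_snd, evL_mulL, evL_mulL, pairMul_shift h hp, mul_assoc]
  · rw [mulPair_fst, evL_mulL, evL_mulL, pairMul_parity hC ho hp, pairMul_parity hC ho hq]; ring
  · rw [mulPair_fst, evL_mulL, Complex.mul_im, pairMul_real hC hr hp, pairMul_real hC hr hq]; simp

lemma exists_op {A : L2Pair →L[ℝ] L2Pair} (h : ∀ p ∈ evenSpace M β, A p ∈ evenSpace M β)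
    (x : EvenFun M β) : ∃ y : EvenFun M β, EvenFun.incl y = A (EvenFun.incl x) :=
  EvenFun.exists_incl (h _ x.incl_mem)

lemma exists_bil {A : L2Pair →L[ℝ] L2Pair →L[ℝ] L2Pair}
    (h : ∀ p ∈ evenSpace M β, ∀ q ∈ evenSpace M β, A p q ∈ evenSpace M β)
    (x y : EvenFun M β) : ∃ z : EvenFun M β, EvenFun.incl z = A (EvenFun.incl x) (EvenFun.incl y) :=
  EvenFun.exists_incl (h _ x.incl_mem _ y.incl_mem)

variable (M β)

/-- The operator `tanh(dD) / (dD)`. -/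
def opT (d : ℝ) : EvenFun M β →L[ℝ] EvenFun M β :=
  resOp EvenFun.incl (pairMul (tSym d 0) (tSym d β))

/-- The bilinear map `(i tanh(dD) f) (i tanh(dD) g)`. -/
def opQ (d : ℝ) : EvenFun M β →L[ℝ] EvenFun M β →L[ℝ] EvenFun M β :=
  resBil EvenFun.incl (sqPair M (pairMul (hSym d 0) (hSym d β)))

/-- The operator `(1 + D²/3)⁻¹`. -/
def opB₀ : EvenFun M β →L[ℝ] EvenFun M β := resOp EvenFun.incl (pairMul (kdvSym 0) (kdvSym β))

/-- The product of functions. -/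
def opM : EvenFun M β →L[ℝ] EvenFun M β →L[ℝ] EvenFun M β := resBil EvenFun.incl (mulPair M)

variable {M β}

lemma opM_coe (p q : EvenFun M β) : EvenFun.incl (opM M β p q) = mulPair M (EvenFun.incl p) (EvenFun.incl q) :=
  resBil_coe (exists_bil mulPair_mem) p q

lemma opB₀_coe (hβ : β ^ 2 < 3) (p : EvenFun M β) :
    EvenFun.incl (opB₀ M β p) = pairMul (kdvSym 0) (kdvSym β) (EvenFun.incl p) :=
  resOp_coe (exists_op <| pairMul_mem (shifts_kdvSym hβ) kdvSym_neg kdvSym_star) p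

lemma opT_coe {d : ℝ} (hd : 0 < d) (h : d ^ 2 * β ^ 2 < 1 / 2) (p : EvenFun M β) :
    EvenFun.incl (opT M β d p) = pairMul (tSym d 0) (tSym d β) (EvenFun.incl p) :=
  resOp_coe (exists_op <| pairMul_mem (shifts_tSym hd h) (tSym_neg d) (tSym_star d)) p

lemma opQ_coe {d : ℝ} (hd : 0 < d) (h : d ^ 2 * β ^ 2 < 1 / 2) (p q : EvenFun M β) :
    EvenFun.incl (opQ M β d p q)
      = mulPair M (pairMul (hSym d 0) (hSym d β) (EvenFun.incl p)) (pairMul (hSym d 0) (hSym d β) (EvenFun.incl q)) :=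
  resBil_coe (exists_bil <| sqPair_mem (shifts_hSym hd h) (hSym_neg d) (hSym_star d)) p q

lemma eventually_small {d : ℝ} (hd : 0 < d) (h : d ^ 2 * β ^ 2 < 1 / 2) :
    ∀ᶠ t in 𝓝 d, 0 < t ∧ t ^ 2 * β ^ 2 < 1 / 2 :=
  (lt_mem_nhds hd).and
    ((((continuous_id.pow 2).mul continuous_const).tendsto d).eventually (gt_mem_nhds h))

lemma contDiffAt_opT {d : ℝ} (hd : 0 < d) (h : d ^ 2 * β ^ 2 < 1 / 2) :
    ContDiffAt ℝ ∞ (opT M β) d := by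
  refine contDiffAt_resOp (contDiffAt_pairMul (contDiffAt_symMul_tSym ?_) (contDiffAt_symMul_tSym ?_)) ?_
  · exact ofReal_mem_admissible hd (by simp)
  · exact ofReal_mem_admissible hd h
  · filter_upwards [eventually_small hd h] with t ht
    exact exists_op <| pairMul_mem (shifts_tSym ht.1 ht.2) (tSym_neg t) (tSym_star t)

lemma contDiffAt_opQ {d : ℝ} (hd : 0 < d) (h : d ^ 2 * β ^ 2 < 1 / 2) :
    ContDiffAt ℝ ∞ (opQ M β) d := by
  refine contDiffAt_resBil (contDiffAt_sqPair M
    (contDiffAt_pairMul (contDiffAt_symMul_hSym ?_) (contDiffAt_symMul_hSym ?_))) ?_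
  · exact ofReal_mem_admissible hd (by simp)
  · exact ofReal_mem_admissible hd h
  · filter_upwards [eventually_small hd h] with t ht
    exact exists_bil <| sqPair_mem (shifts_hSym ht.1 ht.2) (hSym_neg t) (hSym_star t)

end Invariance

/-! ### Elements of `EvenFun` as functions -/

namespace EvenFun
variable {M : ℕ} [NeZero M] {β : ℝ}

/-- The function represented by an element of `EvenFun`. -/
def val (p : EvenFun M β) (x : ℝ) : ℝ := (evL M (incl p).1 x).re

lemma evL_fst (p : EvenFun M β) (x : ℝ) : evL M (incl p).1 x = (p.val x : ℂ) :=
  Complex.ext rfl (p.incl_mem.2.2 x)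

lemma evL_snd (p : EvenFun M β) (x : ℝ) : evL M (incl p).2 x = ((Real.exp (β * x) * p.val x : ℝ) : ℂ) := by
  rw [p.incl_mem.1 x, evL_fst]; push_cast; rfl

lemma fourierInv_ampl (p : EvenFun M β) (x : ℝ) : 𝓕⁻ (ampl M (incl p).1) x = (p.val x : ℂ) := by
  rw [← evL_apply, evL_fst]

lemma val_neg (p : EvenFun M β) (x : ℝ) : p.val (-x) = p.val x := by
  rw [val, p.incl_mem.2.1 x]; rfl

lemma continuous_val (p : EvenFun M β) : Continuous p.val :=
  Complex.continuous_re.comp (evL M (incl p).1).continuous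

lemma norm_fst_incl_le (p : EvenFun M β) : ‖(incl p).1‖ ≤ ‖p‖ :=
  (norm_fst_le _).trans (incl.norm_map p).le

lemma norm_snd_incl_le (p : EvenFun M β) : ‖(incl p).2‖ ≤ ‖p‖ :=
  (norm_snd_le _).trans (incl.norm_map p).le

lemma abs_val_le (p : EvenFun M β) (x : ℝ) : |p.val x| ≤ ‖evL M‖ * ‖p‖ := by
  have := norm_evL_apply_le M (incl p).1 x
  rw [evL_fst, Complex.norm_real, Real.norm_eq_abs] at this
  exact this.trans (mul_le_mul_of_nonneg_left p.norm_fst_incl_le (norm_nonneg _))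

lemma abs_exp_mul_val_le (p : EvenFun M β) (x : ℝ) :
    |Real.exp (β * x) * p.val x| ≤ ‖evL M‖ * ‖p‖ := by
  have := norm_evL_apply_le M (incl p).2 x
  rw [evL_snd, Complex.norm_real, Real.norm_eq_abs] at this
  exact this.trans (mul_le_mul_of_nonneg_left p.norm_snd_incl_le (norm_nonneg _))

lemma val_add (p q : EvenFun M β) (x : ℝ) : (p + q).val x = p.val x + q.val x := by
  simp [val]

lemma val_sub (p q : EvenFun M β) (x : ℝ) : (p - q).val x = p.val x - q.val x := by
  simp [val]

lemma val_smul (c : ℝ) (p : EvenFun M β) (x : ℝ) : (c • p).val x = c * p.val x := by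
  have : (c • (incl p).1 : L2) = (c : ℂ) • (incl p).1 := Lp.ext (by
    filter_upwards [Lp.coeFn_smul c (incl p).1, Lp.coeFn_smul (c : ℂ) (incl p).1] with ξ h1 h2
    rw [h1, h2]; simp)
  rw [val, map_smul, Prod.smul_fst, this, map_smul]
  simp [val]

lemma val_zero (x : ℝ) : (0 : EvenFun M β).val x = 0 := by simp [val]

lemma ext_val {p q : EvenFun M β} (h : ∀ x, p.val x = q.val x) : p = q := by
  refine incl.injective (Prod.ext ?_ ?_)
  · refine evL_injective M (DFunLike.ext _ _ fun x => ?_)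
    rw [evL_fst, evL_fst, h]
  · refine evL_injective M (DFunLike.ext _ _ fun x => ?_)
    rw [evL_snd, evL_snd, h]

lemma exists_val {f : ℝ → ℝ} (hf : ∀ x, f (-x) = f x) {Φ Ψ : L2} (hΦ : ∀ x, evL M Φ x = (f x : ℂ))
    (hΨ : ∀ x, evL M Ψ x = ((Real.exp (β * x) * f x : ℝ) : ℂ)) :
    ∃ p : EvenFun M β, incl p = (Φ, Ψ) ∧ ∀ x, p.val x = f x := by
  obtain ⟨p, hp⟩ := exists_incl (M := M) (β := β) (p := (Φ, Ψ))
    ⟨fun x => by simp only [hΦ, hΨ]; push_cast; rfl, fun x => by simp only [hΦ, hf],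
      fun x => by simp only [hΦ, Complex.ofReal_im]⟩
  exact ⟨p, hp, fun x => by rw [val, hp]; simp only [hΦ, Complex.ofReal_re]⟩

lemma val_opM (p q : EvenFun M β) (x : ℝ) : (opM M β p q).val x = p.val x * q.val x := by
  have := evL_fst (opM M β p q) x
  rw [opM_coe, mulPair_fst, evL_mulL, evL_fst, evL_fst] at this
  exact_mod_cast this.symm

lemma evL_opB₀ (hβ : β ^ 2 < 3) (p : EvenFun M β) (x : ℝ) :
    ((opB₀ M β p).val x : ℂ) = 𝓕⁻ (fun ξ => kdvSym 0 ξ * ampl M (incl p).1 ξ) x := by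
  rw [← evL_fst, opB₀_coe hβ, pairMul_fst, evL_symMul (isSymbol_kdvSym (by norm_num))]

lemma ampl_ae_eq {N : ℕ} [NeZero N] {b : ℝ} {p : EvenFun M β} {q : EvenFun N b}
    (h : ∀ x, p.val x = q.val x) : ampl M (incl p).1 =ᵐ[volume] ampl N (incl q).1 := by
  refine ae_eq_of_fourierInv_ae_eq (integrable_ampl M _) (memLp_ampl M _) (integrable_ampl N _)
    (memLp_ampl N _) (Eventually.of_forall fun x => ?_)
  rw [fourierInv_ampl, fourierInv_ampl, h]

/-- The operator depends only on the function and not on the space it is regarded in. This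
consistency is what makes bootstrapping of regularity possible. -/
lemma val_opB₀_eq {N : ℕ} [NeZero N] {b : ℝ} (hβ : β ^ 2 < 3) (hb : b ^ 2 < 3) {p : EvenFun M β}
    {q : EvenFun N b} (h : ∀ x, p.val x = q.val x) (x : ℝ) :
    (opB₀ M β p).val x = (opB₀ N b q).val x := by
  have h2 : ((opB₀ M β p).val x : ℂ) = (opB₀ N b q).val x := by
    rw [evL_opB₀ hβ, evL_opB₀ hb]
    refine Real.fourierInv_congr_ae ?_ x
    filter_upwards [ampl_ae_eq h] with ξ hξ
    rw [hξ]
  exact_mod_cast h2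

end EvenFun

/-! ### Derivatives and Fourier transform -/

lemma hasDerivAt_fourierInv {F : ℝ → ℂ} (h : Integrable F)
    (h' : Integrable fun ξ : ℝ => (2 * Real.pi * Complex.I * ξ) * F ξ) (x : ℝ) :
    HasDerivAt (𝓕⁻ F) (𝓕⁻ (fun ξ : ℝ => (2 * Real.pi * Complex.I * ξ) * F ξ) x) x := by
  have e : 𝓕⁻ F = fun y => 𝓕 F (-y) := funext fun y => Real.fourierInv_eq_fourier_neg F y
  have hint : Integrable fun ξ : ℝ => ξ • F ξ := by
    refine (h'.const_mul (2 * Real.pi * Complex.I)⁻¹).congr (Eventually.of_forall fun ξ => ?_)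
    have : (2 * Real.pi * Complex.I : ℂ) ≠ 0 := by simp [Real.pi_ne_zero]
    simp only [Complex.real_smul]
    field_simp
  have h1 := (Real.hasDerivAt_fourier h hint (-x)).scomp x (hasDerivAt_neg x)
  rw [e]
  refine HasDerivAt.congr_deriv (f := fun y => 𝓕 F (-y)) h1 ?_
  rw [Real.fourierInv_eq_fourier_neg, neg_one_smul, ← neg_one_mul, ← Real.fourierInv_eq_fourier_neg,
    ← Real.fourierInv_eq_fourier_neg, ← fourierInv_const_mul]
  refine Real.fourierInv_congr_ae (Eventually.of_forall fun ξ => ?_) x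
  simp only [smul_eq_mul]
  ring

/-- `(1 + D²/3)⁻¹ h` solves `u'' = 3 u - 3 h`. -/
lemma EvenFun.hasDerivAt_opB₀ {M : ℕ} [NeZero M] {β : ℝ} (hβ : β ^ 2 < 3) (p : EvenFun M β) :
    ∃ u' : ℝ → ℝ, (∀ x, HasDerivAt (opB₀ M β p).val (u' x) x) ∧
      (∀ x, HasDerivAt u' (3 * (opB₀ M β p).val x - 3 * p.val x) x) ∧ ∃ K, ∀ x, |u' x| ≤ K := by
  set G := ampl M (incl p).1 with hG
  have hGi : Integrable G := integrable_ampl M _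
  have hk0 : IsSymbol (kdvSym 0) (9 / (3 - 0 ^ 2)) := isSymbol_kdvSym (by norm_num)
  have hne : ∀ ξ : ℝ, (3 + (2 * Real.pi * ξ) ^ 2 : ℂ) ≠ 0 := fun ξ => by
    exact_mod_cast (by positivity : (3 + (2 * Real.pi * ξ) ^ 2 : ℝ) ≠ 0)
  have hkd : ∀ ξ, kdvSym 0 ξ = 3 / (3 + (2 * Real.pi * ξ : ℂ) ^ 2) := fun ξ => by
    rw [kdvSym, lineVar_zero]; push_cast; rfl
  -- The algebraic identity -k²·3/(3+k²) = 3·3/(3+k²) - 3, which is the ODE on the Fourier side.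
  have e2 : ∀ ξ : ℝ, (2 * Real.pi * Complex.I * ξ) * ((2 * Real.pi * Complex.I * ξ) * (kdvSym 0 ξ * G ξ))
      = 3 * (kdvSym 0 ξ * G ξ) + -3 * G ξ := by
    intro ξ
    have hk : kdvSym 0 ξ * (3 + (2 * Real.pi * ξ : ℂ) ^ 2) = 3 := by
      rw [hkd, div_mul_cancel₀ _ (hne ξ)]
    linear_combination (-(G ξ)) * hk + (4 * Real.pi ^ 2 * ξ ^ 2 * kdvSym 0 ξ * G ξ) * Complex.I_sq
  have i0 : Integrable fun ξ => kdvSym 0 ξ * G ξ := hk0.integrable_mul hGi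
  have hs1 : IsSymbol (fun ξ : ℝ => (2 * Real.pi * Complex.I * ξ) * kdvSym 0 ξ) 3 := by
    refine ⟨(Continuous.aestronglyMeasurable (by fun_prop)).mul hk0.meas, fun ξ => ?_⟩
    have e : (2 * Real.pi * Complex.I * ξ) * kdvSym 0 ξ
        = Complex.I * ((2 * Real.pi * ξ * (3 / (3 + (2 * Real.pi * ξ) ^ 2)) : ℝ) : ℂ) := by
      rw [hkd]; push_cast; ring
    rw [e, norm_mul, Complex.norm_I, one_mul, Complex.norm_real, Real.norm_eq_abs, abs_mul, abs_div,
      abs_of_pos (by positivity : (0:ℝ) < 3 + (2 * Real.pi * ξ) ^ 2), ← mul_div_assoc,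
      div_le_iff₀ (by positivity)]
    rw [abs_of_pos (by norm_num : (0:ℝ) < 3)]
    nlinarith [sq_abs (2 * Real.pi * ξ), sq_nonneg (|2 * Real.pi * ξ| - 1), abs_nonneg (2 * Real.pi * ξ)]
  have i1 : Integrable fun ξ : ℝ => (2 * Real.pi * Complex.I * ξ) * (kdvSym 0 ξ * G ξ) :=
    (hs1.integrable_mul hGi).congr (Eventually.of_forall fun ξ => by simp only; ring)
  have i2 : Integrable fun ξ : ℝ => (2 * Real.pi * Complex.I * ξ) *
      ((2 * Real.pi * Complex.I * ξ) * (kdvSym 0 ξ * G ξ)) := by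
    simp_rw [e2]; exact (i0.const_mul 3).add (hGi.const_mul (-3))
  have d1 := fun x => hasDerivAt_fourierInv i0 i1 x
  have d2 := fun x => hasDerivAt_fourierInv i1 i2 x
  have hu : ∀ x, (opB₀ M β p).val x = (𝓕⁻ (fun ξ => kdvSym 0 ξ * G ξ) x).re := fun x => by
    rw [← EvenFun.evL_opB₀ hβ]; rfl
  refine ⟨fun x => (𝓕⁻ (fun ξ : ℝ => (2 * Real.pi * Complex.I * ξ) * (kdvSym 0 ξ * G ξ)) x).re,
    fun x => ?_, fun x => ?_, ∫ ξ : ℝ, ‖(2 * Real.pi * Complex.I * ξ) * (kdvSym 0 ξ * G ξ)‖, fun x => ?_⟩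
  · rw [show (opB₀ M β p).val = fun x => (𝓕⁻ (fun ξ => kdvSym 0 ξ * G ξ) x).re from funext hu]
    exact (Complex.reCLM.hasFDerivAt.comp_hasDerivAt x (d1 x))
  · have := Complex.reCLM.hasFDerivAt.comp_hasDerivAt x (d2 x)
    refine HasDerivAt.congr_deriv this ?_
    simp only [e2, Complex.reCLM_apply]
    rw [fourierInv_add_fun (i0.const_mul 3) (hGi.const_mul (-3)), fourierInv_const_mul,
      fourierInv_const_mul, hG, EvenFun.fourierInv_ampl, ← hG, ← EvenFun.evL_opB₀ hβ]
    simp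
    ring
  · refine (Complex.abs_re_le_norm _).trans ?_
    rw [fourierInv_real_eq]
    refine (norm_integral_le_integral_norm _).trans (le_of_eq ?_)
    refine integral_congr_ae (Eventually.of_forall fun ξ => ?_)
    beta_reduce
    rw [norm_mul, show (2 * Real.pi * ξ * x * Complex.I : ℂ)
      = ((2 * Real.pi * ξ * x : ℝ) : ℂ) * Complex.I by push_cast; ring,
      Complex.norm_exp_ofReal_mul_I, one_mul]

/-! ### Fourier decay of twice differentiable functions -/

section C2
variable {v v' v'' : ℝ → ℂ} (h : ∀ x, HasDerivAt v (v' x) x) (h' : ∀ x, HasDerivAt v' (v'' x) x)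
  (hi : Integrable v) (hi' : Integrable v') (hi'' : Integrable v'')
include h h' hi hi' hi''

lemma fourier_second_deriv (ξ : ℝ) : 𝓕 v'' ξ = -(2 * Real.pi * ξ) ^ 2 * 𝓕 v ξ := by
  have e1 : deriv v = v' := funext fun x => (h x).deriv
  have e2 : deriv v' = v'' := funext fun x => (h' x).deriv
  have f1 := Real.fourier_deriv hi (fun x => (h x).differentiableAt) (e1 ▸ hi')
  have f2 := Real.fourier_deriv hi' (fun x => (h' x).differentiableAt) (e2 ▸ hi'')
  rw [e1] at f1
  rw [e2, f1] at f2
  rw [f2]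
  simp only [smul_eq_mul]
  linear_combination (4 * Real.pi ^ 2 * ξ ^ 2 * 𝓕 v ξ) * Complex.I_sq

/-- ⟨k⟩² v̂ is the transform of v - v'', an integrable function. -/
lemma exists_norm_fourier_le : ∃ K : ℝ, 0 ≤ K ∧ ∀ ξ, ‖𝓕 v ξ‖ ≤ K * (jap ξ ^ 2)⁻¹ := by
  refine ⟨∫ x, ‖v x - v'' x‖, integral_nonneg fun _ => norm_nonneg _, fun ξ => ?_⟩
  have e : 𝓕 (fun x => v x - v'' x) ξ = ((jap ξ ^ 2 : ℝ) : ℂ) * 𝓕 v ξ := by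
    have e0 : 𝓕 (fun x => v x - v'' x) ξ = 𝓕 v ξ - 𝓕 v'' ξ := by
      simp only [Real.fourier_eq]
      rw [← integral_sub]
      · simp [smul_sub]
      · exact (Real.fourierIntegral_convergent_iff ξ).2 hi
      · exact (Real.fourierIntegral_convergent_iff ξ).2 hi''
    rw [e0, fourier_second_deriv h h' hi hi' hi'', jap_sq]
    push_cast; ring
  have hj : (0:ℝ) < jap ξ ^ 2 := pow_pos (jap_pos ξ) 2
  rw [← div_eq_mul_inv, le_div_iff₀ hj, mul_comm]
  have h2 : ‖𝓕 (fun x => v x - v'' x) ξ‖ ≤ ∫ x, ‖v x - v'' x‖ :=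
    VectorFourier.norm_fourierIntegral_le_integral_norm _ _ _ _ _
  rwa [e, norm_mul, Complex.norm_real, Real.norm_of_nonneg hj.le] at h2

lemma integrable_fourier_of_C2 : Integrable (𝓕 v) := by
  obtain ⟨K, -, hK⟩ := exists_norm_fourier_le h h' hi hi' hi''
  exact (integrable_jap_sq_inv.const_mul K).mono' (continuous_fourier hi).aestronglyMeasurable
    (Eventually.of_forall hK)

/-- Decay ⟨k⟩⁻² places v in H¹, since ⟨k⟩·⟨k⟩⁻² is square integrable. Higher regularity comes later
from the smoothing of (1+D²/3)⁻¹. -/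
lemma exists_evL_of_C2 : ∃ Φ : L2, (∀ x, evL 1 Φ x = v x) ∧ ampl 1 Φ =ᵐ[volume] 𝓕 v := by
  obtain ⟨K, hK0, hK⟩ := exists_norm_fourier_le h h' hi hi' hi''
  have hm : MemLp (fun ξ => ((jap ξ ^ 1 : ℝ) : ℂ) * 𝓕 v ξ) 2 := by
    refine ((memLp_japInv 1).norm.const_mul K).of_le ?_ (Eventually.of_forall fun ξ => ?_)
    · exact ((Complex.continuous_ofReal.comp (continuous_jap.pow 1)).mul
        (continuous_fourier hi)).aestronglyMeasurable
    · have hj := jap_pos ξ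
      rw [norm_mul, Complex.norm_real, norm_japInv, Real.norm_of_nonneg (by positivity),
        Real.norm_of_nonneg (by positivity), pow_one]
      calc jap ξ * ‖𝓕 v ξ‖ ≤ jap ξ * (K * (jap ξ ^ 2)⁻¹) := mul_le_mul_of_nonneg_left (hK ξ) hj.le
        _ = K * (jap ξ)⁻¹ := by field_simp
  have hc : Continuous v := continuous_iff_continuousAt.2 fun x => (h x).continuousAt
  obtain ⟨h1, h2⟩ := exists_of_weighted hm
  refine ⟨hm.toLp _, fun x => ?_, h1⟩
  rw [h2, hc.fourierInv_fourier_eq hi (integrable_fourier_of_C2 h h' hi hi' hi'')]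

end C2

/-- `u, u', u''` decay in the weighted sense. -/
structure IsWeightedC2 (β : ℝ) (u u' u'' : ℝ → ℝ) : Prop where
  even : ∀ x, u (-x) = u x
  deriv : ∀ x, HasDerivAt u (u' x) x
  deriv' : ∀ x, HasDerivAt u' (u'' x) x
  int : Integrable fun x => Real.exp (β * x) * u x
  int' : Integrable fun x => Real.exp (β * x) * u' x
  int'' : Integrable fun x => Real.exp (β * x) * u'' x

lemma IsWeightedC2.exists_evL {β : ℝ} {u u' u'' : ℝ → ℝ} (h : IsWeightedC2 β u u' u'') :
    ∃ Φ : L2, ∀ x, evL 1 Φ x = ((Real.exp (β * x) * u x : ℝ) : ℂ) := by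
  have hexp : ∀ x, HasDerivAt (fun x => Real.exp (β * x)) (β * Real.exp (β * x)) x := fun x => by
    have := ((hasDerivAt_id x).const_mul β).exp
    simpa [mul_comm] using this
  have d1 : ∀ x, HasDerivAt (fun x => Real.exp (β * x) * u x)
      (β * (Real.exp (β * x) * u x) + Real.exp (β * x) * u' x) x := fun x => by
    exact ((hexp x).mul (h.deriv x)).congr_deriv (by ring)
  have d1' : ∀ x, HasDerivAt (fun x => Real.exp (β * x) * u' x)
      (β * (Real.exp (β * x) * u' x) + Real.exp (β * x) * u'' x) x := fun x => by
    exact ((hexp x).mul (h.deriv' x)).congr_deriv (by ring)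
  have d2 := fun x => ((d1 x).const_mul β).add (d1' x)
  obtain ⟨Φ, hΦ, -⟩ := exists_evL_of_C2 (fun x => (d1 x).ofReal_comp) (fun x => (d2 x).ofReal_comp)
    h.int.ofReal ((h.int.const_mul β).add h.int').ofReal
    ((((h.int.const_mul β).add h.int').const_mul β).add ((h.int'.const_mul β).add h.int'')).ofReal
  exact ⟨Φ, hΦ⟩

/-- A decaying `C²` function `u` is represented in `EvenFun`, and equals `(1 + D²/3)⁻¹ (u - u''/3)`. -/
lemma IsWeightedC2.exists_val {β : ℝ} {u u' u'' : ℝ → ℝ} (hβ : IsWeightedC2 β u u' u'')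
    (h0 : IsWeightedC2 0 u u' u'') : ∃ p : EvenFun 1 β, ∀ x, p.val x = u x := by
  obtain ⟨Φ, hΦ⟩ := h0.exists_evL
  obtain ⟨Ψ, hΨ⟩ := hβ.exists_evL
  obtain ⟨p, -, hp⟩ := EvenFun.exists_val (M := 1) (β := β) hβ.even (Φ := Φ) (Ψ := Ψ)
    (fun x => by simpa using hΦ x) hΨ
  exact ⟨p, hp⟩

/-- Passes from a classical ODE to the operator equation: u - u''/3 has transform (1+k²/3)û, and for
an integrable function the classical transform agrees almost everywhere with the amplitude stored in
q. -/
lemma IsWeightedC2.eq_opB₀ {β : ℝ} (hβ : β ^ 2 < 3) {u u' u'' : ℝ → ℝ} (h0 : IsWeightedC2 0 u u' u'')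
    {p q : EvenFun 1 β} (hp : ∀ x, p.val x = u x) (hq : ∀ x, q.val x = u x - u'' x / 3) :
    p = opB₀ 1 β q := by
  have i0 : Integrable fun x => (u x : ℂ) := by simpa using h0.int.ofReal (𝕜 := ℂ)
  have i1 : Integrable fun x => (u' x : ℂ) := by simpa using h0.int'.ofReal (𝕜 := ℂ)
  have i2 : Integrable fun x => (u'' x : ℂ) := by simpa using h0.int''.ofReal (𝕜 := ℂ)
  have d1 := fun x => (h0.deriv x).ofReal_comp
  have d2 := fun x => (h0.deriv' x).ofReal_comp
  have hfu := integrable_fourier_of_C2 d1 d2 i0 i1 i2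
  have hc : Continuous fun x => (u x : ℂ) := continuous_iff_continuousAt.2 fun x => (d1 x).continuousAt
  have hqe : 𝓕⁻ (ampl 1 (EvenFun.incl q).1) = fun x => (u x : ℂ) - 1 / 3 * (u'' x : ℂ) := by
    ext x; rw [EvenFun.fourierInv_ampl, hq]; push_cast; ring
  have hqf := fourier_fourierInv_ae (integrable_ampl 1 (EvenFun.incl q).1) (memLp_ampl 1 _)
    (by rw [hqe]; exact i0.sub (i2.const_mul _))
  refine EvenFun.ext_val fun x => ?_
  have : ((p.val x : ℝ) : ℂ) = ((opB₀ 1 β q).val x : ℂ) := by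
    rw [EvenFun.evL_opB₀ hβ, hp]
    have h3 := congrFun (hc.fourierInv_fourier_eq i0 hfu) x
    rw [← h3]
    refine Real.fourierInv_congr_ae ?_ x
    filter_upwards [hqf] with ξ hξ
    rw [← hξ, hqe]
    have e0 : 𝓕 (fun x => (u x : ℂ) - 1 / 3 * (u'' x : ℂ)) ξ
        = 𝓕 (fun x => (u x : ℂ)) ξ - 1 / 3 * 𝓕 (fun x => (u'' x : ℂ)) ξ := by
      simp only [Real.fourier_eq]
      rw [← integral_const_mul, ← integral_sub]
      · refine integral_congr_ae (Eventually.of_forall fun y => ?_)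
        simp only [Circle.smul_def, smul_eq_mul]; ring
      · exact (Real.fourierIntegral_convergent_iff ξ).2 i0
      · exact ((Real.fourierIntegral_convergent_iff ξ).2 i2).const_mul _
    have hne : (3 + (2 * Real.pi * ξ) ^ 2 : ℂ) ≠ 0 := by
      exact_mod_cast (by positivity : (3 + (2 * Real.pi * ξ) ^ 2 : ℝ) ≠ 0)
    rw [e0, fourier_second_deriv d1 d2 i0 i1 i2]
    have hk : kdvSym 0 ξ * (3 + (2 * Real.pi * ξ : ℂ) ^ 2) = 3 := by
      rw [kdvSym, lineVar_zero]; push_cast; rw [div_mul_cancel₀ _ hne]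
    linear_combination (-(𝓕 (fun x => (u x : ℂ)) ξ) / 3) * hk
  exact_mod_cast this

/-! ### The linearized KdV equation -/

/-- Half the decay rate of the profile. -/
def kc : ℝ := Real.sqrt 3 / 2

lemma kc_pos : 0 < kc := by unfold kc; positivity

lemma kc_sq : kc ^ 2 = 3 / 4 := by
  rw [kc, div_pow, Real.sq_sqrt (by norm_num)]; norm_num

lemma kc_le_one : kc ≤ 1 := by
  have := kc_sq
  nlinarith [kc_pos]

/-- `cosh (√3 x / 2)`. -/
def kC (x : ℝ) : ℝ := Real.cosh (kc * x)

/-- `sinh (√3 x / 2)`. -/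
def kS (x : ℝ) : ℝ := Real.sinh (kc * x)

lemma one_le_kC (x : ℝ) : 1 ≤ kC x := Real.one_le_cosh _
lemma kC_pos (x : ℝ) : 0 < kC x := Real.cosh_pos _
lemma kC_ne (x : ℝ) : kC x ≠ 0 := (kC_pos x).ne'
lemma kS_sq (x : ℝ) : kS x ^ 2 = kC x ^ 2 - 1 := by rw [kC, kS, Real.cosh_sq]; ring
lemma kC_neg (x : ℝ) : kC (-x) = kC x := by simp [kC]
lemma kS_neg (x : ℝ) : kS (-x) = -kS x := by simp [kS]
lemma kC_zero : kC 0 = 1 := by simp [kC]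
lemma kS_zero : kS 0 = 0 := by simp [kS]

lemma abs_kS_le (x : ℝ) : |kS x| ≤ kC x :=
  abs_le_of_sq_le_sq (by rw [kS_sq]; linarith) (kC_pos x).le

lemma abs_mul_le_kC (x : ℝ) : |kc * x| ≤ kC x := by
  refine le_trans ?_ (abs_kS_le x)
  rw [kS, Real.abs_sinh]
  exact Real.self_le_sinh_iff.2 (abs_nonneg _)

lemma hasDerivAt_kC (x : ℝ) : HasDerivAt kC (kc * kS x) x := by
  have := (Real.hasDerivAt_cosh (kc * x)).comp x ((hasDerivAt_id x).const_mul kc)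
  exact this.congr_deriv (by simp [kS, mul_comm])

lemma hasDerivAt_kS (x : ℝ) : HasDerivAt kS (kc * kC x) x := by
  have := (Real.hasDerivAt_sinh (kc * x)).comp x ((hasDerivAt_id x).const_mul kc)
  exact this.congr_deriv (by simp [kC, mul_comm])

@[fun_prop] lemma continuous_kC : Continuous kC := by unfold kC; fun_prop
@[fun_prop] lemma continuous_kS : Continuous kS := by unfold kS; fun_prop

lemma hasDerivAt_kC_inv_pow (n : ℕ) (x : ℝ) :
    HasDerivAt (fun x => (kC x ^ (n + 1))⁻¹) (-(n + 1) * kc * kS x * (kC x ^ (n + 2))⁻¹) x := by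
  have hC := kC_ne x
  refine (((hasDerivAt_kC x).pow (n + 1)).inv (pow_ne_zero _ hC)).congr_deriv ?_
  simp only [Pi.pow_apply]
  push_cast
  field_simp
  ring

/-- The decaying solution of `f'' = (3 - 9 Θ) f`. -/
def phi₁ (x : ℝ) : ℝ := kS x * (kC x ^ 3)⁻¹
/-- The derivative of `phi₁`. -/
def phi₁' (x : ℝ) : ℝ := kc * (3 * (kC x ^ 4)⁻¹ - 2 * (kC x ^ 2)⁻¹)
/-- The growing solution of `f'' = (3 - 9 Θ) f`. -/
def phi₂ (x : ℝ) : ℝ :=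
  2 * kC x ^ 2 + 5 - 15 * (kC x ^ 2)⁻¹ + 15 * (kc * x) * phi₁ x
/-- The derivative of `phi₂`. -/
def phi₂' (x : ℝ) : ℝ :=
  kc * (4 * (kS x * kC x) + 45 * phi₁ x) + 15 * (kc * x) * phi₁' x

@[fun_prop] lemma continuous_phi₁ : Continuous phi₁ := by
  unfold phi₁
  exact continuous_kS.mul ((continuous_kC.pow 3).inv₀ fun x => pow_ne_zero _ (kC_ne x))

@[fun_prop] lemma continuous_phi₂ : Continuous phi₂ := by
  unfold phi₂
  have h := (continuous_kC.pow 2).inv₀ fun x => pow_ne_zero _ (kC_ne x)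
  exact ((((continuous_kC.pow 2).const_mul 2).add continuous_const).sub (h.const_mul 15)).add
    (((continuous_const.mul continuous_id).const_mul 15).mul continuous_phi₁)

lemma hasDerivAt_phi₁ (x : ℝ) : HasDerivAt phi₁ (phi₁' x) x := by
  have hC := kC_ne x
  refine ((hasDerivAt_kS x).mul (hasDerivAt_kC_inv_pow 2 x)).congr_deriv ?_
  rw [phi₁']
  have f1 : kC x * (kC x ^ 3)⁻¹ = (kC x ^ 2)⁻¹ := by field_simp
  have f2 : kC x ^ 2 * (kC x ^ 4)⁻¹ = (kC x ^ 2)⁻¹ := by field_simp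
  push_cast
  linear_combination (-3 * kc * (kC x ^ 4)⁻¹) * kS_sq x + kc * f1 - 3 * kc * f2

/-- `phi₁` is -Θ'/√3, the mode generated by translation invariance. It is odd, so restricting to
even functions removes it. -/
lemma hasDerivAt_phi₁' (x : ℝ) : HasDerivAt phi₁' ((3 - 9 * (kC x ^ 2)⁻¹) * phi₁ x) x := by
  have hC := kC_ne x
  refine ((((hasDerivAt_kC_inv_pow 3 x).const_mul 3).sub
    ((hasDerivAt_kC_inv_pow 1 x).const_mul 2)).const_mul kc).congr_deriv ?_
  rw [phi₁]
  have f1 : (kC x ^ 2)⁻¹ * (kC x ^ 3)⁻¹ = (kC x ^ 5)⁻¹ := by field_simp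
  push_cast
  linear_combination (4 * kS x * (kC x ^ 3)⁻¹ - 12 * kS x * (kC x ^ 5)⁻¹) * kc_sq + 9 * kS x * f1

lemma hasDerivAt_phi₂ (x : ℝ) : HasDerivAt phi₂ (phi₂' x) x := by
  have hC := kC_ne x
  have h := (((((hasDerivAt_kC x).pow 2).const_mul 2).add_const 5).sub
    ((hasDerivAt_kC_inv_pow 1 x).const_mul 15)).add
    ((((hasDerivAt_id x).const_mul kc).const_mul 15).mul (hasDerivAt_phi₁ x))
  refine h.congr_deriv ?_
  simp only [phi₂', phi₁, id]
  field_simp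
  push_cast
  ring

lemma hasDerivAt_phi₂' (x : ℝ) : HasDerivAt phi₂' ((3 - 9 * (kC x ^ 2)⁻¹) * phi₂ x) x := by
  have hC := kC_ne x
  have h := (((((hasDerivAt_kS x).mul (hasDerivAt_kC x)).const_mul 4).add
    ((hasDerivAt_phi₁ x).const_mul 45)).const_mul kc).add
    ((((hasDerivAt_id x).const_mul kc).const_mul 15).mul (hasDerivAt_phi₁' x))
  refine h.congr_deriv ?_
  have e : kS x * (kc * kS x) = kc * (kC x ^ 2 - 1) := by rw [← kS_sq]; ring
  have e2 : kc * (15 * 1 * phi₁' x) = 15 * kc ^ 2 * (3 * (kC x ^ 4)⁻¹ - 2 * (kC x ^ 2)⁻¹) := by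
    rw [phi₁']; ring
  have e3 : kc * phi₁' x = kc ^ 2 * (3 * (kC x ^ 4)⁻¹ - 2 * (kC x ^ 2)⁻¹) := by
    rw [phi₁']; ring
  have e4 : (kC x ^ 4)⁻¹ = (kC x ^ 2)⁻¹ ^ 2 := by rw [inv_pow]; congr 1; ring
  have e5 : kC x ^ 2 * (kC x ^ 2)⁻¹ = 1 := mul_inv_cancel₀ (pow_ne_zero _ hC)
  simp only [phi₂, id]
  rw [e4] at e3
  linear_combination (4 * kc) * e + 60 * e3 +
    (8 * kC x ^ 2 - 4 + 180 * ((kC x ^ 2)⁻¹) ^ 2 - 120 * (kC x ^ 2)⁻¹) * kc_sq + 18 * e5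

/-- Being nonzero, it gives linear independence of the two solutions, and its value is the
normalization 1/(8 kc) of the Green's function. -/
lemma wronskian_phi (x : ℝ) : phi₁' x * phi₂ x - phi₂' x * phi₁ x = -8 * kc := by
  have hC := kC_ne x
  have e4 : (kC x ^ 4)⁻¹ = (kC x ^ 2)⁻¹ ^ 2 := by rw [inv_pow]; congr 1; ring
  have e5 : kC x ^ 2 * (kC x ^ 2)⁻¹ = 1 := mul_inv_cancel₀ (pow_ne_zero _ hC)
  have e6 : kS x * kC x * phi₁ x = 1 - (kC x ^ 2)⁻¹ := by
    rw [phi₁]; field_simp; linear_combination kS_sq x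
  have e7 : phi₁ x * phi₁ x = ((kC x ^ 2)⁻¹) ^ 2 * (1 - (kC x ^ 2)⁻¹) := by
    rw [phi₁]; field_simp; linear_combination kS_sq x
  have e8 : phi₁' x = kc * (3 * (kC x ^ 2)⁻¹ ^ 2 - 2 * (kC x ^ 2)⁻¹) := by rw [phi₁', e4]
  simp only [phi₂, phi₂']
  rw [e8]
  linear_combination (-4 * kc) * e6 - 45 * kc * e7
    + kc * (6 * (kC x ^ 2)⁻¹ - 4) * e5

/-! #### Bounds -/

lemma inv_kC_sq_le_one (x : ℝ) : (kC x ^ 2)⁻¹ ≤ 1 :=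
  inv_le_one_of_one_le₀ (one_le_pow₀ (one_le_kC x))

lemma inv_kC_sq_pos (x : ℝ) : 0 < (kC x ^ 2)⁻¹ := inv_pos.2 (pow_pos (kC_pos x) 2)

lemma abs_phi₁_le (x : ℝ) : |phi₁ x| ≤ (kC x ^ 2)⁻¹ := by
  have hC := kC_pos x
  rw [phi₁, abs_mul, abs_of_pos (inv_pos.2 (pow_pos hC 3))]
  calc |kS x| * (kC x ^ 3)⁻¹ ≤ kC x * (kC x ^ 3)⁻¹ :=
        mul_le_mul_of_nonneg_right (abs_kS_le x) (by positivity)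
    _ = (kC x ^ 2)⁻¹ := by field_simp

lemma inv_kC_four_le (x : ℝ) : (kC x ^ 4)⁻¹ ≤ (kC x ^ 2)⁻¹ :=
  inv_anti₀ (pow_pos (kC_pos x) 2) (pow_le_pow_right₀ (one_le_kC x) (by norm_num))

lemma abs_phi₁'_le (x : ℝ) : |phi₁' x| ≤ 5 * (kC x ^ 2)⁻¹ := by
  have h1 := inv_kC_four_le x
  have h2 := inv_kC_sq_pos x
  have h3 : 0 < (kC x ^ 4)⁻¹ := inv_pos.2 (pow_pos (kC_pos x) 4)
  rw [phi₁', abs_mul, abs_of_pos kc_pos]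
  have : |3 * (kC x ^ 4)⁻¹ - 2 * (kC x ^ 2)⁻¹| ≤ 5 * (kC x ^ 2)⁻¹ := by
    rw [abs_le]; constructor <;> linarith
  calc kc * |3 * (kC x ^ 4)⁻¹ - 2 * (kC x ^ 2)⁻¹| ≤ 1 * |3 * (kC x ^ 4)⁻¹ - 2 * (kC x ^ 2)⁻¹| :=
        mul_le_mul_of_nonneg_right kc_le_one (abs_nonneg _)
    _ ≤ _ := by rw [one_mul]; exact this

lemma abs_phi₂_le (x : ℝ) : |phi₂ x| ≤ 37 * kC x ^ 2 := by
  have hC := one_le_kC x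
  have h1 := inv_kC_sq_le_one x
  have h2 := inv_kC_sq_pos x
  have h5 : |(kc * x) * phi₁ x| ≤ 1 := by
    rw [abs_mul]
    calc |kc * x| * |phi₁ x| ≤ kC x * (kC x ^ 2)⁻¹ :=
          mul_le_mul (abs_mul_le_kC x) (abs_phi₁_le x) (abs_nonneg _) (kC_pos x).le
      _ = (kC x)⁻¹ := by have := kC_ne x; field_simp
      _ ≤ 1 := inv_le_one_of_one_le₀ hC
  rw [phi₂]
  have h6 := abs_le.1 h5
  have h7 : 1 ≤ kC x ^ 2 := one_le_pow₀ hC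
  rw [abs_le]
  constructor <;> nlinarith

lemma abs_phi₂'_le (x : ℝ) : |phi₂' x| ≤ 124 * kC x ^ 2 := by
  have hC := one_le_kC x
  have h1 := inv_kC_sq_le_one x
  have h2 := inv_kC_sq_pos x
  have h7 : 1 ≤ kC x ^ 2 := one_le_pow₀ hC
  have h5 : |(kc * x) * phi₁' x| ≤ 5 := by
    rw [abs_mul]
    calc |kc * x| * |phi₁' x| ≤ kC x * (5 * (kC x ^ 2)⁻¹) :=
          mul_le_mul (abs_mul_le_kC x) (abs_phi₁'_le x) (abs_nonneg _) (kC_pos x).le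
      _ = 5 * (kC x)⁻¹ := by have := kC_ne x; field_simp
      _ ≤ 5 := by have := inv_le_one_of_one_le₀ hC; linarith
  have h3 : |4 * (kS x * kC x) + 45 * phi₁ x| ≤ 49 * kC x ^ 2 := by
    have a1 : |kS x * kC x| ≤ kC x ^ 2 := by
      rw [abs_mul, abs_of_pos (kC_pos x), sq]
      exact mul_le_mul_of_nonneg_right (abs_kS_le x) (kC_pos x).le
    have a2 := (abs_phi₁_le x).trans h1
    have b1 := abs_le.1 a1
    have b2 := abs_le.1 a2
    rw [abs_le]; constructor <;> linarith
  have h4 : |kc * (4 * (kS x * kC x) + 45 * phi₁ x)| ≤ 49 * kC x ^ 2 := by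
    rw [abs_mul, abs_of_pos kc_pos]
    exact (mul_le_of_le_one_left (abs_nonneg _) kc_le_one).trans h3
  rw [phi₂']
  have h6 := abs_le.1 h5
  have h8 := abs_le.1 h4
  rw [abs_le]
  constructor <;> nlinarith

lemma inv_kC_sq_le_exp (x : ℝ) : (kC x ^ 2)⁻¹ ≤ 4 * Real.exp (-(Real.sqrt 3 * |x|)) := by
  have h1 : Real.exp (kc * |x|) / 2 ≤ kC x := by
    rw [kC, ← Real.cosh_abs, abs_mul, abs_of_pos kc_pos, Real.cosh_eq]
    have := Real.exp_pos (-(kc * |x|))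
    linarith
  have h2 : Real.exp (Real.sqrt 3 * |x|) = Real.exp (kc * |x|) ^ 2 := by
    rw [← Real.exp_nat_mul, kc]; congr 1; push_cast; ring
  rw [Real.exp_neg, h2, ← div_eq_mul_inv, le_div_iff₀ (by positivity), inv_mul_le_iff₀ (pow_pos (kC_pos x) 2)]
  have := pow_le_pow_left₀ (by positivity) h1 2
  rw [div_pow] at this
  linarith

lemma integrable_exp_mul_of_le {b : ℝ} (hb : b ^ 2 < 3) {u : ℝ → ℝ} (hu : Continuous u) {K : ℝ}
    (h : ∀ x, |u x| ≤ K * ((1 + |x|) * (kC x ^ 2)⁻¹)) : Integrable fun x => Real.exp (b * x) * u x := by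
  have hK : 0 ≤ K := by
    have := (abs_nonneg _).trans (h 0)
    simpa [kC_zero] using this
  have hlt : |b| < Real.sqrt 3 := by
    rw [← Real.sqrt_sq_eq_abs]; exact Real.sqrt_lt_sqrt (sq_nonneg _) hb
  -- Half of the gap between the decay rate √3 and the weight absorbs the factor 1+|x|, and the
  -- other half leaves an integrable 1/(1+x²).
  set a := (Real.sqrt 3 - |b|) / 2 with ha
  have ha0 : 0 < a := by rw [ha]; linarith
  refine (integrable_inv_one_add_sq.const_mul (K * 4 * (1 + 1 / a) * (1 + 2 / a ^ 2))).mono'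
    (by fun_prop) (Eventually.of_forall fun x => ?_)
  rw [Real.norm_eq_abs, abs_mul, abs_of_pos (Real.exp_pos _), ← div_eq_mul_inv,
    le_div_iff₀ (by positivity)]
  set y := |x| with hy
  have hy0 : 0 ≤ y := abs_nonneg x
  have hx2 : x ^ 2 = y ^ 2 := (sq_abs x).symm
  have e1 : Real.exp (b * x) ≤ Real.exp (|b| * y) :=
    Real.exp_le_exp.2 ((le_abs_self _).trans (abs_mul b x).le)
  have e2 : 1 + y ≤ (1 + 1 / a) * Real.exp (a * y) := by
    have h1 := Real.add_one_le_exp (a * y)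
    have h2 : 1 ≤ Real.exp (a * y) := Real.one_le_exp (by positivity)
    have h3 : y = 1 / a * (a * y) := by field_simp
    have h4 : 1 / a * (a * y) ≤ 1 / a * Real.exp (a * y) :=
      mul_le_mul_of_nonneg_left (by linarith) (by positivity)
    linarith
  have e3 : 1 + x ^ 2 ≤ (1 + 2 / a ^ 2) * Real.exp (a * y) := by
    have h1 := Real.quadratic_le_exp_of_nonneg (x := a * y) (by positivity)
    have h2 : 1 ≤ Real.exp (a * y) := Real.one_le_exp (by positivity)
    have h3 : y ^ 2 = 2 / a ^ 2 * ((a * y) ^ 2 / 2) := by field_simp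
    have h4 : 2 / a ^ 2 * ((a * y) ^ 2 / 2) ≤ 2 / a ^ 2 * Real.exp (a * y) :=
      mul_le_mul_of_nonneg_left (by nlinarith [mul_nonneg ha0.le hy0]) (by positivity)
    rw [hx2]; linarith
  have e4 : Real.exp (|b| * y) * Real.exp (-(Real.sqrt 3 * y)) * Real.exp (a * y) * Real.exp (a * y) = 1 := by
    rw [← Real.exp_add, ← Real.exp_add, ← Real.exp_add, Real.exp_eq_one_iff, ha]; ring
  have e5 := inv_kC_sq_le_exp x
  calc Real.exp (b * x) * |u x| * (1 + x ^ 2)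
      ≤ Real.exp (|b| * y) * (K * ((1 + 1 / a) * Real.exp (a * y) * (4 * Real.exp (-(Real.sqrt 3 * y)))))
        * ((1 + 2 / a ^ 2) * Real.exp (a * y)) := by
        gcongr
        refine (h x).trans ?_
        gcongr
    _ = K * 4 * (1 + 1 / a) * (1 + 2 / a ^ 2) * (Real.exp (|b| * y) * Real.exp (-(Real.sqrt 3 * y))
          * Real.exp (a * y) * Real.exp (a * y)) := by ring
    _ = _ := by rw [e4, mul_one]

/-! #### Green's function -/

lemma integral_zero_neg_of_odd {f : ℝ → ℝ} (hf : ∀ x, f (-x) = -f x) (x : ℝ) :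
    ∫ t in (0:ℝ)..(-x), f t = ∫ t in (0:ℝ)..x, f t := by
  have := intervalIntegral.integral_comp_neg f (a := 0) (b := x)
  simp only [hf, intervalIntegral.integral_neg, neg_zero] at this
  rw [intervalIntegral.integral_symm, ← this, neg_neg]

lemma integral_zero_neg_of_even {f : ℝ → ℝ} (hf : ∀ x, f (-x) = f x) (x : ℝ) :
    ∫ t in (0:ℝ)..(-x), f t = -∫ t in (0:ℝ)..x, f t := by
  have := intervalIntegral.integral_comp_neg f (a := 0) (b := x)
  simp only [hf, neg_zero] at this
  rw [intervalIntegral.integral_symm, ← this]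

lemma phi₁_neg (x : ℝ) : phi₁ (-x) = -phi₁ x := by simp [phi₁, kS_neg, kC_neg]
lemma phi₂_neg (x : ℝ) : phi₂ (-x) = phi₂ x := by simp [phi₂, phi₁_neg, kC_neg]

lemma nonneg_of_antitone_of_tendsto {g g' : ℝ → ℝ} (hg : ∀ x, HasDerivAt g (g' x) x)
    (hn : ∀ x, 0 ≤ x → g' x ≤ 0) (ht : Tendsto g atTop (𝓝 0)) {x : ℝ} (hx : 0 ≤ x) : 0 ≤ g x := by
  have hanti : AntitoneOn g (Ici 0) := by
    refine antitoneOn_of_deriv_nonpos (convex_Ici 0)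
      (fun y _ => (hg y).continuousAt.continuousWithinAt)
      (fun y _ => (hg y).differentiableAt.differentiableWithinAt) fun y hy => ?_
    rw [interior_Ici] at hy
    rw [(hg y).deriv]
    exact hn y (le_of_lt hy)
  refine le_of_tendsto ht ?_
  filter_upwards [eventually_ge_atTop x] with y hy
  exact hanti hx (hx.trans hy) hy

/-- `kC` tends to infinity. -/
lemma tendsto_inv_kC_four : Tendsto (fun x => (kC x ^ 4)⁻¹) atTop (𝓝 0) := by
  have h : Tendsto (fun x : ℝ => 4 * Real.exp (-(Real.sqrt 3 * |x|))) atTop (𝓝 (4 * 0)) := by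
    refine Tendsto.const_mul 4 (Real.tendsto_exp_neg_atTop_nhds_zero.comp ?_)
    exact Tendsto.const_mul_atTop (by positivity) tendsto_abs_atTop_atTop
  rw [mul_zero] at h
  refine squeeze_zero (fun x => (inv_pos.2 (pow_pos (kC_pos x) 4)).le) (fun x => ?_) h
  exact (inv_kC_four_le x).trans (inv_kC_sq_le_exp x)

/-- Variation of parameters: v = (φ₂ ∫_x^∞ φ₁h + φ₁ ∫_0^x φ₂h)/(8 kc). For even h the product φ₁h is
odd, so ∫_x^∞ φ₁h is even in x and decays at both ends; without parity the term growing like φ₂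
would survive at -∞. The first integral is O(cosh⁻⁴) and the second O(|x|), so v decays like
(1+|x|)Θ. -/
lemma exists_green {h : ℝ → ℝ} (hc : Continuous h) (he : ∀ x, h (-x) = h x)
    {K : ℝ} (hK : ∀ x, |h x| ≤ K * (kC x ^ 2)⁻¹) :
    ∃ v v' : ℝ → ℝ, ∀ b : ℝ, b ^ 2 < 3 →
      IsWeightedC2 b v v' (fun x => (3 - 9 * (kC x ^ 2)⁻¹) * v x - h x) := by
  have hK0 : 0 ≤ K := by simpa [kC_zero] using (abs_nonneg _).trans (hK 0)
  have hc1 : Continuous fun t => phi₁ t * h t := continuous_phi₁.mul hc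
  have hc2 : Continuous fun t => phi₂ t * h t := continuous_phi₂.mul hc
  have hint : Integrable fun t => phi₁ t * h t := by
    have := integrable_exp_mul_of_le (b := 0) (by norm_num) hc1 (K := K) fun x => by
      rw [abs_mul]
      have h2 := (abs_phi₁_le x).trans (inv_kC_sq_le_one x)
      calc |phi₁ x| * |h x| ≤ 1 * (K * (kC x ^ 2)⁻¹) := mul_le_mul h2 (hK x) (abs_nonneg _) zero_le_one
        _ ≤ K * ((1 + |x|) * (kC x ^ 2)⁻¹) := by
          have := mul_nonneg hK0 (mul_nonneg (abs_nonneg x) (inv_kC_sq_pos x).le)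
          nlinarith
    simpa using this
  set A := ∫ t in Ioi (0:ℝ), phi₁ t * h t with hA
  set I : ℝ → ℝ := fun x => A - ∫ t in (0:ℝ)..x, phi₁ t * h t with hI
  set J : ℝ → ℝ := fun x => ∫ t in (0:ℝ)..x, phi₂ t * h t with hJ
  have dI : ∀ x, HasDerivAt I (-(phi₁ x * h x)) x := fun x =>
    (intervalIntegral.integral_hasDerivAt_right (hc1.intervalIntegrable _ _)
      (hc1.stronglyMeasurableAtFilter _ _) hc1.continuousAt).const_sub A
  have dJ : ∀ x, HasDerivAt J (phi₂ x * h x) x := fun x =>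
    intervalIntegral.integral_hasDerivAt_right (hc2.intervalIntegrable _ _)
      (hc2.stronglyMeasurableAtFilter _ _) hc2.continuousAt
  have In : ∀ x, I (-x) = I x := fun x => by
    simp only [hI]; rw [integral_zero_neg_of_odd fun t => by rw [phi₁_neg, he]; ring]
  have Jn : ∀ x, J (-x) = -J x := fun x => by
    simp only [hJ]; rw [integral_zero_neg_of_even fun t => by rw [phi₂_neg, he]]
  have It : Tendsto I atTop (𝓝 0) := by
    have := (intervalIntegral_tendsto_integral_Ioi 0 hint.integrableOn tendsto_id).const_sub A
    rwa [← hA, sub_self] at this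
  have hk := kc_pos
  -- The comparison function is an exact antiderivative of the bound for φ₁h, and both sides vanish
  -- at infinity. Adding or subtracting I leaves a decreasing function with limit 0, hence a
  -- nonnegative one.
  have Ib0 : ∀ x, 0 ≤ x → |I x| ≤ K / (4 * kc) * (kC x ^ 4)⁻¹ := by
    have hd : ∀ x, HasDerivAt (fun x => K / (4 * kc) * (kC x ^ 4)⁻¹) (-(K * (kS x * (kC x ^ 5)⁻¹))) x :=
      fun x => ((hasDerivAt_kC_inv_pow 3 x).const_mul (K / (4 * kc))).congr_deriv (by
        push_cast; field_simp; norm_num)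
    have hle : ∀ x, 0 ≤ x → |phi₁ x * h x| ≤ K * (kS x * (kC x ^ 5)⁻¹) := fun x hx => by
      have hS : 0 ≤ kS x := Real.sinh_nonneg_iff.2 (by positivity)
      have hCx := kC_pos x
      have h1 : |phi₁ x| = kS x * (kC x ^ 3)⁻¹ := by rw [phi₁, abs_of_nonneg (by positivity)]
      rw [abs_mul, h1]
      calc kS x * (kC x ^ 3)⁻¹ * |h x| ≤ kS x * (kC x ^ 3)⁻¹ * (K * (kC x ^ 2)⁻¹) :=
            mul_le_mul_of_nonneg_left (hK x) (by positivity)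
        _ = _ := by field_simp
    have ht : Tendsto (fun x => K / (4 * kc) * (kC x ^ 4)⁻¹) atTop (𝓝 0) := by
      simpa using tendsto_inv_kC_four.const_mul (K / (4 * kc))
    intro x hx
    rw [abs_le]
    constructor
    · have := nonneg_of_antitone_of_tendsto (fun x => (hd x).add (dI x)) (fun y hy => by
        have := abs_le.1 (hle y hy); linarith) (add_zero (0:ℝ) ▸ ht.add It) hx
      simp only [Pi.add_apply] at this
      linarith
    · have := nonneg_of_antitone_of_tendsto (fun x => (hd x).sub (dI x)) (fun y hy => by
        have := abs_le.1 (hle y hy); linarith) (sub_zero (0:ℝ) ▸ ht.sub It) hx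
      simp only [Pi.sub_apply] at this
      linarith
  have Ib : ∀ x, |I x| ≤ K / (4 * kc) * (kC x ^ 4)⁻¹ := fun x => by
    rcases le_total 0 x with hx | hx
    · exact Ib0 x hx
    · have := Ib0 (-x) (by linarith)
      rwa [In, kC_neg] at this
  have Jb : ∀ x, |J x| ≤ 37 * K * |x| := fun x => by
    have := intervalIntegral.norm_integral_le_of_norm_le_const (a := 0) (b := x) (C := 37 * K)
      (f := fun t => phi₂ t * h t) fun t _ => by
        rw [norm_mul, Real.norm_eq_abs, Real.norm_eq_abs]
        calc |phi₂ t| * |h t| ≤ (37 * kC t ^ 2) * (K * (kC t ^ 2)⁻¹) :=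
              mul_le_mul (abs_phi₂_le t) (hK t) (abs_nonneg _) (by positivity)
          _ = 37 * K := by have := kC_ne t; field_simp
    simpa using this
  have comb : ∀ (f g : ℝ → ℝ) (P Q : ℝ), 0 ≤ P → 0 ≤ Q → (∀ x, |f x| ≤ P * kC x ^ 2) →
      (∀ x, |g x| ≤ Q * (kC x ^ 2)⁻¹) → ∀ x, |1 / (8 * kc) * (f x * I x + g x * J x)|
        ≤ 1 / (8 * kc) * (P * (K / (4 * kc)) + Q * (37 * K)) * ((1 + |x|) * (kC x ^ 2)⁻¹) := by
    intro f g P Q hP hQ hf hg x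
    have hp := inv_kC_sq_pos x
    have a1 : |f x * I x| ≤ P * (K / (4 * kc)) * (kC x ^ 2)⁻¹ := by
      rw [abs_mul]
      calc |f x| * |I x| ≤ (P * kC x ^ 2) * (K / (4 * kc) * (kC x ^ 4)⁻¹) :=
            mul_le_mul (hf x) (Ib x) (abs_nonneg _) (mul_nonneg hP (by positivity))
        _ = _ := by have := kC_ne x; field_simp
    have a2 : |g x * J x| ≤ Q * (37 * K) * (|x| * (kC x ^ 2)⁻¹) := by
      rw [abs_mul]
      calc |g x| * |J x| ≤ (Q * (kC x ^ 2)⁻¹) * (37 * K * |x|) :=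
            mul_le_mul (hg x) (Jb x) (abs_nonneg _) (mul_nonneg hQ hp.le)
        _ = _ := by ring
    rw [abs_mul, abs_of_pos (by positivity : 0 < 1 / (8 * kc)), mul_assoc]
    refine mul_le_mul_of_nonneg_left ?_ (by positivity)
    refine (abs_add_le _ _).trans ((add_le_add a1 a2).trans ?_)
    have b1 : 0 ≤ P * (K / (4 * kc)) * (|x| * (kC x ^ 2)⁻¹) := by positivity
    have b2 : 0 ≤ Q * (37 * K) * (kC x ^ 2)⁻¹ := by positivity
    linarith
  set v : ℝ → ℝ := fun x => 1 / (8 * kc) * (phi₂ x * I x + phi₁ x * J x) with hv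
  set v' : ℝ → ℝ := fun x => 1 / (8 * kc) * (phi₂' x * I x + phi₁' x * J x) with hv'
  have dv : ∀ x, HasDerivAt v (v' x) x := fun x =>
    ((((hasDerivAt_phi₂ x).mul (dI x)).add ((hasDerivAt_phi₁ x).mul (dJ x))).const_mul _).congr_deriv
      (by simp only [hv']; ring)
  have dv' : ∀ x, HasDerivAt v' ((3 - 9 * (kC x ^ 2)⁻¹) * v x - h x) x := fun x =>
    ((((hasDerivAt_phi₂' x).mul (dI x)).add ((hasDerivAt_phi₁' x).mul (dJ x))).const_mul _).congr_deriv
      (by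
        have hw := wronskian_phi x
        have h8 : 1 / (8 * kc) * (8 * kc) = 1 := by field_simp
        simp only [hv]
        linear_combination (1 / (8 * kc) * h x) * hw - h x * h8)
  have bv := comb phi₂ phi₁ 37 1 (by norm_num) (by norm_num) abs_phi₂_le
    (fun x => by rw [one_mul]; exact abs_phi₁_le x)
  have bv' := comb phi₂' phi₁' 124 5 (by norm_num) (by norm_num) abs_phi₂'_le abs_phi₁'_le
  have cv : Continuous v := continuous_iff_continuousAt.2 fun x => (dv x).continuousAt
  have cv' : Continuous v' := continuous_iff_continuousAt.2 fun x => (dv' x).continuousAt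
  have cC : Continuous fun x => (kC x ^ 2)⁻¹ :=
    (continuous_kC.pow 2).inv₀ fun x => pow_ne_zero _ (kC_ne x)
  refine ⟨v, v', fun b hb => ⟨fun x => ?_, dv, dv', integrable_exp_mul_of_le hb cv bv,
    integrable_exp_mul_of_le hb cv' bv', ?_⟩⟩
  · simp only [hv, phi₂_neg, phi₁_neg, In, Jn]; ring
  · refine integrable_exp_mul_of_le hb (by fun_prop)
      (K := 12 * (1 / (8 * kc) * (37 * (K / (4 * kc)) + 1 * (37 * K))) + K) fun x => ?_
    have h1 := inv_kC_sq_le_one x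
    have h2 := inv_kC_sq_pos x
    have a1 : |3 - 9 * (kC x ^ 2)⁻¹| ≤ 12 := by rw [abs_le]; constructor <;> linarith
    refine (abs_sub _ _).trans ?_
    rw [abs_mul, add_mul]
    refine add_le_add ?_ ?_
    · rw [mul_assoc]
      exact mul_le_mul a1 (bv x) (abs_nonneg _) (by norm_num)
    · refine (hK x).trans ?_
      have := mul_nonneg hK0 (mul_nonneg (abs_nonneg x) h2.le)
      nlinarith

/-! ### Changing the order of regularity -/

lemma japInv_mul_japInv {M N : ℕ} (h : M ≤ N) (ξ : ℝ) : japInv M ξ * japInv (N - M) ξ = japInv N ξ := by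
  rw [japInv, japInv, japInv, ← Complex.ofReal_mul, ← mul_inv, ← pow_add, Nat.add_sub_cancel' h]

lemma isSymbol_japInv (M : ℕ) : IsSymbol (japInv M) 1 :=
  ⟨(continuous_japInv M).aestronglyMeasurable, norm_japInv_le_one M⟩

lemma evL_symMul_japInv {M N : ℕ} [NeZero M] [NeZero N] (h : M ≤ N) (Φ : L2) (x : ℝ) :
    evL M (symMul (japInv (N - M)) Φ) x = evL N Φ x := by
  rw [evL_apply, evL_apply]
  refine Real.fourierInv_congr_ae ?_ x
  filter_upwards [symMul_coe (isSymbol_japInv (N - M)) Φ] with ξ hξ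
  rw [ampl, hξ, ← mul_assoc, japInv_mul_japInv h, ampl]

lemma EvenFun.exists_lower {M N : ℕ} [NeZero M] [NeZero N] {β : ℝ} (h : M ≤ N) (p : EvenFun N β) :
    ∃ q : EvenFun M β, ∀ x, q.val x = p.val x := by
  obtain ⟨q, -, hq⟩ := EvenFun.exists_val (M := M) (β := β) (f := p.val) p.val_neg
    (Φ := symMul (japInv (N - M)) (incl p).1) (Ψ := symMul (japInv (N - M)) (incl p).2)
    (fun x => by rw [evL_symMul_japInv h, evL_fst]) (fun x => by rw [evL_symMul_japInv h, evL_snd])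
  exact ⟨q, hq⟩

lemma EvenFun.exists_unweighted {M N : ℕ} [NeZero M] [NeZero N] {β : ℝ} (h : M ≤ N) (p : EvenFun N β) :
    ∃ q : EvenFun M 0, (∀ x, q.val x = p.val x) ∧ ‖q‖ ≤ ‖p‖ := by
  have e : ∀ x, evL M (symMul (japInv (N - M)) (incl p).1) x = (p.val x : ℂ) := fun x => by
    rw [evL_symMul_japInv h, evL_fst]
  obtain ⟨q, hq, hv⟩ := EvenFun.exists_val (M := M) (β := 0) (f := p.val) p.val_neg e
    (fun x => by rw [e]; simp)
  refine ⟨q, hv, ?_⟩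
  rw [← incl.norm_map q, hq, Prod.norm_def, max_self]
  refine ((symMul _).le_of_opNorm_le (norm_symMul_le (isSymbol_japInv _)) _).trans ?_
  rw [one_mul]
  exact p.norm_fst_incl_le

/-- `(1 + D²/3)⁻¹` gains regularity. -/
lemma EvenFun.exists_opB₀_raise {M : ℕ} [NeZero M] {β : ℝ} (hβ : β ^ 2 < 3) (p : EvenFun M β) :
    ∃ q : EvenFun (M + 1) β, ∀ x, q.val x = (opB₀ M β p).val x := by
  -- Two derivatives are available; spending one is enough for an induction on M.
  have hs : ∀ b : ℝ, b ^ 2 < 3 → IsSymbol (fun ξ => (jap ξ : ℂ) * kdvSym b ξ) (9 / (3 - b ^ 2)) := by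
    intro b hb
    have h3 : 0 < 3 - b ^ 2 := by linarith
    refine ⟨Continuous.aestronglyMeasurable ((Complex.continuous_ofReal.comp continuous_jap).mul
      (continuous_kdvSym hb)), fun ξ => ?_⟩
    have hj := jap_pos ξ
    rw [norm_mul, Complex.norm_real, Real.norm_of_nonneg hj.le]
    calc jap ξ * ‖kdvSym b ξ‖ ≤ jap ξ * (9 / (3 - b ^ 2) * (jap ξ ^ 2)⁻¹) :=
          mul_le_mul_of_nonneg_left (norm_kdvSym_le hb ξ) hj.le
      _ = 9 / (3 - b ^ 2) * (jap ξ)⁻¹ := by field_simp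
      _ ≤ 9 / (3 - b ^ 2) :=
          mul_le_of_le_one_right (by positivity) (inv_le_one_of_one_le₀ (one_le_jap ξ))
  have key : ∀ b : ℝ, b ^ 2 < 3 → ∀ (Φ : L2) (x : ℝ),
      evL (M + 1) (symMul (fun ξ => (jap ξ : ℂ) * kdvSym b ξ) Φ) x = evL M (symMul (kdvSym b) Φ) x := by
    intro b hb Φ x
    rw [evL_apply, evL_apply]
    refine Real.fourierInv_congr_ae ?_ x
    filter_upwards [symMul_coe (hs b hb) Φ, symMul_coe (isSymbol_kdvSym hb) Φ] with ξ h1 h2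
    have hj : (jap ξ : ℂ) ≠ 0 := Complex.ofReal_ne_zero.2 (jap_pos ξ).ne'
    rw [ampl, ampl, h1, h2, japInv, japInv, pow_succ]
    push_cast
    field_simp
  have e1 := opB₀_coe hβ p
  obtain ⟨q, -, hq⟩ := EvenFun.exists_val (M := M + 1) (β := β) (f := (opB₀ M β p).val)
    (opB₀ M β p).val_neg (Φ := symMul (fun ξ => (jap ξ : ℂ) * kdvSym 0 ξ) (incl p).1)
    (Ψ := symMul (fun ξ => (jap ξ : ℂ) * kdvSym β ξ) (incl p).2)
    (fun x => by rw [key 0 (by norm_num), ← pairMul_fst _ (kdvSym β), ← e1, evL_fst])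
    (fun x => by rw [key β hβ, ← pairMul_snd (kdvSym 0), ← e1, evL_snd])
  exact ⟨q, hq⟩

/-! ### The KdV profile -/

lemma kdvProfile_eq (x : ℝ) : kdvProfile x = (kC x ^ 2)⁻¹ := by
  rw [kdvProfile, kC, one_div, inv_pow, kc]; congr 3; ring

lemma isWeightedC2_kdvProfile {b : ℝ} (hb : b ^ 2 < 3) :
    IsWeightedC2 b kdvProfile (fun x => -2 * kc * phi₁ x)
      (fun x => 3 * kdvProfile x - 9 / 2 * kdvProfile x ^ 2) := by
  have e : kdvProfile = fun x => (kC x ^ 2)⁻¹ := funext kdvProfile_eq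
  have h1 : ∀ x, (kC x ^ 2)⁻¹ ≤ (1 + |x|) * (kC x ^ 2)⁻¹ := fun x => by
    have := mul_nonneg (abs_nonneg x) (inv_kC_sq_pos x).le
    linarith
  have c1 : Continuous fun x => (kC x ^ 2)⁻¹ :=
    (continuous_kC.pow 2).inv₀ fun x => pow_ne_zero _ (kC_ne x)
  rw [e]
  refine ⟨fun x => by simp only [kC_neg], fun x => ?_, fun x => ?_, ?_, ?_, ?_⟩
  · refine (hasDerivAt_kC_inv_pow 1 x).congr_deriv ?_
    rw [phi₁]; push_cast; ring
  · refine ((hasDerivAt_phi₁ x).const_mul (-2 * kc)).congr_deriv ?_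
    have e4 : (kC x ^ 4)⁻¹ = (kC x ^ 2)⁻¹ ^ 2 := by rw [inv_pow]; congr 1; ring
    rw [phi₁', e4]
    linear_combination (-2 * (3 * ((kC x ^ 2)⁻¹) ^ 2 - 2 * (kC x ^ 2)⁻¹)) * kc_sq
  · exact integrable_exp_mul_of_le hb c1 (K := 1) fun x => by
      rw [abs_of_pos (inv_kC_sq_pos x), one_mul]; exact h1 x
  · refine integrable_exp_mul_of_le hb (continuous_phi₁.const_mul _) (K := 2) fun x => ?_
    rw [abs_mul, abs_mul, abs_of_pos kc_pos]
    refine mul_le_mul ?_ ((abs_phi₁_le x).trans (h1 x)) (abs_nonneg _) (by norm_num)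
    rw [abs_neg, abs_two]
    linarith [kc_le_one]
  · refine integrable_exp_mul_of_le hb ((c1.const_mul 3).sub ((c1.pow 2).const_mul _)) (K := 8)
      fun x => ?_
    have h2 := inv_kC_sq_le_one x
    have h3 := inv_kC_sq_pos x
    have h4 := h1 x
    rw [abs_le]
    constructor <;> nlinarith

/-- The ODE Θ'' = 3Θ - (9/2)Θ² gives Θ = (1+D²/3)⁻¹((3/2)Θ²) in H¹. Reading this equation as a
regularity gain lifts it to each order in turn. -/
lemma exists_val_kdvProfile (M : ℕ) [NeZero M] {β : ℝ} (hβ : β ^ 2 < 3) :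
    ∃ p : EvenFun M β, (∀ x, p.val x = kdvProfile x) ∧ p = opB₀ M β ((3 / 2 : ℝ) • opM M β p p) := by
  suffices h : ∀ k : ℕ, ∃ p : EvenFun (k + 1) β, (∀ x, p.val x = kdvProfile x) ∧
      p = opB₀ (k + 1) β ((3 / 2 : ℝ) • opM (k + 1) β p p) by
    obtain ⟨k, rfl⟩ := Nat.exists_eq_succ_of_ne_zero (NeZero.ne M)
    exact h k
  intro k
  induction k with
  | zero =>
    have h0 := isWeightedC2_kdvProfile (b := 0) (by norm_num)
    obtain ⟨p, hp⟩ := (isWeightedC2_kdvProfile hβ).exists_val h0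
    refine ⟨p, hp, h0.eq_opB₀ hβ hp fun x => ?_⟩
    rw [EvenFun.val_smul, EvenFun.val_opM, hp]; ring
  | succ k ih =>
    obtain ⟨p, hp, hfix⟩ := ih
    obtain ⟨q, hq⟩ := EvenFun.exists_opB₀_raise hβ ((3 / 2 : ℝ) • opM (k + 1) β p p)
    have hqp : ∀ x, q.val x = p.val x := fun x => by rw [hq]; exact congrArg (fun r => r.val x) hfix.symm
    refine ⟨q, fun x => (hqp x).trans (hp x), EvenFun.ext_val fun x => ?_⟩
    rw [hq]
    refine EvenFun.val_opB₀_eq hβ hβ (fun y => ?_) x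
    simp only [EvenFun.val_smul, EvenFun.val_opM, hqp]

open Classical in
/-- The KdV profile as an element of `EvenFun M β`. -/
def thetaE (M : ℕ) [NeZero M] (β : ℝ) : EvenFun M β :=
  if h : β ^ 2 < 3 then (exists_val_kdvProfile M h).choose else 0

/-! ### Invertibility of the linearized KdV operator on even functions -/

section Linearized
variable (M : ℕ) [NeZero M] {β : ℝ} (hβ : β ^ 2 < 3)
include hβ

lemma val_thetaE (x : ℝ) : (thetaE M β).val x = kdvProfile x := by
  rw [thetaE, dif_pos hβ]; exact (exists_val_kdvProfile M hβ).choose_spec.1 x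

lemma thetaE_eq : thetaE M β = opB₀ M β ((3 / 2 : ℝ) • opM M β (thetaE M β) (thetaE M β)) := by
  rw [thetaE, dif_pos hβ]; exact (exists_val_kdvProfile M hβ).choose_spec.2

omit hβ in
/-- The linearization `1 - 3 (1 + D²/3)⁻¹ (Θ ·)` at the KdV profile. -/
def opL (β : ℝ) : EvenFun M β →L[ℝ] EvenFun M β :=
  ContinuousLinearMap.id ℝ _ - (3 : ℝ) • (opB₀ M β).comp (opM M β (thetaE M β))

omit hβ in
lemma opL_apply (p : EvenFun M β) :
    opL M β p = p - (3 : ℝ) • opB₀ M β (opM M β (thetaE M β) p) := rfl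

/-- A kernel element is 3q, where q is even, bounded, with bounded derivative, and q'' = (3-9Θ)q.
Its Wronskians with `phi₁` and `phi₂` are constant. The one with `phi₂` vanishes at 0 by evenness,
the one with `phi₁` vanishes at infinity by decay, and together they force q = 0. -/
lemma opL_injective : Function.Injective (opL M β) := by
  refine (injective_iff_map_eq_zero _).2 fun p hp => ?_
  rw [opL_apply, sub_eq_zero] at hp
  obtain ⟨g', d1, d2, K, hK⟩ := EvenFun.hasDerivAt_opB₀ hβ (opM M β (thetaE M β) p)
  set q := opB₀ M β (opM M β (thetaE M β) p) with hq
  have hpq : ∀ x, p.val x = 3 * q.val x := fun x => by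
    conv_lhs => rw [hp]
    rw [EvenFun.val_smul]
  have d3 : ∀ x, HasDerivAt g' ((3 - 9 * (kC x ^ 2)⁻¹) * q.val x) x := fun x => (d2 x).congr_deriv (by
    rw [EvenFun.val_opM, val_thetaE M hβ, hpq, kdvProfile_eq]; ring)
  have w1 : ∀ x, HasDerivAt (fun x => g' x * phi₁ x - q.val x * phi₁' x) 0 x := fun x =>
    (((d3 x).mul (hasDerivAt_phi₁ x)).sub ((d1 x).mul (hasDerivAt_phi₁' x))).congr_deriv (by ring)
  have w2 : ∀ x, HasDerivAt (fun x => g' x * phi₂ x - q.val x * phi₂' x) 0 x := fun x =>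
    (((d3 x).mul (hasDerivAt_phi₂ x)).sub ((d1 x).mul (hasDerivAt_phi₂' x))).congr_deriv (by ring)
  have c1 : ∀ x y, g' x * phi₁ x - q.val x * phi₁' x = g' y * phi₁ y - q.val y * phi₁' y :=
    is_const_of_deriv_eq_zero (fun x => (w1 x).differentiableAt) fun x => (w1 x).deriv
  have c2 : ∀ x y, g' x * phi₂ x - q.val x * phi₂' x = g' y * phi₂ y - q.val y * phi₂' y :=
    is_const_of_deriv_eq_zero (fun x => (w2 x).differentiableAt) fun x => (w2 x).deriv
  have g0 : g' 0 = 0 := by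
    have h1 := (d1 0)
    have h2 : HasDerivAt (fun x => q.val (-x)) (-g' 0) 0 := by
      have := (HasDerivAt.scomp (0:ℝ) (by simpa using d1 0 : HasDerivAt q.val (g' 0) (-0)) (hasDerivAt_neg 0))
      simpa [Function.comp_def] using this
    simp only [EvenFun.val_neg] at h2
    have := h1.unique h2
    linarith
  have h20 : phi₂' 0 = 0 := by simp [phi₂', phi₁, kS_zero]
  have z2 : ∀ x, g' x * phi₂ x - q.val x * phi₂' x = 0 := fun x => by
    rw [c2 x 0, g0, h20]; ring
  have z1 : ∀ x, g' x * phi₁ x - q.val x * phi₁' x = 0 := by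
    have ht0 : Tendsto (fun x => (kC x ^ 2)⁻¹) atTop (𝓝 0) := by
      have := tendsto_inv_kC_four.sqrt
      rw [Real.sqrt_zero] at this
      refine this.congr fun x => ?_
      rw [Real.sqrt_inv, show kC x ^ 4 = (kC x ^ 2) ^ 2 by ring, Real.sqrt_sq (by positivity)]
    have ht : Tendsto (fun x => g' x * phi₁ x - q.val x * phi₁' x) atTop (𝓝 0) := by
      refine squeeze_zero_norm (a := fun x => (K + ‖evL M‖ * ‖q‖ * 5) * (kC x ^ 2)⁻¹) (fun x => ?_) ?_
      · rw [Real.norm_eq_abs]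
        refine (abs_sub _ _).trans ?_
        rw [abs_mul, abs_mul, add_mul]
        refine add_le_add ?_ ?_
        · exact mul_le_mul (hK x) (abs_phi₁_le x) (abs_nonneg _) ((abs_nonneg _).trans (hK x))
        · rw [mul_assoc]
          exact mul_le_mul (q.abs_val_le x) (abs_phi₁'_le x) (abs_nonneg _) (by positivity)
      · simpa using ht0.const_mul (K + ‖evL M‖ * ‖q‖ * 5)
    intro x
    refine tendsto_nhds_unique (tendsto_const_nhds.congr fun y => c1 x y) ht
  have hq0 : ∀ x, q.val x = 0 := fun x => by
    have hw := wronskian_phi x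
    have h3 : q.val x * (-8 * kc) = 0 := by
      rw [← hw]; linear_combination phi₁ x * z2 x - phi₂ x * z1 x
    have := kc_pos
    rcases mul_eq_zero.1 h3 with h | h
    · exact h
    · linarith
  exact EvenFun.ext_val fun x => by rw [hpq, hq0, EvenFun.val_zero, mul_zero]

/-- A preimage of p is sought as p + q, where q'' = (3-9Θ)q - 9Θp. The source 9Θp decays like Θ for
every bounded p, so the Green's function applies. For higher regularity, the preimage r found one
order lower satisfies r = p + 3(1+D²/3)⁻¹(Θr), whose second term gains a derivative. -/
lemma opL_surjective : Function.Surjective (opL M β) := by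
  suffices h : ∀ k : ℕ, Function.Surjective (opL (k + 1) β) by
    obtain ⟨k, rfl⟩ := Nat.exists_eq_succ_of_ne_zero (NeZero.ne M)
    exact h k
  intro k
  induction k with
  | zero =>
    intro p
    obtain ⟨v, v', hv⟩ := exists_green (h := fun x => 9 * (kC x ^ 2)⁻¹ * p.val x)
      (((((continuous_kC.pow 2).inv₀ fun x => pow_ne_zero _ (kC_ne x))).const_mul 9).mul p.continuous_val)
      (fun x => by rw [kC_neg, p.val_neg]) (K := 9 * (‖evL 1‖ * ‖p‖)) (fun x => by
        rw [abs_mul, abs_mul, abs_of_pos (inv_kC_sq_pos x), abs_of_pos (by norm_num : (0:ℝ) < 9)]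
        have := mul_le_mul_of_nonneg_right (p.abs_val_le x) (inv_kC_sq_pos x).le
        linarith)
    obtain ⟨q, hq⟩ := (hv β hβ).exists_val (hv 0 (by norm_num))
    have e := (hv 0 (by norm_num)).eq_opB₀ hβ hq (q := (3 : ℝ) • opM 1 β (thetaE 1 β) (p + q)) fun x => by
      rw [EvenFun.val_smul, EvenFun.val_opM, EvenFun.val_add, val_thetaE 1 hβ, hq, kdvProfile_eq]
      ring
    refine ⟨p + q, ?_⟩
    rw [opL_apply, ← map_smul]
    exact sub_eq_of_eq_add (congrArg _ e)
  | succ k ih =>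
    intro p
    obtain ⟨p', hp'⟩ := EvenFun.exists_lower (M := k + 1) (N := k + 1 + 1) (Nat.le_succ _) p
    obtain ⟨r, hr⟩ := ih p'
    obtain ⟨q, hq⟩ := EvenFun.exists_opB₀_raise hβ (opM (k + 1) β (thetaE (k + 1) β) r)
    have hr' : ∀ x, r.val x = p.val x + 3 * q.val x := fun x => by
      have := congrArg (fun s => s.val x) hr
      simp only [opL_apply, EvenFun.val_sub, EvenFun.val_smul] at this
      rw [hq, ← hp']; linarith
    refine ⟨p + (3 : ℝ) • q, EvenFun.ext_val fun x => ?_⟩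
    have e := EvenFun.val_opB₀_eq hβ hβ
      (p := opM (k + 1 + 1) β (thetaE (k + 1 + 1) β) (p + (3 : ℝ) • q))
      (q := opM (k + 1) β (thetaE (k + 1) β) r) (fun y => by
        rw [EvenFun.val_opM, EvenFun.val_opM, val_thetaE _ hβ, val_thetaE _ hβ, hr', EvenFun.val_add,
          EvenFun.val_smul]) x
    rw [opL_apply, EvenFun.val_sub, EvenFun.val_smul, EvenFun.val_add, EvenFun.val_smul, e, hq]
    ring

/-- The linearization at the KdV profile is invertible on even functions. -/
lemma exists_opL_equiv : ∃ L : EvenFun M β ≃L[ℝ] EvenFun M β, ∀ p, L p = opL M β p :=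
  ⟨ContinuousLinearEquiv.ofBijective (opL M β) (LinearMap.ker_eq_bot.2 (opL_injective M hβ))
    (LinearMap.range_eq_top.2 (opL_surjective M hβ)), fun _ => rfl⟩

end Linearized

/-! ### Lipschitz estimates, uniformly in a small parameter -/

section Uniform
variable {X Y Z W : Type*} [NormedAddCommGroup X] [NormedAddCommGroup Y]
  [NormedSpace ℝ Y] [NormedAddCommGroup Z] [NormedSpace ℝ Z] [NormedAddCommGroup W] [NormedSpace ℝ W]

/-- `f` is bounded and Lipschitz on `s` with constant `c`. -/
structure BddLip (s : Set X) (f : X → Y) (c : ℝ) : Prop where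
  bdd : ∀ x ∈ s, ‖f x‖ ≤ c
  lip : ∀ x ∈ s, ∀ y ∈ s, ‖f x - f y‖ ≤ c * ‖x - y‖

lemma BddLip.bilin {s : Set X} {f : X → Y} {g : X → Z} {c d k : ℝ} (hf : BddLip s f c)
    (hg : BddLip s g d) (B : Y →L[ℝ] Z →L[ℝ] W) (hc : 0 ≤ c) (hB : ‖B‖ ≤ k) :
    BddLip s (fun x => B (f x) (g x)) (2 * k * c * d) := by
  have hk := (norm_nonneg B).trans hB
  have hle : ∀ (y : Y) (z : Z) {a b : ℝ}, 0 ≤ a → ‖y‖ ≤ a → ‖z‖ ≤ b → ‖B y z‖ ≤ k * a * b :=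
    fun y z a b ha hy hz => (B.le_opNorm₂ y z).trans (by gcongr)
  refine ⟨fun x hx => ?_, fun x hx y hy => ?_⟩
  · have hd : 0 ≤ d := (norm_nonneg _).trans (hg.bdd x hx)
    have := hle _ _ hc (hf.bdd x hx) (hg.bdd x hx)
    have h2 : 0 ≤ k * c * d := by positivity
    linarith
  · have e : B (f x) (g x) - B (f y) (g y) = B (f x - f y) (g x) + B (f y) (g x - g y) := by
      simp only [map_sub, _root_.sub_apply]; abel
    rw [e]
    refine (norm_add_le _ _).trans ?_
    have h1 := hle _ _ (by positivity) (hf.lip x hx y hy) (hg.bdd x hx)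
    have h2 := hle _ _ hc (hf.bdd y hy) (hg.lip x hx y hy)
    linarith

omit [NormedSpace ℝ Y] in
lemma BddLip.add {s : Set X} {f g : X → Y} {c d : ℝ} (hf : BddLip s f c) (hg : BddLip s g d) :
    BddLip s (fun x => f x + g x) (c + d) := by
  refine ⟨fun x hx => (norm_add_le _ _).trans (add_le_add (hf.bdd x hx) (hg.bdd x hx)),
    fun x hx y hy => ?_⟩
  rw [add_sub_add_comm, add_mul]
  exact (norm_add_le _ _).trans (add_le_add (hf.lip x hx y hy) (hg.lip x hx y hy))

lemma BddLip.comp {s : Set X} {f : X → Y} {c k : ℝ} (hf : BddLip s f c) (A : Y →L[ℝ] Z)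
    (hA : ‖A‖ ≤ k) : BddLip s (fun x => A (f x)) (k * c) := by
  have hk := (norm_nonneg A).trans hA
  refine ⟨fun x hx => (A.le_of_opNorm_le hA _).trans (mul_le_mul_of_nonneg_left (hf.bdd x hx) hk),
    fun x hx y hy => ?_⟩
  rw [← map_sub, mul_assoc]
  exact (A.le_of_opNorm_le hA _).trans (mul_le_mul_of_nonneg_left (hf.lip x hx y hy) hk)

/-- `f ε` is `O(w ε)` and Lipschitz with constant `O(w ε)` on `s` as `ε → 0+`. -/
def UnifLip (s : Set X) (f : ℝ → X → Y) (w : ℝ → ℝ) : Prop :=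
  ∃ C, 0 ≤ C ∧ ∀ᶠ ε in 𝓝[>] (0:ℝ), BddLip s (f ε) (C * w ε)

variable {s : Set X} {f g : ℝ → X → Y} {w : ℝ → ℝ}

omit [NormedSpace ℝ Y] in
lemma UnifLip.add (hf : UnifLip s f w) (hg : UnifLip s g w) :
    UnifLip s (fun ε x => f ε x + g ε x) w := by
  obtain ⟨C, hC, h1⟩ := hf
  obtain ⟨D, hD, h2⟩ := hg
  refine ⟨C + D, add_nonneg hC hD, ?_⟩
  filter_upwards [h1, h2] with ε a b
  rw [add_mul]; exact a.add b

lemma UnifLip.comp (hf : UnifLip s f w) {A : ℝ → Y →L[ℝ] Z} {k : ℝ}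
    (hA : ∀ᶠ ε in 𝓝[>] (0:ℝ), ‖A ε‖ ≤ k) : UnifLip s (fun ε x => A ε (f ε x)) w := by
  obtain ⟨C, hC, h1⟩ := hf
  have hk : 0 ≤ k := by
    obtain ⟨ε, hε⟩ := hA.exists
    exact (norm_nonneg _).trans hε
  refine ⟨k * C, mul_nonneg hk hC, ?_⟩
  filter_upwards [h1, hA] with ε a b
  rw [mul_assoc]; exact a.comp _ b

lemma UnifLip.comp_small (hf : UnifLip s f fun _ => 1) {A : ℝ → Y →L[ℝ] Z} {k : ℝ} (hk : 0 ≤ k)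
    (hA : ∀ᶠ ε in 𝓝[>] (0:ℝ), ‖A ε‖ ≤ k * w ε) : UnifLip s (fun ε x => A ε (f ε x)) w := by
  obtain ⟨C, hC, h1⟩ := hf
  refine ⟨k * C, mul_nonneg hk hC, ?_⟩
  filter_upwards [h1, hA] with ε a b
  rw [mul_right_comm, ← mul_one C, ← mul_assoc (k * w ε), mul_one]
  simpa using a.comp _ b

lemma UnifLip.bilin {g : ℝ → X → Z} (hf : UnifLip s f w) (hg : UnifLip s g fun _ => 1)
    (hw : ∀ ε, 0 ≤ w ε) {B : ℝ → Y →L[ℝ] Z →L[ℝ] W} {k : ℝ} (hB : ∀ᶠ ε in 𝓝[>] (0:ℝ), ‖B ε‖ ≤ k) :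
    UnifLip s (fun ε x => B ε (f ε x) (g ε x)) w := by
  obtain ⟨C, hC, h1⟩ := hf
  obtain ⟨D, hD, h2⟩ := hg
  have hk : 0 ≤ k := by
    obtain ⟨ε, hε⟩ := hB.exists
    exact le_trans (norm_nonneg (B ε)) hε
  refine ⟨2 * k * C * D, by positivity, ?_⟩
  filter_upwards [h1, h2, hB] with ε a b c
  have := a.bilin b (B ε) (mul_nonneg hC (hw ε)) c
  convert this using 1; ring

lemma UnifLip.sq_smul (hf : UnifLip s f fun _ => 1) {c : ℝ → ℝ} {k : ℝ} (hk : 0 ≤ k)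
    (hc : ∀ᶠ ε in 𝓝[>] (0:ℝ), |c ε| ≤ k * ε ^ 2) :
    UnifLip s (fun ε x => c ε • f ε x) fun ε => ε ^ 2 := by
  refine hf.comp_small (A := fun ε => c ε • ContinuousLinearMap.id ℝ Y) hk ?_
  filter_upwards [hc] with ε h
  refine ContinuousLinearMap.opNorm_le_bound _ (by positivity) fun y => ?_
  rw [_root_.smul_apply, ContinuousLinearMap.id_apply, norm_smul, Real.norm_eq_abs]
  exact mul_le_mul_of_nonneg_right h (norm_nonneg _)

lemma UnifLip.id_of_bounded {s : Set X} {K : ℝ} (hs : ∀ x ∈ s, ‖x‖ ≤ K) : UnifLip s (fun _ x => x) fun _ => 1 := by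
  refine ⟨max K 1, zero_le_one.trans (le_max_right _ _), Eventually.of_forall fun ε => ⟨fun x hx => ?_, fun x _ y _ => ?_⟩⟩
  · rw [mul_one]; exact (hs x hx).trans (le_max_left _ _)
  · rw [mul_one]; exact le_mul_of_one_le_left (norm_nonneg _) (le_max_right _ _)

/-! ### Inverses of operators close to the identity -/

variable [CompleteSpace Y]

lemma isUnit_one_add {a : Y →L[ℝ] Y} (h : ‖a‖ ≤ 1 / 2) : IsUnit (1 + a) := by
  have := isUnit_one_sub_of_norm_lt_one (x := -a) (by rw [norm_neg]; linarith)
  rwa [sub_neg_eq_add] at this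

lemma inverse_one_add_eq {a : Y →L[ℝ] Y} (h : ‖a‖ ≤ 1 / 2) :
    Ring.inverse (1 + a) - 1 = -(a * Ring.inverse (1 + a)) := by
  have := Ring.mul_inverse_cancel _ (isUnit_one_add h)
  rw [add_mul, one_mul] at this
  rw [sub_eq_iff_eq_add, eq_neg_add_iff_add_eq, add_comm]
  exact this

lemma norm_inverse_one_add_le {a : Y →L[ℝ] Y} (h : ‖a‖ ≤ 1 / 2) : ‖Ring.inverse (1 + a)‖ ≤ 2 := by
  have e : Ring.inverse (1 + a) = 1 - a * Ring.inverse (1 + a) := by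
    rw [sub_eq_add_neg, ← inverse_one_add_eq h]; abel
  have h1 : ‖Ring.inverse (1 + a)‖ ≤ 1 + 1 / 2 * ‖Ring.inverse (1 + a)‖ := by
    conv_lhs => rw [e]
    refine (norm_sub_le _ _).trans (add_le_add ContinuousLinearMap.norm_id_le ?_)
    exact (norm_mul_le _ _).trans (mul_le_mul_of_nonneg_right h (norm_nonneg _))
  linarith

lemma norm_inverse_one_add_sub_one_le {a : Y →L[ℝ] Y} (h : ‖a‖ ≤ 1 / 2) :
    ‖Ring.inverse (1 + a) - 1‖ ≤ 2 * ‖a‖ := by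
  rw [inverse_one_add_eq h, norm_neg]
  refine (norm_mul_le _ _).trans ?_
  have := mul_le_mul_of_nonneg_left (norm_inverse_one_add_le h) (norm_nonneg a)
  linarith

lemma norm_inverse_one_add_sub_le {a b : Y →L[ℝ] Y} (ha : ‖a‖ ≤ 1 / 2) (hb : ‖b‖ ≤ 1 / 2) :
    ‖Ring.inverse (1 + a) - Ring.inverse (1 + b)‖ ≤ 4 * ‖a - b‖ := by
  have e : Ring.inverse (1 + a) - Ring.inverse (1 + b)
      = Ring.inverse (1 + a) * (b - a) * Ring.inverse (1 + b) := by
    have h1 := Ring.inverse_mul_cancel _ (isUnit_one_add ha)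
    have h2 := Ring.mul_inverse_cancel _ (isUnit_one_add hb)
    calc Ring.inverse (1 + a) - Ring.inverse (1 + b)
        = Ring.inverse (1 + a) * ((1 + b) * Ring.inverse (1 + b))
          - Ring.inverse (1 + a) * (1 + a) * Ring.inverse (1 + b) := by rw [h1, h2, mul_one, one_mul]
      _ = _ := by noncomm_ring
  rw [e]
  refine (norm_mul_le _ _).trans ?_
  refine (mul_le_mul (norm_mul_le _ _) (norm_inverse_one_add_le hb) (norm_nonneg _) (by positivity)).trans ?_
  rw [norm_sub_rev b a]
  have := mul_le_mul_of_nonneg_right (norm_inverse_one_add_le ha) (norm_nonneg (a - b))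
  linarith

lemma UnifLip.inverse_sub_one {f : ℝ → X → Y →L[ℝ] Y} (hf : UnifLip s f fun ε => ε ^ 2) :
    UnifLip s (fun ε x => Ring.inverse (1 + f ε x) - 1) fun ε => ε ^ 2 := by
  obtain ⟨C, hC, h1⟩ := hf
  have hsmall : ∀ᶠ ε in 𝓝[>] (0:ℝ), C * ε ^ 2 < 1 / 2 := by
    have : Tendsto (fun ε : ℝ => C * ε ^ 2) (𝓝[>] 0) (𝓝 (C * 0 ^ 2)) :=
      (((continuous_id.pow 2).const_mul C).tendsto 0).mono_left nhdsWithin_le_nhds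
    exact this.eventually (gt_mem_nhds (by norm_num))
  refine ⟨4 * C, by positivity, ?_⟩
  filter_upwards [h1, hsmall] with ε h hε
  have hx : ∀ x ∈ s, ‖f ε x‖ ≤ 1 / 2 := fun x hx => (h.bdd x hx).trans hε.le
  refine ⟨fun x hxs => ?_, fun x hxs y hys => ?_⟩
  · refine (norm_inverse_one_add_sub_one_le (hx x hxs)).trans ?_
    have := h.bdd x hxs
    have h0 := norm_nonneg (f ε x)
    linarith
  · rw [sub_sub_sub_cancel_right]
    refine (norm_inverse_one_add_sub_le (hx x hxs) (hx y hys)).trans ?_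
    have := h.lip x hxs y hys
    linarith

end Uniform

/-! ### The rescaled equation -/

section Equation
variable {X : Type*} [NormedAddCommGroup X] [NormedSpace ℝ X]

/-- The numerator of the rescaled nonlinearity. -/
def numer (m : X →L[ℝ] X →L[ℝ] X) (T : X →L[ℝ] X) (q : X →L[ℝ] X →L[ℝ] X) (γ e : ℝ) (θ : X) : X :=
  (3 / 2 : ℝ) • m θ θ + e • m θ (m θ θ) - (1 / 2 : ℝ) • q θ θ + (γ * e) • m (q θ θ) (T θ)

/-- The rescaled nonlinearity: the numerator divided by `(1 + e θ)²`. -/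
def nonlin (m : X →L[ℝ] X →L[ℝ] X) (T : X →L[ℝ] X) (q : X →L[ℝ] X →L[ℝ] X) (γ e : ℝ) (θ : X) : X :=
  Ring.inverse (1 + e • m θ) (Ring.inverse (1 + e • m θ) (numer m T q γ e θ))

variable [CompleteSpace X] {m : X →L[ℝ] X →L[ℝ] X} {T B : ℝ → X →L[ℝ] X} {q : ℝ → X →L[ℝ] X →L[ℝ] X}
  {γ : ℝ → ℝ} {B₀ : X →L[ℝ] X} {Θ : X} {K : ℝ}

/-- Up to `O(ε²)`, the nonlinearity is `3/2 θ² - 1/2 (i tanh(εD) θ)²`. -/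
lemma unifLip_nonlin_sub {s : Set X} (hs : ∀ x ∈ s, ‖x‖ ≤ K)
    (hT : ∀ᶠ ε in 𝓝[>] (0:ℝ), ‖T ε‖ ≤ K) (hq : ∀ᶠ ε in 𝓝[>] (0:ℝ), ‖q ε‖ ≤ K)
    (hγ : ∀ᶠ ε in 𝓝[>] (0:ℝ), |γ ε| ≤ 1) :
    UnifLip s (fun ε θ => nonlin m (T ε) (q ε) (γ ε) (ε ^ 2) θ
      - ((3 / 2 : ℝ) • m θ θ - (1 / 2 : ℝ) • q ε θ θ)) (fun ε => ε ^ 2) := by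
  have hm : ∀ᶠ _ε in 𝓝[>] (0:ℝ), ‖m‖ ≤ ‖m‖ := Eventually.of_forall fun _ => le_rfl
  have one_nn : ∀ _ε : ℝ, (0:ℝ) ≤ 1 := fun _ => zero_le_one
  have hsq : ∀ᶠ ε in 𝓝[>] (0:ℝ), |ε ^ 2| ≤ 1 * ε ^ 2 := Eventually.of_forall fun ε => by
    rw [abs_of_nonneg (sq_nonneg ε), one_mul]
  have hγ' : ∀ᶠ ε in 𝓝[>] (0:ℝ), |γ ε * ε ^ 2| ≤ 1 * ε ^ 2 := hγ.mono fun ε h => by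
    rw [abs_mul, abs_of_nonneg (sq_nonneg ε)]; exact mul_le_mul_of_nonneg_right h (sq_nonneg ε)
  have hid : UnifLip s (fun _ x => x) fun _ => 1 := UnifLip.id_of_bounded hs
  have hmm : UnifLip s (fun _ x => m x x) fun _ => 1 := hid.bilin hid one_nn (B := fun _ => m) hm
  have hqq : UnifLip s (fun ε x => q ε x x) fun _ => 1 := hid.bilin hid one_nn (B := q) hq
  have hTx : UnifLip s (fun ε x => T ε x) fun _ => 1 := hid.comp (A := T) hT
  have h3 : UnifLip s (fun _ x => m x (m x x)) fun _ => 1 := hid.bilin hmm one_nn (B := fun _ => m) hm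
  have h4 : UnifLip s (fun ε x => m (q ε x x) (T ε x)) fun _ => 1 :=
    hqq.bilin hTx one_nn (B := fun _ => m) hm
  have h5 := (h3.sq_smul zero_le_one hsq).add (h4.sq_smul zero_le_one hγ')
  have hmop : UnifLip s (fun ε x => ε ^ 2 • m x) fun ε => ε ^ 2 :=
    UnifLip.sq_smul (f := fun _ x => m x) (hid.comp (A := fun _ => m) hm) zero_le_one hsq
  have hR := hmop.inverse_sub_one
  set R : ℝ → X → X →L[ℝ] X := fun ε x => Ring.inverse (1 + ε ^ 2 • m x) with hRd
  have hle : ∀ᶠ ε in 𝓝[>] (0:ℝ), ε ^ 2 ≤ 1 := by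
    filter_upwards [Ioo_mem_nhdsGT (zero_lt_one (α := ℝ))] with ε hε
    exact pow_le_one₀ hε.1.le hε.2.le
  have weaken : ∀ {Y : Type _} [NormedAddCommGroup Y] [NormedSpace ℝ Y] {f : ℝ → X → Y},
      UnifLip s f (fun ε => ε ^ 2) → UnifLip s f fun _ => 1 := by
    rintro Y _ _ f ⟨C, hC, h⟩
    refine ⟨C, hC, ?_⟩
    filter_upwards [h, hle] with ε a b
    have h2 : C * ε ^ 2 ≤ C * 1 := mul_le_mul_of_nonneg_left b hC
    exact ⟨fun x hx => (a.bdd x hx).trans h2, fun x hx y hy =>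
      (a.lip x hx y hy).trans (mul_le_mul_of_nonneg_right h2 (norm_nonneg _))⟩
  have hnum : UnifLip s (fun ε x => numer m (T ε) (q ε) (γ ε) (ε ^ 2) x) fun _ => 1 := by
    have a1 := hmm.comp (A := fun _ => (3 / 2 : ℝ) • ContinuousLinearMap.id ℝ X)
      (Eventually.of_forall fun _ => le_rfl)
    have a2 := hqq.comp (A := fun _ => (-(1 / 2) : ℝ) • ContinuousLinearMap.id ℝ X)
      (Eventually.of_forall fun _ => le_rfl)
    have := (a1.add a2).add (weaken h5)
    convert this using 3
    simp only [numer, _root_.smul_apply, _root_.neg_apply, ContinuousLinearMap.id_apply, neg_smul]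
    abel
  have happ : ∀ᶠ _ε in 𝓝[>] (0:ℝ), ‖ContinuousLinearMap.id ℝ (X →L[ℝ] X)‖ ≤ 1 :=
    Eventually.of_forall fun _ => ContinuousLinearMap.norm_id_le
  have sq_nn : ∀ ε : ℝ, 0 ≤ ε ^ 2 := fun ε => sq_nonneg ε
  have r1 := hR.bilin hnum sq_nn (B := fun _ => ContinuousLinearMap.id ℝ (X →L[ℝ] X)) happ
  have r2 := hR.bilin (weaken r1) sq_nn (B := fun _ => ContinuousLinearMap.id ℝ (X →L[ℝ] X)) happ
  -- Writing the inverse as 1 + R, the two applications give (1+R)²n = n + 2Rn + R²n, while n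
  -- differs from its leading part by the explicit O(ε²) terms.
  have := ((r1.add r1).add r2).add h5
  convert this using 3
  simp only [nonlin, numer, _root_.sub_apply, ContinuousLinearMap.id_apply,
    one_apply_eq_self, map_sub]
  abel

/-- Estimates for the rescaled equation near `ε = 0`, compared with its limit, the stationary
KdV equation. -/
structure IsKdVPerturbation (m : X →L[ℝ] X →L[ℝ] X) (T B : ℝ → X →L[ℝ] X)
    (q : ℝ → X →L[ℝ] X →L[ℝ] X) (γ : ℝ → ℝ) (B₀ : X →L[ℝ] X) (Θ : X) (K : ℝ) : Prop where
  m_comm : ∀ x y, m x y = m y x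
  q_comm : ∀ᶠ ε in 𝓝[>] (0:ℝ), ∀ x y, q ε x y = q ε y x
  T_le : ∀ᶠ ε in 𝓝[>] (0:ℝ), ‖T ε‖ ≤ K
  q_le : ∀ᶠ ε in 𝓝[>] (0:ℝ), ‖q ε‖ ≤ K
  γ_le : ∀ᶠ ε in 𝓝[>] (0:ℝ), |γ ε| ≤ 1
  B_le : ∀ᶠ ε in 𝓝[>] (0:ℝ), ‖B ε - B₀‖ ≤ K * ε ^ 2
  qΘ_le : ∀ᶠ ε in 𝓝[>] (0:ℝ), ‖q ε Θ‖ ≤ K * ε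
  qΘΘ_le : ∀ᶠ ε in 𝓝[>] (0:ℝ), ‖q ε Θ Θ‖ ≤ K * ε ^ 2
  fixed : Θ = B₀ ((3 / 2 : ℝ) • m Θ Θ)

/-- The deviation of the equation from its linearization at `Θ`. -/
lemma IsKdVPerturbation.remainder (h : IsKdVPerturbation m T B q γ B₀ Θ K) :
    ∃ C, 0 ≤ C ∧ ∀ᶠ ε in 𝓝[>] (0:ℝ),
      ‖B ε (nonlin m (T ε) (q ε) (γ ε) (ε ^ 2) Θ) - Θ‖ ≤ C * ε ^ 2 ∧
      ∀ r, 0 ≤ r → r ≤ 1 → ∀ x ∈ Metric.closedBall Θ r, ∀ y ∈ Metric.closedBall Θ r,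
        ‖(B ε (nonlin m (T ε) (q ε) (γ ε) (ε ^ 2) x) - (3 : ℝ) • B₀ (m Θ x))
          - (B ε (nonlin m (T ε) (q ε) (γ ε) (ε ^ 2) y) - (3 : ℝ) • B₀ (m Θ y))‖
          ≤ C * (r + ε) * ‖x - y‖ := by
  have hK0 : 0 ≤ K := by
    obtain ⟨ε, hε⟩ := h.T_le.exists
    exact (norm_nonneg _).trans hε
  set s := Metric.closedBall Θ 1 with hs
  have hsb : ∀ x ∈ s, ‖x‖ ≤ max K (‖Θ‖ + 1) := fun x hx => by
    rw [hs, mem_closedBall_iff_norm] at hx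
    refine le_trans ?_ (le_max_right _ _)
    have := norm_le_norm_add_norm_sub' x Θ
    linarith
  have hKm : K ≤ max K (‖Θ‖ + 1) := le_max_left _ _
  have hB : ∀ᶠ ε in 𝓝[>] (0:ℝ), ‖B ε‖ ≤ ‖B₀‖ + K := by
    filter_upwards [h.B_le, Ioo_mem_nhdsGT (zero_lt_one (α := ℝ))] with ε h1 hε
    have h2 : K * ε ^ 2 ≤ K := mul_le_of_le_one_right hK0 (pow_le_one₀ hε.1.le hε.2.le)
    have := norm_le_norm_add_norm_sub' (B ε) B₀
    linarith
  have hid : UnifLip s (fun _ x => x) fun _ => 1 := UnifLip.id_of_bounded hsb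
  have hmm : UnifLip s (fun _ x => m x x) fun _ => 1 :=
    hid.bilin hid (fun _ => zero_le_one) (B := fun _ => m) (Eventually.of_forall fun _ => le_rfl)
  have g1 := UnifLip.comp_small (f := fun _ x => (3 / 2 : ℝ) • m x x) (A := fun ε => B ε - B₀)
    (w := fun ε => ε ^ 2)
    (hmm.comp (A := fun _ => (3 / 2 : ℝ) • ContinuousLinearMap.id ℝ X)
      (Eventually.of_forall fun _ => le_rfl)) hK0 h.B_le
  have g2 := (unifLip_nonlin_sub (m := m) hsb (h.T_le.mono fun _ a => a.trans hKm)
    (h.q_le.mono fun _ a => a.trans hKm) h.γ_le).comp (A := B) hB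
  obtain ⟨C, hC, hg⟩ := g1.add g2
  set b := ‖B₀‖ + K with hb
  have hb0 : 0 ≤ b := by positivity
  refine ⟨C + b * K + 3 / 2 * ‖B₀‖ * ‖m‖ * 2, by positivity, ?_⟩
  filter_upwards [hg, h.q_comm, h.q_le, h.qΘ_le, h.qΘΘ_le, hB, Ioo_mem_nhdsGT (zero_lt_one (α := ℝ))]
    with ε hg hqc hq hqΘ hqΘΘ hBε hε
  have hε0 : 0 ≤ ε := hε.1.le
  -- G collects everything that is O(ε²) both in value and in Lipschitz constant. What remains is
  -- the KdV quadratic term and the q term.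
  set G : X → X := fun x => (B ε - B₀) ((3 / 2 : ℝ) • m x x)
    + B ε (nonlin m (T ε) (q ε) (γ ε) (ε ^ 2) x - ((3 / 2 : ℝ) • m x x - (1 / 2 : ℝ) • q ε x x)) with hG
  have dec : ∀ x, B ε (nonlin m (T ε) (q ε) (γ ε) (ε ^ 2) x)
      = G x + (3 / 2 : ℝ) • B₀ (m x x) - (1 / 2 : ℝ) • B ε (q ε x x) := fun x => by
    simp only [hG, map_sub, map_smul, _root_.sub_apply]
    module
  have hsqle : ε ^ 2 ≤ ε := by nlinarith [hε.1, hε.2]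
  constructor
  · have e : B ε (nonlin m (T ε) (q ε) (γ ε) (ε ^ 2) Θ) - Θ = G Θ - (1 / 2 : ℝ) • B ε (q ε Θ Θ) := by
      have hf := h.fixed
      rw [map_smul] at hf
      rw [dec, ← hf]; abel
    rw [e]
    refine (norm_sub_le _ _).trans ?_
    have h1 := hg.bdd Θ (Metric.mem_closedBall_self zero_le_one)
    have h2 : ‖(1 / 2 : ℝ) • B ε (q ε Θ Θ)‖ ≤ b * K * ε ^ 2 := by
      rw [norm_smul, Real.norm_of_nonneg (by norm_num)]
      have := (B ε).le_of_opNorm_le hBε (q ε Θ Θ)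
      have h3 := mul_le_mul_of_nonneg_left hqΘΘ hb0
      have h4 := norm_nonneg (B ε (q ε Θ Θ))
      linarith
    have h3 : 0 ≤ 3 / 2 * ‖B₀‖ * ‖m‖ * 2 * ε ^ 2 := by positivity
    calc _ ≤ C * ε ^ 2 + b * K * ε ^ 2 := add_le_add h1 h2
      _ ≤ _ := by linarith
  · intro r hr0 hr1 x hx y hy
    have hxs : x ∈ s := Metric.closedBall_subset_closedBall hr1 hx
    have hys : y ∈ s := Metric.closedBall_subset_closedBall hr1 hy
    rw [mem_closedBall_iff_norm] at hx hy
    -- Symmetry of the product gives x² - y² - 2Θ(x-y) = (x-Θ)(x-y) + (y-Θ)(x-y), small of order r.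
    -- No linear part is removed from q, because q(Θ,·) is already O(ε).
    have e : (B ε (nonlin m (T ε) (q ε) (γ ε) (ε ^ 2) x) - (3 : ℝ) • B₀ (m Θ x))
          - (B ε (nonlin m (T ε) (q ε) (γ ε) (ε ^ 2) y) - (3 : ℝ) • B₀ (m Θ y))
        = (G x - G y) + ((3 / 2 : ℝ) • B₀ (m (x - Θ) (x - y) + m (y - Θ) (x - y))
          - (1 / 2 : ℝ) • B ε (q ε x (x - y) + q ε y (x - y))) := by
      rw [dec, dec]
      simp only [map_sub, map_add, _root_.sub_apply, smul_sub, smul_add, h.m_comm y x, hqc y x]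
      module
    rw [e]
    have a1 := hg.lip x hxs y hys
    have n0 := norm_nonneg (x - y)
    have a2 : ‖m (x - Θ) (x - y) + m (y - Θ) (x - y)‖ ≤ 2 * ‖m‖ * r * ‖x - y‖ := by
      refine (norm_add_le _ _).trans ?_
      have b1 := (m.le_opNorm₂ (x - Θ) (x - y)).trans
        (mul_le_mul_of_nonneg_right (mul_le_mul_of_nonneg_left hx (norm_nonneg m)) n0)
      have b2 := (m.le_opNorm₂ (y - Θ) (x - y)).trans
        (mul_le_mul_of_nonneg_right (mul_le_mul_of_nonneg_left hy (norm_nonneg m)) n0)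
      linarith
    have hqx : ∀ z, ‖z - Θ‖ ≤ r → ‖q ε z (x - y)‖ ≤ K * (r + ε) * ‖x - y‖ := fun z hz => by
      have e2 : q ε z (x - y) = q ε Θ (x - y) + q ε (z - Θ) (x - y) := by
        simp only [map_sub, _root_.sub_apply]; abel
      rw [e2]
      refine (norm_add_le _ _).trans ?_
      have b1 := (q ε Θ).le_of_opNorm_le hqΘ (x - y)
      have b2 := ((q ε).le_opNorm₂ (z - Θ) (x - y)).trans
        (mul_le_mul_of_nonneg_right (mul_le_mul hq hz (norm_nonneg _) hK0) n0)
      linarith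
    have a3 : ‖q ε x (x - y) + q ε y (x - y)‖ ≤ 2 * (K * (r + ε) * ‖x - y‖) :=
      (norm_add_le _ _).trans (by linarith [hqx x hx, hqx y hy])
    have a4 : ‖(3 / 2 : ℝ) • B₀ (m (x - Θ) (x - y) + m (y - Θ) (x - y))‖
        ≤ 3 / 2 * ‖B₀‖ * ‖m‖ * 2 * r * ‖x - y‖ := by
      rw [norm_smul, Real.norm_of_nonneg (by norm_num)]
      have := (B₀.le_opNorm (m (x - Θ) (x - y) + m (y - Θ) (x - y))).trans
        (mul_le_mul_of_nonneg_left a2 (norm_nonneg B₀))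
      linarith
    have a5 : ‖(1 / 2 : ℝ) • B ε (q ε x (x - y) + q ε y (x - y))‖ ≤ b * K * (r + ε) * ‖x - y‖ := by
      rw [norm_smul, Real.norm_of_nonneg (by norm_num)]
      have := ((B ε).le_of_opNorm_le hBε (q ε x (x - y) + q ε y (x - y))).trans
        (mul_le_mul_of_nonneg_left a3 hb0)
      linarith
    refine (norm_add_le _ _).trans ((add_le_add a1 ((norm_sub_le _ _).trans (add_le_add a4 a5))).trans ?_)
    have c1 : C * ε ^ 2 * ‖x - y‖ ≤ C * (r + ε) * ‖x - y‖ := by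
      gcongr; linarith
    have c2 : 3 / 2 * ‖B₀‖ * ‖m‖ * 2 * r * ‖x - y‖ ≤ 3 / 2 * ‖B₀‖ * ‖m‖ * 2 * (r + ε) * ‖x - y‖ := by
      gcongr; linarith
    linarith

/-- Existence, local uniqueness and nondegeneracy of the solution near `Θ`. -/
theorem IsKdVPerturbation.exists_fixed (h : IsKdVPerturbation m T B q γ B₀ Θ K) (L : X ≃L[ℝ] X)
    (hL : ∀ x, L x = x - (3 : ℝ) • B₀ (m Θ x)) :
    ∃ r C, 0 < r ∧ 0 ≤ C ∧ ∀ᶠ ε in 𝓝[>] (0:ℝ),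
      (∃ θ, ‖θ - Θ‖ ≤ C * ε ^ 2 ∧ B ε (nonlin m (T ε) (q ε) (γ ε) (ε ^ 2) θ) = θ) ∧
      (∀ θ θ', ‖θ - Θ‖ ≤ r → ‖θ' - Θ‖ ≤ r → B ε (nonlin m (T ε) (q ε) (γ ε) (ε ^ 2) θ) = θ →
        B ε (nonlin m (T ε) (q ε) (γ ε) (ε ^ 2) θ') = θ' → θ = θ') ∧
      (∀ (θ : X) (D : X →L[ℝ] X), ‖θ - Θ‖ < r → HasFDerivAt (fun x => B ε (nonlin m (T ε) (q ε) (γ ε) (ε ^ 2) x)) D θ →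
        IsUnit (1 - D)) := by
  obtain ⟨C, hC, hev⟩ := h.remainder
  set l := ‖(L.symm : X →L[ℝ] X)‖ with hl
  have hl0 : 0 ≤ l := norm_nonneg _
  -- Chosen so that lCr ≤ 1/4. With ε < r the Lipschitz constant lC(r+ε) of the iteration is at most
  -- 1/2.
  set r : ℝ := min 1 (1 / (4 * (l * C + 1))) with hr
  have hD : 0 < l * C + 1 := by positivity
  have hr0 : 0 < r := lt_min one_pos (by positivity)
  have hr1 : r ≤ 1 := min_le_left _ _
  have hrC : l * C * r ≤ 1 / 4 := by
    have h1 : r ≤ 1 / (4 * (l * C + 1)) := min_le_right _ _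
    have h2 : l * C * r ≤ (l * C + 1) * r := by nlinarith
    have h3 : (l * C + 1) * r ≤ (l * C + 1) * (1 / (4 * (l * C + 1))) := mul_le_mul_of_nonneg_left h1 hD.le
    have h4 : (l * C + 1) * (1 / (4 * (l * C + 1))) = 1 / 4 := by field_simp
    linarith
  refine ⟨r, 2 * l * C, hr0, by positivity, ?_⟩
  have hsm : ∀ᶠ ε in 𝓝[>] (0:ℝ), 2 * l * C * ε ^ 2 < r := by
    have : Tendsto (fun ε : ℝ => 2 * l * C * ε ^ 2) (𝓝[>] 0) (𝓝 (2 * l * C * 0 ^ 2)) :=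
      (((continuous_id.pow 2).const_mul _).tendsto 0).mono_left nhdsWithin_le_nhds
    exact this.eventually (gt_mem_nhds (by simpa using hr0))
  filter_upwards [hev, hsm, Ioo_mem_nhdsGT hr0] with ε ⟨hΘ, hlip⟩ hε hεr
  have hε0 : 0 < ε := hεr.1
  set F : X → X := fun x => B ε (nonlin m (T ε) (q ε) (γ ε) (ε ^ 2) x) with hF
  set N : X → X := fun x => F x - (3 : ℝ) • B₀ (m Θ x) with hN
  have hNlip : ∀ x ∈ Metric.closedBall Θ r, ∀ y ∈ Metric.closedBall Θ r,
      l * ‖N x - N y‖ ≤ 1 / 2 * ‖x - y‖ := fun x hx y hy => by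
    have h1 := hlip r hr0.le hr1 x hx y hy
    have h2 : C * (r + ε) ≤ C * (2 * r) := mul_le_mul_of_nonneg_left (by linarith [hεr.2]) hC
    have h3 := mul_le_mul_of_nonneg_left (h1.trans (mul_le_mul_of_nonneg_right h2 (norm_nonneg _))) hl0
    have h4 : l * (C * (2 * r) * ‖x - y‖) = 2 * (l * C * r) * ‖x - y‖ := by ring
    rw [h4] at h3
    refine h3.trans (mul_le_mul_of_nonneg_right ?_ (norm_nonneg _))
    linarith
  -- The simplified Newton map: the linear part at Θ is moved to the left-hand side and inverted,
  -- leaving a contraction with the same fixed points as F.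
  set Ψ : X → X := fun x => L.symm (N x) with hΨ
  have hfix : ∀ x, Ψ x = x ↔ F x = x := fun x => by
    simp only [hΨ]
    rw [ContinuousLinearEquiv.symm_apply_eq, hL]
    simp only [hN]
    constructor
    · intro e; exact sub_left_injective e
    · intro e; rw [e]
  have hΨlip : ∀ x ∈ Metric.closedBall Θ r, ∀ y ∈ Metric.closedBall Θ r,
      ‖Ψ x - Ψ y‖ ≤ 1 / 2 * ‖x - y‖ := fun x hx y hy => by
    simp only [hΨ]
    rw [← map_sub]
    exact ((L.symm : X →L[ℝ] X).le_opNorm _).trans (hNlip x hx y hy)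
  have hΨΘ : ‖Ψ Θ - Θ‖ ≤ l * C * ε ^ 2 := by
    have e : Ψ Θ - Θ = L.symm (F Θ - Θ) := by
      refine L.injective ?_
      simp only [hΨ, hN]
      rw [map_sub, L.apply_symm_apply, L.apply_symm_apply, hL Θ]
      abel
    rw [e]
    refine ((L.symm : X →L[ℝ] X).le_opNorm _).trans ?_
    rw [mul_assoc]
    exact mul_le_mul_of_nonneg_left hΘ hl0
  refine ⟨?_, ?_, ?_⟩
  · set ρ := 2 * l * C * ε ^ 2 with hρ
    have hρ0 : 0 ≤ ρ := by positivity
    have hsub : Metric.closedBall Θ ρ ⊆ Metric.closedBall Θ r := Metric.closedBall_subset_closedBall hε.le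
    have hΘρ : Θ ∈ Metric.closedBall Θ ρ := Metric.mem_closedBall_self hρ0
    have hmaps : MapsTo Ψ (Metric.closedBall Θ ρ) (Metric.closedBall Θ ρ) := by
      intro x hx
      have h1 := hΨlip x (hsub hx) Θ (hsub hΘρ)
      rw [mem_closedBall_iff_norm] at hx ⊢
      have h2 := norm_sub_le_norm_sub_add_norm_sub (Ψ x) (Ψ Θ) Θ
      have h3 : l * C * ε ^ 2 = ρ / 2 := by rw [hρ]; ring
      linarith
    have hcontr : ContractingWith (1 / 2) (hmaps.restrict Ψ _ _) := by
      refine ⟨by norm_num, LipschitzWith.of_dist_le_mul fun x y => ?_⟩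
      have := hΨlip x (hsub x.2) y (hsub y.2)
      simpa [dist_eq_norm, Subtype.dist_eq] using this
    obtain ⟨y, hy, hfy, -⟩ := ContractingWith.exists_fixedPoint' (Metric.isClosed_closedBall.isComplete)
      hmaps hcontr hΘρ (edist_ne_top _ _)
    exact ⟨y, mem_closedBall_iff_norm.1 hy, (hfix y).1 hfy⟩
  · intro θ θ' hθ hθ' e e'
    have h1 := hΨlip θ (mem_closedBall_iff_norm.2 hθ) θ' (mem_closedBall_iff_norm.2 hθ')
    rw [(hfix θ).2 e, (hfix θ').2 e'] at h1
    have h2 := norm_nonneg (θ - θ')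
    exact sub_eq_zero.1 (norm_eq_zero.1 (by linarith))
  · intro θ D hθ hDer
    have hA : HasFDerivAt (fun x => (3 : ℝ) • B₀ (m Θ x)) ((3 : ℝ) • B₀.comp (m Θ)) θ :=
      ((3 : ℝ) • B₀.comp (m Θ)).hasFDerivAt
    have hND : HasFDerivAt Ψ ((L.symm : X →L[ℝ] X).comp (D - (3 : ℝ) • B₀.comp (m Θ))) θ :=
      (L.symm : X →L[ℝ] X).hasFDerivAt.comp θ (hDer.sub hA)
    set E := (L.symm : X →L[ℝ] X).comp (D - (3 : ℝ) • B₀.comp (m Θ)) with hE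
    -- The derivative inherits the Lipschitz constant 1/2, and 1 - D = L(1 - E) is then a product of
    -- invertible operators.
    have hEn : ‖E‖ ≤ 1 / 2 := by
      have hnb : Metric.closedBall Θ r ∈ 𝓝 θ :=
        Filter.mem_of_superset (Metric.isOpen_ball.mem_nhds (mem_ball_iff_norm.2 hθ)) Metric.ball_subset_closedBall
      have := hND.le_of_lip' (C := 1 / 2) (by norm_num) (by
        filter_upwards [hnb] with x hx
        exact hΨlip x hx θ (mem_closedBall_iff_norm.2 hθ.le))
      exact this
    have hu : IsUnit (1 - E) := isUnit_one_sub_of_norm_lt_one (by linarith)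
    have e : 1 - D = (L : X →L[ℝ] X) * (1 - E) := by
      ext x
      change x - D x = L (x - L.symm (D x - (3 : ℝ) • B₀ (m Θ x)))
      rw [map_sub, L.apply_symm_apply, hL]
      abel
    rw [e]
    have huL : IsUnit (L : X →L[ℝ] X) := ⟨⟨L, L.symm, by ext x; simp, by ext x; simp⟩, rfl⟩
    exact huL.mul hu

end Equation

/-! ### The rescaled equation on the spaces of even functions -/

section Operators
variable {M : ℕ} [NeZero M] {β : ℝ}

open EvenFun

lemma IsSymbol.mono {σ : ℝ → ℂ} {C D : ℝ} (h : IsSymbol σ C) (hCD : C ≤ D) : IsSymbol σ D :=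
  ⟨h.meas, fun ξ => (h.bound ξ).trans hCD⟩

lemma norm_opT_le {d C : ℝ} (hd : 0 < d) (h : d ^ 2 * β ^ 2 < 1 / 2) (h₀ : IsSymbol (tSym d 0) C)
    (h₁ : IsSymbol (tSym d β) C) : ‖opT M β d‖ ≤ C := by
  refine ContinuousLinearMap.opNorm_le_bound _ h₀.nonneg fun p => ?_
  rw [← incl.norm_map, ← incl.norm_map p, opT_coe hd h]
  exact (pairMul _ _).le_of_opNorm_le (norm_pairMul_le h₀ h₁) _

lemma sq_mul_sq_lt {ε : ℝ} (h : ε ^ 2 ≤ (3 - β ^ 2) / 9) : ε ^ 2 * β ^ 2 < 1 / 2 := by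
  nlinarith [sq_nonneg β, sq_nonneg (β ^ 2 - 3 / 2)]

/-- Neumann series. The worst frequency is k = 0 on the line Im = β, and even there the factor 1-ε²
keeps the norm below 1. -/
lemma isUnit_one_sub_opT {ε : ℝ} (hε : 0 < ε) (hβ : β ^ 2 < 3) (h : ε ^ 2 ≤ (3 - β ^ 2) / 9) :
    IsUnit (1 - (1 - ε ^ 2) • opT M β ε) := by
  obtain ⟨h1, h2⟩ := exists_norm_tSym_le hε hβ h
  have h0 := (exists_norm_tSym_le (b := 0) hε (by norm_num) (by nlinarith [sq_nonneg β])).2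
  have hs := sq_mul_sq_lt h
  have hle : tauR (-(ε ^ 2 * 0 ^ 2)) ≤ tauR (-(ε ^ 2 * β ^ 2)) :=
    tauR_antitone (by linarith) (by nlinarith [mul_nonneg (sq_nonneg ε) (sq_nonneg β)])
  have h3 := norm_opT_le (M := M) hε hs (h0.mono hle) h2
  have h4 : 0 ≤ 1 - ε ^ 2 := by nlinarith [sq_nonneg β]
  refine isUnit_one_sub_of_norm_lt_one ?_
  rw [norm_smul, Real.norm_of_nonneg h4]
  exact (mul_le_mul_of_nonneg_left h3 h4).trans_lt h1

variable (M β) in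
/-- The operator `d² (1 - γ tanh(dD) / (dD))⁻¹`. -/
def opB (d γ : ℝ) : EvenFun M β →L[ℝ] EvenFun M β := d ^ 2 • Ring.inverse (1 - γ • opT M β d)

lemma opB_spec {d γ : ℝ} (hu : IsUnit (1 - γ • opT M β d)) (p : EvenFun M β) :
    opB M β d γ p - γ • opT M β d (opB M β d γ p) = d ^ 2 • p := by
  have h : ∀ q, (1 - γ • opT M β d) (Ring.inverse (1 - γ • opT M β d) q) = q := fun q => by
    have := congrArg (fun A : EvenFun M β →L[ℝ] EvenFun M β => A q) (Ring.mul_inverse_cancel _ hu)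
    exact this
  have h2 := h (d ^ 2 • p)
  rw [map_smul] at h2
  exact h2

lemma coeFn_real_smul (c : ℝ) (Φ : L2) : ((c • Φ : L2) : ℝ → ℂ) =ᵐ[volume] fun ξ => (c : ℂ) * Φ ξ := by
  filter_upwards [Lp.coeFn_smul c Φ] with ξ h
  rw [h]; simp

/-- The resolvent is defined as an abstract inverse, which makes smoothness in (d, γ) immediate.
This identity recovers its symbol, so that the frequency estimates apply to it. -/
lemma opB_ae {d γ : ℝ} (hd : 0 < d) (h : d ^ 2 * β ^ 2 < 1 / 2) (hu : IsUnit (1 - γ • opT M β d))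
    (p : EvenFun M β) :
    (∀ᵐ ξ, (1 - (γ : ℂ) * tSym d 0 ξ) * (incl (opB M β d γ p)).1 ξ = (d : ℂ) ^ 2 * (incl p).1 ξ) ∧
    ∀ᵐ ξ, (1 - (γ : ℂ) * tSym d β ξ) * (incl (opB M β d γ p)).2 ξ = (d : ℂ) ^ 2 * (incl p).2 ξ := by
  set q := opB M β d γ p with hq
  have e := congrArg incl (opB_spec hu p)
  rw [← hq, map_sub, map_smul, map_smul, opT_coe hd h] at e
  have gen : ∀ (b : ℝ) (Φ Ψ : L2), IsSymbol (tSym d b) 6 →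
      Φ - γ • symMul (tSym d b) Φ = (d ^ 2) • Ψ →
      ∀ᵐ ξ, (1 - (γ : ℂ) * tSym d b ξ) * Φ ξ = (d : ℂ) ^ 2 * Ψ ξ := by
    intro b Φ Ψ hs he
    have he' : ∀ᵐ ξ, (Φ - γ • symMul (tSym d b) Φ : L2) ξ = (d ^ 2 • Ψ : L2) ξ := by
      rw [he]; exact Eventually.of_forall fun _ => rfl
    filter_upwards [he', Lp.coeFn_sub Φ (γ • symMul (tSym d b) Φ), coeFn_real_smul γ (symMul (tSym d b) Φ),
      symMul_coe hs Φ, coeFn_real_smul (d ^ 2) Ψ] with ξ h1 h2 h3 h4 h5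
    rw [h2, Pi.sub_apply, h3, h4, h5] at h1
    push_cast at h1
    linear_combination h1
  have hb0 : (d : ℂ) ∈ admissible 0 := ofReal_mem_admissible hd (by simp)
  have hb1 : (d : ℂ) ∈ admissible β := ofReal_mem_admissible hd h
  exact ⟨gen 0 _ _ (isSymbol_tSym hb0) (congrArg Prod.fst e), gen β _ _ (isSymbol_tSym hb1) (congrArg Prod.snd e)⟩

lemma norm_sub_symMul_le {σ τ : ℝ → ℂ} {C D : ℝ} (hτ : IsSymbol τ D)
    (h : ∀ ξ, ‖σ ξ - τ ξ‖ ≤ C) {Φ Ψ : L2} (he : ∀ᵐ ξ, Ψ ξ = σ ξ * Φ ξ) :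
    ‖Ψ - symMul τ Φ‖ ≤ C * ‖Φ‖ := by
  refine Lp.norm_le_mul_norm_of_ae_le_mul ?_
  filter_upwards [he, symMul_coe hτ Φ, Lp.coeFn_sub Ψ (symMul τ Φ)] with ξ h1 h2 h3
  rw [h3, Pi.sub_apply, h1, h2, ← sub_mul, norm_mul]
  exact mul_le_mul_of_nonneg_right (h ξ) (norm_nonneg _)

lemma norm_opB_sub_opB₀_le {ε : ℝ} (hε : 0 < ε) (hβ : β ^ 2 < 3) (h : ε ^ 2 ≤ (3 - β ^ 2) / 9) :
    ‖opB M β ε (1 - ε ^ 2) - opB₀ M β‖ ≤ 189 / ((3 - β ^ 2) / 3) ^ 2 * ε ^ 2 := by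
  have h3 : 0 < 3 - β ^ 2 := by linarith
  have hC : 0 ≤ 189 / ((3 - β ^ 2) / 3) ^ 2 * ε ^ 2 := by positivity
  have hs := sq_mul_sq_lt h
  have h0 : ε ^ 2 ≤ (3 - 0 ^ 2) / 9 := by nlinarith [sq_nonneg β]
  refine ContinuousLinearMap.opNorm_le_bound _ hC fun p => ?_
  rw [← incl.norm_map, ← incl.norm_map p, _root_.sub_apply, map_sub, opB₀_coe hβ]
  obtain ⟨e0, e1⟩ := opB_ae hε hs (isUnit_one_sub_opT hε hβ h) p
  have hne : ∀ b : ℝ, b ^ 2 < 3 → ε ^ 2 ≤ (3 - b ^ 2) / 9 → ∀ ξ,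
      1 - ((1 - ε ^ 2 : ℝ) : ℂ) * tSym ε b ξ ≠ 0 := by
    intro b hb hb' ξ
    have h1 := norm_one_sub_tSym_ge hε hb hb' ξ
    have h4 : 0 < 3 - b ^ 2 := by linarith
    have := jap_pos ξ
    exact norm_pos_iff.1 (lt_of_lt_of_le (by positivity) h1)
  have gen : ∀ b : ℝ, (hb : b ^ 2 ≤ β ^ 2) → ∀ Φ Ψ : L2,
      (∀ᵐ ξ, (1 - ((1 - ε ^ 2 : ℝ) : ℂ) * tSym ε b ξ) * Ψ ξ = (ε : ℂ) ^ 2 * Φ ξ) →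
      ‖Ψ - symMul (kdvSym b) Φ‖ ≤ 189 / ((3 - β ^ 2) / 3) ^ 2 * ε ^ 2 * ‖Φ‖ := by
    intro b hb Φ Ψ he
    have hb3 : b ^ 2 < 3 := hb.trans_lt hβ
    have hb' : ε ^ 2 ≤ (3 - b ^ 2) / 9 := h.trans (by linarith)
    refine norm_sub_symMul_le (σ := fun ξ => (ε : ℂ) ^ 2 / (1 - ((1 - ε ^ 2 : ℝ) : ℂ) * tSym ε b ξ))
      (isSymbol_kdvSym hb3) (fun ξ => ?_) ?_
    · refine (norm_resolvent_sub_kdvSym_le hε hb3 hb' ξ).trans ?_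
      gcongr
    · filter_upwards [he] with ξ h1
      rw [div_mul_eq_mul_div, eq_div_iff (hne b hb3 hb' ξ), ← h1]; ring
  rw [Prod.norm_def]
  refine max_le ?_ ?_
  · exact (gen 0 (by nlinarith [sq_nonneg β]) _ _ e0).trans (mul_le_mul_of_nonneg_left (norm_fst_le _) hC)
  · exact (gen β le_rfl _ _ e1).trans (mul_le_mul_of_nonneg_left (norm_snd_le _) hC)

lemma opM_comm (p q : EvenFun M β) : opM M β p q = opM M β q p :=
  ext_val fun x => by rw [val_opM, val_opM, mul_comm]

lemma mulL_comm (Φ Ψ : L2) : mulL M Φ Ψ = mulL M Ψ Φ :=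
  evL_injective M (DFunLike.ext _ _ fun x => by rw [evL_mulL, evL_mulL, mul_comm])

lemma opQ_comm {d : ℝ} (hd : 0 < d) (h : d ^ 2 * β ^ 2 < 1 / 2) (p q : EvenFun M β) :
    opQ M β d p q = opQ M β d q p := by
  refine ext_val fun x => ?_
  have h1 := evL_fst (opQ M β d p q) x
  have h2 := evL_fst (opQ M β d q p) x
  rw [opQ_coe hd h, mulPair_fst, mulL_comm, ← mulPair_fst M, ← opQ_coe hd h, h2] at h1
  exact_mod_cast h1.symm

lemma norm_opQ_apply_le {d A C : ℝ} (hd : 0 < d) (h : d ^ 2 * β ^ 2 < 1 / 2) {p q : EvenFun M β}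
    (hp : ‖pairMul (hSym d 0) (hSym d β) (incl p)‖ ≤ A) (hq : ‖pairMul (hSym d 0) (hSym d β) (incl q)‖ ≤ C) :
    ‖opQ M β d p q‖ ≤ ‖mulPair M‖ * A * C := by
  rw [← incl.norm_map, opQ_coe hd h]
  have hA := (norm_nonneg _).trans hp
  exact ((mulPair M).le_opNorm₂ _ _).trans (by gcongr)

lemma norm_pairMul_hSym_le {d : ℝ} (hd : 0 < d) (h : d ^ 2 * β ^ 2 < 1 / 2) (p : L2Pair) :
    ‖pairMul (hSym d 0) (hSym d β) p‖ ≤ 12 * ‖p‖ :=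
  (pairMul _ _).le_of_opNorm_le (norm_pairMul_le (isSymbol_hSym (ofReal_mem_admissible hd (by simp)))
    (isSymbol_hSym (ofReal_mem_admissible hd h))) p

/-- `i tanh(εD) = O(ε)` on smoother functions. -/
lemma exists_norm_pairMul_hSym_le (hβ : β ^ 2 < 3) {p : EvenFun M β} {q : EvenFun (M + 1) β}
    (hpq : ∀ x, p.val x = q.val x) {d : ℝ} (hd : 0 < d) (h : d ^ 2 * β ^ 2 < 1 / 2) :
    ‖pairMul (hSym d 0) (hSym d β) (incl p)‖ ≤ 12 * d * ‖q‖ := by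
  have gen : ∀ b : ℝ, b ^ 2 < 3 → (d : ℂ) ∈ admissible b → ∀ Φ Ψ : L2, (∀ x, evL M Φ x = evL (M + 1) Ψ x) →
      ‖symMul (hSym d b) Φ‖ ≤ 12 * d * ‖Ψ‖ := by
    intro b hb hadm Φ Ψ he
    have e : Φ = symMul (japInv 1) Ψ := by
      refine evL_injective M (DFunLike.ext _ _ fun x => ?_)
      have := evL_symMul_japInv (M := M) (N := M + 1) (Nat.le_succ M) Ψ x
      rw [he, ← this, Nat.add_sub_cancel_left]
    have hs : IsSymbol (fun ξ => hSym d b ξ * japInv 1 ξ) (12 * d) := by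
      refine ⟨((isSymbol_hSym hadm).mul (isSymbol_japInv 1)).meas, fun ξ => ?_⟩
      have hj := jap_pos ξ
      rw [norm_mul, norm_japInv, pow_one]
      calc _ ≤ 12 * d * jap ξ * (jap ξ)⁻¹ := by
            gcongr; exact norm_hSym_le hd hadm hb ξ
        _ = 12 * d := by field_simp
    rw [e, symMul_comp (isSymbol_hSym hadm) (isSymbol_japInv 1)]
    exact (symMul _).le_of_opNorm_le (norm_symMul_le hs) _
  rw [Prod.norm_def, pairMul_fst, pairMul_snd]
  refine max_le ?_ ?_
  · refine (gen 0 (by norm_num) (ofReal_mem_admissible hd (by simp)) _ (incl q).1 fun x => ?_).trans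
      (mul_le_mul_of_nonneg_left q.norm_fst_incl_le (by positivity))
    rw [evL_fst, evL_fst, hpq]
  · refine (gen β hβ (ofReal_mem_admissible hd h) _ (incl q).2 fun x => ?_).trans
      (mul_le_mul_of_nonneg_left q.norm_snd_incl_le (by positivity))
    rw [evL_snd, evL_snd, hpq]

lemma eventually_sq_le {c : ℝ} (hc : 0 < c) : ∀ᶠ ε in 𝓝[>] (0:ℝ), 0 < ε ∧ ε ^ 2 ≤ c := by
  have h : ∀ᶠ ε in 𝓝 (0:ℝ), ε ^ 2 < c :=
    ((continuous_pow 2).tendsto (0:ℝ)).eventually (gt_mem_nhds (by simpa using hc))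
  filter_upwards [self_mem_nhdsWithin, h.filter_mono nhdsWithin_le_nhds] with ε h1 h2
  exact ⟨h1, h2.le⟩

variable (M) in
theorem exists_isKdVPerturbation (hβ : β ^ 2 < 3) : ∃ K, IsKdVPerturbation (opM M β) (opT M β)
    (fun ε => opB M β ε (1 - ε ^ 2)) (opQ M β) (fun ε => 1 - ε ^ 2) (opB₀ M β) (thetaE M β) K := by
  set n := ‖thetaE (M + 1) β‖
  set t := ‖thetaE M β‖
  set c := ‖mulPair M‖
  set e := 189 / ((3 - β ^ 2) / 3) ^ 2
  have h3 : 0 < 3 - β ^ 2 := by linarith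
  have hn : 0 ≤ n := norm_nonneg _
  have hc : 0 ≤ c := norm_nonneg (mulPair M)
  have he : 0 ≤ e := by positivity
  have hsm := eventually_sq_le (c := (3 - β ^ 2) / 9) (by linarith)
  have hk : 0 ≤ c * 144 + c * (12 * n) * 12 + c * (12 * n) * (12 * n) := by positivity
  -- The extra derivative of Θ is what makes i tanh(εD)Θ of size O(ε), hence the bounds for q(Θ,·)
  -- and q(Θ,Θ).
  have hΘ : ∀ x, (thetaE M β).val x = (thetaE (M + 1) β).val x := fun x => by
    rw [val_thetaE M hβ, val_thetaE (M + 1) hβ]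
  have p1 : 0 ≤ c * 144 := by positivity
  have p2 : 0 ≤ c * (12 * n) * 12 := by positivity
  have p3 : 0 ≤ c * (12 * n) * (12 * n) := by positivity
  refine ⟨6 + e + (c * 144 + c * (12 * n) * 12 + c * (12 * n) * (12 * n)), opM_comm, ?_, ?_, ?_, ?_, ?_, ?_, ?_,
    thetaE_eq M hβ⟩
  all_goals filter_upwards [hsm] with ε ⟨hε, hs⟩
  · exact opQ_comm hε (sq_mul_sq_lt hs)
  · refine (norm_opT_le hε (sq_mul_sq_lt hs) (isSymbol_tSym (ofReal_mem_admissible hε (by simp)))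
      (isSymbol_tSym (mem_admissible_of_small hε hs))).trans (by linarith)
  · refine ContinuousLinearMap.opNorm_le_bound₂ _ (by linarith) fun p q => ?_
    have h1 := norm_opQ_apply_le hε (sq_mul_sq_lt hs) (norm_pairMul_hSym_le hε (sq_mul_sq_lt hs) (incl p))
      (norm_pairMul_hSym_le hε (sq_mul_sq_lt hs) (incl q))
    rw [incl.norm_map, incl.norm_map] at h1
    refine h1.trans ?_
    have : c * (12 * ‖p‖) * (12 * ‖q‖) = c * 144 * ‖p‖ * ‖q‖ := by ring
    change c * (12 * ‖p‖) * (12 * ‖q‖) ≤ _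
    rw [this]
    gcongr
    linarith
  · rw [abs_le]; constructor <;> nlinarith [sq_nonneg β]
  · refine (norm_opB_sub_opB₀_le hε hβ hs).trans (mul_le_mul_of_nonneg_right ?_ (sq_nonneg _))
    change e ≤ _
    linarith
  · refine ContinuousLinearMap.opNorm_le_bound _ (by positivity) fun p => ?_
    have h1 := norm_opQ_apply_le hε (sq_mul_sq_lt hs) (exists_norm_pairMul_hSym_le hβ hΘ hε (sq_mul_sq_lt hs))
      (norm_pairMul_hSym_le hε (sq_mul_sq_lt hs) (incl p))
    rw [incl.norm_map] at h1
    refine h1.trans ?_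
    have : c * (12 * ε * n) * (12 * ‖p‖) = c * (12 * n) * 12 * ε * ‖p‖ := by ring
    change c * (12 * ε * n) * (12 * ‖p‖) ≤ _
    rw [this]
    gcongr
    linarith
  · have hH := exists_norm_pairMul_hSym_le hβ hΘ hε (sq_mul_sq_lt hs)
    refine (norm_opQ_apply_le hε (sq_mul_sq_lt hs) hH hH).trans ?_
    have : c * (12 * ε * n) * (12 * ε * n) = c * (12 * n) * (12 * n) * ε ^ 2 := by ring
    change c * (12 * ε * n) * (12 * ε * n) ≤ _
    rw [this]
    gcongr
    linarith

end Operators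

/-! ### Smooth dependence on the parameters -/

section Family
variable {M : ℕ} [NeZero M] {β : ℝ}

open EvenFun

variable (M β) in
/-- The map whose fixed points are the rescaled solitary waves. -/
def fixMap (d γ : ℝ) (θ : EvenFun M β) : EvenFun M β :=
  opB M β d γ (nonlin (opM M β) (opT M β d) (opQ M β d) γ (d ^ 2) θ)

lemma contDiffAt_ringInverse_comp {E X : Type*} [NormedAddCommGroup E] [NormedSpace ℝ E]
    [NormedAddCommGroup X] [NormedSpace ℝ X] [CompleteSpace X] {f : E → X →L[ℝ] X} {z : E}
    (hf : ContDiffAt ℝ ∞ f z) (hu : IsUnit (f z)) : ContDiffAt ℝ ∞ (fun y => Ring.inverse (f y)) z := by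
  obtain ⟨u, hu⟩ := hu
  have h := contDiffAt_ringInverse (n := ∞) ℝ u
  rw [hu] at h
  exact h.comp z hf

lemma contDiffAt_numer {E X : Type*} [NormedAddCommGroup E] [NormedSpace ℝ E]
    [NormedAddCommGroup X] [NormedSpace ℝ X] (m : X →L[ℝ] X →L[ℝ] X) {T : E → X →L[ℝ] X}
    {q : E → X →L[ℝ] X →L[ℝ] X} {γ e : E → ℝ} {θ : E → X} {z : E} (hT : ContDiffAt ℝ ∞ T z)
    (hq : ContDiffAt ℝ ∞ q z) (hγ : ContDiffAt ℝ ∞ γ z) (he : ContDiffAt ℝ ∞ e z)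
    (hθ : ContDiffAt ℝ ∞ θ z) :
    ContDiffAt ℝ ∞ (fun y => numer m (T y) (q y) (γ y) (e y) (θ y)) z := by
  have hm : ∀ {f g : E → X}, ContDiffAt ℝ ∞ f z → ContDiffAt ℝ ∞ g z →
      ContDiffAt ℝ ∞ (fun y => m (f y) (g y)) z := fun hf hg =>
    (contDiffAt_const.clm_apply hf).clm_apply hg
  have hqq : ContDiffAt ℝ ∞ (fun y => q y (θ y) (θ y)) z := (hq.clm_apply hθ).clm_apply hθ
  unfold numer
  exact (((contDiffAt_const.smul (hm hθ hθ)).add (he.smul (hm hθ (hm hθ hθ)))).sub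
    (contDiffAt_const.smul hqq)).add ((hγ.mul he).smul (hm hqq (hT.clm_apply hθ)))

/-- The wave has d = ε and γ = 1-ε², but the two parameters are kept independent so that γ can later
vary while the spatial scale is frozen. -/
lemma contDiffAt_fixMap {d γ : ℝ} {θ : EvenFun M β} (hd : 0 < d) (h : d ^ 2 * β ^ 2 < 1 / 2)
    (hu : IsUnit (1 - γ • opT M β d)) (hθ : IsUnit (1 + d ^ 2 • opM M β θ)) :
    ContDiffAt ℝ ∞ (fun z : (ℝ × ℝ) × EvenFun M β => fixMap M β z.1.1 z.1.2 z.2) ((d, γ), θ) := by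
  have h1 : ContDiffAt ℝ ∞ (fun z : (ℝ × ℝ) × EvenFun M β => z.1.1) ((d, γ), θ) := by fun_prop
  have h2 : ContDiffAt ℝ ∞ (fun z : (ℝ × ℝ) × EvenFun M β => z.1.2) ((d, γ), θ) := by fun_prop
  have h3 : ContDiffAt ℝ ∞ (fun z : (ℝ × ℝ) × EvenFun M β => z.2) ((d, γ), θ) := by fun_prop
  have hT : ContDiffAt ℝ ∞ (fun z : (ℝ × ℝ) × EvenFun M β => opT M β z.1.1) ((d, γ), θ) :=
    ContDiffAt.comp (g := opT M β) ((d, γ), θ) (contDiffAt_opT hd h) h1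
  have hQ : ContDiffAt ℝ ∞ (fun z : (ℝ × ℝ) × EvenFun M β => opQ M β z.1.1) ((d, γ), θ) :=
    ContDiffAt.comp (g := opQ M β) ((d, γ), θ) (contDiffAt_opQ hd h) h1
  have hB : ContDiffAt ℝ ∞ (fun z : (ℝ × ℝ) × EvenFun M β => opB M β z.1.1 z.1.2) ((d, γ), θ) :=
    (h1.pow 2).smul (contDiffAt_ringInverse_comp (contDiffAt_const.sub (h2.smul hT)) hu)
  have hI : ContDiffAt ℝ ∞ (fun z : (ℝ × ℝ) × EvenFun M β =>
      Ring.inverse (1 + z.1.1 ^ 2 • opM M β z.2)) ((d, γ), θ) :=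
    contDiffAt_ringInverse_comp (contDiffAt_const.add ((h1.pow 2).smul (contDiffAt_const.clm_apply h3))) hθ
  exact hB.clm_apply (hI.clm_apply (hI.clm_apply (contDiffAt_numer _ hT hQ h2 (h1.pow 2) h3)))

/-- A nondegenerate fixed point extends to a smooth family. -/
lemma exists_family {d γ : ℝ} {θ : EvenFun M β} (hd : 0 < d) (h : d ^ 2 * β ^ 2 < 1 / 2)
    (hu : IsUnit (1 - γ • opT M β d)) (hθ : IsUnit (1 + d ^ 2 • opM M β θ)) (hfix : fixMap M β d γ θ = θ)
    (hD : ∀ D : EvenFun M β →L[ℝ] EvenFun M β, HasFDerivAt (fixMap M β d γ) D θ → IsUnit (1 - D)) :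
    ∃ Ξ : ℝ × ℝ → EvenFun M β, Ξ (d, γ) = θ ∧ ContDiffAt ℝ ∞ Ξ (d, γ) ∧
      ∀ᶠ z in 𝓝 (d, γ), fixMap M β z.1 z.2 (Ξ z) = Ξ z := by
  set u : (ℝ × ℝ) × EvenFun M β := ((d, γ), θ) with hudef
  set G : (ℝ × ℝ) × EvenFun M β → EvenFun M β := fun z => z.2 - fixMap M β z.1.1 z.1.2 z.2 with hG
  have hF := contDiffAt_fixMap hd h hu hθ
  have hGc : ContDiffAt ℝ ∞ G u := contDiffAt_snd.sub hF
  have hFd := (hF.differentiableAt (by simp)).hasFDerivAt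
  set A := fderiv ℝ (fun z : (ℝ × ℝ) × EvenFun M β => fixMap M β z.1.1 z.1.2 z.2) u with hA
  have hpart : HasFDerivAt (fixMap M β d γ) (A ∘L .inr ℝ (ℝ × ℝ) (EvenFun M β)) θ :=
    hFd.comp θ (hasFDerivAt_prodMk_right (d, γ) θ)
  have hGd : fderiv ℝ G u = .snd ℝ (ℝ × ℝ) (EvenFun M β) - A :=
    (hasFDerivAt_snd.sub hFd).fderiv
  have hinv : (fderiv ℝ G u ∘L .inr ℝ (ℝ × ℝ) (EvenFun M β)).IsInvertible := by
    have e : fderiv ℝ G u ∘L .inr ℝ (ℝ × ℝ) (EvenFun M β) = 1 - A ∘L .inr ℝ (ℝ × ℝ) (EvenFun M β) := by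
      rw [hGd]; ext x; simp
    rw [e]
    obtain ⟨v, hv⟩ := hD _ hpart
    exact ⟨ContinuousLinearEquiv.ofUnit v, hv⟩
  refine ⟨hGc.implicitFunction (by simp) hinv, hGc.implicitFunction_apply_self (by simp) hinv,
    hGc.contDiffAt_implicitFunction (by simp) hinv, ?_⟩
  filter_upwards [hGc.eventually_apply_implicitFunction (by simp) hinv] with z hz
  have h0 : G u = 0 := by simp only [hG, hudef, hfix, sub_self]
  rw [h0] at hz
  exact (sub_eq_zero.1 hz).symm

lemma eventually_isUnit {d γ : ℝ} {Ξ : ℝ × ℝ → EvenFun M β} (hd : 0 < d) (h : d ^ 2 * β ^ 2 < 1 / 2)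
    (hu : IsUnit (1 - γ • opT M β d)) (hθ : IsUnit (1 + d ^ 2 • opM M β (Ξ (d, γ))))
    (hΞ : ContDiffAt ℝ ∞ Ξ (d, γ)) :
    ∀ᶠ z in 𝓝 (d, γ), IsUnit (1 - z.2 • opT M β z.1) ∧ IsUnit (1 + z.1 ^ 2 • opM M β (Ξ z)) := by
  have hT : ContinuousAt (fun z : ℝ × ℝ => opT M β z.1) (d, γ) :=
    ContinuousAt.comp (g := opT M β) (contDiffAt_opT hd h).continuousAt continuousAt_fst
  have h1 : ContinuousAt (fun z : ℝ × ℝ => 1 - z.2 • opT M β z.1) (d, γ) :=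
    continuousAt_const.sub (continuousAt_snd.smul hT)
  have h2 : ContinuousAt (fun z : ℝ × ℝ => 1 + z.1 ^ 2 • opM M β (Ξ z)) (d, γ) :=
    continuousAt_const.add ((continuousAt_fst.pow 2).smul
      ((opM M β).continuous.continuousAt.comp hΞ.continuousAt))
  exact (h1.eventually (Units.isOpen.mem_nhds hu)).and (h2.eventually (Units.isOpen.mem_nhds hθ))

variable (M β) in
/-- The rescaled equation at `ε` is solved uniquely and smoothly near the KdV profile: it has a
solution at distance `≤ C ε²` and at most one at distance `≤ r`. -/
structure IsBranchAt (r C ε : ℝ) : Prop where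
  exists_fix : ∃ θ : EvenFun M β, ‖θ - thetaE M β‖ ≤ C * ε ^ 2 ∧ fixMap M β ε (1 - ε ^ 2) θ = θ
  unique : ∀ θ θ' : EvenFun M β, ‖θ - thetaE M β‖ ≤ r → ‖θ' - thetaE M β‖ ≤ r →
    fixMap M β ε (1 - ε ^ 2) θ = θ → fixMap M β ε (1 - ε ^ 2) θ' = θ' → θ = θ'
  small : ε ^ 2 * β ^ 2 < 1 / 2
  unit : IsUnit (1 - (1 - ε ^ 2) • opT M β ε)
  unit_one_add : ∀ θ : EvenFun M β, ‖θ - thetaE M β‖ ≤ r → IsUnit (1 + ε ^ 2 • opM M β θ)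
  family : ∀ θ : EvenFun M β, ‖θ - thetaE M β‖ < r → fixMap M β ε (1 - ε ^ 2) θ = θ →
    ∃ Ξ : ℝ × ℝ → EvenFun M β, Ξ (ε, 1 - ε ^ 2) = θ ∧ ContDiffAt ℝ ∞ Ξ (ε, 1 - ε ^ 2) ∧
      ∀ᶠ z in 𝓝 (ε, 1 - ε ^ 2), fixMap M β z.1 z.2 (Ξ z) = Ξ z

variable (M) in
/-- The branch of rescaled solitary waves that bifurcates from the KdV profile. -/
theorem exists_branch (hβ : β ^ 2 < 3) :
    ∃ r C, 0 < r ∧ 0 ≤ C ∧ ∀ᶠ ε in 𝓝[>] (0:ℝ), IsBranchAt M β r C ε := by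
  obtain ⟨K, hK⟩ := exists_isKdVPerturbation M hβ
  obtain ⟨L, hL⟩ := exists_opL_equiv M hβ
  obtain ⟨r, C, hr, hC, hev⟩ := hK.exists_fixed L hL
  refine ⟨r, C, hr, hC, ?_⟩
  -- Below this bound ε²‖θ‖ is small enough, for every θ in the ball, that multiplication by 1 + ε²θ
  -- is invertible.
  have hc : 0 < 1 / (2 * (‖opM M β‖ * (‖thetaE M β‖ + r) + 1)) := by positivity
  filter_upwards [hev, eventually_sq_le (c := (3 - β ^ 2) / 9) (by linarith), eventually_sq_le hc]
    with ε ⟨h1, h2, h3⟩ ⟨hε, hs⟩ ⟨_, hs'⟩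
  have hun : ∀ θ : EvenFun M β, ‖θ - thetaE M β‖ ≤ r → IsUnit (1 + ε ^ 2 • opM M β θ) := by
    intro θ hθ
    refine isUnit_one_add ?_
    rw [norm_smul, Real.norm_of_nonneg (sq_nonneg ε)]
    have hn : ‖θ‖ ≤ ‖thetaE M β‖ + r := by
      have := norm_le_norm_add_norm_sub' θ (thetaE M β); linarith
    have hm : ‖opM M β θ‖ ≤ ‖opM M β‖ * (‖thetaE M β‖ + r) :=
      ((opM M β).le_opNorm θ).trans (mul_le_mul_of_nonneg_left hn (norm_nonneg _))
    have hnn : 0 ≤ ‖opM M β‖ * (‖thetaE M β‖ + r) := by positivity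
    rw [le_div_iff₀ (by positivity)] at hs'
    have := mul_le_mul_of_nonneg_left hm (sq_nonneg ε)
    nlinarith [sq_nonneg ε]
  have hsm := sq_mul_sq_lt hs
  have hu := isUnit_one_sub_opT (M := M) hε hβ hs
  exact ⟨h1, h2, hsm, hu, hun, fun θ hlt hfix =>
    exists_family hε hsm hu (hun θ hlt.le) hfix fun D hD => h3 θ D hlt hD⟩

end Family

/-! ### Pointwise form of the rescaled equation -/

section Pointwise
variable {M : ℕ} [NeZero M] {β : ℝ}

open EvenFun

lemma memLp_evL (Φ : L2) : MemLp (fun x => evL M Φ x) 2 := by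
  have : (fun x => evL M Φ x) = 𝓕⁻ (ampl M Φ) := funext fun x => evL_apply M Φ x
  rw [this]
  exact memLp_fourierInv (integrable_ampl M Φ) (memLp_ampl M Φ)

lemma EvenFun.memLp_val (p : EvenFun M β) : MemLp p.val 2 := (memLp_evL (M := M) (incl p).1).re

lemma EvenFun.integrable_val_mul (p q : EvenFun M β) : Integrable fun x => p.val x * q.val x :=
  p.memLp_val.integrable_mul q.memLp_val

lemma EvenFun.integrable_val_opM (p q : EvenFun M β) : Integrable (opM M β p q).val := by
  have : (opM M β p q).val = fun x => p.val x * q.val x := funext (val_opM p q)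
  rw [this]; exact p.integrable_val_mul q

lemma evL_opT {d : ℝ} (hd : 0 < d) (h : d ^ 2 * β ^ 2 < 1 / 2) (p : EvenFun M β) (x : ℝ) :
    ((opT M β d p).val x : ℂ) = 𝓕⁻ (fun ξ => tSym d 0 ξ * ampl M (incl p).1 ξ) x := by
  rw [← evL_fst, opT_coe hd h, pairMul_fst,
    evL_symMul (isSymbol_tSym (ofReal_mem_admissible hd (by simp)))]

lemma evL_opQ {d : ℝ} (hd : 0 < d) (h : d ^ 2 * β ^ 2 < 1 / 2) (p : EvenFun M β) (x : ℝ) :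
    ((opQ M β d p p).val x : ℂ) = 𝓕⁻ (fun ξ => hSym d 0 ξ * ampl M (incl p).1 ξ) x ^ 2 := by
  rw [← evL_fst, opQ_coe hd h, mulPair_fst, evL_mulL, pairMul_fst,
    evL_symMul (isSymbol_hSym (ofReal_mem_admissible hd (by simp))), sq]

lemma integrable_val_opQ {d : ℝ} (hd : 0 < d) (h : d ^ 2 * β ^ 2 < 1 / 2) (p : EvenFun M β) :
    Integrable (opQ M β d p p).val := by
  have hm := memLp_evL (M := M) (symMul (hSym d 0) (incl p).1)
  refine (hm.integrable_mul hm).re.congr (Eventually.of_forall fun x => ?_)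
  have h1 := evL_fst (opQ M β d p p) x
  rw [opQ_coe hd h, mulPair_fst, evL_mulL, pairMul_fst] at h1
  simp only [Pi.mul_apply]
  rw [h1]
  simp

lemma val_inverse_one_add {e : ℝ} {θ : EvenFun M β} (hu : IsUnit (1 + e • opM M β θ)) (p : EvenFun M β)
    (x : ℝ) : (Ring.inverse (1 + e • opM M β θ) p).val x * (1 + e * θ.val x) = p.val x := by
  have h1 : (1 + e • opM M β θ) (Ring.inverse (1 + e • opM M β θ) p) = p :=
    congrArg (fun A : EvenFun M β →L[ℝ] EvenFun M β => A p) (Ring.mul_inverse_cancel _ hu)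
  set y := Ring.inverse (1 + e • opM M β θ) p
  have h2 : y + e • opM M β θ y = p := h1
  rw [← h2, val_add, val_smul, val_opM]; ring

/-- Invertibility of the multiplication operator makes Θ a multiple of 1 + eθ, and Θ has no zero. -/
lemma one_add_val_ne_zero (hβ : β ^ 2 < 3) {e : ℝ} {θ : EvenFun M β} (hu : IsUnit (1 + e • opM M β θ))
    (x : ℝ) : 1 + e * θ.val x ≠ 0 := by
  intro h0
  have h1 := val_inverse_one_add hu (thetaE M β) x
  rw [h0, mul_zero, val_thetaE M hβ] at h1
  have h2 : 0 < kdvProfile x := by unfold kdvProfile; positivity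
  exact h2.ne h1

lemma val_numer {d γ : ℝ} (e : ℝ) (θ : EvenFun M β) (x : ℝ) :
    (numer (opM M β) (opT M β d) (opQ M β d) γ e θ).val x
      = 3 / 2 * θ.val x ^ 2 + e * θ.val x ^ 3 - 1 / 2 * (opQ M β d θ θ).val x
        + γ * e * ((opQ M β d θ θ).val x * (opT M β d θ).val x) := by
  rw [numer, val_add, val_sub, val_add, val_smul, val_smul, val_smul, val_smul, val_opM, val_opM, val_opM,
    val_opM]
  ring

lemma val_nonlin {d γ e : ℝ} {θ : EvenFun M β} (hu : IsUnit (1 + e • opM M β θ)) (x : ℝ) :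
    (nonlin (opM M β) (opT M β d) (opQ M β d) γ e θ).val x * (1 + e * θ.val x) ^ 2
      = (numer (opM M β) (opT M β d) (opQ M β d) γ e θ).val x := by
  rw [← val_inverse_one_add hu (numer (opM M β) (opT M β d) (opQ M β d) γ e θ) x,
    ← val_inverse_one_add hu (Ring.inverse (1 + e • opM M β θ) _) x, nonlin]
  ring

/-- The quotient N is a priori only in L². Solving N(1+eθ)² = numerator for N exhibits it as a sum
of products of L² functions, so its classical Fourier integral converges. -/
lemma integrable_val_nonlin {d γ e : ℝ} {θ : EvenFun M β} (hd : 0 < d) (h : d ^ 2 * β ^ 2 < 1 / 2)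
    (hu : IsUnit (1 + e • opM M β θ)) :
    Integrable (nonlin (opM M β) (opT M β d) (opQ M β d) γ e θ).val := by
  set N := nonlin (opM M β) (opT M β d) (opQ M β d) γ e θ with hN
  have hv : ∀ x, N.val x = 3 / 2 * (opM M β θ θ).val x + e * (opM M β θ (opM M β θ θ)).val x
      - 1 / 2 * (opQ M β d θ θ).val x + γ * e * (opM M β (opQ M β d θ θ) (opT M β d θ)).val x
      - (2 * e * (opM M β N θ).val x + e ^ 2 * (opM M β N (opM M β θ θ)).val x) := fun x => by
    have h1 := val_nonlin (d := d) (γ := γ) hu x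
    rw [← hN, val_numer] at h1
    simp only [val_opM]
    linear_combination h1
  rw [funext hv]
  exact (((((integrable_val_opM _ _).const_mul _).add ((integrable_val_opM _ _).const_mul _)).sub
    ((integrable_val_opQ hd h _).const_mul _)).add ((integrable_val_opM _ _).const_mul _)).sub
    (((integrable_val_opM _ _).const_mul _).add ((integrable_val_opM _ _).const_mul _))

/-- The classical Fourier transform of an integrable element. -/
lemma EvenFun.fourier_val_ae {p : EvenFun M β} (hp : Integrable p.val) :
    𝓕 (fun x => (p.val x : ℂ)) =ᵐ[volume] ampl M (incl p).1 := by
  have e : 𝓕⁻ (ampl M (incl p).1) = fun x => (p.val x : ℂ) := funext (fourierInv_ampl p)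
  have := fourier_fourierInv_ae (integrable_ampl M (incl p).1) (memLp_ampl M _) (by rw [e]; exact hp.ofReal)
  rwa [e] at this

lemma fourierMultiplier_congr {σ : ℝ → ℂ} {f g : ℝ → ℂ} (h : f =ᵐ[volume] g) :
    fourierMultiplier σ f = fourierMultiplier σ g := by
  have : 𝓕 f = 𝓕 g := funext fun ξ => Real.fourier_congr_ae h ξ
  rw [fourierMultiplier, fourierMultiplier, this]

lemma fourier_comp_mul {d : ℝ} (hd : 0 < d) (c : ℂ) (f : ℝ → ℂ) (ξ : ℝ) :
    𝓕 (fun x => c * f (d * x)) ξ = c * (d : ℂ)⁻¹ * 𝓕 f (ξ / d) := by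
  rw [Real.fourier_real_eq_integral_exp_smul, Real.fourier_real_eq_integral_exp_smul]
  have h := Measure.integral_comp_mul_left
    (fun y : ℝ => Complex.exp (↑(-2 * Real.pi * y * (ξ / d)) * Complex.I) • (c * f y)) d
  have e : ∀ x : ℝ, Complex.exp (↑(-2 * Real.pi * (d * x) * (ξ / d)) * Complex.I) • (c * f (d * x))
      = Complex.exp (↑(-2 * Real.pi * x * ξ) * Complex.I) • (c * f (d * x)) := fun x => by
    congr 4; field_simp
  rw [integral_congr_ae (Eventually.of_forall e)] at h
  rw [h, abs_of_pos (inv_pos.2 hd)]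
  have e2 : ∀ y : ℝ, Complex.exp (↑(-2 * Real.pi * y * (ξ / d)) * Complex.I) • (c * f y)
      = c * (Complex.exp (↑(-2 * Real.pi * y * (ξ / d)) * Complex.I) • f y) := fun y => by
    simp only [smul_eq_mul]; ring
  rw [integral_congr_ae (Eventually.of_forall e2), integral_const_mul, Complex.real_smul]
  push_cast; ring

lemma fourierInv_comp_mul {d : ℝ} (hd : 0 < d) (g : ℝ → ℂ) (x : ℝ) :
    𝓕⁻ (fun ξ => g (d⁻¹ * ξ)) x = d * 𝓕⁻ g (d * x) := by
  rw [fourierInv_real_eq, fourierInv_real_eq]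
  have h := Measure.integral_comp_mul_left
    (fun η : ℝ => Complex.exp (2 * Real.pi * η * (d * x : ℝ) * Complex.I) * g η) d⁻¹
  have e : ∀ ξ : ℝ, Complex.exp (2 * Real.pi * (d⁻¹ * ξ : ℝ) * (d * x : ℝ) * Complex.I) * g (d⁻¹ * ξ)
      = Complex.exp (2 * Real.pi * ξ * x * Complex.I) * g (d⁻¹ * ξ) := fun ξ => by
    have hdc : (d : ℂ) ≠ 0 := Complex.ofReal_ne_zero.2 hd.ne'
    congr 2; push_cast; field_simp
  rw [integral_congr_ae (Eventually.of_forall e)] at h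
  rw [h, inv_inv, abs_of_pos hd, Complex.real_smul]

/-- Dilation by d turns σ(D) into σ(dD); this produces the rescaled equation. -/
lemma fourierMultiplier_comp_mul {d : ℝ} (hd : 0 < d) (σ : ℝ → ℂ) (c : ℂ) (f : ℝ → ℂ) (x : ℝ) :
    fourierMultiplier σ (fun x => c * f (d * x)) x
      = c * 𝓕⁻ (fun ξ => σ (2 * Real.pi * (d * ξ)) * 𝓕 f ξ) (d * x) := by
  have e1 : (fun ξ : ℝ => σ (2 * Real.pi * ξ) * 𝓕 (fun x => c * f (d * x)) ξ)
      = fun ξ => (c * (d : ℂ)⁻¹) * (fun η => σ (2 * Real.pi * (d * η)) * 𝓕 f η) (d⁻¹ * ξ) := by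
    funext ξ
    rw [fourier_comp_mul hd]
    have : 2 * Real.pi * (d * (d⁻¹ * ξ)) = 2 * Real.pi * ξ := by field_simp
    simp only [this]
    rw [div_eq_inv_mul]; ring
  have hdc : (d : ℂ) ≠ 0 := Complex.ofReal_ne_zero.2 hd.ne'
  rw [fourierMultiplier, e1, fourierInv_const_mul,
    fourierInv_comp_mul hd (fun η => σ (2 * Real.pi * (d * η)) * 𝓕 f η), ← mul_assoc, mul_assoc c,
    inv_mul_cancel₀ hdc, mul_one]

lemma hSym_zero (d ξ : ℝ) : hSym d 0 ξ = Complex.I * (Real.tanh (2 * Real.pi * (d * ξ)) : ℂ) := by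
  have e : (d : ℂ) * lineVar 0 ξ = ((2 * Real.pi * (d * ξ) : ℝ) : ℂ) := by
    rw [lineVar_zero]; push_cast; ring
  rw [hSym, e, tau_sq_real, ← Complex.ofReal_mul, tanhc]
  split_ifs with h
  · rw [h]; simp
  · rw [mul_div_cancel₀ _ h]

lemma tSym_zero_eq_tanhc (d ξ : ℝ) : tSym d 0 ξ = (tanhc (2 * Real.pi * (d * ξ)) : ℂ) := by
  have e : (d : ℂ) * lineVar 0 ξ = ((2 * Real.pi * (d * ξ) : ℝ) : ℂ) := by
    rw [lineVar_zero]; push_cast; ring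
  rw [tSym, e, tau_sq_real]

lemma abs_tanhc_le_one (k : ℝ) : |tanhc k| ≤ 1 := by
  have h0 : tauR 0 = 1 := by
    simpa [tauR] using hasSum_two_div_lam_sq.tsum_eq
  have hre : ((k : ℂ) ^ 2).re = k ^ 2 := by rw [← Complex.ofReal_pow, Complex.ofReal_re]
  have h1 := norm_tau_le (w := (k : ℂ) ^ 2) (by rw [hre]; nlinarith [sq_nonneg k])
  rw [tau_sq_real, Complex.norm_real, Real.norm_eq_abs, hre] at h1
  exact h1.trans ((tauR_antitone (by norm_num) (sq_nonneg k)).trans h0.le)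

lemma one_sub_mul_tanhc_ne_zero {γ : ℝ} (h0 : 0 ≤ γ) (h1 : γ < 1) (k : ℝ) : 1 - γ * tanhc k ≠ 0 := by
  have := (abs_le.1 (abs_tanhc_le_one k)).2
  nlinarith

/-! ### The strain equation in rescaled variables -/

section Strain
variable {d γ : ℝ} {θ : EvenFun M β}

lemma hilbertStrip_kdvScale (hd : 0 < d) (h : d ^ 2 * β ^ 2 < 1 / 2) (hint : Integrable θ.val) (x : ℝ) :
    hilbertStrip (fun y => (kdvScale d θ.val y : ℂ)) x ^ 2
      = (d : ℂ) ^ 4 * ((opQ M β d θ θ).val (d * x) : ℂ) := by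
  have e : (fun y => (kdvScale d θ.val y : ℂ)) = fun y => (d : ℂ) ^ 2 * (θ.val (d * y) : ℂ) := by
    funext y; simp [kdvScale]
  rw [hilbertStrip, e, fourierMultiplier_comp_mul hd _ _ (fun z => (θ.val z : ℂ)), evL_opQ hd h]
  have e2 : 𝓕⁻ (fun ξ => hSym d 0 ξ * ampl M (incl θ).1 ξ) (d * x)
      = 𝓕⁻ (fun ξ => Complex.I * (Real.tanh (2 * Real.pi * (d * ξ)) : ℂ) * 𝓕 (fun z => (θ.val z : ℂ)) ξ)
        (d * x) := by
    refine Real.fourierInv_congr_ae ?_ _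
    filter_upwards [fourier_val_ae hint] with ξ hξ
    rw [hξ, hSym_zero]
  rw [e2]; ring

lemma tanhDivD_kdvScale (hd : 0 < d) (h : d ^ 2 * β ^ 2 < 1 / 2) (hint : Integrable θ.val) (x : ℝ) :
    tanhDivD (fun y => (kdvScale d θ.val y : ℂ)) x = (d : ℂ) ^ 2 * ((opT M β d θ).val (d * x) : ℂ) := by
  have e : (fun y => (kdvScale d θ.val y : ℂ)) = fun y => (d : ℂ) ^ 2 * (θ.val (d * y) : ℂ) := by
    funext y; simp [kdvScale]
  rw [tanhDivD, e, fourierMultiplier_comp_mul hd _ _ (fun z => (θ.val z : ℂ)), evL_opT hd h]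
  congr 1
  refine Real.fourierInv_congr_ae ?_ _
  filter_upwards [fourier_val_ae hint] with ξ hξ
  rw [hξ, tSym_zero_eq_tanhc]

lemma strainNonlinearity_kdvScale (hβ : β ^ 2 < 3) (hd : 0 < d) (h : d ^ 2 * β ^ 2 < 1 / 2)
    (hint : Integrable θ.val) (hθ : IsUnit (1 + d ^ 2 • opM M β θ)) :
    strainNonlinearity γ (fun y => (kdvScale d θ.val y : ℂ)) = fun x => (d : ℂ) ^ 4 *
      ((nonlin (opM M β) (opT M β d) (opQ M β d) γ (d ^ 2) θ).val (d * x) : ℂ) := by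
  funext x
  simp only [strainNonlinearity]
  rw [hilbertStrip_kdvScale hd h hint, tanhDivD_kdvScale hd h hint]
  have h1 := val_nonlin (d := d) (γ := γ) hθ (d * x)
  have h2 : (1 + (d : ℂ) ^ 2 * (θ.val (d * x) : ℂ)) ≠ 0 := by
    exact_mod_cast one_add_val_ne_zero hβ hθ (d * x)
  rw [val_numer] at h1
  have h3 := congrArg (fun t : ℝ => (t : ℂ)) h1
  simp only [kdvScale] at h3 ⊢
  push_cast at h3 ⊢
  rw [div_eq_iff (pow_ne_zero 2 h2)]
  linear_combination (-(d : ℂ) ^ 4) * h3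

/-- The right-hand side of the strain equation, in rescaled form. -/
theorem dispersionInv_kdvScale (hβ : β ^ 2 < 3) (hd : 0 < d) (h : d ^ 2 * β ^ 2 < 1 / 2)
    (hγ : ∀ k, 1 - γ * tanhc k ≠ 0) (hu : IsUnit (1 - γ • opT M β d))
    (hint : Integrable θ.val) (hθ : IsUnit (1 + d ^ 2 • opM M β θ)) (x : ℝ) :
    dispersionInv γ (strainNonlinearity γ (fun y => (kdvScale d θ.val y : ℂ))) x
      = (kdvScale d (fixMap M β d γ θ).val x : ℂ) := by
  rw [strainNonlinearity_kdvScale hβ hd h hint hθ, dispersionInv]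
  set N := nonlin (opM M β) (opT M β d) (opQ M β d) γ (d ^ 2) θ with hN
  rw [fourierMultiplier_comp_mul hd _ _ (fun z => (N.val z : ℂ))]
  have hdc : (d : ℂ) ≠ 0 := Complex.ofReal_ne_zero.2 hd.ne'
  have e : ((fixMap M β d γ θ).val (d * x) : ℂ) = (d : ℂ) ^ 2 *
      𝓕⁻ (fun ξ => (((1 - γ * tanhc (2 * Real.pi * (d * ξ)))⁻¹ : ℝ) : ℂ) * 𝓕 (fun z => (N.val z : ℂ)) ξ)
        (d * x) := by
    rw [← fourierInv_const_mul, ← fourierInv_ampl]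
    refine Real.fourierInv_congr_ae ?_ _
    filter_upwards [fourier_val_ae (integrable_val_nonlin (γ := γ) hd h hθ), (opB_ae hd h hu N).1] with ξ h1 h2
    rw [tSym_zero_eq_tanhc] at h2
    have h3 : (1 - (γ : ℂ) * (tanhc (2 * Real.pi * (d * ξ)) : ℂ)) ≠ 0 := by
      exact_mod_cast hγ (2 * Real.pi * (d * ξ))
    have h4 : fixMap M β d γ θ = opB M β d γ N := rfl
    rw [h1, h4, ampl, ampl]
    push_cast
    have h5 : (incl (opB M β d γ N)).1 ξ
        = (1 - (γ : ℂ) * (tanhc (2 * Real.pi * (d * ξ)) : ℂ))⁻¹ * ((d : ℂ) ^ 2 * (incl N).1 ξ) := by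
      rw [← h2, inv_mul_cancel_left₀ h3]
    rw [h5]; ring
  have e2 : (kdvScale d (fixMap M β d γ θ).val x : ℂ)
      = (d : ℂ) ^ 2 * ((fixMap M β d γ θ).val (d * x) : ℂ) := by simp [kdvScale]
  rw [e2, e]; ring

lemma kdvScale_injective (hd : 0 < d) {f g : ℝ → ℝ} (h : kdvScale d f = kdvScale d g) : f = g := by
  funext x
  have := congrFun h (x / d)
  simp only [kdvScale, mul_div_cancel₀ x hd.ne'] at this
  exact mul_left_cancel₀ (by positivity) this

/-- The bridge between the equation with classical Fourier integrals and the Banach space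
fixed-point problem. Integrability of θ is what makes its classical transform agree with the stored
amplitude. -/
theorem isRiemannStrain_kdvScale_iff (hβ : β ^ 2 < 3) (hd : 0 < d) (h : d ^ 2 * β ^ 2 < 1 / 2)
    (hγ : ∀ k, 1 - γ * tanhc k ≠ 0) (hu : IsUnit (1 - γ • opT M β d))
    (hint : Integrable θ.val) (hθ : IsUnit (1 + d ^ 2 • opM M β θ)) :
    IsRiemannStrain γ (kdvScale d θ.val) ↔ fixMap M β d γ θ = θ := by
  have key := dispersionInv_kdvScale hβ hd h hγ hu hint hθ
  constructor
  · intro hs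
    refine ext_val (congrFun (kdvScale_injective hd (funext fun x => ?_)))
    have := hs x
    rw [key] at this
    exact_mod_cast this.symm
  · intro hf x
    rw [key, hf]

end Strain

end Pointwise

/-! ### Dilations -/

lemma memLp_comp_mul {c : ℝ} (hc : c ≠ 0) (Φ : L2) : MemLp (fun ξ => Φ (c * ξ)) 2 := by
  have h : MemLp Φ 2 (Measure.map (c * ·) volume) := by
    rw [Real.map_volume_mul_left hc]; exact (Lp.memLp Φ).smul_measure ENNReal.ofReal_ne_top
  exact h.comp_of_map (measurable_const_mul c).aemeasurable

lemma ae_comp_mul {c : ℝ} (hc : c ≠ 0) {p : ℝ → Prop} (h : ∀ᵐ x, p x) : ∀ᵐ x, p (c * x) := by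
  have h2 : ∀ᵐ x ∂(Measure.map (c * ·) volume), p x := by
    rw [Real.map_volume_mul_left hc]; exact Measure.ae_smul_measure h _
  exact ae_of_ae_map (measurable_const_mul c).aemeasurable h2

lemma norm_toLp_comp_mul {c : ℝ} (hc : c ≠ 0) (Φ : L2) :
    ‖(memLp_comp_mul hc Φ).toLp _‖ = Real.sqrt |c⁻¹| * ‖Φ‖ := by
  have hm : AEStronglyMeasurable Φ (Measure.map (c * ·) volume) := by
    rw [Real.map_volume_mul_left hc]; exact (Lp.aestronglyMeasurable Φ).smul_measure _
  have h : eLpNorm (fun ξ => Φ (c * ξ)) 2 volume = ENNReal.ofReal |c⁻¹| ^ (1 / 2 : ℝ) * eLpNorm Φ 2 volume := by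
    have h1 := eLpNorm_map_measure (p := 2) hm (measurable_const_mul c).aemeasurable
    rw [Real.map_volume_mul_left hc, eLpNorm_smul_measure_of_ne_top (by norm_num)] at h1
    simpa [Function.comp_def] using h1.symm
  rw [Lp.norm_toLp, h, ENNReal.toReal_mul, ← ENNReal.toReal_rpow, ENNReal.toReal_ofReal (abs_nonneg _),
    Real.sqrt_eq_rpow, Lp.norm_def]

/-- The dilation `Φ ↦ Φ(c ·)` of `L²`. -/
def dilL (c : ℝ) : L2 →L[ℂ] L2 :=
  if hc : c ≠ 0 then
    LinearMap.mkContinuous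
      { toFun := fun Φ => (memLp_comp_mul hc Φ).toLp _
        map_add' := fun Φ Ψ => Lp.ext (by
          filter_upwards [(memLp_comp_mul hc (Φ + Ψ)).coeFn_toLp, (memLp_comp_mul hc Φ).coeFn_toLp,
            (memLp_comp_mul hc Ψ).coeFn_toLp, Lp.coeFn_add ((memLp_comp_mul hc Φ).toLp _)
              ((memLp_comp_mul hc Ψ).toLp _), ae_comp_mul hc (Lp.coeFn_add Φ Ψ)] with ξ h1 h2 h3 h4 h5
          rw [h1, h4, Pi.add_apply, h2, h3, h5, Pi.add_apply])
        map_smul' := fun a Φ => Lp.ext (by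
          filter_upwards [(memLp_comp_mul hc (a • Φ)).coeFn_toLp, (memLp_comp_mul hc Φ).coeFn_toLp,
            Lp.coeFn_smul a ((memLp_comp_mul hc Φ).toLp _), ae_comp_mul hc (Lp.coeFn_smul a Φ)]
            with ξ h1 h2 h3 h4
          rw [h1, RingHom.id_apply, h3, Pi.smul_apply, h2, h4, Pi.smul_apply]) }
      (Real.sqrt |c⁻¹|) fun Φ => (norm_toLp_comp_mul hc Φ).le
  else 0

lemma dilL_coe {c : ℝ} (hc : c ≠ 0) (Φ : L2) : dilL c Φ =ᵐ[volume] fun ξ => Φ (c * ξ) := by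
  rw [dilL, dif_pos hc]; exact (memLp_comp_mul hc Φ).coeFn_toLp

lemma norm_dilL_apply {c : ℝ} (hc : c ≠ 0) (Φ : L2) : ‖dilL c Φ‖ = Real.sqrt |c⁻¹| * ‖Φ‖ := by
  rw [dilL, dif_pos hc]; exact norm_toLp_comp_mul hc Φ

lemma evL_dilL_neg_one (M : ℕ) [NeZero M] (Φ : L2) (x : ℝ) :
    evL M (dilL (-1) Φ) x = evL M Φ (-x) := by
  rw [evL_apply, evL_apply, ← fourierInv_comp_neg]
  refine Real.fourierInv_congr_ae ?_ x
  filter_upwards [dilL_coe (c := -1) (by norm_num) Φ] with ξ h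
  rw [ampl, h, ampl, neg_one_mul, japInv, japInv, jap_neg]

lemma jap_le_max_mul {s : ℝ} (hs : 0 < s) (ξ : ℝ) : jap ξ ≤ max 1 s * jap (s⁻¹ * ξ) := by
  have hm : 1 ≤ max 1 s := le_max_left _ _
  refine abs_le_of_sq_le_sq' ?_ (mul_nonneg (by linarith) (jap_pos _).le) |>.2
  rw [mul_pow, jap_sq, jap_sq]
  have h1 : (2 * Real.pi * ξ) ^ 2 = s ^ 2 * (2 * Real.pi * (s⁻¹ * ξ)) ^ 2 := by field_simp
  rw [h1]
  have h2 : s ^ 2 ≤ max 1 s ^ 2 := pow_le_pow_left₀ hs.le (le_max_right _ _) 2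
  have h3 : 1 ≤ max 1 s ^ 2 := one_le_pow₀ hm
  nlinarith [mul_le_mul_of_nonneg_right h2 (sq_nonneg (2 * Real.pi * (s⁻¹ * ξ)))]

lemma isSymbol_jap_ratio (M : ℕ) {s : ℝ} (hs : 0 < s) :
    IsSymbol (fun ξ => ((jap ξ ^ M * (jap (s⁻¹ * ξ) ^ M)⁻¹ : ℝ) : ℂ)) (max 1 s ^ M) := by
  refine ⟨Continuous.aestronglyMeasurable ?_, fun ξ => ?_⟩
  · refine Complex.continuous_ofReal.comp ((continuous_jap.pow M).mul (Continuous.inv₀ ?_ fun ξ => ?_))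
    · exact (continuous_jap.comp (continuous_const.mul continuous_id)).pow M
    · exact (pow_pos (jap_pos _) M).ne'
  · have h1 := jap_pos ξ
    have h2 := jap_pos (s⁻¹ * ξ)
    rw [Complex.norm_real, Real.norm_of_nonneg (by positivity), ← div_eq_mul_inv,
      div_le_iff₀ (by positivity), ← mul_pow]
    exact pow_le_pow_left₀ h1.le (jap_le_max_mul hs ξ) M

/-- The dilation `f ↦ s² f(s ·)` of `H^M` on the Fourier side. -/
def dilS (M : ℕ) (s : ℝ) : L2 →L[ℂ] L2 :=
  (s : ℂ) • (symMul (fun ξ => ((jap ξ ^ M * (jap (s⁻¹ * ξ) ^ M)⁻¹ : ℝ) : ℂ))).comp (dilL s⁻¹)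

section Dilation
variable {M : ℕ} {s : ℝ}

lemma dilS_coe (hs : 0 < s) (Φ : L2) : dilS M s Φ =ᵐ[volume]
    fun ξ => (s : ℂ) * (((jap ξ ^ M * (jap (s⁻¹ * ξ) ^ M)⁻¹ : ℝ) : ℂ) * Φ (s⁻¹ * ξ)) := by
  have e : dilS M s Φ = (s : ℂ) • symMul (fun ξ => ((jap ξ ^ M * (jap (s⁻¹ * ξ) ^ M)⁻¹ : ℝ) : ℂ))
    (dilL s⁻¹ Φ) := rfl
  rw [e]
  filter_upwards [Lp.coeFn_smul (s : ℂ) (symMul (fun ξ => ((jap ξ ^ M * (jap (s⁻¹ * ξ) ^ M)⁻¹ : ℝ) : ℂ))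
    (dilL s⁻¹ Φ)), symMul_coe (isSymbol_jap_ratio M hs) (dilL s⁻¹ Φ), dilL_coe (inv_ne_zero hs.ne') Φ]
    with ξ h1 h2 h3
  rw [h1, Pi.smul_apply, h2, h3, smul_eq_mul]

lemma norm_dilS_le (hs : 0 < s) (Φ : L2) : ‖dilS M s Φ‖ ≤ s * (max 1 s ^ M * (Real.sqrt s * ‖Φ‖)) := by
  have e : dilS M s Φ = (s : ℂ) • symMul (fun ξ => ((jap ξ ^ M * (jap (s⁻¹ * ξ) ^ M)⁻¹ : ℝ) : ℂ))
    (dilL s⁻¹ Φ) := rfl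
  rw [e, norm_smul, Complex.norm_real, Real.norm_of_nonneg hs.le]
  refine mul_le_mul_of_nonneg_left ?_ hs.le
  have h := norm_dilL_apply (inv_ne_zero hs.ne') Φ
  rw [inv_inv, abs_of_pos hs] at h
  rw [← h]
  exact (symMul _).le_of_opNorm_le (norm_symMul_le (isSymbol_jap_ratio M hs)) _

/-- The transform of s²f(s·) is s f̂(·/s): one power of s is lost to the change of variables. -/
lemma ampl_dilS (hs : 0 < s) (Φ : L2) :
    ampl M (dilS M s Φ) =ᵐ[volume] fun ξ => (s : ℂ) * ampl M Φ (s⁻¹ * ξ) := by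
  filter_upwards [dilS_coe (M := M) hs Φ] with ξ h
  have h1 : ((jap ξ ^ M : ℝ) : ℂ) ≠ 0 := Complex.ofReal_ne_zero.2 (pow_pos (jap_pos ξ) M).ne'
  rw [ampl, h, ampl, japInv, japInv]
  push_cast at h1 ⊢
  field_simp

lemma evL_dilS [NeZero M] (hs : 0 < s) (Φ : L2) (x : ℝ) :
    evL M (dilS M s Φ) x = (s : ℂ) ^ 2 * evL M Φ (s * x) := by
  rw [evL_apply, Real.fourierInv_congr_ae (ampl_dilS hs Φ) x, fourierInv_const_mul,
    fourierInv_comp_mul hs (ampl M Φ), evL_apply]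
  ring

end Dilation

/-! ### The weighted Sobolev spaces -/

section Sobolev
variable {m : ℕ} [NeZero m] {a : ℝ} {f : ℝ → ℝ}

/-- Through this lemma the weighted component of an element of `EvenFun` is exactly its image in the
statement's model of H^m_a, so norms and smoothness carry over. -/
lemma sobolevEmbed_eq_of_evL {Ψ : L2}
    (h : ∀ᵐ x, ((Real.exp (a * x) * f x : ℝ) : ℂ) = evL m Ψ x) :
    MemWeightedSobolev m a f ∧ sobolevEmbed m a f = Ψ := by
  have h2 : MemWeightedL2 a f := (memLp_congr_ae h).2 (memLp_evL Ψ)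
  have h3 : ∀ h4 : MemWeightedL2 a f, besselFourier m a f h4 =ᵐ[volume] Ψ := fun h4 => by
    have e := fourier_toLp_of_ae_eq_fourierInv (integrable_ampl m Ψ) (memLp_ampl m Ψ) h4
      (by filter_upwards [h] with x hx; rw [hx, evL_apply])
    filter_upwards [(memLp_ampl m Ψ).coeFn_toLp] with ξ hξ
    have h1 : ((jap ξ ^ m : ℝ) : ℂ) ≠ 0 := Complex.ofReal_ne_zero.2 (pow_pos (jap_pos ξ) m).ne'
    rw [besselFourier, e, hξ, ampl, japInv]
    change ((jap ξ ^ m : ℝ) : ℂ) * _ = _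
    push_cast at h1 ⊢
    field_simp
  have hmem : MemWeightedSobolev m a f := ⟨h2, (memLp_congr_ae (h3 h2)).2 (Lp.memLp Ψ)⟩
  refine ⟨hmem, ?_⟩
  rw [sobolevEmbed, dif_pos hmem]
  exact Lp.ext ((MemLp.coeFn_toLp _).trans (h3 _))

lemma evL_sobolevEmbed (h : MemWeightedSobolev m a f) :
    ∀ᵐ x, ((Real.exp (a * x) * f x : ℝ) : ℂ) = evL m (sobolevEmbed m a f) x := by
  rw [sobolevEmbed, dif_pos h]
  set h1 := h.choose
  set h2 : MemLp (besselFourier m a f h1) 2 := h.choose_spec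
  have e : ampl m (h2.toLp _) =ᵐ[volume] (𝓕 (h1.toLp _) : L2) := by
    filter_upwards [h2.coeFn_toLp] with ξ hξ
    have h3 : ((jap ξ ^ m : ℝ) : ℂ) ≠ 0 := Complex.ofReal_ne_zero.2 (pow_pos (jap_pos ξ) m).ne'
    rw [ampl, hξ, besselFourier, japInv]
    change _ * (((jap ξ ^ m : ℝ) : ℂ) * _) = _
    rw [← mul_assoc]
    push_cast at h3 ⊢
    rw [inv_mul_cancel₀ h3, one_mul]
  have e2 : 𝓕 (h1.toLp _) = (memLp_ampl m (h2.toLp _)).toLp _ :=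
    Lp.ext (e.symm.trans (MemLp.coeFn_toLp _).symm)
  filter_upwards [fourierInv_ae_of_fourier_toLp (integrable_ampl m _) (memLp_ampl m _) h1 e2] with x hx
  rw [hx, evL_apply]

end Sobolev

/-! ### Even functions in one-sided weighted spaces -/

section OneSided
variable {α : ℝ}

/-- The function `1 / (e^(αx) + e^(-αx))`. -/
def halfSech (α x : ℝ) : ℝ := (2 * Real.cosh (α * x))⁻¹

lemma halfSech_pos (α x : ℝ) : 0 < halfSech α x := by
  have := Real.cosh_pos (α * x)
  unfold halfSech; positivity

lemma halfSech_neg (α x : ℝ) : halfSech α (-x) = halfSech α x := by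
  rw [halfSech, mul_neg, Real.cosh_neg, halfSech]

/-- For even f this gives f = `halfSech` · (g + g(-·)) with g = e^{αx}f, so the one-sided weight
controls f on both sides. -/
lemma exp_add_exp_mul_halfSech (α x : ℝ) :
    (Real.exp (α * x) + Real.exp (-(α * x))) * halfSech α x = 1 := by
  have h := Real.cosh_pos (α * x)
  have e : Real.exp (α * x) + Real.exp (-(α * x)) = 2 * Real.cosh (α * x) := by rw [Real.cosh_eq]; ring
  rw [e, halfSech, mul_inv_cancel₀ (by positivity)]

@[fun_prop] lemma continuous_halfSech (α : ℝ) : Continuous (halfSech α) :=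
  (continuous_const.mul (Real.continuous_cosh.comp (continuous_const.mul continuous_id))).inv₀
    fun _ => (mul_pos two_pos (Real.cosh_pos _)).ne'

lemma halfSech_le (α x : ℝ) : halfSech α x ≤ 2 * (1 + (α * x) ^ 2)⁻¹ := by
  set y := α * x with hy
  have h1 := Real.quadratic_le_exp_of_nonneg (abs_nonneg y)
  rw [sq_abs] at h1
  have h2 : Real.exp |y| ≤ 2 * Real.cosh y := by
    rw [← Real.cosh_abs, Real.cosh_eq]
    have := Real.exp_pos (-|y|)
    linarith
  have h3 : (1 + y ^ 2) / 2 ≤ 2 * Real.cosh y := by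
    have := abs_nonneg y
    nlinarith [sq_nonneg y]
  calc halfSech α x ≤ ((1 + y ^ 2) / 2)⁻¹ := inv_anti₀ (by positivity) h3
    _ = 2 * (1 + y ^ 2)⁻¹ := by rw [inv_div]; ring

lemma halfSech_le_half (α x : ℝ) : halfSech α x ≤ 1 / 2 := by
  rw [halfSech, one_div]
  exact inv_anti₀ two_pos (by linarith [Real.one_le_cosh (α * x)])

lemma integrable_of_le_halfSech (hα : α ≠ 0) {u : ℝ → ℝ} (hu : Continuous u) {K : ℝ}
    (h : ∀ x, |u x| ≤ K * halfSech α x) : Integrable u := by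
  have hK : 0 ≤ K := nonneg_of_mul_nonneg_left ((abs_nonneg _).trans (h 0)) (halfSech_pos α 0)
  refine ((integrable_inv_one_add_sq.comp_mul_left' hα).const_mul (K * 2)).mono' hu.aestronglyMeasurable
    (Eventually.of_forall fun x => (h x).trans ?_)
  rw [mul_assoc]
  exact mul_le_mul_of_nonneg_left (halfSech_le α x) hK

lemma isWeightedC2_halfSech (hα : α ≠ 0) : IsWeightedC2 0 (halfSech α)
    (fun x => -(2 * α) * Real.sinh (α * x) * halfSech α x ^ 2)
    (fun x => α ^ 2 * (halfSech α x - 8 * halfSech α x ^ 3)) := by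
  have hlin : ∀ x, HasDerivAt (fun x : ℝ => α * x) α x := fun x => by
    simpa using (hasDerivAt_id x).const_mul α
  have d1 : ∀ x, HasDerivAt (halfSech α) (-(2 * α) * Real.sinh (α * x) * halfSech α x ^ 2) x := fun x => by
    have hc := Real.cosh_pos (α * x)
    have h := (((hlin x).cosh).const_mul 2).inv (by positivity)
    refine h.congr_deriv ?_
    rw [halfSech]; field_simp
  have hsinh : ∀ x, |2 * Real.sinh (α * x) * halfSech α x| ≤ 1 := fun x => by
    have hc := Real.cosh_pos (α * x)
    have e : 2 * Real.sinh (α * x) * halfSech α x = Real.sinh (α * x) / Real.cosh (α * x) := by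
      rw [halfSech]; field_simp
    rw [e, abs_div, abs_of_pos hc, div_le_one hc]
    refine abs_le_of_sq_le_sq ?_ hc.le
    have := Real.cosh_sq (α * x)
    linarith
  refine ⟨halfSech_neg α, d1, fun x => ?_, ?_, ?_, ?_⟩
  · have hc := Real.cosh_pos (α * x)
    have h := (((hlin x).sinh).const_mul (-(2 * α))).mul ((d1 x).pow 2)
    refine h.congr_deriv ?_
    have h2 := Real.cosh_sq (α * x)
    have h3 : Real.sinh (α * x) ^ 2 = Real.cosh (α * x) ^ 2 - 1 := by linarith
    simp only [Pi.pow_apply, halfSech]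
    push_cast
    field_simp
    ring_nf
    rw [h3]; ring
  · simpa using integrable_of_le_halfSech hα (continuous_halfSech α) (K := 1)
      fun x => by rw [abs_of_pos (halfSech_pos α x), one_mul]
  · have := integrable_of_le_halfSech hα (u := fun x => -(2 * α) * Real.sinh (α * x) * halfSech α x ^ 2)
      (by fun_prop) (K := |α|) fun x => by
        have e : -(2 * α) * Real.sinh (α * x) * halfSech α x ^ 2
            = -(α * (2 * Real.sinh (α * x) * halfSech α x) * halfSech α x) := by ring
        rw [e, abs_neg, abs_mul, abs_mul, abs_of_pos (halfSech_pos α x)]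
        exact mul_le_mul_of_nonneg_right (mul_le_of_le_one_right (abs_nonneg _) (hsinh x)) (halfSech_pos α x).le
    simpa using this
  · have := integrable_of_le_halfSech hα (u := fun x => α ^ 2 * (halfSech α x - 8 * halfSech α x ^ 3))
      (by fun_prop) (K := α ^ 2) fun x => by
        have h0 := halfSech_pos α x
        have h1 := halfSech_le_half α x
        rw [abs_mul, abs_of_nonneg (sq_nonneg α)]
        refine mul_le_mul_of_nonneg_left ?_ (sq_nonneg α)
        rw [abs_le]
        have h2 : halfSech α x ^ 2 ≤ 1 / 4 := by nlinarith
        have h3 : 0 ≤ halfSech α x * (1 / 4 - halfSech α x ^ 2) := mul_nonneg h0.le (by linarith)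
        constructor <;> nlinarith [pow_pos h0 3]
    simpa using this

lemma abs_le_halfSech {f : ℝ → ℝ} {K : ℝ} (hf : ∀ x, f (-x) = f x)
    (h : ∀ x, |Real.exp (α * x) * f x| ≤ K) (x : ℝ) : |f x| ≤ 2 * K * halfSech α x := by
  have h1 := h x
  have h2 := h (-x)
  rw [abs_mul, abs_of_pos (Real.exp_pos _)] at h1 h2
  rw [hf, mul_neg] at h2
  have e := exp_add_exp_mul_halfSech α x
  have h3 : (Real.exp (α * x) + Real.exp (-(α * x))) * |f x| ≤ 2 * K := by linarith
  calc |f x| = (Real.exp (α * x) + Real.exp (-(α * x))) * |f x| * halfSech α x := by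
        linear_combination (-|f x|) * e
    _ ≤ 2 * K * halfSech α x := mul_le_mul_of_nonneg_right h3 (halfSech_pos α x).le

lemma EvenFun.integrable_val {M : ℕ} [NeZero M] (hα : α ≠ 0) (p : EvenFun M α) : Integrable p.val :=
  integrable_of_le_halfSech hα p.continuous_val
    fun x => abs_le_halfSech p.val_neg p.abs_exp_mul_val_le x

/-- An even function in a one-sided weighted Sobolev space belongs to the unweighted space. -/
theorem exists_evenFun_of_memWeightedSobolev (hα : α ≠ 0) (m : ℕ) [NeZero m] : ∃ C, 0 ≤ C ∧
    ∀ f : ℝ → ℝ, (∀ x, f (-x) = f x) → MemWeightedSobolev m α f →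
      ∃ p : EvenFun 1 0, (∀ᵐ x, p.val x = f x) ∧ Integrable p.val ∧ ‖p‖ ≤ C * weightedSobolevNorm m α f := by
  obtain ⟨S, hS⟩ := (isWeightedC2_halfSech hα).exists_val (isWeightedC2_halfSech hα)
  refine ⟨‖mulL 1‖ * ‖S‖ * 2, by positivity, fun f hf hmem => ?_⟩
  set Ψ := symMul (japInv (m - 1)) (sobolevEmbed m α f) with hΨ
  have h1m : 1 ≤ m := Nat.one_le_iff_ne_zero.2 (NeZero.ne m)
  have hΨn : ‖Ψ‖ ≤ weightedSobolevNorm m α f := by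
    refine ((symMul _).le_of_opNorm_le (norm_symMul_le (isSymbol_japInv _)) _).trans ?_
    rw [one_mul, weightedSobolevNorm]
  have hev : ∀ᵐ x, ((Real.exp (α * x) * f x : ℝ) : ℂ) = evL 1 Ψ x := by
    filter_upwards [evL_sobolevEmbed hmem] with x hx
    rw [hx, hΨ, evL_symMul_japInv h1m]
  -- Reality holds almost everywhere by construction, and everywhere by continuity.
  have him : ∀ x, (evL 1 Ψ x).im = 0 := by
    have hc : Continuous fun x => (evL 1 Ψ x).im := Complex.continuous_im.comp (evL 1 Ψ).continuous
    have h0 : (fun x => (evL 1 Ψ x).im) =ᵐ[volume] fun _ => (0:ℝ) := by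
      filter_upwards [hev] with x hx
      rw [← hx, Complex.ofReal_im]
    exact congrFun ((hc.ae_eq_iff_eq volume continuous_const).1 h0)
  set Φ := mulL 1 (EvenFun.incl S).1 (Ψ + dilL (-1) Ψ) with hΦ
  have hΦv : ∀ x, evL 1 Φ x = ((halfSech α x * ((evL 1 Ψ x).re + (evL 1 Ψ (-x)).re) : ℝ) : ℂ) := by
    intro x
    have hr : ∀ y, evL 1 Ψ y = ((evL 1 Ψ y).re : ℂ) := fun y => Complex.ext rfl (him y)
    rw [hΦ, evL_mulL, EvenFun.evL_fst, hS, map_add, BoundedContinuousFunction.add_apply, evL_dilL_neg_one]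
    push_cast
    rw [← hr, ← hr]
  obtain ⟨p, hp, hpv⟩ := EvenFun.exists_val (M := 1) (β := 0)
    (f := fun x => halfSech α x * ((evL 1 Ψ x).re + (evL 1 Ψ (-x)).re))
    (fun x => by simp only [halfSech_neg, neg_neg]; ring) hΦv (fun x => by rw [hΦv]; simp)
  refine ⟨p, ?_, ?_, ?_⟩
  · have hneg : ∀ᵐ x, ((Real.exp (α * -x) * f (-x) : ℝ) : ℂ) = evL 1 Ψ (-x) := by
      have := ae_comp_mul (c := -1) (by norm_num) hev
      simpa only [neg_one_mul] using this
    filter_upwards [hev, hneg] with x h1 h2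
    rw [hpv, ← h1, ← h2, Complex.ofReal_re, Complex.ofReal_re, hf, mul_neg]
    linear_combination f x * exp_add_exp_mul_halfSech α x
  · refine integrable_of_le_halfSech hα p.continuous_val (K := ‖evL 1 Ψ‖ + ‖evL 1 Ψ‖) fun x => ?_
    have hb : ∀ y, |(evL 1 Ψ y).re| ≤ ‖evL 1 Ψ‖ := fun y =>
      (Complex.abs_re_le_norm _).trans ((evL 1 Ψ).norm_coe_le_norm y)
    rw [hpv, abs_mul, abs_of_pos (halfSech_pos α x), mul_comm]
    exact mul_le_mul_of_nonneg_right ((abs_add_le _ _).trans (add_le_add (hb _) (hb _))) (halfSech_pos α x).le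
  · rw [← EvenFun.incl.norm_map, hp, Prod.norm_def, max_self]
    have h2 : ‖Ψ + dilL (-1) Ψ‖ ≤ 2 * weightedSobolevNorm m α f := by
      have h3 := norm_dilL_apply (c := -1) (by norm_num) Ψ
      norm_num at h3
      have := norm_add_le Ψ (dilL (-1) Ψ)
      linarith
    calc ‖Φ‖ ≤ ‖mulL 1‖ * ‖(EvenFun.incl S).1‖ * ‖Ψ + dilL (-1) Ψ‖ := (mulL 1).le_opNorm₂ _ _
      _ ≤ ‖mulL 1‖ * ‖S‖ * (2 * weightedSobolevNorm m α f) := by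
          gcongr
          exact S.norm_fst_incl_le
      _ = _ := by ring

end OneSided

/-! ### Dilations of solutions -/

section DilateEven
open EvenFun

lemma EvenFun.sobolevEmbed_kdvScale {m : ℕ} [NeZero m] {α d : ℝ} (hd : 0 < d) (p : EvenFun m α) :
    MemWeightedSobolev m (α * d) (kdvScale d p.val) ∧
      sobolevEmbed m (α * d) (kdvScale d p.val) = dilS m d (incl p).2 := by
  refine sobolevEmbed_eq_of_evL (Eventually.of_forall fun x => ?_)
  rw [evL_dilS hd, evL_snd, kdvScale]
  have : α * d * x = α * (d * x) := by ring
  rw [this]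
  push_cast; ring

lemma EvenFun.sobolevEmbed_val {m : ℕ} [NeZero m] {α : ℝ} (p : EvenFun m α) :
    MemWeightedSobolev m α p.val ∧ sobolevEmbed m α p.val = (incl p).2 :=
  sobolevEmbed_eq_of_evL (Eventually.of_forall fun x => (evL_snd p x).symm)

lemma EvenFun.exists_dilate {s : ℝ} (hs : 0 < s) (p : EvenFun 1 0) :
    ∃ q : EvenFun 1 0, incl q = (dilS 1 s (incl p).1, dilS 1 s (incl p).1) ∧
      q.val = kdvScale s p.val := by
  have h : ∀ x, evL 1 (dilS 1 s (incl p).1) x = (kdvScale s p.val x : ℂ) := fun x => by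
    rw [evL_dilS hs, evL_fst, kdvScale]; push_cast; ring
  obtain ⟨q, hq, hv⟩ := exists_val (M := 1) (β := 0) (f := kdvScale s p.val)
    (fun x => by rw [kdvScale, kdvScale, mul_neg, val_neg]) h (fun x => by rw [h]; simp)
  exact ⟨q, hq, funext hv⟩

lemma norm_sq_L2 (Φ : L2) : ‖Φ‖ ^ 2 = ∫ ξ, ‖Φ ξ‖ ^ 2 := by
  have h := inner_self_eq_norm_sq_to_K (𝕜 := ℂ) Φ
  rw [L2.inner_def] at h
  have e : ∀ ξ, inner ℂ (Φ ξ) (Φ ξ) = ((‖Φ ξ‖ ^ 2 : ℝ) : ℂ) := fun ξ => by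
    rw [inner_self_eq_norm_sq_to_K]; simp
  simp only [e] at h
  rw [integral_complex_ofReal] at h
  exact Complex.ofReal_injective (by rw [Complex.ofReal_pow]; exact h.symm)

/-- Dilations are continuous at functions whose Fourier transform decays. -/
lemma tendsto_dilS_sub {Φ : L2} {F : ℝ → ℂ} (hF : Continuous F) {K : ℝ}
    (hK : ∀ ξ, ‖F ξ‖ ≤ K * (jap ξ ^ 2)⁻¹) (hΦ : ampl 1 Φ =ᵐ[volume] F) :
    Tendsto (fun s => ‖dilS 1 s Φ - Φ‖) (𝓝 1) (𝓝 0) := by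
  have hK0 : 0 ≤ K := by
    have h1 := (norm_nonneg _).trans (hK 0)
    have := jap_pos 0
    exact nonneg_of_mul_nonneg_left h1 (by positivity)
  have hs : ∀ᶠ s : ℝ in 𝓝 1, s ∈ Ioo (1 / 2) 2 := Ioo_mem_nhds (by norm_num) (by norm_num)
  set g : ℝ → ℝ → ℂ := fun s ξ => (jap ξ : ℂ) * ((s : ℂ) * F (s⁻¹ * ξ) - F ξ) with hg
  have hnorm : ∀ᶠ s : ℝ in 𝓝 1, ∫ ξ, ‖g s ξ‖ ^ 2 = ‖dilS 1 s Φ - Φ‖ ^ 2 := by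
    filter_upwards [hs] with s hs
    have hs0 : 0 < s := by linarith [hs.1]
    rw [norm_sq_L2]
    refine integral_congr_ae ?_
    filter_upwards [Lp.coeFn_sub (dilS 1 s Φ) Φ, ampl_dilS (M := 1) hs0 Φ, hΦ,
      ae_comp_mul (inv_ne_zero hs0.ne') hΦ] with ξ h1 h2 h3 h4
    have hj : ∀ Ψ : ℝ → ℂ, Ψ ξ = (jap ξ : ℂ) * ampl 1 Ψ ξ := fun Ψ => by
      rw [ampl, japInv, ← mul_assoc, ← Complex.ofReal_mul, pow_one, mul_inv_cancel₀ (jap_pos ξ).ne',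
        Complex.ofReal_one, one_mul]
    simp only [hg]
    rw [h1, Pi.sub_apply, hj (dilS 1 s Φ), hj Φ, h2, h3, h4, mul_sub]
  have hlim : Tendsto (fun s => ∫ ξ, ‖g s ξ‖ ^ 2) (𝓝 1) (𝓝 (∫ _ : ℝ, (0:ℝ))) := by
    refine tendsto_integral_filter_of_dominated_convergence
      (fun ξ => (17 * K) ^ 2 * (jap ξ ^ 2)⁻¹) ?_ ?_ (integrable_jap_sq_inv.const_mul _) ?_
    · refine Eventually.of_forall fun s => Continuous.aestronglyMeasurable ?_
      have h1 : Continuous fun ξ => F (s⁻¹ * ξ) := hF.comp (continuous_const.mul continuous_id)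
      exact (((Complex.continuous_ofReal.comp continuous_jap).mul
        ((continuous_const.mul h1).sub hF)).norm).pow 2
    · filter_upwards [hs] with s hs
      refine Eventually.of_forall fun ξ => ?_
      have hs0 : 0 < s := by linarith [hs.1]
      have hj := jap_pos ξ
      have hj' := jap_pos (s⁻¹ * ξ)
      have h1 : (jap (s⁻¹ * ξ) ^ 2)⁻¹ ≤ 4 * (jap ξ ^ 2)⁻¹ := by
        have h2 := jap_le_max_mul hs0 ξ
        have h3 : max 1 s ≤ 2 := max_le (by norm_num) hs.2.le
        have h4 : jap ξ ≤ 2 * jap (s⁻¹ * ξ) := h2.trans (mul_le_mul_of_nonneg_right h3 hj'.le)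
        rw [← div_eq_mul_inv, le_div_iff₀ (by positivity), inv_mul_le_iff₀ (by positivity)]
        nlinarith
      have h5 : ‖(s : ℂ) * F (s⁻¹ * ξ) - F ξ‖ ≤ 9 * K * (jap ξ ^ 2)⁻¹ := by
        refine (norm_sub_le _ _).trans ?_
        rw [norm_mul, Complex.norm_real, Real.norm_of_nonneg hs0.le]
        have h6 : s * ‖F (s⁻¹ * ξ)‖ ≤ 2 * (K * (4 * (jap ξ ^ 2)⁻¹)) :=
          mul_le_mul hs.2.le ((hK _).trans (mul_le_mul_of_nonneg_left h1 hK0)) (norm_nonneg _) (by norm_num)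
        linarith [hK ξ]
      have h7 : ‖g s ξ‖ ≤ 17 * K * (jap ξ)⁻¹ := by
        simp only [hg]
        rw [norm_mul, Complex.norm_real, Real.norm_of_nonneg hj.le]
        calc jap ξ * _ ≤ jap ξ * (9 * K * (jap ξ ^ 2)⁻¹) := mul_le_mul_of_nonneg_left h5 hj.le
          _ = 9 * K * (jap ξ)⁻¹ := by field_simp
          _ ≤ 17 * K * (jap ξ)⁻¹ := by gcongr; norm_num
      rw [norm_pow, norm_norm, ← inv_pow, ← mul_pow]
      exact pow_le_pow_left₀ (norm_nonneg _) h7 2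
    · refine Eventually.of_forall fun ξ => ?_
      have h1 : Tendsto (fun s : ℝ => s⁻¹ * ξ) (𝓝 1) (𝓝 ξ) := by
        have : Tendsto (fun s : ℝ => s⁻¹ * ξ) (𝓝 1) (𝓝 (1⁻¹ * ξ)) :=
          (tendsto_inv₀ one_ne_zero).mul_const ξ
        simpa using this
      have h2 : Tendsto (fun s : ℝ => (s : ℂ) * F (s⁻¹ * ξ) - F ξ) (𝓝 1) (𝓝 (((1:ℝ) : ℂ) * F ξ - F ξ)) :=
        (((Complex.continuous_ofReal.tendsto 1).mul ((hF.tendsto ξ).comp h1)).sub_const _)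
      have h3 := ((h2.const_mul (jap ξ : ℂ)).norm).pow 2
      simpa [hg] using h3
  have h2 := (hlim.congr' hnorm).sqrt
  simpa using h2

lemma tendsto_dilate_thetaE :
    Tendsto (fun s => ‖dilS 1 s (incl (thetaE 1 0)).1 - (incl (thetaE 1 0)).1‖) (𝓝 1) (𝓝 0) := by
  have h0 : (0:ℝ) ^ 2 < 3 := by norm_num
  have hw := isWeightedC2_kdvProfile h0
  have i0 : Integrable fun x => (kdvProfile x : ℂ) := by simpa using hw.int.ofReal (𝕜 := ℂ)
  have i1 : Integrable fun x => ((-2 * kc * phi₁ x : ℝ) : ℂ) := by simpa using hw.int'.ofReal (𝕜 := ℂ)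
  have i2 : Integrable fun x => ((3 * kdvProfile x - 9 / 2 * kdvProfile x ^ 2 : ℝ) : ℂ) := by
    simpa using hw.int''.ofReal (𝕜 := ℂ)
  obtain ⟨K, -, hK⟩ := exists_norm_fourier_le (fun x => (hw.deriv x).ofReal_comp)
    (fun x => (hw.deriv' x).ofReal_comp) i0 i1 i2
  refine tendsto_dilS_sub (continuous_fourier i0) hK ?_
  have hi : Integrable (thetaE 1 0).val := by
    have : (thetaE 1 0).val = kdvProfile := funext (val_thetaE 1 h0)
    rw [this]; simpa using hw.int
  have := fourier_val_ae hi
  simp only [val_thetaE 1 h0] at this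
  exact this.symm

/-- Dilations by factors near `1` almost preserve small neighbourhoods of the KdV profile. -/
lemma eventually_dilate_near {r : ℝ} (hr : 0 < r) : ∀ᶠ s : ℝ in 𝓝 1, 0 < s ∧
    ∀ p : EvenFun 1 0, ‖p - thetaE 1 0‖ < r / 16 →
      ∃ q : EvenFun 1 0, q.val = kdvScale s p.val ∧ ‖q - thetaE 1 0‖ ≤ r := by
  have hs : ∀ᶠ s : ℝ in 𝓝 1, s ∈ Ioo (1 / 2) 2 := Ioo_mem_nhds (by norm_num) (by norm_num)
  filter_upwards [hs, tendsto_dilate_thetaE.eventually (gt_mem_nhds (half_pos hr))] with s hs hΘ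
  have hs0 : 0 < s := by linarith [hs.1]
  refine ⟨hs0, fun p hp => ?_⟩
  obtain ⟨q, hq, hv⟩ := exists_dilate hs0 p
  refine ⟨q, hv, ?_⟩
  set Θ := thetaE 1 0
  have hΘ2 : (incl Θ).2 = (incl Θ).1 :=
    evL_injective 1 (DFunLike.ext _ _ fun x => by rw [evL_snd, evL_fst]; simp)
  have e : incl (q - Θ) = (dilS 1 s (incl p).1 - (incl Θ).1, dilS 1 s (incl p).1 - (incl Θ).1) := by
    rw [map_sub, hq]
    refine Prod.ext rfl ?_
    rw [Prod.snd_sub, hΘ2]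
  rw [← incl.norm_map, e, Prod.norm_def, max_self]
  have e2 : dilS 1 s (incl p).1 - (incl Θ).1
      = dilS 1 s (incl (p - Θ)).1 + (dilS 1 s (incl Θ).1 - (incl Θ).1) := by
    rw [map_sub, Prod.fst_sub, map_sub]; abel
  rw [e2]
  have h1 := norm_dilS_le (M := 1) hs0 (incl (p - Θ)).1
  have h2 : ‖(incl (p - Θ)).1‖ ≤ r / 16 := (norm_fst_incl_le _).trans hp.le
  have h3 : Real.sqrt s ≤ 2 := by
    rw [Real.sqrt_le_left (by norm_num)]; linarith [hs.2]
  have h4 : max 1 s ^ 1 ≤ 2 := by rw [pow_one]; exact max_le (by norm_num) hs.2.le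
  -- For s < 2 the dilation has norm at most 8, whence r/16 in the hypothesis: this term takes r/2,
  -- and the motion of Θ under dilation takes the other r/2.
  have h5 : s * (max 1 s ^ 1 * (Real.sqrt s * ‖(incl (p - Θ)).1‖)) ≤ 2 * (2 * (2 * (r / 16))) := by
    have := hs.2.le
    gcongr
  refine (norm_add_le _ _).trans ?_
  linarith

end DilateEven

/-! ### Solitary waves -/

section Solitary
open EvenFun

/-- The smallness conditions on `ε`. -/
structure IsSmallParameter (α : ℝ) (m : ℕ) [NeZero m] (ν r₀ r C₀ C K ε : ℝ) : Prop where
  pos : 0 < ε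
  lt_one : ε < 1
  weighted : IsBranchAt m α r C ε
  unweighted : IsBranchAt 1 0 r₀ C₀ ε
  lt_rpow : C * ε ^ 2 < ε ^ ν
  lt_r : C * ε ^ 2 < r
  lt_r₀ : C * ε ^ 2 < r₀ / 16
  rpow_le : K * ε ^ ν ≤ r₀

lemma eventually_mul_sq_lt (C : ℝ) {c : ℝ} (hc : 0 < c) : ∀ᶠ ε : ℝ in 𝓝[>] 0, C * ε ^ 2 < c := by
  have : Tendsto (fun ε : ℝ => C * ε ^ 2) (𝓝[>] 0) (𝓝 (C * 0 ^ 2)) :=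
    (((continuous_id.pow 2).const_mul _).tendsto 0).mono_left nhdsWithin_le_nhds
  exact this.eventually (gt_mem_nhds (by simpa using hc))

lemma eventually_mul_rpow_lt (C : ℝ) {c p : ℝ} (hc : 0 < c) (hp : 0 < p) :
    ∀ᶠ ε : ℝ in 𝓝[>] 0, C * ε ^ p < c := by
  have : Tendsto (fun ε : ℝ => C * ε ^ p) (𝓝[>] 0) (𝓝 (C * 0 ^ p)) :=
    (((Real.continuous_rpow_const hp.le).const_mul _).tendsto 0).mono_left nhdsWithin_le_nhds
  exact this.eventually (gt_mem_nhds (by rwa [Real.zero_rpow hp.ne', mul_zero]))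

/-! ### Existence and uniqueness at one small parameter -/

section Parameter
variable {α : ℝ} {m : ℕ} [NeZero m] {ν r₀ r C₀ C K ε : ℝ}

lemma one_sub_sq_mul_tanhc_ne_zero (h0 : 0 < ε) (h1 : ε < 1) (k : ℝ) : 1 - (1 - ε ^ 2) * tanhc k ≠ 0 :=
  one_sub_mul_tanhc_ne_zero (by nlinarith) (by nlinarith) k

lemma IsSmallParameter.fix_iff (h : IsSmallParameter α m ν r₀ r C₀ C K ε) {q : EvenFun 1 0}
    (hq : ‖q - thetaE 1 0‖ ≤ r₀) (hi : Integrable q.val) :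
    IsRiemannStrain (1 - ε ^ 2) (kdvScale ε q.val) ↔ fixMap 1 0 ε (1 - ε ^ 2) q = q :=
  isRiemannStrain_kdvScale_iff (by norm_num) h.pos h.unweighted.small
    (one_sub_sq_mul_tanhc_ne_zero h.pos h.lt_one) h.unweighted.unit hi (h.unweighted.unit_one_add q hq)

/-- Uniqueness among integrable solutions near the KdV profile in the unweighted space. -/
lemma IsSmallParameter.unique (h : IsSmallParameter α m ν r₀ r C₀ C K ε) {p q : EvenFun 1 0}
    (hp : ‖p - thetaE 1 0‖ ≤ r₀) (hq : ‖q - thetaE 1 0‖ ≤ r₀) (hpi : Integrable p.val)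
    (hqi : Integrable q.val) (hps : IsRiemannStrain (1 - ε ^ 2) (kdvScale ε p.val))
    (hqs : IsRiemannStrain (1 - ε ^ 2) (kdvScale ε q.val)) : p = q :=
  h.unweighted.unique p q hp hq ((h.fix_iff hp hpi).1 hps) ((h.fix_iff hq hqi).1 hqs)

lemma EvenFun.exists_unweighted_sub (hα : α ^ 2 < 3) (t : EvenFun m α) :
    ∃ q : EvenFun 1 0, q.val = t.val ∧ ‖q - thetaE 1 0‖ ≤ ‖t - thetaE m α‖ := by
  obtain ⟨q, hq, hn⟩ := EvenFun.exists_unweighted (M := 1) (Nat.one_le_iff_ne_zero.2 (NeZero.ne m))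
    (t - thetaE m α)
  refine ⟨q + thetaE 1 0, funext fun x => ?_, by rwa [add_sub_cancel_right]⟩
  rw [val_add, hq, val_sub, val_thetaE m hα, val_thetaE 1 (by norm_num)]; ring

/-- Every solution of the required form is given by an element of the unweighted space. -/
lemma IsSmallParameter.exists_of_isSolitaryStrain (h : IsSmallParameter α m ν r₀ r C₀ C K ε)
    (hK0 : 0 ≤ K) (hK : ∀ f : ℝ → ℝ, (∀ x, f (-x) = f x) → MemWeightedSobolev m α f →
      ∃ p : EvenFun 1 0, (∀ᵐ x, p.val x = f x) ∧ Integrable p.val ∧ ‖p‖ ≤ K * weightedSobolevNorm m α f)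
    {w : ℝ → ℝ} (hw : IsSolitaryStrain α m ν ε w) :
    ∃ q : EvenFun 1 0, ‖q - thetaE 1 0‖ ≤ r₀ ∧ Integrable q.val ∧ w = kdvScale ε q.val := by
  have hε := h.pos
  have h03 : (0:ℝ) ^ 2 < 3 := by norm_num
  obtain ⟨θ, rfl, hmem, hnear⟩ := hw.near
  have heven : ∀ x, θ (-x) = θ x := fun x => by
    have := hw.even (x / ε)
    simp only [kdvScale, mul_neg, mul_div_cancel₀ x hε.ne'] at this
    exact mul_left_cancel₀ (by positivity) this
  have hpe : ∀ x, kdvProfile (-x) = kdvProfile x := fun x => by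
    rw [← val_thetaE 1 h03, val_neg, val_thetaE 1 h03]
  obtain ⟨p, hp, hpi, hpn⟩ := hK _ (fun x => by rw [heven, hpe]) hmem
  have hqv : (p + thetaE 1 0).val = fun x => p.val x + kdvProfile x := funext fun x => by
    rw [val_add, val_thetaE 1 h03]
  have hqi : Integrable (p + thetaE 1 0).val := by
    rw [hqv]
    have := (isWeightedC2_kdvProfile h03).int
    exact hpi.add (by simpa using this)
  have hqn : ‖p + thetaE 1 0 - thetaE 1 0‖ ≤ r₀ := by
    rw [add_sub_cancel_right]
    exact (hpn.trans (mul_le_mul_of_nonneg_left hnear.le hK0)).trans h.rpow_le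
  set q := p + thetaE 1 0 with hq
  have hae : ∀ᵐ x, kdvScale ε θ x = kdvScale ε q.val x := by
    filter_upwards [ae_comp_mul hε.ne' hp] with x hx
    simp only [kdvScale, hqv, hx]; ring
  -- The right-hand side sees w only through Fourier integrals, hence only up to null sets.
  have hcong : dispersionInv (1 - ε ^ 2) (strainNonlinearity (1 - ε ^ 2) (fun y => (kdvScale ε θ y : ℂ)))
      = dispersionInv (1 - ε ^ 2) (strainNonlinearity (1 - ε ^ 2) (fun y => (kdvScale ε q.val y : ℂ))) := by
    have hae' : (fun y => (kdvScale ε θ y : ℂ)) =ᵐ[volume] fun y => (kdvScale ε q.val y : ℂ) := by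
      filter_upwards [hae] with x hx
      rw [hx]
    refine fourierMultiplier_congr ?_
    filter_upwards [hae'] with x hx
    simp only [strainNonlinearity, hilbertStrip, tanhDivD, fourierMultiplier_congr hae', hx]
  have hval : ∀ x, kdvScale ε θ x = kdvScale ε (fixMap 1 0 ε (1 - ε ^ 2) q).val x := fun x => by
    have h1 := hw.eqn x
    rw [hcong, dispersionInv_kdvScale h03 hε h.unweighted.small
      (one_sub_sq_mul_tanhc_ne_zero hε h.lt_one) h.unweighted.unit hqi (h.unweighted.unit_one_add q hqn)] at h1
    exact_mod_cast h1
  have hcont : ∀ u : EvenFun 1 0, Continuous (kdvScale ε u.val) := fun u =>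
    continuous_const.mul (u.continuous_val.comp (continuous_const.mul continuous_id))
  -- The equation holds at every point, so w coincides with its continuous right-hand side, and
  -- almost everywhere equality with the continuous q becomes equality.
  refine ⟨q, hqn, hqi, ?_⟩
  rw [funext hval] at hae ⊢
  exact ((hcont _).ae_eq_iff_eq volume (hcont _)).1 hae

lemma IsSmallParameter.eq_of_isSolitaryStrain (h : IsSmallParameter α m ν r₀ r C₀ C K ε)
    (hK0 : 0 ≤ K) (hK : ∀ f : ℝ → ℝ, (∀ x, f (-x) = f x) → MemWeightedSobolev m α f →
      ∃ p : EvenFun 1 0, (∀ᵐ x, p.val x = f x) ∧ Integrable p.val ∧ ‖p‖ ≤ K * weightedSobolevNorm m α f)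
    {w w' : ℝ → ℝ} (hw : IsSolitaryStrain α m ν ε w) (hw' : IsSolitaryStrain α m ν ε w') : w = w' := by
  obtain ⟨p, hp, hpi, rfl⟩ := h.exists_of_isSolitaryStrain hK0 hK hw
  obtain ⟨q, hq, hqi, rfl⟩ := h.exists_of_isSolitaryStrain hK0 hK hw'
  rw [h.unique hp hq hpi hqi hw.eqn hw'.eqn]

variable (hα : α ^ 2 < 3) (hα0 : 0 < α)
include hα hα0

lemma IsSmallParameter.isRiemannStrain (h : IsSmallParameter α m ν r₀ r C₀ C K ε) {t : EvenFun m α}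
    (ht : ‖t - thetaE m α‖ ≤ C * ε ^ 2) (hfix : fixMap m α ε (1 - ε ^ 2) t = t) :
    IsRiemannStrain (1 - ε ^ 2) (kdvScale ε t.val) :=
  (isRiemannStrain_kdvScale_iff hα h.pos h.weighted.small
    (one_sub_sq_mul_tanhc_ne_zero h.pos h.lt_one) h.weighted.unit (t.integrable_val hα0.ne')
    (h.weighted.unit_one_add t (ht.trans h.lt_r.le))).2 hfix

lemma IsSmallParameter.isSolitaryStrain (h : IsSmallParameter α m ν r₀ r C₀ C K ε) {t : EvenFun m α}
    (ht : ‖t - thetaE m α‖ ≤ C * ε ^ 2) (hfix : fixMap m α ε (1 - ε ^ 2) t = t) :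
    IsSolitaryStrain α m ν ε (kdvScale ε t.val) := by
  refine ⟨fun x => ?_, ?_, h.isRiemannStrain hα hα0 ht hfix, t.val, rfl, ?_⟩
  · rw [kdvScale, kdvScale, mul_neg, val_neg]
  · obtain ⟨q, hq⟩ := EvenFun.exists_lower (M := 1) (Nat.one_le_iff_ne_zero.2 (NeZero.ne m)) t
    rw [← show q.val = t.val from funext hq]
    exact (q.sobolevEmbed_kdvScale h.pos).1
  · have e : (fun x => t.val x - kdvProfile x) = (t - thetaE m α).val := funext fun x => by
      rw [val_sub, val_thetaE m hα]
    obtain ⟨h1, h2⟩ := (t - thetaE m α).sobolevEmbed_val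
    rw [e]
    refine ⟨h1, ?_⟩
    rw [weightedSobolevNorm, h2]
    exact ((norm_snd_incl_le _).trans ht).trans_lt h.lt_rpow

end Parameter

/-! ### Smooth dependence on ε, in scaled and unscaled variables -/

section Smooth
variable {α : ℝ} {m : ℕ} [NeZero m] {ν r₀ r C₀ C K ε₀ ε₁ : ℝ} {t : ℝ → EvenFun m α}

/-- The rescaled solution is a smooth function of `ε`. -/
lemma contDiffAt_of_branch (h : ∀ ε ∈ Ioo 0 ε₀, IsSmallParameter α m ν r₀ r C₀ C K ε)
    (ht : ∀ ε ∈ Ioo 0 ε₀, ‖t ε - thetaE m α‖ ≤ C * ε ^ 2 ∧ fixMap m α ε (1 - ε ^ 2) (t ε) = t ε)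
    (h₁ : ε₁ ∈ Ioo 0 ε₀) : ContDiffAt ℝ ∞ t ε₁ := by
  have hs := h ε₁ h₁
  obtain ⟨ht1, ht2⟩ := ht ε₁ h₁
  obtain ⟨Ξ, hΞ, hc, hfix⟩ := hs.weighted.family (t ε₁) (ht1.trans_lt hs.lt_r) ht2
  have hcurve : ContDiffAt ℝ ∞ (fun ε : ℝ => (ε, 1 - ε ^ 2)) ε₁ := by fun_prop
  have hφ : ContDiffAt ℝ ∞ (fun ε => Ξ (ε, 1 - ε ^ 2)) ε₁ := ContDiffAt.comp (g := Ξ) ε₁ hc hcurve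
  refine hφ.congr_of_eventuallyEq ?_
  have hnear : ∀ᶠ ε in 𝓝 ε₁, ‖Ξ (ε, 1 - ε ^ 2) - thetaE m α‖ < r := by
    refine (hφ.continuousAt.sub continuousAt_const).norm.eventually (gt_mem_nhds ?_)
    simp only [Pi.sub_apply, hΞ]; exact ht1.trans_lt hs.lt_r
  -- The solutions t ε were chosen separately for each ε. Uniqueness in the ball identifies them
  -- with the smooth family near ε₁.
  filter_upwards [hcurve.continuousAt.eventually hfix, hnear, isOpen_Ioo.mem_nhds h₁] with ε e1 e2 e3
  obtain ⟨e4, e5⟩ := ht ε e3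
  exact (h ε e3).weighted.unique _ _ (e4.trans (h ε e3).lt_r.le) e2.le e5 e1

/-- Near `ε₁` the unscaled solution is `ε₁² φ_ε(ε₁ x)` with `φ_ε` smooth in `ε`. -/
lemma exists_contDiffAt_fixed_scale (hα : α ^ 2 < 3) (hα0 : 0 < α)
    (h : ∀ ε ∈ Ioo 0 ε₀, IsSmallParameter α m ν r₀ r C₀ C K ε)
    (ht : ∀ ε ∈ Ioo 0 ε₀, ‖t ε - thetaE m α‖ ≤ C * ε ^ 2 ∧ fixMap m α ε (1 - ε ^ 2) (t ε) = t ε)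
    (h₁ : ε₁ ∈ Ioo 0 ε₀) (hr₀ : 0 < r₀) : ∃ φ : ℝ → EvenFun m α, ContDiffAt ℝ ∞ φ ε₁ ∧
      ∀ᶠ ε in 𝓝 ε₁, kdvScale ε (t ε).val = kdvScale ε₁ (φ ε).val := by
  have hs := h ε₁ h₁
  obtain ⟨ht1, ht2⟩ := ht ε₁ h₁
  obtain ⟨Ξ, hΞ, hc, hfix⟩ := hs.weighted.family (t ε₁) (ht1.trans_lt hs.lt_r) ht2
  -- The scale stays at ε₁ and only γ varies, so the unscaled functions all carry the same weight
  -- αε₁ and no derivative of a dilation is needed.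
  have hcurve : ContDiffAt ℝ ∞ (fun ε : ℝ => (ε₁, 1 - ε ^ 2)) ε₁ := by fun_prop
  have hφ : ContDiffAt ℝ ∞ (fun ε => Ξ (ε₁, 1 - ε ^ 2)) ε₁ := ContDiffAt.comp (g := Ξ) ε₁ hc hcurve
  refine ⟨fun ε => Ξ (ε₁, 1 - ε ^ 2), hφ, ?_⟩
  have hunit := eventually_isUnit hs.pos hs.weighted.small hs.weighted.unit
    (by rw [hΞ]; exact hs.weighted.unit_one_add _ (ht1.trans hs.lt_r.le)) hc
  have hnear : ∀ᶠ ε in 𝓝 ε₁, ‖Ξ (ε₁, 1 - ε ^ 2) - thetaE m α‖ < r₀ / 16 := by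
    refine (hφ.continuousAt.sub continuousAt_const).norm.eventually (gt_mem_nhds ?_)
    simp only [Pi.sub_apply, hΞ]; exact ht1.trans_lt hs.lt_r₀
  have hdil : ∀ᶠ ε in 𝓝 ε₁, 0 < ε₁ / ε ∧ ∀ p : EvenFun 1 0, ‖p - thetaE 1 0‖ < r₀ / 16 →
      ∃ q : EvenFun 1 0, q.val = kdvScale (ε₁ / ε) p.val ∧ ‖q - thetaE 1 0‖ ≤ r₀ := by
    have : Tendsto (fun ε => ε₁ / ε) (𝓝 ε₁) (𝓝 1) := by
      have := (tendsto_const_nhds (x := ε₁) (f := 𝓝 ε₁)).div tendsto_id h₁.1.ne'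
      rwa [div_self h₁.1.ne'] at this
    exact this.eventually (eventually_dilate_near hr₀)
  filter_upwards [hcurve.continuousAt.eventually hfix, hcurve.continuousAt.eventually hunit, hnear, hdil,
    isOpen_Ioo.mem_nhds h₁] with ε e1 ⟨e2, e3⟩ e4 ⟨e5, e6⟩ e7
  have hε := h ε e7
  obtain ⟨ht3, ht4⟩ := ht ε e7
  set φ := Ξ (ε₁, 1 - ε ^ 2) with hφdef
  have hstrain : IsRiemannStrain (1 - ε ^ 2) (kdvScale ε₁ φ.val) :=
    (isRiemannStrain_kdvScale_iff hα hs.pos hs.weighted.small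
      (one_sub_sq_mul_tanhc_ne_zero hε.pos hε.lt_one) e2 (φ.integrable_val hα0.ne') e3).2 e1
  obtain ⟨p, hp, hpn⟩ := φ.exists_unweighted_sub hα
  obtain ⟨q, hq, hqn⟩ := e6 p (hpn.trans_lt e4)
  have hscale : kdvScale ε q.val = kdvScale ε₁ φ.val := by
    have := hε.pos.ne'
    funext x
    rw [hq, hp]
    simp only [kdvScale]
    have e : ε₁ / ε * (ε * x) = ε₁ * x := by field_simp
    rw [e]; field_simp
  -- In the variable scaled by ε the two candidates have different weights, α and αε₁/ε. They are
  -- compared in the unweighted space, where dilations by factors near 1 keep them close to Θ.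
  obtain ⟨t', ht', htn⟩ := (t ε).exists_unweighted_sub hα
  have hqi : Integrable q.val := by
    rw [hq, hp]
    exact ((φ.integrable_val hα0.ne').comp_mul_left' e5.ne').const_mul _
  have hti : Integrable t'.val := by rw [ht']; exact (t ε).integrable_val hα0.ne'
  have htr : ‖t' - thetaE 1 0‖ ≤ r₀ := by linarith [hε.lt_r₀]
  have heq := hε.unique htr hqn hti hqi (by rw [ht']; exact hε.isRiemannStrain hα hα0 ht3 ht4)
    (by rwa [hscale])
  rw [← ht', heq, hscale]

end Smooth

/-- All small parameters satisfy the smallness conditions. -/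
lemma exists_isSmallParameter {α ν K : ℝ} (hα : α ^ 2 < 3) (m : ℕ) [NeZero m] (hν : 0 < ν) (hν' : ν < 1) :
    ∃ r₀ r C₀ C ε₀, 0 < r₀ ∧ 0 < ε₀ ∧ ∀ ε ∈ Ioo 0 ε₀, IsSmallParameter α m ν r₀ r C₀ C K ε := by
  obtain ⟨r, C, hr, hC, h1⟩ := exists_branch m hα
  obtain ⟨r₀, C₀, hr₀, hC₀, h2⟩ := exists_branch 1 (β := 0) (by norm_num)
  have hev : ∀ᶠ ε : ℝ in 𝓝[>] 0, IsSmallParameter α m ν r₀ r C₀ C K ε := by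
    filter_upwards [h1, h2, eventually_mul_sq_lt C hr, eventually_mul_sq_lt C (by positivity : 0 < r₀ / 16),
      eventually_mul_rpow_lt K hr₀ hν, eventually_mul_rpow_lt C one_pos (by linarith : 0 < 2 - ν),
      Ioo_mem_nhdsGT one_pos] with ε e1 e2 e3 e4 e5 e6 e7
    refine ⟨e7.1, e7.2, e1, e2, ?_, e3, e4, e5.le⟩
    -- The O(ε²) error beats ε^ν because 2 - ν > 0.
    have e : ε ^ 2 = ε ^ (2 - ν) * ε ^ ν := by
      rw [← Real.rpow_add e7.1, sub_add_cancel, Real.rpow_two]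
    rw [e, ← mul_assoc]
    exact mul_lt_of_lt_one_left (Real.rpow_pos_of_pos e7.1 ν) e6
  obtain ⟨ε₀, hε₀, hsub⟩ := mem_nhdsGT_iff_exists_Ioo_subset.1 hev
  exact ⟨r₀, r, C₀, C, ε₀, hr₀, hε₀, fun ε hε => hsub hε⟩

end Solitary

end SolitaryWave

end

theorem theorem4p1 (α : ℝ) (hα : α ∈ Ioo 0 (Real.sqrt 3)) (m : ℕ) (hm : 2 ≤ m)
    (ν : ℝ) (hν : ν ∈ Ioo (0 : ℝ) 1) :
    ∃ ε₀ : ℝ, 0 < ε₀ ∧ ∃ θ : ℝ → ℝ → ℝ,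
      -- for each small `ε`, existence and uniqueness of the solution `w(x) = ε² θ(ε x)`
      (∀ ε ∈ Ioo 0 ε₀, IsSolitaryStrain α m ν ε (kdvScale ε (θ ε)) ∧
        ∀ w : ℝ → ℝ, IsSolitaryStrain α m ν ε w → w = kdvScale ε (θ ε)) ∧
      -- the scaled profile is a smooth function of `ε` with values in `H^m_α`
      (∀ ε ∈ Ioo 0 ε₀, MemWeightedSobolev m α (θ ε)) ∧
      ContDiffOn ℝ ∞ (fun ε => sobolevEmbed m α (θ ε)) (Ioo 0 ε₀) ∧
      -- near each `ε₁`, the solution is a smooth function of `ε` with values in `H^m_a`, `a = α ε₁`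
      (∀ ε₁ ∈ Ioo 0 ε₀,
        (∀ᶠ ε in 𝓝 ε₁, MemWeightedSobolev m (α * ε₁) (kdvScale ε (θ ε))) ∧
        ContDiffAt ℝ ∞ (fun ε => sobolevEmbed m (α * ε₁) (kdvScale ε (θ ε))) ε₁) := by
  have hα0 : 0 < α := hα.1
  have hα3 : α ^ 2 < 3 := (Real.lt_sqrt hα0.le).1 hα.2
  have : NeZero m := ⟨by omega⟩
  obtain ⟨K, hK0, hK⟩ := exists_evenFun_of_memWeightedSobolev hα0.ne' m
  obtain ⟨r₀, r, C₀, C, ε₀, hr₀, hε₀, h⟩ := exists_isSmallParameter (K := K) hα3 m hν.1 hν.2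
  -- The choice is made for all real ε, with the value 0 outside the interval, so that the family is
  -- a total function.
  have hex : ∀ ε, ∃ t : EvenFun m α, ε ∈ Ioo 0 ε₀ →
      ‖t - thetaE m α‖ ≤ C * ε ^ 2 ∧ fixMap m α ε (1 - ε ^ 2) t = t := fun ε => by
    by_cases hε : ε ∈ Ioo 0 ε₀
    · obtain ⟨t, ht⟩ := (h ε hε).weighted.exists_fix
      exact ⟨t, fun _ => ht⟩
    · exact ⟨0, fun hε' => absurd hε' hε⟩
  choose t ht using hex
  refine ⟨ε₀, hε₀, fun ε => (t ε).val, fun ε hε => ?_, fun ε _ => (t ε).sobolevEmbed_val.1, ?_,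
    fun ε₁ h₁ => ?_⟩
  · have hsol := (h ε hε).isSolitaryStrain hα3 hα0 (ht ε hε).1 (ht ε hε).2
    exact ⟨hsol, fun w hw => (h ε hε).eq_of_isSolitaryStrain hK0 hK hw hsol⟩
  · intro ε hε
    have e : (fun ε => sobolevEmbed m α (t ε).val) = fun ε => (EvenFun.incl (t ε)).2 :=
      funext fun ε => (t ε).sobolevEmbed_val.2
    rw [e]
    have hc := EvenFun.incl.contDiff.contDiffAt.comp ε (contDiffAt_of_branch h ht hε)
    exact (contDiffAt_snd.comp ε hc).contDiffWithinAt
  · obtain ⟨φ, hφ, heq⟩ := exists_contDiffAt_fixed_scale hα3 hα0 h ht h₁ hr₀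
    constructor
    · filter_upwards [heq] with ε he
      rw [he]
      exact ((φ ε).sobolevEmbed_kdvScale h₁.1).1
    · have hc := EvenFun.incl.contDiff.contDiffAt.comp ε₁ hφ
      have hd : ContDiffAt ℝ ∞ (fun ε => dilS m ε₁ (EvenFun.incl (φ ε)).2) ε₁ :=
        (((dilS m ε₁).restrictScalars ℝ).contDiff.contDiffAt).comp ε₁ (contDiffAt_snd.comp ε₁ hc)
      refine hd.congr_of_eventuallyEq ?_
      filter_upwards [heq] with ε he
      rw [he]
      exact ((φ ε).sobolevEmbed_kdvScale h₁.1).2
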